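/- Notation. For a real random variable $Z$, a random vector $Z$ in a normed space $(E,\|\cdot\|)$ and a function $\alpha:\mathbb R_+\to\mathbb R_+$: we write $Z\propto_c\alpha$ (convex concentration) if for every $1$-Lipschitz quasiconvex $f:E\to\mathbb R$ (all sets $\{f\le s\}$ convex) and an independent copy $Z'$ of $Z$, $\mathbb P(|f(Z)-f(Z')|\ge t)\le\alpha(t)$ for all $t>0$. For a deterministic $\tilde Z\in E$ we write $Z\in\tilde Z\pm\alpha$ in $(E,\|\cdot\|)$ (linear concentration) if for every linear form $u$ with $|u(x)|\le\|x\|$ for all $x\in E$, $\mathbb P(|u(Z)-u(\tilde Z)|\ge t)\le\alpha(t)$ for all $t>0$. Theorem. Let $C_0\ge e$, $c_0,q,z_0,\nu>0$, $K\in\mathbb N$ and $M,\Gamma\in\mathbb R$. There are $N\in\mathbb N$, $C\ge e$ and $c>0$, depending only on these quantities, such that the following holds for all $n\ge N$, all $p$ with $p/n\le\Gamma$, all $k\le K$ and all $z\ge z_0$. Let $\mu_1,\dots,\mu_k$ be probability laws on $\mathbb R^p$ (Euclidean norm), let $y_l$ denote a vector of law $\mu_l$, and let $x_1,\dots,x_n$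 be independent random vectors, $x_i$ having law $\mu_{\kappa(i)}$ for a map $\kappa:\{1,\dots,n\}\to\{1,\dots,k\}$. Put $n_l=\#\{i:\kappa(i)=l\}$, $X=[x_1,\dots,x_n]$, and $\Sigma_l=\mathbb E[y_ly_l^T]$. Assume 1. for every $l$ and every $m\in\mathbb N$, the $p\times m$ matrix whose columns are $m$ independent vectors of law $\mu_l$ satisfies $(y^{(1)},\dots,y^{(m)})\propto_c C_0e^{-(\,\cdot\,)^q/c_0}$ for the Frobenius norm; 2. either $\mathbb E\|y_l\|\le M\sqrt p$ for every $l$, or $q\ge2$ and $\|\mathbb E y_l\|\le M\sqrt p$ for every $l$; 3. every class that occurs is not too small: $n_l\ge\nu\sqrt n$ whenever $n_l\ge1$. Then the system $$\delta'_l=\frac1n\operatorname{tr}\Big(\Sigma_l\Big(\sum_{h=1}^k\frac{n_h}{n}\frac{\Sigma_h}{1+\delta'_h}+zI_p\Big)^{-1}\Big),\qquad 1\le l\le k,$$ has a unique solution $\delta'\in\mathbb R_+^k$, and with $$Q=\Big(\tfrac1nXX^T+zI_p\Big)^{-1},\qquad \tilde Q_{\delta'}=\Big(\sum_{l=1}^k\frac{n_l}{n}\frac{\Sigma_l}{1+\delta'_l}+zI_p\Big)^{-1}$$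 one has $$Q\in\tilde Q_{\delta'}\pm Ce^{-(\sqrt n\,\cdot\,)^q/c}\quad\text{in } (\mathcal M_p,\|\cdot\|),$$ where $\mathcal M_p$ is the space of real $p\times p$ matrices and $\|\cdot\|$ is the spectral norm. -/

import Mathlib

open MeasureTheory ProbabilityTheory

noncomputable section

namespace SampleCov

/-! ### Concentration of random variables and of random vectors -/

/-- `Z ∝ α`: for an independent copy `Z'` of `Z`, `ℙ(|Z - Z'| ≥ t) ≤ α t` for all `t > 0`.
The pair `(Z, Z')` is realized by the two coordinates of the product space; the condition depends
on the law of `Z` only. -/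
def Concentrated {Ω : Type*} [MeasurableSpace Ω] (P : Measure Ω) (Z : Ω → ℝ) (α : ℝ → ℝ) : Prop :=
  ∀ t : ℝ, 0 < t → (P.prod P) {w : Ω × Ω | t ≤ |Z w.1 - Z w.2|} ≤ ENNReal.ofReal (α t)

/-- `Z ∈ a ± α`: concentration of a random variable around the pivot `a`. -/
def ConcentratedAround {Ω : Type*} [MeasurableSpace Ω] (P : Measure Ω) (Z : Ω → ℝ) (a : ℝ)
    (α : ℝ → ℝ) : Prop :=
  ∀ t : ℝ, 0 < t → P {ω : Ω | t ≤ |Z ω - a|} ≤ ENNReal.ofReal (α t)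

/-- `Z ∝_c α` in the normed space `E`: `f(Z) ∝ α` for each `1`-Lipschitz quasiconvex `f`. -/
def ConvexlyConcentrated {Ω : Type*} [MeasurableSpace Ω] {E : Type*} [NormedAddCommGroup E]
    [NormedSpace ℝ E] (P : Measure Ω) (Z : Ω → E) (α : ℝ → ℝ) : Prop :=
  ∀ f : E → ℝ, LipschitzWith 1 f → QuasiconvexOn ℝ Set.univ f →
    Concentrated P (fun ω => f (Z ω)) α

/-- `Z ∈ z' ± α` in the normed space `E`: linear concentration of `Z` around the deterministic
equivalent `z'`, i.e. `u(Z) ∈ u(z') ± α` for each linear form `u` with `|u x| ≤ ‖x‖`. -/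
def LinearlyConcentrated {Ω : Type*} [MeasurableSpace Ω] {E : Type*} [NormedAddCommGroup E]
    [NormedSpace ℝ E] (P : Measure Ω) (Z : Ω → E) (z' : E) (α : ℝ → ℝ) : Prop :=
  ∀ u : E →ₗ[ℝ] ℝ, (∀ x : E, |u x| ≤ ‖x‖) →
    ConcentratedAround P (fun ω => u (Z ω)) (u z') α

/-! ### The same notions for random matrices, with the norm made explicit -/

section Frobenius

open scoped Matrix.Norms.Frobenius

/-- Convex concentration in the space of `p × m` matrices with the Frobenius norm. -/
def ConvexlyConcentratedFrobenius {Ω : Type*} [MeasurableSpace Ω] {p m : ℕ} (P : Measure Ω)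
    (Z : Ω → Matrix (Fin p) (Fin m) ℝ) (α : ℝ → ℝ) : Prop :=
  ConvexlyConcentrated P Z α

end Frobenius

section Spectral

open scoped Matrix.Norms.L2Operator

/-- Linear concentration in the space of `p × m` matrices with the spectral norm. -/
def LinearlyConcentratedSpectral {Ω : Type*} [MeasurableSpace Ω] {p m : ℕ} (P : Measure Ω)
    (Z : Ω → Matrix (Fin p) (Fin m) ℝ) (z' : Matrix (Fin p) (Fin m) ℝ) (α : ℝ → ℝ) : Prop :=
  LinearlyConcentrated P Z z' α

end Spectral

/-! ### Data matrices, sample covariance, resolvents -/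

/-- The matrix `[y₁, …, y_m]` whose columns are the given vectors. -/
def columns {p m : ℕ} (y : Fin m → EuclideanSpace ℝ (Fin p)) : Matrix (Fin p) (Fin m) ℝ :=
  Matrix.of fun i j => y j i

/-- For each `m`, the matrix formed by `m` independent vectors of law `μ` is convexly
`α`-concentrated for the Frobenius norm. -/
def LawConvexlyConcentrated {p : ℕ} (μ : Measure (EuclideanSpace ℝ (Fin p))) (α : ℝ → ℝ) : Prop :=
  ∀ m : ℕ, ConvexlyConcentratedFrobenius (Measure.pi fun _ : Fin m => μ)
    (fun y : Fin m → EuclideanSpace ℝ (Fin p) => columns y) α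

/-- The (non-centered) population covariance `𝔼[y yᵀ]` of a vector `y` of law `μ`. -/
def popCov {p : ℕ} (μ : Measure (EuclideanSpace ℝ (Fin p))) : Matrix (Fin p) (Fin p) ℝ :=
  Matrix.of fun i j => ∫ y, y i * y j ∂μ

/-- The sample covariance `X Xᵀ / n`. -/
def sampleCov {p n : ℕ} (X : Matrix (Fin p) (Fin n) ℝ) : Matrix (Fin p) (Fin p) ℝ :=
  (n : ℝ)⁻¹ • (X * X.transpose)

/-- The resolvent `(S + z I)⁻¹`. -/
def resolvent {p : ℕ} (S : Matrix (Fin p) (Fin p) ℝ) (z : ℝ) : Matrix (Fin p) (Fin p) ℝ :=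
  (S + z • (1 : Matrix (Fin p) (Fin p) ℝ))⁻¹

/-- The number `n_l` of columns belonging to the class `l`. -/
def classSize {n k : ℕ} (κ : Fin n → Fin k) (l : Fin k) : ℕ :=
  (Finset.univ.filter fun i => κ i = l).card

/-- `Σ_δ = ∑ l, (n_l / n) Σ_l / (1 + δ_l)`. -/
def mixedCov {p n k : ℕ} (κ : Fin n → Fin k) (μ : Fin k → Measure (EuclideanSpace ℝ (Fin p)))
    (δ : Fin k → ℝ) : Matrix (Fin p) (Fin p) ℝ :=
  ∑ l, ((classSize κ l : ℝ) / n / (1 + δ l)) • popCov (μ l)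

/-- `δ ∈ ℝ₊^k` solves `δ_l = (1/n) tr (Σ_l (Σ_δ + z I)⁻¹)`, `1 ≤ l ≤ k`. -/
def IsFixedPoint {p n k : ℕ} (κ : Fin n → Fin k)
    (μ : Fin k → Measure (EuclideanSpace ℝ (Fin p))) (z : ℝ) (δ : Fin k → ℝ) : Prop :=
  (∀ l, 0 ≤ δ l) ∧
    ∀ l, δ l = (n : ℝ)⁻¹ * (popCov (μ l) * resolvent (mixedCov κ μ δ) z).trace

end SampleCov

end

/-! On symmetric matrices, a linear form bounded by the spectral norm is a combination `∑ a_k ⟪v_k,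
· v_k⟫` with unit `v_k` and `∑ |a_k| ≤ 1` (`exists_quadratic_decomposition`). So only quadratic
forms `⟪v, Q v⟫` matter. They have to be controlled in two respects: fluctuation around the mean,
and bias of the mean.

Fluctuation, `q ≤ 2`. `⟪v, Q v⟫` is not a convex function of the columns, so the hypothesis is
exploited one column at a time and exponential moments are tensorized (`mgf_avg_le`). By the
rank-one formula, a column `y` enters through `⟪y, Q₀ v⟫² / (n + ⟪y, Q₀ y⟫)`, where `Q₀` is the
resolvent without it. The dangerous part is the mean `m` of `y`, whose norm may be of order `√p`. It
is tamed by `⟪m, Q₀ m⟫ ≲ n / n_l`: an average `w` of a positive proportion of the class satisfies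
`⟪w, Q₀ w⟫ ≲ n / n_l` deterministically, and `m` is close to `w` with high probability
(`mean_inner_res_le`). This requires typical columns of the same class, so the columns are cut into
two halves. One half is averaged out while the other is frozen in a good event, and a mixture of two
independent samples links the two partial averages (`measure_prod_sub_le_avg`). A column of class
`l` costs a small multiple of `T^r / n_l` in the exponent, `r = max q 1`, and these costs sum to at
most a small multiple of `k T^r`. Chernoff's bound at the scale `T / √n` then gives the tail
(`exists_avg_tail`).

For `q < 1` the step needs linear forms of a column to have exponential moments of order one.
Quasiconvexity supplies them: the maximum of any number of independent copies is an admissible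
function, so it fluctuates by a bounded amount, and this forces the tail to be halved by each
bounded increase of the level (`measureReal_tail_halving`).

For `q > 2` the law is a Dirac mass. Normalized sums of `m` copies would have tails lighter than
Gaussian uniformly in `m`, which the central limit theorem allows only for zero variance
(`ae_eq_zero_of_expBdd_sums`). Then only the bias remains.

Bias. Put `D_l = 𝔼 n⁻¹ tr(Σ_l Q)`. A leave-one-out expansion shows that `𝔼 ⟪v, Q v⟫` differs from
`⟪v, Q̃_D v⟫` by `O(1/√n)` (`abs_integral_sub_le`). Applied to normalized traces, this says that `D`
solves the fixed-point system up to `O(1/√n)`.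

Fixed point. If `1 + D ≤ α (1 + δ)` coordinatewise with `α ≥ 1`, then `Q̃_D ≤ α Q̃_δ` as quadratic
forms, so the traces grow by at most `α`, whereas the summand `1` does not grow. Comparing the
largest ratio `(1 + D_l) / (1 + δ_l)` with itself gives uniqueness, and stability under an error in
the equations. Existence follows from monotonicity. -/

namespace SampleCov

/-! ### Exponential moments of order `q`, and passage to and from tails. -/

section ExponentialMoments

variable {Ω : Type*} [MeasurableSpace Ω] {P : Measure Ω}

/-- `𝔼 exp(κ |Z|^q) ≤ B`. -/
def ExpBdd (P : Measure Ω) (Z : Ω → ℝ) (q κ B : ℝ) : Prop :=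
  ∫⁻ ω, ENNReal.ofReal (Real.exp (κ * |Z ω| ^ q)) ∂P ≤ ENNReal.ofReal B

/-- Layer-cake formula for `|Z|^q`. Halving the rate turns the integrand into `C κ e^{-κ t}`, of
total mass `C`; the additional `1` is the value of the exponential at zero. -/
theorem ExpBdd.of_tail [IsProbabilityMeasure P] {Z : Ω → ℝ} (hZ : Measurable Z) {q c C : ℝ}
    (hq : 0 < q) (hc : 0 < c) (hC : 0 ≤ C)
    (h : ∀ t : ℝ, 0 < t → P {ω | t ≤ |Z ω|} ≤ ENNReal.ofReal (C * Real.exp (-(t ^ q) / c))) :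
    ExpBdd P Z q (1 / (2 * c)) (1 + C) := by
  set κ : ℝ := 1 / (2 * c) with hκ
  have hκ0 : 0 < κ := by positivity
  have key := lintegral_comp_eq_lintegral_meas_le_mul P (f := fun ω => |Z ω| ^ q)
    (g := fun t => κ * Real.exp (κ * t))
    (Filter.Eventually.of_forall fun ω => by positivity)
    ((hZ.abs.pow_const q).aemeasurable)
    (fun t _ => (by fun_prop : Continuous fun t => κ * Real.exp (κ * t)).intervalIntegrable _ _)
    (Filter.Eventually.of_forall fun t => by positivity)
  have hint : ∀ w : ℝ, ∫ t in (0 : ℝ)..w, κ * Real.exp (κ * t) = Real.exp (κ * w) - 1 := by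
    intro w
    simp
  simp only [hint] at key
  have hright : ∫⁻ t in Set.Ioi (0 : ℝ), P {a | t ≤ |Z a| ^ q} *
      ENNReal.ofReal (κ * Real.exp (κ * t)) ≤ ENNReal.ofReal C := by
    calc _ ≤ ∫⁻ t in Set.Ioi (0 : ℝ), ENNReal.ofReal (C * (κ * Real.exp (-κ * t))) := by
          refine setLIntegral_mono' measurableSet_Ioi fun t ht => ?_
          have ht : 0 < t := ht
          have h1 : {a | t ≤ |Z a| ^ q} ⊆ {a | t ^ (1 / q) ≤ |Z a|} := by
            intro a ha
            have h2 : t ^ (1 / q) ≤ (|Z a| ^ q) ^ (1 / q) :=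
              Real.rpow_le_rpow ht.le ha (by positivity)
            rwa [← Real.rpow_mul (abs_nonneg _), mul_one_div_cancel hq.ne', Real.rpow_one] at h2
          have h3 := (measure_mono h1).trans (h (t ^ (1 / q)) (by positivity))
          rw [← Real.rpow_mul ht.le, one_div_mul_cancel hq.ne', Real.rpow_one] at h3
          calc _ ≤ ENNReal.ofReal (C * Real.exp (-t / c)) *
                ENNReal.ofReal (κ * Real.exp (κ * t)) := by gcongr
            _ = _ := by
              rw [← ENNReal.ofReal_mul (by positivity)]
              congr 1
              have : Real.exp (-κ * t) = Real.exp (-t / c) * Real.exp (κ * t) := by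
                rw [← Real.exp_add]; congr 1; rw [hκ]; field_simp; ring
              rw [this]; ring
      _ = ENNReal.ofReal C := by
          have hi : IntegrableOn (fun t => C * (κ * Real.exp (-κ * t))) (Set.Ioi 0) :=
            ((integrableOn_exp_mul_Ioi (by linarith) 0).const_mul κ).const_mul C
          rw [← ofReal_integral_eq_lintegral_ofReal hi
            (Filter.Eventually.of_forall fun t => by positivity)]
          congr 1
          rw [integral_const_mul, integral_const_mul, integral_exp_mul_Ioi (by linarith)]
          simp; field_simp
  unfold ExpBdd
  have hsplit : ∀ ω, ENNReal.ofReal (Real.exp (κ * |Z ω| ^ q)) =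
      1 + ENNReal.ofReal (Real.exp (κ * |Z ω| ^ q) - 1) := by
    intro ω
    rw [← ENNReal.ofReal_one, ← ENNReal.ofReal_add zero_le_one]
    · congr 1; ring
    · have := Real.one_le_exp (x := κ * |Z ω| ^ q) (by positivity)
      linarith
  simp only [hsplit]
  rw [lintegral_add_left measurable_const, key, ENNReal.ofReal_add zero_le_one hC]
  simp only [lintegral_const, measure_univ, mul_one, ENNReal.ofReal_one]
  gcongr

theorem ExpBdd.mono {Z : Ω → ℝ} {q κ κ' B B' : ℝ} (h : ExpBdd P Z q κ B) (hκ : κ' ≤ κ)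
    (hB : B ≤ B') : ExpBdd P Z q κ' B' := by
  refine le_trans (lintegral_mono fun ω => ?_) (h.trans (ENNReal.ofReal_le_ofReal hB))
  gcongr

theorem ExpBdd.integrable [IsFiniteMeasure P] {Z : Ω → ℝ} {q κ B : ℝ} (hZ : Measurable Z)
    (h : ExpBdd P Z q κ B) : Integrable (fun ω => Real.exp (κ * |Z ω| ^ q)) P := by
  refine ⟨(((hZ.abs.pow_const q).const_mul κ).exp).aestronglyMeasurable, ?_⟩
  rw [hasFiniteIntegral_iff_ofReal (Filter.Eventually.of_forall fun ω => by positivity)]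
  exact h.trans_lt ENNReal.ofReal_lt_top

theorem ExpBdd.one_le [IsProbabilityMeasure P] {Z : Ω → ℝ} {q κ B : ℝ} (hκ : 0 ≤ κ)
    (h : ExpBdd P Z q κ B) : 1 ≤ B := by
  have h1 : (1 : ENNReal) ≤ ENNReal.ofReal B := by
    refine le_trans ?_ h
    calc (1 : ENNReal) = ∫⁻ _, 1 ∂P := by simp
      _ ≤ _ := lintegral_mono fun ω => by
        rw [← ENNReal.ofReal_one]
        exact ENNReal.ofReal_le_ofReal (Real.one_le_exp (by positivity))
  rwa [ENNReal.one_le_ofReal] at h1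

theorem ExpBdd.integral_le [IsProbabilityMeasure P] {Z : Ω → ℝ} {q κ B : ℝ} (hκ : 0 ≤ κ)
    (hZ : Measurable Z)
    (h : ExpBdd P Z q κ B) : ∫ ω, Real.exp (κ * |Z ω| ^ q) ∂P ≤ B := by
  have hB := h.one_le hκ
  have h' := h
  unfold ExpBdd at h'
  rw [← ofReal_integral_eq_lintegral_ofReal (h.integrable hZ)
    (Filter.Eventually.of_forall fun ω => by positivity)] at h'
  exact (ENNReal.ofReal_le_ofReal_iff (by linarith)).1 h'

theorem exists_pow_le_exp_rpow {q κ : ℝ} (hq : 0 < q) (hκ : 0 < κ) (j : ℕ) :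
    ∃ K : ℝ, 0 < K ∧ ∀ x : ℝ, 0 ≤ x → x ^ j ≤ K * Real.exp (κ * x ^ q) := by
  obtain ⟨i, hi⟩ := exists_nat_ge ((j : ℝ) / q)
  have hi' : (j : ℝ) ≤ q * i := by
    rw [div_le_iff₀ hq] at hi; linarith
  refine ⟨1 + i.factorial / κ ^ i, by positivity, fun x hx => ?_⟩
  have hexp : 1 ≤ Real.exp (κ * x ^ q) := Real.one_le_exp (by positivity)
  have h1 : x ^ (q * i) ≤ i.factorial / κ ^ i * Real.exp (κ * x ^ q) := by
    have := Real.pow_div_factorial_le_exp (κ * x ^ q) (by positivity) i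
    rw [mul_pow, ← Real.rpow_natCast (x ^ q) i, ← Real.rpow_mul hx] at this
    rw [div_mul_eq_mul_div, le_div_iff₀ (by positivity)]
    rw [div_le_iff₀ (by positivity)] at this
    linarith
  rw [add_mul, one_mul]
  rcases le_total x 1 with hx1 | hx1
  · have : x ^ j ≤ 1 := pow_le_one₀ hx hx1
    have : (0 : ℝ) ≤ i.factorial / κ ^ i * Real.exp (κ * x ^ q) := by positivity
    linarith
  · have : x ^ j ≤ x ^ (q * i) := by
      rw [← Real.rpow_natCast]; exact Real.rpow_le_rpow_of_exponent_le hx1 hi'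
    linarith

/-- Bounding the sum by twice the maximum also covers `q < 1`, where convexity of the power is not
available. -/
theorem abs_add_rpow_le {q : ℝ} (hq : 0 < q) (x y : ℝ) :
    |x + y| ^ q ≤ 2 ^ q * (|x| ^ q + |y| ^ q) := by
  have h1 : |x + y| ≤ 2 * max |x| |y| := by
    have := abs_add_le x y
    have := le_max_left |x| |y|
    have := le_max_right |x| |y|
    linarith
  have h2 : |x + y| ^ q ≤ (2 * max |x| |y|) ^ q := Real.rpow_le_rpow (abs_nonneg _) h1 hq.le
  rw [Real.mul_rpow zero_le_two (by positivity)] at h2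
  refine h2.trans (mul_le_mul_of_nonneg_left ?_ (by positivity))
  have hx : 0 ≤ |x| ^ q := by positivity
  have hy : 0 ≤ |y| ^ q := by positivity
  rcases max_cases |x| |y| with ⟨h, _⟩ | ⟨h, _⟩ <;> rw [h] <;> linarith

theorem ExpBdd.add_const {Z : Ω → ℝ} {q κ B : ℝ} (hq : 0 < q) (hκ : 0 < κ)
    (h : ExpBdd P Z q κ B) {a A : ℝ} (ha : |a| ≤ A) :
    ExpBdd P (fun ω => Z ω + a) q (κ / 2 ^ q) (Real.exp (κ * A ^ q) * B) := by
  have h2 : (0 : ℝ) < 2 ^ q := by positivity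
  unfold ExpBdd at *
  calc _ ≤ ∫⁻ ω, ENNReal.ofReal (Real.exp (κ * A ^ q)) *
        ENNReal.ofReal (Real.exp (κ * |Z ω| ^ q)) ∂P := by
        refine lintegral_mono fun ω => ?_
        rw [← ENNReal.ofReal_mul (by positivity), ← Real.exp_add]
        refine ENNReal.ofReal_le_ofReal (Real.exp_le_exp.2 ?_)
        have h1 := abs_add_rpow_le hq (Z ω) a
        have h3 : |a| ^ q ≤ A ^ q := Real.rpow_le_rpow (abs_nonneg _) ha hq.le
        calc κ / 2 ^ q * |Z ω + a| ^ q ≤ κ / 2 ^ q * (2 ^ q * (|Z ω| ^ q + |a| ^ q)) := by gcongr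
          _ = κ * |a| ^ q + κ * |Z ω| ^ q := by field_simp; ring
          _ ≤ _ := by gcongr
    _ = ENNReal.ofReal (Real.exp (κ * A ^ q)) *
        ∫⁻ ω, ENNReal.ofReal (Real.exp (κ * |Z ω| ^ q)) ∂P :=
        lintegral_const_mul' _ _ ENNReal.ofReal_ne_top
    _ ≤ _ := by
        rw [ENNReal.ofReal_mul (by positivity)]
        gcongr

theorem ExpBdd.moment {q κ : ℝ} (B : ℝ) (hq : 0 < q) (hκ : 0 < κ) (j : ℕ) :
    ∃ K : ℝ, 0 < K ∧ ∀ {Ω : Type} [MeasurableSpace Ω] (P : Measure Ω) [IsProbabilityMeasure P]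
      (Z : Ω → ℝ), Measurable Z → ExpBdd P Z q κ B →
        Integrable (fun ω => |Z ω| ^ j) P ∧ ∫ ω, |Z ω| ^ j ∂P ≤ K := by
  obtain ⟨K, hK, h⟩ := exists_pow_le_exp_rpow hq hκ j
  refine ⟨K * max B 1, by positivity, fun {Ω} _ P _ Z hZ hB => ?_⟩
  have hi := (hB.integrable hZ).const_mul K
  have hj : Integrable (fun ω => |Z ω| ^ j) P := by
    refine hi.mono' (hZ.abs.pow_const j).aestronglyMeasurable
      (Filter.Eventually.of_forall fun ω => ?_)
    rw [Real.norm_of_nonneg (by positivity)]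
    exact h _ (abs_nonneg _)
  refine ⟨hj, (integral_mono hj hi fun ω => h _ (abs_nonneg _)).trans ?_⟩
  rw [integral_const_mul]
  gcongr
  exact (hB.integral_le hκ.le hZ).trans (le_max_left _ _)

/-- The pivot `ρ` and the mean differ by at most `𝔼 |Z - ρ|`, which the exponential moment bounds.
The constants come before the probability space, hence are uniform in the dimension and the number
of columns. -/
theorem ExpBdd.center {q κ : ℝ} (B : ℝ) (hq : 0 < q) (hκ : 0 < κ) :
    ∃ κ' B' : ℝ, 0 < κ' ∧ ∀ {Ω : Type} [MeasurableSpace Ω] (P : Measure Ω)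
      [IsProbabilityMeasure P] (Z : Ω → ℝ) (ρ : ℝ), Measurable Z →
      ExpBdd P (fun ω => Z ω - ρ) q κ B →
        Integrable Z P ∧ ExpBdd P (fun ω => Z ω - ∫ ω, Z ω ∂P) q κ' B' := by
  obtain ⟨K, hK, h⟩ := ExpBdd.moment B hq hκ 1
  refine ⟨κ / 2 ^ q, Real.exp (κ * K ^ q) * B, by positivity, fun {Ω} _ P _ Z ρ hZ hB => ?_⟩
  obtain ⟨h1, h2⟩ := h P (fun ω => Z ω - ρ) (hZ.sub_const ρ) hB
  simp only [pow_one] at h1 h2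
  have hi : Integrable (fun ω => Z ω - ρ) P :=
    (integrable_norm_iff (hZ.sub_const ρ).aestronglyMeasurable).1 h1
  have hZi : Integrable Z P := by
    have := hi.add (integrable_const ρ)
    refine this.congr (Filter.Eventually.of_forall fun ω => by simp)
  refine ⟨hZi, ?_⟩
  have ha : |ρ - ∫ ω, Z ω ∂P| ≤ K := by
    have : ∫ ω, (Z ω - ρ) ∂P = ∫ ω, Z ω ∂P - ρ := by
      rw [integral_sub hZi (integrable_const ρ)]; simp
    rw [abs_sub_comm, ← this]
    exact (abs_integral_le_integral_abs).trans h2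
  have := hB.add_const hq hκ ha
  simpa using this

theorem ExpBdd.tail [IsProbabilityMeasure P] {Z : Ω → ℝ} {q κ B : ℝ} (hZ : Measurable Z)
    (hq : 0 < q) (hκ : 0 < κ) (h : ExpBdd P Z q κ B) {t : ℝ} (ht : 0 ≤ t) :
    P {ω | t ≤ |Z ω|} ≤ ENNReal.ofReal (B * Real.exp (-(κ * t ^ q))) := by
  have h1 := mul_meas_ge_le_lintegral₀ (μ := P)
    (f := fun ω => ENNReal.ofReal (Real.exp (κ * |Z ω| ^ q)))
    (((hZ.abs.pow_const q).const_mul κ).exp.ennreal_ofReal.aemeasurable)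
    (ENNReal.ofReal (Real.exp (κ * t ^ q)))
  have h2 : {ω | t ≤ |Z ω|} ⊆ {ω | ENNReal.ofReal (Real.exp (κ * t ^ q)) ≤
      ENNReal.ofReal (Real.exp (κ * |Z ω| ^ q))} := by
    intro ω hω
    refine ENNReal.ofReal_le_ofReal (Real.exp_le_exp.2 ?_)
    exact mul_le_mul_of_nonneg_left (Real.rpow_le_rpow ht hω hq.le) hκ.le
  have h3 := (mul_le_mul_right (measure_mono h2) _).trans (h1.trans h)
  have hpos : (0 : ℝ) < Real.exp (κ * t ^ q) := by positivity
  have h4 : P {ω | t ≤ |Z ω|} ≤ ENNReal.ofReal B / ENNReal.ofReal (Real.exp (κ * t ^ q)) := by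
    rw [ENNReal.le_div_iff_mul_le (Or.inl (by simpa using hpos)) (Or.inl ENNReal.ofReal_ne_top),
      mul_comm]
    exact h3
  rw [← ENNReal.ofReal_div_of_pos hpos] at h4
  rwa [Real.exp_neg, ← div_eq_mul_inv]

/-- By Fubini, the exponential moment of `Z - Z'` is an average over the value of `Z'`; some value
does at least as well as the average and serves as a deterministic pivot. -/
theorem Concentrated.exists_expBdd [IsProbabilityMeasure P] {Z : Ω → ℝ} (hZ : Measurable Z)
    {q c C : ℝ} (hq : 0 < q) (hc : 0 < c) (hC : 0 ≤ C)
    (h : Concentrated P Z fun t => C * Real.exp (-(t ^ q) / c)) :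
    ∃ ω', ExpBdd P (fun ω => Z ω - Z ω') q (1 / (2 * c)) (1 + C) := by
  have hm : Measurable fun w : Ω × Ω => Z w.1 - Z w.2 :=
    (hZ.comp measurable_fst).sub (hZ.comp measurable_snd)
  have h1 := ExpBdd.of_tail hm hq hc hC h
  unfold ExpBdd at h1
  rw [lintegral_prod_symm' _
    (((hm.abs.pow_const q).const_mul _).exp.ennreal_ofReal)] at h1
  have hm2 : Measurable fun ω' => ∫⁻ ω, ENNReal.ofReal
      (Real.exp (1 / (2 * c) * |Z ω - Z ω'| ^ q)) ∂P :=
    (((hm.abs.pow_const q).const_mul _).exp.ennreal_ofReal).lintegral_prod_left'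
  obtain ⟨ω', hω'⟩ := exists_le_lintegral (μ := P) hm2.aemeasurable
  exact ⟨ω', hω'.trans h1⟩

end ExponentialMoments

/-! ### Resolvents of nonnegative symmetric operators: order, Cauchy–Schwarz, rank-one updates. -/

section Resolvents

open scoped RealInnerProductSpace

variable {E : Type*} [NormedAddCommGroup E] [InnerProductSpace ℝ E]

/-- `Q = (S + z)⁻¹` for a symmetric nonnegative operator `S` and `z > 0`. -/
structure IsRes (S Q : E →ₗ[ℝ] E) (z : ℝ) : Prop where
  pos : 0 < z
  symm : ∀ v w, ⟪S v, w⟫ = ⟪v, S w⟫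
  nonneg : ∀ v, 0 ≤ ⟪S v, v⟫
  eq : ∀ v, S (Q v) + z • Q v = v

namespace IsRes

variable {S Q S' Q' : E →ₗ[ℝ] E} {z : ℝ}

theorem inner_eq (h : IsRes S Q z) (v : E) :
    ⟪v, Q v⟫ = ⟪S (Q v), Q v⟫ + z * ‖Q v‖ ^ 2 := by
  nth_rewrite 1 [← h.eq v]
  rw [inner_add_left, real_inner_smul_left, real_inner_self_eq_norm_sq]

theorem Q_symm (h : IsRes S Q z) (v w : E) : ⟪Q v, w⟫ = ⟪v, Q w⟫ := by
  nth_rewrite 1 [← h.eq w]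
  nth_rewrite 2 [← h.eq v]
  rw [inner_add_left, inner_add_right, real_inner_smul_left, real_inner_smul_right, h.symm]

theorem mul_norm_sq_le (h : IsRes S Q z) (v : E) : z * ‖Q v‖ ^ 2 ≤ ⟪v, Q v⟫ := by
  have := h.inner_eq v
  have := h.nonneg (Q v)
  linarith

theorem inner_nonneg (h : IsRes S Q z) (v : E) : 0 ≤ ⟪v, Q v⟫ :=
  le_trans (mul_nonneg h.pos.le (sq_nonneg _)) (h.mul_norm_sq_le v)

theorem norm_le (h : IsRes S Q z) (v : E) : ‖Q v‖ ≤ ‖v‖ / z := by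
  have h1 := (h.mul_norm_sq_le v).trans (real_inner_le_norm v (Q v))
  rw [le_div_iff₀ h.pos]
  rcases (norm_nonneg (Q v)).eq_or_lt with h0 | h0
  · rw [← h0]; simp
  · have : ‖Q v‖ * (z * ‖Q v‖) ≤ ‖Q v‖ * ‖v‖ := by nlinarith
    have := le_of_mul_le_mul_left this h0
    linarith

theorem inner_le (h : IsRes S Q z) (v : E) : ⟪v, Q v⟫ ≤ ‖v‖ ^ 2 / z := by
  have h1 := h.norm_le v
  calc ⟪v, Q v⟫ ≤ ‖v‖ * ‖Q v‖ := real_inner_le_norm v (Q v)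
    _ ≤ ‖v‖ * (‖v‖ / z) := by gcongr
    _ = _ := by ring

/-- Nonnegativity of the form of `S + z` at `w - Q v`. Equality at `w = Q v` exhibits `⟪v, Q v⟫` as
a maximum over `w`, which turns comparisons of `S` into comparisons of `Q`. -/
theorem variational (h : IsRes S Q z) (v w : E) :
    2 * ⟪v, w⟫ - ⟪S w, w⟫ - z * ‖w‖ ^ 2 ≤ ⟪v, Q v⟫ := by
  have h1 := h.nonneg (w - Q v)
  have h2 : 0 ≤ z * ‖w - Q v‖ ^ 2 := mul_nonneg h.pos.le (sq_nonneg _)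
  have h3 := congrArg (fun x => ⟪x, w⟫) (h.eq v)
  simp only [inner_add_left, real_inner_smul_left] at h3
  have h4 := h.inner_eq v
  rw [map_sub, inner_sub_left, inner_sub_right, inner_sub_right] at h1
  rw [norm_sub_sq_real] at h2
  have h5 : ⟪S w, Q v⟫ = ⟪S (Q v), w⟫ := by rw [h.symm, real_inner_comm]
  have h6 : ⟪w, Q v⟫ = ⟪Q v, w⟫ := real_inner_comm _ _
  rw [h6] at h2
  rw [h5] at h1
  nlinarith

theorem unique (h : IsRes S Q z) {v w : E} (hw : S w + z • w = v) : w = Q v := by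
  have h1 : S (w - Q v) + z • (w - Q v) = 0 := by
    rw [map_sub, smul_sub]
    have := h.eq v
    rw [← sub_eq_zero] at this hw
    calc _ = (S w + z • w - v) - (S (Q v) + z • Q v - v) := by abel
      _ = 0 := by rw [this, hw, sub_zero]
  have h2 := congrArg (fun x => ⟪x, w - Q v⟫) h1
  simp only [inner_add_left, real_inner_smul_left, inner_zero_left,
    real_inner_self_eq_norm_sq] at h2
  have h3 := h.nonneg (w - Q v)
  have h4 : ‖w - Q v‖ ^ 2 ≤ 0 := by
    have : z * ‖w - Q v‖ ^ 2 ≤ 0 := by linarith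
    exact nonpos_of_mul_nonpos_right this h.pos
  have : ‖w - Q v‖ = 0 := by
    have := sq_nonneg ‖w - Q v‖
    exact pow_eq_zero_iff (two_ne_zero) |>.1 (le_antisymm h4 this)
  rwa [norm_eq_zero, sub_eq_zero] at this

/-- Since `α ≥ 1`, the assumption gives `S + z ≤ α (S' + z)`, and inversion reverses the order. This
is the inequality behind the stability of the fixed-point system. -/
theorem inner_le_mul (h : IsRes S Q z) (h' : IsRes S' Q' z) {α : ℝ} (hα : 1 ≤ α)
    (hS : ∀ w, ⟪S w, w⟫ ≤ α * ⟪S' w, w⟫) (v : E) : ⟪v, Q' v⟫ ≤ α * ⟪v, Q v⟫ := by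
  have hα0 : 0 < α := by linarith
  -- The test vector `α⁻¹ Q' v` is the maximizer for the operator `α (S' + z)`.
  have h1 := h.variational v (α⁻¹ • Q' v)
  have h2 := h'.inner_eq v
  simp only [map_smul, real_inner_smul_left, real_inner_smul_right, norm_smul, mul_pow] at h1
  rw [Real.norm_of_nonneg (by positivity)] at h1
  have h3 := hS (Q' v)
  have h4 := h.pos
  have h5 : 0 ≤ z * ‖Q' v‖ ^ 2 := by positivity
  have h6 : α * (2 * (α⁻¹ * ⟪v, Q' v⟫) - α⁻¹ * (α⁻¹ * ⟪S (Q' v), Q' v⟫) -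
      z * (α⁻¹ ^ 2 * ‖Q' v‖ ^ 2)) ≤ α * ⟪v, Q v⟫ := mul_le_mul_of_nonneg_left h1 hα0.le
  refine le_trans ?_ h6
  have h7 : α⁻¹ * ⟪S (Q' v), Q' v⟫ ≤ ⟪S' (Q' v), Q' v⟫ := by
    rw [inv_mul_le_iff₀ hα0]; exact h3
  have h8 : α⁻¹ * (z * ‖Q' v‖ ^ 2) ≤ z * ‖Q' v‖ ^ 2 := by
    have : α⁻¹ ≤ 1 := inv_le_one_of_one_le₀ hα
    nlinarith
  have h9 : α * (2 * (α⁻¹ * ⟪v, Q' v⟫) - α⁻¹ * (α⁻¹ * ⟪S (Q' v), Q' v⟫) -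
      z * (α⁻¹ ^ 2 * ‖Q' v‖ ^ 2)) =
      2 * ⟪v, Q' v⟫ - α⁻¹ * ⟪S (Q' v), Q' v⟫ - α⁻¹ * (z * ‖Q' v‖ ^ 2) := by
    field_simp
  rw [h9]
  linarith

theorem cauchy (h : IsRes S Q z) (v w : E) : ⟪v, Q w⟫ ^ 2 ≤ ⟪v, Q v⟫ * ⟪w, Q w⟫ := by
  have h1 : ∀ t : ℝ, 0 ≤ ⟪w, Q w⟫ * (t * t) + 2 * ⟪v, Q w⟫ * t + ⟪v, Q v⟫ := by
    intro t
    have := h.inner_nonneg (v + t • w)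
    rw [map_add, map_smul, inner_add_left, inner_add_right, inner_add_right, real_inner_smul_left,
      real_inner_smul_left, real_inner_smul_right, real_inner_smul_right] at this
    have h2 : ⟪w, Q v⟫ = ⟪v, Q w⟫ := by rw [← h.Q_symm, real_inner_comm]
    rw [h2] at this
    linarith
  have := discrim_le_zero h1
  unfold discrim at this
  nlinarith

theorem inner_add_le (h : IsRes S Q z) (v w : E) :
    ⟪v + w, Q (v + w)⟫ ≤ 2 * ⟪v, Q v⟫ + 2 * ⟪w, Q w⟫ := by
  have h1 := h.inner_nonneg (v - w)
  rw [map_sub, inner_sub_left, inner_sub_right, inner_sub_right] at h1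
  rw [map_add, inner_add_left, inner_add_right, inner_add_right]
  linarith

/-- The rank-one perturbation formula. -/
theorem rank_one (h : IsRes S Q z) (h' : IsRes S' Q' z) {n : ℝ} (hn : 0 < n) (x : E)
    (hS : ∀ v, S' v = S v + (n⁻¹ * ⟪x, v⟫) • x) (v : E) :
    Q' v = Q v - (⟪x, Q v⟫ / (n + ⟪x, Q x⟫)) • Q x := by
  symm
  apply h'.unique
  have hd : 0 < n + ⟪x, Q x⟫ := by have := h.inner_nonneg x; linarith
  set a := ⟪x, Q v⟫ / (n + ⟪x, Q x⟫) with ha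
  have e1 : n⁻¹ * ⟪x, Q v - a • Q x⟫ = a := by
    rw [inner_sub_right, real_inner_smul_right, ha]; field_simp; ring
  rw [hS, e1, map_sub, map_smul]
  calc _ = (S (Q v) + z • Q v) - a • (S (Q x) + z • Q x) + a • x := by module
    _ = v := by rw [h.eq, h.eq]; abel

theorem rank_one_inner (h : IsRes S Q z) (h' : IsRes S' Q' z) {n : ℝ} (hn : 0 < n) (x : E)
    (hS : ∀ v, S' v = S v + (n⁻¹ * ⟪x, v⟫) • x) (v : E) :
    ⟪v, Q' v⟫ = ⟪v, Q v⟫ - ⟪x, Q v⟫ ^ 2 / (n + ⟪x, Q x⟫) := by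
  rw [h.rank_one h' hn x hS v, inner_sub_right, real_inner_smul_right]
  have : ⟪v, Q x⟫ = ⟪x, Q v⟫ := by rw [← h.Q_symm, real_inner_comm]
  rw [this]; ring

theorem rank_one_apply (h : IsRes S Q z) (h' : IsRes S' Q' z) {n : ℝ} (hn : 0 < n) (x : E)
    (hS : ∀ v, S' v = S v + (n⁻¹ * ⟪x, v⟫) • x) (v : E) :
    ⟪x, Q' v⟫ = ⟪x, Q v⟫ / (1 + ⟪x, Q x⟫ / n) := by
  have hd : 0 < n + ⟪x, Q x⟫ := by have := h.inner_nonneg x; linarith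
  rw [h.rank_one h' hn x hS v, inner_sub_right, real_inner_smul_right]
  have : 1 + ⟪x, Q x⟫ / n ≠ 0 := by
    have := h.inner_nonneg x; positivity
  field_simp; ring

theorem rank_one_sub (h : IsRes S Q z) (h' : IsRes S' Q' z) {n : ℝ} (hn : 0 < n) (x : E)
    (hS : ∀ v, S' v = S v + (n⁻¹ * ⟪x, v⟫) • x) (v : E) :
    Q v - Q' v = (n⁻¹ * ⟪x, Q' v⟫) • Q x := by
  have hd : 0 < n + ⟪x, Q x⟫ := by have := h.inner_nonneg x; linarith
  rw [h.rank_one_apply h' hn x hS v, h.rank_one h' hn x hS v, sub_sub_cancel]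
  congr 1
  field_simp

/-- `(1/n) ∑ ⟪x_i, Q v⟫² ≤ ⟪v, Q v⟫` for a sample covariance operator. -/
theorem sum_sq_le {ι : Type*} [Fintype ι] {n : ℝ} {x : ι → E} (h : IsRes S Q z)
    (hS : ∀ v, S v = ∑ i, (n⁻¹ * ⟪x i, v⟫) • x i) (v : E) :
    n⁻¹ * ∑ i, ⟪x i, Q v⟫ ^ 2 ≤ ⟪v, Q v⟫ := by
  have h1 := h.inner_eq v
  rw [hS (Q v), sum_inner] at h1
  have h2 : ∑ i, ⟪(n⁻¹ * ⟪x i, Q v⟫) • x i, Q v⟫ = n⁻¹ * ∑ i, ⟪x i, Q v⟫ ^ 2 := by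
    rw [Finset.mul_sum]
    refine Finset.sum_congr rfl fun i _ => ?_
    rw [real_inner_smul_left]; ring
  rw [h2] at h1
  have := h.pos
  have : 0 ≤ z * ‖Q v‖ ^ 2 := by positivity
  linarith

/-- The average `w` of the columns with index in `J` satisfies `⟪w, Q w⟫ ≤ n / |J|`. -/
theorem inner_mean_le {ι : Type*} [Fintype ι] {n : ℝ} (hn : 0 < n) {x : ι → E}
    (h : IsRes S Q z) (hS : ∀ v, S v = ∑ i, (n⁻¹ * ⟪x i, v⟫) • x i) (J : Finset ι)
    (hJ : J.Nonempty) :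
    ⟪(J.card : ℝ)⁻¹ • ∑ j ∈ J, x j, Q ((J.card : ℝ)⁻¹ • ∑ j ∈ J, x j)⟫ ≤ n / J.card := by
  set w := (J.card : ℝ)⁻¹ • ∑ j ∈ J, x j with hw
  have hc : (0 : ℝ) < J.card := by exact_mod_cast hJ.card_pos
  have h1 : ⟪w, Q w⟫ = (J.card : ℝ)⁻¹ * ∑ j ∈ J, ⟪x j, Q w⟫ := by
    nth_rewrite 1 [hw]
    rw [real_inner_smul_left, sum_inner]
  have h2 : (∑ j ∈ J, ⟪x j, Q w⟫) ^ 2 ≤ J.card * ∑ j ∈ J, ⟪x j, Q w⟫ ^ 2 :=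
    sq_sum_le_card_mul_sum_sq
  have h3 : ∑ j ∈ J, ⟪x j, Q w⟫ ^ 2 ≤ ∑ j, ⟪x j, Q w⟫ ^ 2 :=
    Finset.sum_le_univ_sum_of_nonneg fun _ => sq_nonneg _
  have h4 := h.sum_sq_le hS w
  rw [inv_mul_le_iff₀ hn] at h4
  -- Self-bounding: `⟪w, Q w⟫` is an average of `⟪x_j, Q w⟫`, whose squares sum to at most `n ⟪w, Q
  -- w⟫`. Dividing by `⟪w, Q w⟫` gives a bound that does not see the size of the columns.
  have h5 : ⟪w, Q w⟫ ^ 2 * J.card ≤ n * ⟪w, Q w⟫ := by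
    rw [h1, mul_pow, ← h1]
    calc _ = (J.card : ℝ)⁻¹ * (∑ j ∈ J, ⟪x j, Q w⟫) ^ 2 := by field_simp
      _ ≤ (J.card : ℝ)⁻¹ * (J.card * (n * ⟪w, Q w⟫)) := by
          gcongr
          exact h2.trans (by gcongr; linarith)
      _ = _ := by field_simp
  rw [le_div_iff₀ hc]
  rcases (h.inner_nonneg w).eq_or_lt with h0 | h0
  · rw [← h0]; simpa using hn.le
  · nlinarith

end IsRes

end Resolvents

/-! ### Matrices as operators, the sample resolvent, and population covariances. -/

section Matrices

open scoped RealInnerProductSpace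

variable {p n k : ℕ}

/-- The operator of a square matrix on the Euclidean space. -/
noncomputable def op (M : Matrix (Fin p) (Fin p) ℝ) : EuclideanSpace ℝ (Fin p) →ₗ[ℝ] EuclideanSpace ℝ (Fin p) :=
  Matrix.toEuclideanLin M

theorem op_apply (M : Matrix (Fin p) (Fin p) ℝ) (v : EuclideanSpace ℝ (Fin p)) (i : Fin p) :
    op M v i = ∑ j, M i j * v j := rfl

theorem inner_eq_sum (v w : EuclideanSpace ℝ (Fin p)) : ⟪v, w⟫ = ∑ i, v i * w i := by
  simp [PiLp.inner_apply, mul_comm]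

theorem inner_op (M : Matrix (Fin p) (Fin p) ℝ) (v w : EuclideanSpace ℝ (Fin p)) :
    ⟪v, op M w⟫ = ∑ i, ∑ j, v i * M i j * w j := by
  rw [inner_eq_sum]
  refine Finset.sum_congr rfl fun i _ => ?_
  rw [op_apply, Finset.mul_sum]
  exact Finset.sum_congr rfl fun j _ => by ring

theorem op_mul (M N : Matrix (Fin p) (Fin p) ℝ) (v : EuclideanSpace ℝ (Fin p)) :
    op (M * N) v = op M (op N v) := by
  ext i
  change (M * N).mulVec v.ofLp i = M.mulVec (N.mulVec v.ofLp) i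
  rw [Matrix.mulVec_mulVec]

theorem op_one (v : EuclideanSpace ℝ (Fin p)) : op 1 v = v := by
  ext i
  change (1 : Matrix (Fin p) (Fin p) ℝ).mulVec v.ofLp i = v i
  rw [Matrix.one_mulVec]

theorem op_add (M N : Matrix (Fin p) (Fin p) ℝ) (v : EuclideanSpace ℝ (Fin p)) :
    op (M + N) v = op M v + op N v := by
  simp [op]

theorem op_smul (c : ℝ) (M : Matrix (Fin p) (Fin p) ℝ) (v : EuclideanSpace ℝ (Fin p)) :
    op (c • M) v = c • op M v := by
  simp [op]

theorem op_sum {ι : Type*} (s : Finset ι) (M : ι → Matrix (Fin p) (Fin p) ℝ)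
    (v : EuclideanSpace ℝ (Fin p)) : op (∑ i ∈ s, M i) v = ∑ i ∈ s, op (M i) v := by
  simp [op]

theorem isUnit_det_add_smul {S : Matrix (Fin p) (Fin p) ℝ} {z : ℝ} (hz : 0 < z)
    (hnn : ∀ v, 0 ≤ ⟪op S v, v⟫) : (S + z • (1 : Matrix (Fin p) (Fin p) ℝ)).det ≠ 0 := by
  intro h
  obtain ⟨v, hv, h0⟩ := Matrix.exists_mulVec_eq_zero_iff.2 h
  have h1 : op (S + z • (1 : Matrix (Fin p) (Fin p) ℝ)) (WithLp.toLp 2 v) = 0 := by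
    ext i
    exact congrFun h0 i
  rw [op_add, op_smul, op_one] at h1
  have h2 := congrArg (fun x => ⟪x, WithLp.toLp 2 v⟫) h1
  simp only [inner_add_left, real_inner_smul_left, inner_zero_left,
    real_inner_self_eq_norm_sq] at h2
  have h3 := hnn (WithLp.toLp 2 v)
  have h4 : z * ‖WithLp.toLp 2 v‖ ^ 2 ≤ 0 := by linarith
  have h5 : ‖WithLp.toLp 2 v‖ ^ 2 ≤ 0 := nonpos_of_mul_nonpos_right h4 hz
  have h6 : ‖WithLp.toLp 2 v‖ = 0 :=
    pow_eq_zero_iff (two_ne_zero) |>.1 (le_antisymm h5 (sq_nonneg _))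
  rw [norm_eq_zero] at h6
  exact hv (by simpa using congrArg WithLp.ofLp h6)

theorem isRes_resolvent {S : Matrix (Fin p) (Fin p) ℝ} {z : ℝ} (hz : 0 < z)
    (hs : ∀ v w, ⟪op S v, w⟫ = ⟪v, op S w⟫) (hnn : ∀ v, 0 ≤ ⟪op S v, v⟫) :
    IsRes (op S) (op (resolvent S z)) z := by
  refine ⟨hz, hs, hnn, fun v => ?_⟩
  have hu : IsUnit (S + z • (1 : Matrix (Fin p) (Fin p) ℝ)).det :=
    isUnit_iff_ne_zero.2 (isUnit_det_add_smul hz hnn)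
  have h1 := Matrix.mul_nonsing_inv _ hu
  have h2 := congrArg (fun M => op M v) h1
  simp only [op_mul, op_one, op_add, op_smul] at h2
  exact h2

theorem op_sampleCov (x : Fin n → EuclideanSpace ℝ (Fin p)) (v : EuclideanSpace ℝ (Fin p)) :
    op (sampleCov (columns x)) v = ∑ i, ((n : ℝ)⁻¹ * ⟪x i, v⟫) • x i := by
  ext a
  rw [op_apply]
  simp only [sampleCov, columns, Matrix.smul_apply, Matrix.mul_apply, Matrix.transpose_apply,
    Matrix.of_apply, smul_eq_mul, inner_eq_sum, WithLp.ofLp_sum, WithLp.ofLp_smul,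
    Finset.sum_apply, Pi.smul_apply, Finset.mul_sum, Finset.sum_mul]
  rw [Finset.sum_comm]
  exact Finset.sum_congr rfl fun i _ => Finset.sum_congr rfl fun j _ => by ring

theorem inner_op_sampleCov (x : Fin n → EuclideanSpace ℝ (Fin p))
    (v w : EuclideanSpace ℝ (Fin p)) :
    ⟪op (sampleCov (columns x)) v, w⟫ = (n : ℝ)⁻¹ * ∑ i, ⟪x i, v⟫ * ⟪x i, w⟫ := by
  rw [op_sampleCov, sum_inner, Finset.mul_sum]
  exact Finset.sum_congr rfl fun i _ => by rw [real_inner_smul_left]; ring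

/-- The resolvent of the sample covariance of the columns `x`. -/
noncomputable def res (z : ℝ) (x : Fin n → EuclideanSpace ℝ (Fin p)) : Matrix (Fin p) (Fin p) ℝ :=
  resolvent (sampleCov (columns x)) z

theorem sampleCov_nonneg (x : Fin n → EuclideanSpace ℝ (Fin p)) (v : EuclideanSpace ℝ (Fin p)) :
    0 ≤ ⟪op (sampleCov (columns x)) v, v⟫ := by
  rw [inner_op_sampleCov]
  exact mul_nonneg (by positivity) (Finset.sum_nonneg fun i _ => mul_self_nonneg _)

theorem isRes_res {z : ℝ} (hz : 0 < z) (x : Fin n → EuclideanSpace ℝ (Fin p)) :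
    IsRes (op (sampleCov (columns x))) (op (res z x)) z := by
  refine isRes_resolvent hz (fun v w => ?_) (sampleCov_nonneg x)
  rw [inner_op_sampleCov, real_inner_comm, inner_op_sampleCov]
  congr 1
  exact Finset.sum_congr rfl fun i _ => mul_comm _ _

/-- Replacing a column by `0` removes it without changing the index set or the factor `1 / n`. All
leave-one-out resolvents below are written in this way. -/
theorem op_sampleCov_update (x : Fin n → EuclideanSpace ℝ (Fin p)) (i : Fin n)
    (y v : EuclideanSpace ℝ (Fin p)) :
    op (sampleCov (columns (Function.update x i y))) v =
      op (sampleCov (columns (Function.update x i 0))) v + ((n : ℝ)⁻¹ * ⟪y, v⟫) • y := by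
  rw [op_sampleCov, op_sampleCov, Finset.sum_eq_add_sum_sdiff_singleton_of_mem (Finset.mem_univ i),
    Finset.sum_eq_add_sum_sdiff_singleton_of_mem (Finset.mem_univ i)]
  simp only [Function.update_self, smul_zero, zero_add]
  rw [add_comm]
  congr 1
  refine Finset.sum_congr rfl fun j hj => ?_
  have : j ≠ i := by simpa using hj
  rw [Function.update_of_ne this, Function.update_of_ne this]

/-- The inverse is the adjugate divided by a determinant that never vanishes. This supplies the
measurability of every functional of the resolvent below. -/
theorem continuous_res_apply {z : ℝ} (hz : 0 < z) (a b : Fin p) :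
    Continuous fun x : Fin n → EuclideanSpace ℝ (Fin p) => res z x a b := by
  have h1 : Continuous fun x : Fin n → EuclideanSpace ℝ (Fin p) =>
      sampleCov (columns x) + z • (1 : Matrix (Fin p) (Fin p) ℝ) := by
    refine continuous_matrix fun c d => ?_
    simp only [sampleCov, columns, Matrix.add_apply, Matrix.smul_apply, Matrix.mul_apply,
      Matrix.transpose_apply, Matrix.of_apply]
    fun_prop
  have h2 := h1.matrix_det.inv₀ fun x => isUnit_det_add_smul hz (sampleCov_nonneg x)
  have h3 := (h2.smul h1.matrix_adjugate).matrix_elem a b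
  refine h3.congr fun x => ?_
  simp only [res, resolvent, Matrix.inv_def, Ring.inverse_eq_inv']
  rfl

theorem continuous_inner_res {z : ℝ} (hz : 0 < z) {X : Type*} [TopologicalSpace X]
    {x : X → Fin n → EuclideanSpace ℝ (Fin p)} {v w : X → EuclideanSpace ℝ (Fin p)}
    (hx : Continuous x) (hv : Continuous v) (hw : Continuous w) :
    Continuous fun s => ⟪v s, op (res z (x s)) (w s)⟫ := by
  simp only [inner_op]
  refine continuous_finsetSum _ fun i _ => continuous_finsetSum _ fun j _ => ?_
  exact ((by fun_prop : Continuous fun s => v s i).mul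
    ((continuous_res_apply hz i j).comp hx)).mul (by fun_prop)

theorem isSymm_of_inner {M : Matrix (Fin p) (Fin p) ℝ} (h : ∀ v w, ⟪op M v, w⟫ = ⟪v, op M w⟫) :
    M.IsSymm := by
  ext i j
  have := h (EuclideanSpace.single i 1) (EuclideanSpace.single j 1)
  rw [real_inner_comm, inner_op, inner_op] at this
  simpa [Finset.sum_ite_eq, Pi.single_apply] using this

theorem trace_mul_eq_sum (A M : Matrix (Fin p) (Fin p) ℝ) :
    (A * M).trace = ∑ i, ∑ j, A i j * M j i := by
  simp [Matrix.trace, Matrix.mul_apply]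

section PopCov

variable {μ : Measure (EuclideanSpace ℝ (Fin p))}

theorem inner_popCov (hμ : ∀ i j, Integrable (fun y : EuclideanSpace ℝ (Fin p) => y i * y j) μ)
    (v w : EuclideanSpace ℝ (Fin p)) :
    ⟪v, op (popCov μ) w⟫ = ∫ y, ⟪y, v⟫ * ⟪y, w⟫ ∂μ := by
  have h1 : ∀ y : EuclideanSpace ℝ (Fin p), ⟪y, v⟫ * ⟪y, w⟫ =
      ∑ i, ∑ j, (v i * w j) * (y i * y j) := by
    intro y
    rw [inner_eq_sum, inner_eq_sum, Finset.sum_mul_sum]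
    exact Finset.sum_congr rfl fun i _ => Finset.sum_congr rfl fun j _ => by ring
  simp only [h1]
  rw [integral_finsetSum _ fun i _ => integrable_finsetSum _ fun j _ => (hμ i j).const_mul _,
    inner_op]
  refine Finset.sum_congr rfl fun i _ => ?_
  rw [integral_finsetSum _ fun j _ => (hμ i j).const_mul _]
  refine Finset.sum_congr rfl fun j _ => ?_
  rw [integral_const_mul, popCov, Matrix.of_apply]
  ring

theorem trace_popCov_mul
    (hμ : ∀ i j, Integrable (fun y : EuclideanSpace ℝ (Fin p) => y i * y j) μ)
    (M : Matrix (Fin p) (Fin p) ℝ) :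
    (popCov μ * M).trace = ∫ y, ⟪y, op M y⟫ ∂μ := by
  simp only [inner_op]
  rw [integral_finsetSum _ fun i _ => integrable_finsetSum _ fun j _ => by
    simpa [mul_comm, mul_assoc, mul_left_comm] using (hμ i j).const_mul (M i j), trace_mul_eq_sum,
    Finset.sum_comm]
  refine Finset.sum_congr rfl fun i _ => ?_
  rw [integral_finsetSum _ fun j _ => by
    simpa [mul_comm, mul_assoc, mul_left_comm] using (hμ i j).const_mul (M i j)]
  refine Finset.sum_congr rfl fun j _ => ?_
  rw [popCov, Matrix.of_apply, ← integral_mul_const]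
  congr 1
  ext y
  ring

theorem inner_op_popCov_symm (μ : Measure (EuclideanSpace ℝ (Fin p)))
    (v w : EuclideanSpace ℝ (Fin p)) : ⟪op (popCov μ) v, w⟫ = ⟪v, op (popCov μ) w⟫ := by
  rw [real_inner_comm, inner_op, inner_op, Finset.sum_comm]
  refine Finset.sum_congr rfl fun i _ => Finset.sum_congr rfl fun j _ => ?_
  have : popCov μ j i = popCov μ i j := by
    simp only [popCov, Matrix.of_apply]
    congr 1
    ext y
    ring
  rw [this]
  ring

end PopCov

/-! ### Linear forms bounded by the spectral norm. -/

section Functionals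

open scoped Matrix.Norms.L2Operator

theorem norm_op_le (M : Matrix (Fin p) (Fin p) ℝ) (v : EuclideanSpace ℝ (Fin p)) :
    ‖op M v‖ ≤ ‖M‖ * ‖v‖ :=
  Matrix.l2_opNorm_mulVec M v

theorem norm_le_of_op {M : Matrix (Fin p) (Fin p) ℝ} {C : ℝ} (hC : 0 ≤ C)
    (h : ∀ v, ‖op M v‖ ≤ C * ‖v‖) : ‖M‖ ≤ C := by
  rw [Matrix.l2_opNorm_def]
  exact ContinuousLinearMap.opNorm_le_bound _ hC h

theorem linear_eq_sum (u : Matrix (Fin p) (Fin p) ℝ →ₗ[ℝ] ℝ) (M : Matrix (Fin p) (Fin p) ℝ) :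
    u M = ∑ i, ∑ j, M i j * u (Matrix.single i j 1) := by
  conv_lhs => rw [Matrix.matrix_eq_sum_single M]
  simp only [map_sum]
  refine Finset.sum_congr rfl fun i _ => Finset.sum_congr rfl fun j _ => ?_
  have : Matrix.single i j (M i j) = M i j • Matrix.single i j (1 : ℝ) := by
    simp [Matrix.smul_single]
  rw [this, map_smul, smul_eq_mul]

/-- On symmetric matrices, a linear form bounded by the spectral norm is an absolutely convex
combination of quadratic forms `M ↦ ⟪v, M v⟫` with unit vectors `v`. -/
theorem exists_quadratic_decomposition (u : Matrix (Fin p) (Fin p) ℝ →ₗ[ℝ] ℝ)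
    (hu : ∀ M, |u M| ≤ ‖M‖) :
    ∃ (a : Fin p → ℝ) (v : Fin p → EuclideanSpace ℝ (Fin p)), (∀ k, ‖v k‖ = 1) ∧
      ∑ k, |a k| ≤ 1 ∧ ∀ M : Matrix (Fin p) (Fin p) ℝ, M.IsSymm →
        u M = ∑ k, a k * ⟪v k, op M (v k)⟫ := by
  -- `A` is the symmetric matrix representing `u` on symmetric matrices through the trace pairing;
  -- its spectral decomposition provides the weights and the vectors.
  set A : Matrix (Fin p) (Fin p) ℝ := Matrix.of fun i j =>
    (u (Matrix.single i j 1) + u (Matrix.single j i 1)) / 2 with hA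
  have hAs : A.IsHermitian := by
    ext i j
    simp [hA, add_comm]
  set b := hAs.eigenvectorBasis with hb
  set a := hAs.eigenvalues with ha
  have hAb : ∀ k, op A (b k) = a k • b k := by
    intro k
    ext i
    exact congrFun (hAs.mulVec_eigenvectorBasis k) i
  have hAij : ∀ i j, A i j = ∑ k, a k * (b k i * b k j) := by
    intro i j
    have h1 : ⟪EuclideanSpace.single i (1 : ℝ), op A (EuclideanSpace.single j 1)⟫ = A i j := by
      rw [inner_op]; simp
    rw [← h1, ← b.sum_repr' (EuclideanSpace.single j 1), map_sum, inner_sum]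
    refine Finset.sum_congr rfl fun k _ => ?_
    rw [map_smul, hAb, real_inner_smul_right, real_inner_smul_right, inner_eq_sum, inner_eq_sum]
    simp
    ring
  have hmain : ∀ M : Matrix (Fin p) (Fin p) ℝ, M.IsSymm →
      u M = ∑ k, a k * ⟪b k, op M (b k)⟫ := by
    intro M hM
    have h1 : u M = ∑ i, ∑ j, M i j * A i j := by
      have h2 : u M = ∑ i, ∑ j, M i j * u (Matrix.single j i 1) := by
        rw [linear_eq_sum u M, Finset.sum_comm]
        refine Finset.sum_congr rfl fun i _ => Finset.sum_congr rfl fun j _ => ?_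
        rw [hM.apply]
      have h3 := linear_eq_sum u M
      have : u M = (u M + u M) / 2 := by ring
      rw [this]
      nth_rewrite 1 [h3]
      rw [h2, ← Finset.sum_add_distrib, Finset.sum_div]
      refine Finset.sum_congr rfl fun i _ => ?_
      rw [← Finset.sum_add_distrib, Finset.sum_div]
      refine Finset.sum_congr rfl fun j _ => ?_
      simp only [hA, Matrix.of_apply]
      ring
    rw [h1]
    simp only [inner_op, hAij, Finset.mul_sum]
    rw [Finset.sum_comm_cycle]
    refine Finset.sum_congr rfl fun k _ => Finset.sum_congr rfl fun i _ =>
      Finset.sum_congr rfl fun j _ => by ring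
  refine ⟨a, b, fun k => b.orthonormal.1 k, ?_, hmain⟩
  -- `W` is the sign of `A` in functional calculus: its spectral norm is at most `1`, and `u W` is
  -- the sum of the absolute values of the eigenvalues.
  set W : Matrix (Fin p) (Fin p) ℝ := Matrix.of fun i j =>
    ∑ k, SignType.sign (a k) * (b k i * b k j) with hW
  have hWs : W.IsSymm := by
    ext i j
    simp only [hW, Matrix.transpose_apply, Matrix.of_apply]
    exact Finset.sum_congr rfl fun k _ => by ring
  have hWop : ∀ x, op W x = ∑ k, ((SignType.sign (a k) : ℝ) * ⟪b k, x⟫) • b k := by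
    intro x
    ext i
    rw [op_apply]
    simp only [hW, Matrix.of_apply, WithLp.ofLp_sum, WithLp.ofLp_smul,
      Finset.sum_apply, Pi.smul_apply, smul_eq_mul, inner_eq_sum, Finset.mul_sum, Finset.sum_mul]
    rw [Finset.sum_comm]
    refine Finset.sum_congr rfl fun k _ => Finset.sum_congr rfl fun j _ => by ring
  have hWb : ∀ k x, ⟪b k, op W x⟫ = (SignType.sign (a k) : ℝ) * ⟪b k, x⟫ := by
    intro k x
    rw [hWop, inner_sum, Finset.sum_eq_single k]
    · rw [real_inner_smul_right, real_inner_self_eq_norm_sq, b.orthonormal.1 k]; ring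
    · intro j _ hj
      rw [real_inner_smul_right, b.orthonormal.2 hj.symm, mul_zero]
    · simp
  have hsgn : ∀ c : ℝ, ((SignType.sign c : ℝ)) ^ 2 ≤ 1 := by
    intro c
    rcases lt_trichotomy c 0 with h | h | h <;> simp [h]
  have hWn : ‖W‖ ≤ 1 := by
    refine norm_le_of_op zero_le_one fun x => ?_
    rw [one_mul]
    refine (sq_le_sq₀ (norm_nonneg _) (norm_nonneg _)).1 ?_
    rw [← b.sum_sq_norm_inner_right (op W x), ← b.sum_sq_norm_inner_right x]
    refine Finset.sum_le_sum fun k _ => ?_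
    rw [hWb, norm_mul, mul_pow, Real.norm_eq_abs, sq_abs]
    nlinarith [hsgn (a k), sq_nonneg ‖(⟪b k, x⟫ : ℝ)‖]
  have h1 := (le_abs_self _).trans ((hu W).trans hWn)
  rw [hmain W hWs] at h1
  refine le_trans (le_of_eq (Finset.sum_congr rfl fun k _ => ?_)) h1
  rw [hWb, real_inner_self_eq_norm_sq, b.orthonormal.1 k]
  rcases lt_trichotomy (a k) 0 with h | h | h
  · simp [h, abs_of_neg]
  · simp [h]
  · simp [h, abs_of_pos]

end Functionals

end Matrices

/-! ### Resampling coordinates of a product measure; tensorization. -/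

section ProductMeasures

theorem _root_.MeasureTheory.MeasurePreserving.integral_comp_measurable {α β : Type*}
    [MeasurableSpace α] [MeasurableSpace β] {P : Measure α} {Q : Measure β} {T : α → β}
    (hT : MeasurePreserving T P Q) {g : β → ℝ} (hg : Measurable g) :
    ∫ x, g (T x) ∂P = ∫ y, g y ∂Q := by
  rw [← hT.map_eq, integral_map hT.measurable.aemeasurable hg.aestronglyMeasurable]

theorem piecewise_update {ι α : Type*} [DecidableEq ι] {S : Finset ι} {i : ι} (hi : i ∉ S) (x x' : ι → α) (e : α) :
    (insert i S).piecewise (Function.update x' i e) x = S.piecewise x' (Function.update x i e) := by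
  ext j
  by_cases hj : j = i
  · subst hj; simp [hi]
  · by_cases hS : j ∈ S <;> simp [hj, hS]

theorem piecewise_update_right {ι α : Type*} [DecidableEq ι] {S : Finset ι} {i : ι} (hi : i ∉ S) (x x' : ι → α) (e : α) :
    S.piecewise x' (Function.update x i e) = Function.update (S.piecewise x' x) i e := by
  ext j
  by_cases hj : j = i
  · subst hj; simp [hi]
  · by_cases hS : j ∈ S <;> simp [hj, hS]

theorem measurable_piecewise {ι α : Type*} [DecidableEq ι] [MeasurableSpace α] (S : Finset ι) :
    Measurable fun q : (ι → α) × (ι → α) => S.piecewise q.2 q.1 := by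
  refine measurable_pi_iff.2 fun j => ?_
  by_cases hj : j ∈ S
  · simp only [Finset.piecewise, hj, if_true]
    exact (measurable_pi_apply j).comp measurable_snd
  · simp only [Finset.piecewise, hj, if_false]
    exact (measurable_pi_apply j).comp measurable_fst

variable {ι : Type*} [Fintype ι] [DecidableEq ι] {α : Type*} [MeasurableSpace α]
  (μ : ι → Measure α) [∀ i, IsProbabilityMeasure (μ i)]

theorem measurePreserving_update (i : ι) :
    MeasurePreserving (fun q : (ι → α) × α => Function.update q.1 i q.2)
      ((Measure.pi μ).prod (μ i)) (Measure.pi μ) := by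
  refine ⟨measurable_update', (Measure.pi_eq fun s hs => ?_).symm⟩
  rw [Measure.map_apply measurable_update' (MeasurableSet.univ_pi hs)]
  have h1 : (fun q : (ι → α) × α => Function.update q.1 i q.2) ⁻¹' Set.univ.pi s =
      (Set.univ.pi (Function.update s i Set.univ)) ×ˢ s i := by
    ext q
    simp only [Set.mem_preimage, Set.mem_pi, Set.mem_univ, true_implies, Set.mem_prod]
    constructor
    · intro h
      refine ⟨fun j => ?_, by simpa using h i⟩
      by_cases hj : j = i
      · subst hj; simp
      · simpa [hj] using h j
    · rintro ⟨h, h'⟩ j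
      by_cases hj : j = i
      · subst hj; simpa using h'
      · simpa [hj] using h j
  rw [h1, Measure.prod_prod, Measure.pi_pi, ← Finset.mul_prod_erase _ _ (Finset.mem_univ i),
    ← Finset.mul_prod_erase Finset.univ (fun j => μ j (s j)) (Finset.mem_univ i)]
  simp only [Function.update_self, measure_univ, one_mul]
  rw [mul_comm]
  congr 1
  refine Finset.prod_congr rfl fun j hj => ?_
  rw [Function.update_of_ne (Finset.ne_of_mem_erase hj)]

theorem measurePreserving_piecewise (S : Finset ι) :
    MeasurePreserving (fun q : (ι → α) × (ι → α) => S.piecewise q.2 q.1)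
      ((Measure.pi μ).prod (Measure.pi μ)) (Measure.pi μ) := by
  refine ⟨measurable_piecewise S, (Measure.pi_eq fun s hs => ?_).symm⟩
  rw [Measure.map_apply (measurable_piecewise S) (MeasurableSet.univ_pi hs)]
  have h1 : (fun q : (ι → α) × (ι → α) => S.piecewise q.2 q.1) ⁻¹' Set.univ.pi s =
      (Set.univ.pi (S.piecewise (fun _ => Set.univ) s)) ×ˢ
        (Set.univ.pi (S.piecewise s fun _ => Set.univ)) := by
    ext q
    simp only [Set.mem_preimage, Set.mem_pi, Set.mem_univ, true_implies, Set.mem_prod,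
      ← forall_and]
    refine forall_congr' fun j => ?_
    by_cases hj : j ∈ S <;> simp [hj]
  rw [h1, Measure.prod_prod, Measure.pi_pi, Measure.pi_pi, ← Finset.prod_mul_distrib]
  refine Finset.prod_congr rfl fun j _ => ?_
  by_cases hj : j ∈ S <;> simp [hj]

theorem measurePreserving_comp_injective {κ : Type*} [Fintype κ] {f : κ → ι}
    (hf : Function.Injective f) :
    MeasurePreserving (fun (x : ι → α) j => x (f j)) (Measure.pi μ)
      (Measure.pi fun j => μ (f j)) := by
  have hm : Measurable fun (x : ι → α) j => x (f j) :=
    measurable_pi_iff.2 fun j => measurable_pi_apply (f j)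
  refine ⟨hm, (Measure.pi_eq fun s hs => ?_).symm⟩
  rw [Measure.map_apply hm (MeasurableSet.univ_pi hs)]
  have h1 : (fun (x : ι → α) j => x (f j)) ⁻¹' Set.univ.pi s =
      Set.univ.pi (Function.extend f s fun _ => Set.univ) := by
    ext x
    simp only [Set.mem_preimage, Set.mem_pi, Set.mem_univ, true_implies]
    constructor
    · intro h i
      by_cases hi : ∃ j, f j = i
      · obtain ⟨j, rfl⟩ := hi
        rw [hf.extend_apply]; exact h j
      · rw [Function.extend_apply' _ _ _ hi]; trivial
    · intro h j
      have := h (f j)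
      rwa [hf.extend_apply] at this
  rw [h1, Measure.pi_pi]
  symm
  refine Fintype.prod_of_injective f hf _ _ (fun i hi => ?_) fun j => ?_
  · rw [Function.extend_apply' _ _ _ (by simpa using hi)]; simp
  · rw [hf.extend_apply]

/-- The average of `f` over the coordinates in `S`. -/
noncomputable def avg (S : Finset ι) (f : (ι → α) → ℝ) (x : ι → α) : ℝ :=
  ∫ x', f (S.piecewise x' x) ∂(Measure.pi μ)

theorem integrable_of_abs_le {Ω : Type*} [MeasurableSpace Ω] {P : Measure Ω} [IsFiniteMeasure P]
    {f : Ω → ℝ} (hf : Measurable f) {B : ℝ} (hB : ∀ x, |f x| ≤ B) : Integrable f P :=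
  Integrable.of_bound hf.aestronglyMeasurable B (Filter.Eventually.of_forall hB)

theorem integral_piecewise_insert {S : Finset ι} {i : ι} (hi : i ∉ S) {f : (ι → α) → ℝ}
    (hf : Measurable f) {B : ℝ} (hB : ∀ x, |f x| ≤ B) (x : ι → α) :
    ∫ x', f ((insert i S).piecewise x' x) ∂(Measure.pi μ) =
      ∫ e, ∫ x', f (S.piecewise x' (Function.update x i e)) ∂(Measure.pi μ) ∂(μ i) := by
  have hm : ∀ T : Finset ι, Measurable fun x' => T.piecewise x' x := fun T =>
    (measurable_piecewise T).comp (measurable_const.prodMk measurable_id)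
  rw [← (measurePreserving_update μ i).integral_comp_measurable
    (g := fun x' => f ((insert i S).piecewise x' x)) (hf.comp (hm (insert i S)))]
  have hg : Measurable fun q : (ι → α) × α =>
      f ((insert i S).piecewise (Function.update q.1 i q.2) x) :=
    hf.comp ((hm _).comp measurable_update')
  rw [integral_prod_symm _ (integrable_of_abs_le hg fun _ => hB _)]
  simp only [piecewise_update hi]

theorem avg_bound {f : (ι → α) → ℝ} {B : ℝ} (hB : ∀ x, |f x| ≤ B) (S : Finset ι) (x : ι → α) :
    |avg μ S f x| ≤ B := by
  have := norm_integral_le_of_norm_le_const (μ := Measure.pi μ)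
    (f := fun x' => f (S.piecewise x' x)) (C := B) (Filter.Eventually.of_forall fun x' => hB _)
  simpa [avg] using this

theorem measurable_avg {f : (ι → α) → ℝ} (hf : Measurable f) (S : Finset ι) :
    Measurable (avg μ S f) := by
  have h : StronglyMeasurable fun q : (ι → α) × (ι → α) => f (S.piecewise q.2 q.1) :=
    (hf.comp (measurable_piecewise S)).stronglyMeasurable
  exact h.integral_prod_right'.measurable

/-- Tensorization of exponential moments around averages. -/
theorem mgf_avg_le {f : (ι → α) → ℝ} (hf : Measurable f) {B : ℝ} (hB : ∀ x, |f x| ≤ B) (lam : ℝ)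
    (β : ι → ℝ) (S : Finset ι) : ∀ x : ι → α,
    (∀ y, (∀ j, j ∉ S → y j = x j) → ∀ i ∈ S,
      ∫ e, Real.exp (lam * (f (Function.update y i e) -
        ∫ e', f (Function.update y i e') ∂(μ i))) ∂(μ i) ≤ Real.exp (β i)) →
    ∫ x', Real.exp (lam * (f (S.piecewise x' x) - avg μ S f x)) ∂(Measure.pi μ) ≤
      Real.exp (∑ i ∈ S, β i) := by
  induction S using Finset.induction_on with
  | empty => intro x _; simp [avg]
  | insert i S hi ih =>
    intro x hx
    have hB0 : 0 ≤ B := (abs_nonneg _).trans (hB x)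
    have hexpB : ∀ a b : ℝ, |a| ≤ B → |b| ≤ B →
        |Real.exp (lam * (a - b))| ≤ Real.exp (|lam| * (2 * B)) := by
      intro a b ha hb
      rw [abs_of_pos (Real.exp_pos _), Real.exp_le_exp]
      calc lam * (a - b) ≤ |lam * (a - b)| := le_abs_self _
        _ = |lam| * |a - b| := abs_mul _ _
        _ ≤ _ := by
          gcongr
          have := abs_sub a b
          linarith
    -- `f - G` splits into `f - g e`, handled by induction with coordinate `i` frozen at `e`, and `g
    -- e - G`, handled by Jensen's inequality. The coordinate estimate is required only at points
    -- agreeing with `x` off `S ∪ {i}`, so it may rely on a good event for the frozen coordinates.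
    set g : α → ℝ := fun e => avg μ S f (Function.update x i e) with hg
    have hgB : ∀ e, |g e| ≤ B := fun e => avg_bound μ hB S _
    have hgm : Measurable g :=
      (measurable_avg μ hf S).comp (measurable_update x)
    set G := avg μ (insert i S) f x with hG
    have hGe : G = ∫ e, g e ∂(μ i) := integral_piecewise_insert μ hi hf hB x
    have hGB : |G| ≤ B := avg_bound μ hB _ _
    have hfm2 : Measurable fun q : α × (ι → α) => f (S.piecewise q.2 (Function.update x i q.1)) :=
      hf.comp ((measurable_piecewise S).comp
        (((measurable_update x).comp measurable_fst).prodMk measurable_snd))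
    have hstep : ∫ x', Real.exp (lam * (f ((insert i S).piecewise x' x) - G)) ∂(Measure.pi μ) =
        ∫ e, ∫ x', Real.exp (lam * (f (S.piecewise x' (Function.update x i e)) - G))
          ∂(Measure.pi μ) ∂(μ i) :=
      integral_piecewise_insert μ hi (f := fun w => Real.exp (lam * (f w - G)))
        ((hf.sub_const G).const_mul lam).exp (fun w => hexpB _ _ (hB w) hGB) x
    have hinner : ∀ e, ∫ x', Real.exp (lam * (f (S.piecewise x' (Function.update x i e)) - G))
          ∂(Measure.pi μ) ≤ Real.exp (∑ j ∈ S, β j) * Real.exp (lam * (g e - G)) := by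
      intro e
      have h1 := ih (Function.update x i e) (fun y hy j hj => hx y (fun a ha => by
        rw [Finset.mem_insert, not_or] at ha
        rw [hy a ha.2, Function.update_of_ne ha.1]) j (Finset.mem_insert_of_mem hj))
      have h2 : ∀ x', Real.exp (lam * (f (S.piecewise x' (Function.update x i e)) - G)) =
          Real.exp (lam * (f (S.piecewise x' (Function.update x i e)) - g e)) *
            Real.exp (lam * (g e - G)) := by
        intro x'
        rw [← Real.exp_add]; congr 1; ring
      simp only [h2]
      rw [integral_mul_const]
      gcongr
    have hlast : ∫ e, Real.exp (lam * (g e - G)) ∂(μ i) ≤ Real.exp (β i) := by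
      have hφm : Measurable fun q : α × (ι → α) =>
          f (Function.update (S.piecewise q.2 x) i q.1) -
            ∫ e', f (Function.update (S.piecewise q.2 x) i e') ∂(μ i) := by
        refine Measurable.sub (by simpa only [piecewise_update_right hi] using hfm2) ?_
        have : StronglyMeasurable fun r : (ι → α) × α =>
            f (Function.update (S.piecewise r.1 x) i r.2) := by
          have := hfm2.comp measurable_swap
          simp only [piecewise_update_right hi] at this
          exact this.stronglyMeasurable
        exact (this.integral_prod_right'.measurable).comp measurable_snd
      have hφB : ∀ q : α × (ι → α), |∫ e', f (Function.update (S.piecewise q.2 x) i e') ∂(μ i)|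
          ≤ B := by
        intro q
        have := norm_integral_le_of_norm_le_const (μ := μ i)
          (f := fun e' => f (Function.update (S.piecewise q.2 x) i e')) (C := B)
          (Filter.Eventually.of_forall fun x' => hB _)
        simpa using this
      have hgG : ∀ e, g e - G = ∫ x', (f (Function.update (S.piecewise x' x) i e) -
            ∫ e', f (Function.update (S.piecewise x' x) i e') ∂(μ i)) ∂(Measure.pi μ) := by
        intro e
        rw [integral_sub, hGe]
        · congr 1
          · simp only [hg, avg, piecewise_update_right hi]
          · simp only [hg, avg, piecewise_update_right hi]
            refine integral_integral_swap (integrable_of_abs_le (B := B) ?_ fun _ => hB _)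
            simp only [piecewise_update_right hi] at hfm2
            exact hfm2
        · refine integrable_of_abs_le (B := B) ?_ fun _ => hB _
          have := hfm2.comp (measurable_const (a := e) |>.prodMk measurable_id)
          simp only [piecewise_update_right hi] at this
          exact this
        · refine integrable_of_abs_le (B := B) ?_ fun x' => hφB (e, x')
          have : StronglyMeasurable fun r : (ι → α) × α =>
            f (Function.update (S.piecewise r.1 x) i r.2) := by
            have := hfm2.comp measurable_swap
            simp only [piecewise_update_right hi] at this
            exact this.stronglyMeasurable
          exact this.integral_prod_right'.measurable
      have hexpm := (hφm.const_mul lam).exp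
      have hexpi : Integrable (fun q : α × (ι → α) =>
          Real.exp (lam * (f (Function.update (S.piecewise q.2 x) i q.1) -
            ∫ e', f (Function.update (S.piecewise q.2 x) i e') ∂(μ i))))
          ((μ i).prod (Measure.pi μ)) :=
        integrable_of_abs_le hexpm fun q => hexpB _ _ (hB _) (hφB q)
      -- `g e - G` averages, over the coordinates in `S`, the increments of `f` in coordinate `i`;
      -- convexity of `exp` moves the average outside.
      have hjensen : ∀ e, Real.exp (lam * (g e - G)) ≤
          ∫ x', Real.exp (lam * (f (Function.update (S.piecewise x' x) i e) -
            ∫ e', f (Function.update (S.piecewise x' x) i e') ∂(μ i))) ∂(Measure.pi μ) := by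
        intro e
        rw [hgG, ← integral_const_mul]
        have hm1 := hφm.comp (measurable_const (a := e) |>.prodMk measurable_id)
        refine convexOn_exp.map_integral_le (f := fun x' => lam *
          (f (Function.update (S.piecewise x' x) i e) -
            ∫ e', f (Function.update (S.piecewise x' x) i e') ∂(μ i))) (s := Set.univ)
          Real.continuous_exp.continuousOn isClosed_univ
          (Filter.Eventually.of_forall fun _ => Set.mem_univ _) ?_ ?_
        · refine (integrable_of_abs_le (B := 2 * B) hm1 fun x' => ?_).const_mul lam
          have h1 := hφB (e, x')
          have h2 := hB (Function.update (S.piecewise x' x) i e)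
          have h3 := abs_sub (f (Function.update (S.piecewise x' x) i e))
            (∫ e', f (Function.update (S.piecewise x' x) i e') ∂(μ i))
          simp only [Function.comp_apply, id_eq] at h1 ⊢
          linarith
        · exact integrable_of_abs_le ((hm1.const_mul lam).exp) fun x' =>
            hexpB _ _ (hB _) (hφB (e, x'))
      calc _ ≤ ∫ e, ∫ x', Real.exp (lam * (f (Function.update (S.piecewise x' x) i e) -
            ∫ e', f (Function.update (S.piecewise x' x) i e') ∂(μ i))) ∂(Measure.pi μ) ∂(μ i) := by
            refine integral_mono (integrable_of_abs_le
              (((hgm.sub_const G).const_mul lam).exp) fun e => hexpB _ _ (hgB e) hGB)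
              hexpi.integral_prod_left hjensen
        _ = ∫ x', ∫ e, Real.exp (lam * (f (Function.update (S.piecewise x' x) i e) -
            ∫ e', f (Function.update (S.piecewise x' x) i e') ∂(μ i))) ∂(μ i) ∂(Measure.pi μ) :=
            integral_integral_swap hexpi
        _ ≤ ∫ x', Real.exp (β i) ∂(Measure.pi μ) := by
            refine integral_mono hexpi.integral_prod_right (integrable_const _) fun x' => ?_
            exact hx _ (fun j hj => by
              rw [Finset.mem_insert, not_or] at hj
              exact Finset.piecewise_eq_of_notMem _ _ _ hj.2) i (Finset.mem_insert_self _ _)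
        _ = _ := by simp
    rw [hstep]
    have hmid : Integrable (fun e => ∫ x', Real.exp (lam * (f (S.piecewise x'
        (Function.update x i e)) - G)) ∂(Measure.pi μ)) (μ i) :=
      (integrable_of_abs_le (P := (μ i).prod (Measure.pi μ))
        (((hfm2.sub_const G).const_mul lam).exp) fun q => hexpB _ _ (hB _) hGB).integral_prod_left
    calc _ ≤ ∫ e, Real.exp (∑ j ∈ S, β j) * Real.exp (lam * (g e - G)) ∂(μ i) := by
          refine integral_mono hmid ?_ hinner
          exact (integrable_of_abs_le (((hgm.sub_const G).const_mul lam).exp)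
            fun e => hexpB _ _ (hgB e) hGB).const_mul _
      _ ≤ Real.exp (∑ j ∈ S, β j) * Real.exp (β i) := by
          rw [integral_const_mul]
          gcongr
      _ = _ := by rw [← Real.exp_add, Finset.sum_insert hi, add_comm]

end ProductMeasures

/-! ### Exponential tails from the concentration of maxima. -/

section MaxTrick

variable {Ω : Type*} [MeasurableSpace Ω] {P : Measure Ω} [IsProbabilityMeasure P]

/-- If maxima of independent copies of `W` fluctuate by less than `T` with high probability,
then the upper tail of `W` is halved whenever the level is raised by `T`. -/
theorem measureReal_tail_halving {W : Ω → ℝ} (hW : Measurable W) {T : ℝ}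
    (h : ∀ m : ℕ, ((Measure.pi fun _ : Fin (m + 1) => P).prod (Measure.pi fun _ => P))
      {w | T ≤ |Finset.univ.sup' Finset.univ_nonempty (fun j : Fin (m + 1) => W (w.1 j)) -
        Finset.univ.sup' Finset.univ_nonempty (fun j : Fin (m + 1) => W (w.2 j))|} ≤
          ENNReal.ofReal (Real.exp (-3) / 3))
    {s : ℝ} (hs : P.real {ω | s ≤ W ω} ≤ 1 / 2) :
    P.real {ω | s + T ≤ W ω} ≤ P.real {ω | s ≤ W ω} / 2 := by
  classical
  set g := P.real {ω | s ≤ W ω} with hg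
  set g' := P.real {ω | s + T ≤ W ω} with hg'
  have hg0 : 0 ≤ g := measureReal_nonneg
  have hg'0 : 0 ≤ g' := measureReal_nonneg
  have hg'1 : g' ≤ 1 := measureReal_le_one
  rcases le_or_gt g' 0 with h0 | h0
  · linarith
  by_contra hcon
  push Not at hcon
  have hgg : g / 2 < g' := hcon
  -- With about `1 / g` copies, the maximum stays below `s` with probability at least `e⁻³`. If `g'
  -- > g / 2`, it also reaches `s + T` with probability above `1 / 3`. For two independent maxima
  -- this contradicts the assumed bound `e⁻³ / 3`.
  obtain ⟨m, hm1, hm2⟩ : ∃ m : ℕ, ((m : ℝ) + 1) * g ≤ 1 + g ∧ 1 ≤ ((m : ℝ) + 1) * g' * 2 := by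
    rcases hg0.eq_or_lt with hz | hz
    · obtain ⟨m, hm⟩ := exists_nat_ge (1 / (g' * 2))
      refine ⟨m, by rw [← hz]; simp, ?_⟩
      rw [div_le_iff₀ (by positivity)] at hm
      nlinarith
    · refine ⟨⌊1 / g⌋₊, ?_, ?_⟩
      · have := Nat.floor_le (a := 1 / g) (by positivity)
        rw [le_div_iff₀ hz] at this
        linarith
      · have := Nat.lt_floor_add_one (1 / g)
        rw [div_lt_iff₀ hz] at this
        nlinarith
  set π := Measure.pi fun _ : Fin (m + 1) => P with hπ
  set M : (Fin (m + 1) → Ω) → ℝ :=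
    fun y => Finset.univ.sup' Finset.univ_nonempty (fun j : Fin (m + 1) => W (y j)) with hM
  have hlow : ∀ a : ℝ, π.real {y | M y < a} = (1 - P.real {ω | a ≤ W ω}) ^ (m + 1) := by
    intro a
    have h1 : {y : Fin (m + 1) → Ω | M y < a} = Set.univ.pi fun _ => {ω | W ω < a} := by
      ext y
      simp [hM, Finset.sup'_lt_iff]
    have h2 : {ω | W ω < a} = {ω | a ≤ W ω}ᶜ := by ext ω; simp
    rw [h1, measureReal_def, hπ, Measure.pi_pi]
    simp only [Finset.prod_const, Finset.card_univ, Fintype.card_fin, ENNReal.toReal_pow]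
    rw [h2, ← measureReal_def, probReal_compl_eq_one_sub (measurableSet_le measurable_const hW)]
  have hMm : Measurable M := by
    refine measurable_of_Iio fun a => ?_
    have h1 : M ⁻¹' Set.Iio a = ⋂ j, {y : Fin (m + 1) → Ω | W (y j) < a} := by
      ext y
      simp [hM, Finset.sup'_lt_iff]
    rw [h1]
    exact MeasurableSet.iInter fun j =>
      measurableSet_lt (hW.comp (measurable_pi_apply j)) measurable_const
  have hup : π.real {y | s + T ≤ M y} = 1 - (1 - g') ^ (m + 1) := by
    have h1 : {y | s + T ≤ M y} = {y | M y < s + T}ᶜ := by ext y; simp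
    rw [h1, probReal_compl_eq_one_sub (measurableSet_lt hMm measurable_const), hlow]
  have hprod : π.real {y | s + T ≤ M y} * π.real {y | M y < s} ≤ Real.exp (-3) / 3 := by
    rw [← measureReal_prod_prod]
    refine ENNReal.toReal_le_of_le_ofReal (by positivity) (le_trans (measure_mono ?_) (h m))
    rintro ⟨y, y'⟩ ⟨h1, h2⟩
    simp only [Set.mem_ofPred_eq] at h1 h2 ⊢
    exact le_trans (by simp only [hM] at h1 h2; linarith) (le_abs_self _)
  rw [hup, hlow s, ← hg] at hprod
  -- `1 - g ≥ e^{-2g}` for `g ≤ 1/2`, and `2 (m + 1) g ≤ 2 (1 + g) ≤ 3`.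
  have hl : Real.exp (-3) ≤ (1 - g) ^ (m + 1) := by
    have h1 : Real.exp (-2 * g) ≤ 1 - g := by
      have hp : 0 < 1 - g := by linarith
      rw [← Real.le_log_iff_exp_le hp]
      refine le_trans ?_ (Real.one_sub_inv_le_log_of_pos hp)
      have : (1 - g)⁻¹ ≤ 1 + 2 * g := by
        rw [inv_le_iff_one_le_mul₀ hp]; nlinarith
      linarith
    calc Real.exp (-3) ≤ Real.exp (((m + 1 : ℕ) : ℝ) * (-2 * g)) := by
          apply Real.exp_le_exp.2; push_cast; nlinarith
      _ = Real.exp (-2 * g) ^ (m + 1) := by rw [Real.exp_nat_mul]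
      _ ≤ _ := by gcongr
  have hu : (1 - g') ^ (m + 1) ≤ Real.exp (-((m + 1 : ℝ) * g')) := by
    have h1 : 1 - g' ≤ Real.exp (-g') := by have := Real.add_one_le_exp (-g'); linarith
    calc (1 - g') ^ (m + 1) ≤ Real.exp (-g') ^ (m + 1) :=
          pow_le_pow_left₀ (by linarith) h1 _
      _ = _ := by rw [← Real.exp_nat_mul]; push_cast; ring_nf
  set x := (m + 1 : ℝ) * g' with hx
  have hx1 : 1 / 2 ≤ x := by linarith
  have hex : Real.exp (-x) < 2 / 3 := by
    calc Real.exp (-x) ≤ Real.exp (-(1 / 2)) := Real.exp_le_exp.2 (by linarith)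
      _ < 2 / 3 := by
        rw [Real.exp_neg, inv_lt_comm₀ (by positivity) (by norm_num)]
        have := Real.add_one_lt_exp (x := 1 / 2) (by norm_num)
        linarith
  have hA : 1 / 3 < 1 - (1 - g') ^ (m + 1) := by linarith
  have he3 : 0 < Real.exp (-3) := Real.exp_pos _
  nlinarith

/-- Iterating `measureReal_tail_halving`. -/
theorem measureReal_tail_exp {W : Ω → ℝ} {T s : ℝ} (hT : 0 < T)
    (h : ∀ s', P.real {ω | s' ≤ W ω} ≤ 1 / 2 →
      P.real {ω | s' + T ≤ W ω} ≤ P.real {ω | s' ≤ W ω} / 2)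
    (hs : P.real {ω | s ≤ W ω} ≤ 1 / 2) (t : ℝ) :
    P.real {ω | s + t ≤ W ω} ≤ Real.exp (-(t / T) * Real.log 2) := by
  have hlog : 0 < Real.log 2 := Real.log_pos (by norm_num)
  have hj : ∀ j : ℕ, P.real {ω | s + j * T ≤ W ω} ≤ 1 / 2 * (1 / 2) ^ j := by
    intro j
    induction j with
    | zero => simpa using hs
    | succ j ih =>
      have h1 : (1 / 2 : ℝ) * (1 / 2) ^ j ≤ 1 / 2 := by
        have : (1 / 2 : ℝ) ^ j ≤ 1 := pow_le_one₀ (by norm_num) (by norm_num)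
        linarith
      have h2 := h _ (ih.trans h1)
      have h3 : s + j * T + T = s + ((j + 1 : ℕ) : ℝ) * T := by push_cast; ring
      rw [h3] at h2
      rw [pow_succ]
      linarith
  rcases le_or_gt t 0 with ht | ht
  · refine measureReal_le_one.trans (Real.one_le_exp ?_)
    have : t / T ≤ 0 := div_nonpos_of_nonpos_of_nonneg ht hT.le
    nlinarith
  · set j := ⌊t / T⌋₊ with hjd
    have h1 : (j : ℝ) ≤ t / T := Nat.floor_le (by positivity)
    have h2 : t / T < j + 1 := Nat.lt_floor_add_one _
    have h3 : (j : ℝ) * T ≤ t := by rwa [le_div_iff₀ hT] at h1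
    calc P.real {ω | s + t ≤ W ω} ≤ P.real {ω | s + j * T ≤ W ω} :=
          measureReal_mono fun ω (hω : s + t ≤ W ω) => show s + j * T ≤ W ω by linarith
      _ ≤ 1 / 2 * (1 / 2) ^ j := hj j
      -- The initial factor `1 / 2` pays for rounding `t / T` down.
      _ = Real.exp (-((j : ℝ) + 1) * Real.log 2) := by
          rw [neg_mul, Real.exp_neg, mul_comm ((j : ℝ) + 1), Real.exp_mul, Real.exp_log two_pos]
          rw [Real.rpow_add two_pos, Real.rpow_natCast, Real.rpow_one]
          simp [mul_comm]
      _ ≤ _ := Real.exp_le_exp.2 (by nlinarith)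

end MaxTrick

/-! ### Exponents above `2` force degenerate laws. -/

section Degenerate

variable {Ω : Type*} [MeasurableSpace Ω] {P : Measure Ω} [IsProbabilityMeasure P]

theorem one_add_sq_div_two_le_cosh (x : ℝ) : 1 + x ^ 2 / 2 ≤ Real.cosh x := by
  have h1 : Real.cosh x = 1 + 2 * Real.sinh (x / 2) ^ 2 := by
    have := Real.cosh_two_mul (x / 2)
    rw [Real.cosh_sq, mul_div_cancel₀ _ (two_ne_zero)] at this
    linarith
  have h2 : |x / 2| ≤ |Real.sinh (x / 2)| := by
    rw [Real.abs_sinh]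
    exact Real.self_le_sinh_iff.2 (abs_nonneg _)
  have h3 := sq_le_sq.2 h2
  nlinarith

/-- A crude Young inequality: past the crossover `(lam / κ)^{1/(q-1)}` the power dominates the
linear term. The resulting growth `lam^{q/(q-1)}` is slower than quadratic exactly when `q > 2`. -/
theorem mul_le_rpow_add {q κ lam x : ℝ} (hq : 1 < q) (hκ : 0 < κ) (hlam : 0 < lam) (hx : 0 ≤ x) :
    lam * x ≤ lam * (lam / κ) ^ (1 / (q - 1)) + κ * x ^ q := by
  have hq' : 0 < q - 1 := by linarith
  rcases le_total x ((lam / κ) ^ (1 / (q - 1))) with h | h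
  · have : 0 ≤ κ * x ^ q := by positivity
    nlinarith
  · have hx0 : 0 < x := lt_of_lt_of_le (by positivity) h
    have h1 : lam / κ ≤ x ^ (q - 1) := by
      have := Real.rpow_le_rpow (by positivity) h hq'.le
      rwa [← Real.rpow_mul (by positivity), one_div_mul_cancel hq'.ne', Real.rpow_one] at this
    have h2 : x ^ q = x ^ (q - 1) * x := by
      rw [← Real.rpow_add_one hx0.ne']; congr 1; ring
    rw [div_le_iff₀ hκ] at h1
    have h3 : 0 ≤ lam * (lam / κ) ^ (1 / (q - 1)) := by positivity
    rw [h2]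
    nlinarith

/-- If all normalized sums of independent copies of a variable have uniformly tails
lighter than Gaussian ones, then the variable vanishes. -/
theorem ae_eq_zero_of_expBdd_sums {W : Ω → ℝ} (hW : Measurable W) {q κ B : ℝ} (hq : 2 < q)
    (hκ : 0 < κ)
    (h : ∀ m : ℕ, 0 < m → ExpBdd (Measure.pi fun _ : Fin m => P)
      (fun y => (√m)⁻¹ * ∑ j, W (y j)) q κ B) :
    W =ᵐ[P] 0 := by
  have h1 : ExpBdd P W q κ B := by
    have := h 1 one_pos
    unfold ExpBdd at this ⊢
    simp only [Nat.cast_one, Real.sqrt_one, inv_one, one_mul, Fin.sum_univ_one] at this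
    rwa [(measurePreserving_eval (fun _ : Fin 1 => P) 0).lintegral_comp
      (f := fun ω => ENNReal.ofReal (Real.exp (κ * |W ω| ^ q)))
      (((hW.abs.pow_const q).const_mul _).exp.ennreal_ofReal)] at this
  have hB := h1.one_le hκ.le
  have hq1 : 1 < q := by linarith
  have hexp : ∀ lam : ℝ, Integrable (fun ω => Real.exp (lam * W ω)) P := by
    intro lam
    have hl : 0 < |lam| + 1 := by positivity
    refine ((h1.integrable hW).const_mul
      (Real.exp ((|lam| + 1) * ((|lam| + 1) / κ) ^ (1 / (q - 1))))).mono'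
      ((hW.const_mul lam).exp.aestronglyMeasurable) (Filter.Eventually.of_forall fun ω => ?_)
    rw [Real.norm_of_nonneg (by positivity), ← Real.exp_add]
    refine Real.exp_le_exp.2 (le_trans ?_ (mul_le_rpow_add hq1 hκ hl (abs_nonneg (W ω))))
    calc lam * W ω ≤ |lam| * |W ω| := by rw [← abs_mul]; exact le_abs_self _
      _ ≤ _ := by have := abs_nonneg (W ω); nlinarith
  have hsq : Integrable (fun ω => W ω ^ 2) P := by
    obtain ⟨K, hK, hKx⟩ := exists_pow_le_exp_rpow (by linarith : 0 < q) hκ 2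
    refine ((h1.integrable hW).const_mul K).mono' (hW.pow_const 2).aestronglyMeasurable
      (Filter.Eventually.of_forall fun ω => ?_)
    rw [Real.norm_of_nonneg (by positivity), ← sq_abs]
    exact hKx _ (abs_nonneg _)
  set σ := ∫ ω, W ω ^ 2 ∂P with hσ
  set f : ℝ → ℝ := fun lam => ∫ ω, Real.exp (lam * W ω) ∂P with hf
  have hf0 : ∀ lam, 0 ≤ f lam := fun lam => integral_nonneg fun ω => by positivity
  -- Averaging over the two signs of `lam` removes the odd part, so `W` need not be centred.
  have hcosh : ∀ lam, 1 + lam ^ 2 * σ / 2 ≤ (f lam + f (-lam)) / 2 := by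
    intro lam
    have e1 : (f lam + f (-lam)) / 2 = ∫ ω, Real.cosh (lam * W ω) ∂P := by
      rw [hf, ← integral_add (hexp lam) (hexp (-lam)), ← integral_div]
      simp only [Real.cosh_eq, neg_mul]
    have e2 : 1 + lam ^ 2 * σ / 2 = ∫ ω, (1 + (lam * W ω) ^ 2 / 2) ∂P := by
      rw [integral_add (integrable_const _)]
      · simp only [mul_pow, integral_div, integral_const_mul]; simp [hσ]
      · simp only [mul_pow]; exact (hsq.const_mul _).div_const 2
    rw [e1, e2]
    refine integral_mono ?_ ?_ fun ω => one_add_sq_div_two_le_cosh _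
    · refine (integrable_const _).add ?_
      simp only [mul_pow]; exact (hsq.const_mul _).div_const 2
    · simp only [Real.cosh_eq]
      have := ((hexp lam).add (hexp (-lam))).div_const 2
      simpa [neg_mul] using this
  -- By independence this power is the Laplace transform of the normalized sum of `m` copies; the
  -- bound does not depend on `m`.
  have hpow : ∀ (m : ℕ), 0 < m → ∀ lam : ℝ, f (lam / √m) ^ m ≤
      Real.exp ((|lam| + 1) * ((|lam| + 1) / κ) ^ (1 / (q - 1))) * B := by
    intro m hm lam
    have hVm : Measurable fun y : Fin m → Ω => (√m)⁻¹ * ∑ j, W (y j) :=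
      (Finset.measurable_sum _ fun j _ => hW.comp (measurable_pi_apply j)).const_mul _
    have e1 : f (lam / √m) ^ m = ∫ y, Real.exp (lam * ((√m)⁻¹ * ∑ j, W (y j)))
        ∂(Measure.pi fun _ : Fin m => P) := by
      have := integral_fintype_prod_eq_pow (ι := Fin m) (μ := P)
        (fun ω => Real.exp (lam / √m * W ω))
      rw [Fintype.card_fin] at this
      rw [hf, ← this]
      congr 1
      ext y
      rw [← Real.exp_sum, ← Finset.mul_sum]
      congr 1
      ring
    rw [e1]
    have hi := (h m hm).integrable hVm
    have hl : 0 < |lam| + 1 := by positivity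
    have hle : ∀ y : Fin m → Ω, Real.exp (lam * ((√m)⁻¹ * ∑ j, W (y j))) ≤
        Real.exp ((|lam| + 1) * ((|lam| + 1) / κ) ^ (1 / (q - 1))) *
          Real.exp (κ * |(√m)⁻¹ * ∑ j, W (y j)| ^ q) := by
      intro y
      rw [← Real.exp_add]
      refine Real.exp_le_exp.2 (le_trans ?_ (mul_le_rpow_add hq1 hκ hl
        (abs_nonneg ((√m)⁻¹ * ∑ j, W (y j)))))
      calc lam * ((√m)⁻¹ * ∑ j, W (y j)) ≤ |lam| * |(√m)⁻¹ * ∑ j, W (y j)| := by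
            rw [← abs_mul]; exact le_abs_self _
        _ ≤ _ := by have := abs_nonneg ((√m)⁻¹ * ∑ j, W (y j)); nlinarith
    have hil := hi.const_mul (Real.exp ((|lam| + 1) * ((|lam| + 1) / κ) ^ (1 / (q - 1))))
    refine (integral_mono (hil.mono' (hVm.const_mul lam).exp.aestronglyMeasurable
      (Filter.Eventually.of_forall fun y => ?_)) hil hle).trans ?_
    · rw [Real.norm_of_nonneg (by positivity)]; exact hle y
    · rw [integral_const_mul]
      gcongr
      exact (h m hm).integral_le hκ.le hVm
  have hmain : ∀ lam : ℝ, 0 < lam → lam ^ 2 * σ / 2 ≤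
      (lam + 1) * ((lam + 1) / κ) ^ (1 / (q - 1)) + Real.log B := by
    intro lam hlam
    set R := Real.exp ((lam + 1) * ((lam + 1) / κ) ^ (1 / (q - 1))) * B with hR
    have hR0 : 0 < R := by positivity
    have hm : ∀ m : ℕ, 0 < m → (1 + (lam ^ 2 * σ / 2) / m) ^ m ≤ R := by
      intro m hm
      have hm0 : (0 : ℝ) < m := by exact_mod_cast hm
      have a1 := hcosh (lam / √m)
      have a2 := hpow m hm lam
      have a3 := hpow m hm (-lam)
      rw [abs_of_pos hlam] at a2
      rw [abs_neg, abs_of_pos hlam, neg_div] at a3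
      have a4 : (lam / √m) ^ 2 * σ / 2 = (lam ^ 2 * σ / 2) / m := by
        rw [div_pow, Real.sq_sqrt hm0.le]; ring
      rw [a4] at a1
      have hσ0 : 0 ≤ σ := integral_nonneg fun ω => sq_nonneg _
      -- Convexity of the `m`-th power transfers the bounds at `±lam` to the average appearing in
      -- `hcosh`.
      have a5 := add_pow_le (hf0 (lam / √m)) (hf0 (-(lam / √m))) m
      have a6 : ((f (lam / √m) + f (-(lam / √m))) / 2) ^ m ≤ R := by
        rw [div_pow, div_le_iff₀ (by positivity)]
        have a7 : (2 : ℝ) ^ m = 2 ^ (m - 1) * 2 := by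
          rw [← pow_succ, Nat.sub_add_cancel hm]
        rw [a7]
        have : (0 : ℝ) < 2 ^ (m - 1) := by positivity
        nlinarith
      exact (pow_le_pow_left₀ (by positivity) a1 m).trans a6
    -- The limit of `(1 + a/m)^m` replaces the central limit theorem: the Gaussian growth `exp (lam²
    -- σ / 2)` is bounded by the sub-Gaussian growth in `R`.
    have hlim := le_of_tendsto (Real.tendsto_one_add_div_pow_exp (lam ^ 2 * σ / 2))
      (Filter.eventually_atTop.2 ⟨1, fun m hm1 => hm m hm1⟩)
    have := Real.log_le_log (Real.exp_pos _) hlim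
    rwa [Real.log_exp, hR, Real.log_mul (by positivity) (by positivity), Real.log_exp] at this
  have hσ0 : σ ≤ 0 := by
    set e := 1 / (q - 1) with he
    have he1 : e < 1 := by rw [he, div_lt_one (by linarith)]; linarith
    have he0 : 0 < e := by rw [he]; apply one_div_pos.2; linarith
    -- Since `e < 1`, dividing `hmain` by the square of its parameter leaves a right-hand side
    -- tending to zero.
    have hlim : Filter.Tendsto (fun x : ℝ => 8 * (1 / κ) ^ e * x ^ (-(1 - e)) +
        2 * Real.log B * x ^ (-(2 : ℝ))) Filter.atTop (nhds (8 * (1 / κ) ^ e * 0 +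
          2 * Real.log B * 0)) :=
      ((tendsto_rpow_neg_atTop (by linarith)).const_mul _).add
        ((tendsto_rpow_neg_atTop two_pos).const_mul _)
    simp only [mul_zero, add_zero] at hlim
    refine ge_of_tendsto hlim (Filter.eventually_atTop.2 ⟨1, fun x hx => ?_⟩)
    have hx0 : 0 < x := by linarith
    have b1 := hmain x hx0
    have b2 : (x + 1) * ((x + 1) / κ) ^ e ≤ (2 * x) * (2 ^ e * x ^ e * (1 / κ) ^ e) := by
      rw [← Real.mul_rpow two_pos.le hx0.le, ← Real.mul_rpow (by positivity) (by positivity)]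
      gcongr
      · linarith
      · rw [div_eq_mul_one_div]; gcongr; linarith
    have b3 : (2 : ℝ) ^ e ≤ 2 := by
      calc (2 : ℝ) ^ e ≤ 2 ^ (1 : ℝ) := Real.rpow_le_rpow_of_exponent_le (by norm_num) he1.le
        _ = 2 := by simp
    have b4 : x ^ (-(1 - e)) * x ^ 2 = x * x ^ e := by
      rw [← Real.rpow_natCast, ← Real.rpow_add hx0]
      have : -(1 - e) + ((2 : ℕ) : ℝ) = 1 + e := by push_cast; ring
      rw [this, Real.rpow_add hx0, Real.rpow_one]
    have b5 : x ^ (-(2 : ℝ)) * x ^ 2 = 1 := by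
      rw [← Real.rpow_natCast, ← Real.rpow_add hx0]; norm_num
    refine le_of_mul_le_mul_right ?_ (by positivity : 0 < x ^ 2)
    calc σ * x ^ 2 = 2 * (x ^ 2 * σ / 2) := by ring
      _ ≤ 2 * ((2 * x) * (2 * x ^ e * (1 / κ) ^ e) + Real.log B) := by
          refine mul_le_mul_of_nonneg_left (b1.trans (add_le_add_left (b2.trans ?_) _))
            two_pos.le
          gcongr
      _ = 8 * (1 / κ) ^ e * (x * x ^ e) + 2 * Real.log B * 1 := by ring
      _ = _ := by rw [← b4, ← b5]; ring
  have hσz : ∫ ω, W ω ^ 2 ∂P = 0 := le_antisymm hσ0 (integral_nonneg fun ω => sq_nonneg _)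
  have := (integral_eq_zero_iff_of_nonneg (fun ω => sq_nonneg (W ω)) hsq).1 hσz
  filter_upwards [this] with ω hω
  simpa using hω

end Degenerate

/-! ### What convex concentration says about a single law and its powers. -/

section Laws

open scoped RealInnerProductSpace

variable {p : ℕ}

/-- Quasiconvex functions of `m` vectors, `1`-Lipschitz for the Frobenius norm. -/
structure QLip {m : ℕ} (h : (Fin m → EuclideanSpace ℝ (Fin p)) → ℝ) : Prop where
  convex : ∀ r, Convex ℝ {Y | h Y ≤ r}
  lip : ∀ Y Y', |h Y - h Y'| ≤ √(∑ j, ‖Y j - Y' j‖ ^ 2)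

theorem QLip.continuous {m : ℕ} {h : (Fin m → EuclideanSpace ℝ (Fin p)) → ℝ} (hh : QLip h) :
    Continuous h := by
  refine continuous_iff_continuousAt.2 fun Y => ?_
  have h1 : Continuous fun Y' : Fin m → EuclideanSpace ℝ (Fin p) =>
      √(∑ j, ‖Y' j - Y j‖ ^ 2) := by fun_prop
  have h2 := h1.tendsto Y
  simp only [sub_self, norm_zero, ne_eq, OfNat.ofNat_ne_zero, not_false_eq_true, zero_pow,
    Finset.sum_const_zero, Real.sqrt_zero] at h2
  rw [ContinuousAt, tendsto_iff_norm_sub_tendsto_zero]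
  exact squeeze_zero (fun _ => norm_nonneg _) (fun Y' => hh.lip Y' Y) h2

open scoped Matrix.Norms.Frobenius in
theorem LawConvexlyConcentrated.concentrated {μ : Measure (EuclideanSpace ℝ (Fin p))} {α : ℝ → ℝ}
    (hμ : LawConvexlyConcentrated μ α) {m : ℕ} {h : (Fin m → EuclideanSpace ℝ (Fin p)) → ℝ}
    (hh : QLip h) : Concentrated (Measure.pi fun _ : Fin m => μ) h α := by
  set g : Matrix (Fin p) (Fin m) ℝ → (Fin m → EuclideanSpace ℝ (Fin p)) :=
    fun A j => WithLp.toLp 2 fun i => A i j with hg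
  refine hμ m (fun A => h (g A)) ?_ ?_
  · refine LipschitzWith.of_dist_le_mul fun A A' => ?_
    rw [Real.dist_eq, NNReal.coe_one, one_mul, dist_eq_norm, Matrix.frobenius_norm_def]
    refine (hh.lip _ _).trans (le_of_eq ?_)
    rw [Real.sqrt_eq_rpow]
    congr 1
    simp only [EuclideanSpace.norm_sq_eq]
    rw [Finset.sum_comm]
    exact Finset.sum_congr rfl fun i _ => Finset.sum_congr rfl fun j _ => by
      simp [hg]
  · intro r A hA A' hA' a b ha hb hab
    refine ⟨trivial, ?_⟩
    have h1 : g (a • A + b • A') = a • g A + b • g A' := by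
      ext j i
      simp [hg]
    change h (g (a • A + b • A')) ≤ r
    rw [h1]
    exact hh.convex r hA.2 hA'.2 ha hb hab

/-- The consequences of convex concentration used below. -/
structure LawReg (μ : Measure (EuclideanSpace ℝ (Fin p))) (q r κ B : ℝ) : Prop where
  prob : IsProbabilityMeasure μ
  lin : ∀ b : EuclideanSpace ℝ (Fin p), ‖b‖ ≤ 1 →
    ExpBdd μ (fun y => ⟪b, y - ∫ y, y ∂μ⟫) r κ B
  sum : ∀ (m : ℕ), 0 < m → ∀ b : EuclideanSpace ℝ (Fin p), ‖b‖ ≤ 1 →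
    ExpBdd (Measure.pi fun _ : Fin m => μ)
      (fun Y => (√m)⁻¹ * ∑ j, ⟪b, Y j - ∫ y, y ∂μ⟫) q κ B
  conv : ∀ (m : ℕ) (h : (Fin m → EuclideanSpace ℝ (Fin p)) → ℝ), QLip h →
    ∃ Y₀, ExpBdd (Measure.pi fun _ : Fin m => μ) (fun Y => h Y - h Y₀) q κ B

theorem sum_norm_le_sqrt_mul_sqrt {m : ℕ} {F : Type*} [SeminormedAddCommGroup F] (d : Fin m → F) :
    ∑ j, ‖d j‖ ≤ √m * √(∑ j, ‖d j‖ ^ 2) := by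
  rw [← Real.sqrt_mul (Nat.cast_nonneg m)]
  refine Real.le_sqrt_of_sq_le ?_
  have := sq_sum_le_card_mul_sum_sq (s := Finset.univ) (f := fun j => ‖d j‖)
  simpa using this

/-- Normalized sums of a linear form. -/
theorem qLip_sum_inner {b : EuclideanSpace ℝ (Fin p)} (hb : ‖b‖ ≤ 1) (m : ℕ) :
    QLip fun Y : Fin m → EuclideanSpace ℝ (Fin p) => (√m)⁻¹ * ∑ j, ⟪b, Y j⟫ := by
  constructor
  · intro r Y hY Y' hY' a c ha hc hac
    simp only [Set.mem_ofPred_eq, Pi.add_apply, Pi.smul_apply, inner_add_right,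
      real_inner_smul_right, Finset.sum_add_distrib, ← Finset.mul_sum] at *
    have : r = a * r + c * r := by rw [← add_mul, hac, one_mul]
    rw [this]
    nlinarith
  · intro Y Y'
    rw [← mul_sub, ← Finset.sum_sub_distrib, abs_mul, abs_of_nonneg (by positivity)]
    rcases Nat.eq_zero_or_pos m with h0 | h0
    · subst h0; simp
    have hm : (0 : ℝ) < √m := Real.sqrt_pos.2 (by exact_mod_cast h0)
    rw [inv_mul_le_iff₀ hm]
    refine le_trans ?_ (sum_norm_le_sqrt_mul_sqrt fun j => Y j - Y' j)
    refine (Finset.abs_sum_le_sum_abs _ _).trans (Finset.sum_le_sum fun j _ => ?_)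
    rw [← inner_sub_right]
    calc |⟪b, Y j - Y' j⟫| ≤ ‖b‖ * ‖Y j - Y' j‖ := abs_real_inner_le_norm _ _
      _ ≤ 1 * ‖Y j - Y' j‖ := by gcongr
      _ = _ := one_mul _

/-- Sublevel sets of a maximum are intersections of half-spaces, and the Lipschitz constant does not
grow with the number of columns. This is the function fed to `measureReal_tail_halving`. -/
theorem qLip_max_inner {b : EuclideanSpace ℝ (Fin p)} (hb : ‖b‖ ≤ 1) (m : ℕ) :
    QLip fun Y : Fin (m + 1) → EuclideanSpace ℝ (Fin p) =>
      Finset.univ.sup' Finset.univ_nonempty (fun j : Fin (m + 1) => ⟪b, Y j⟫) := by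
  constructor
  · intro r Y hY Y' hY' a c ha hc hac
    simp only [Set.mem_ofPred_eq, Finset.sup'_le_iff, Finset.mem_univ, true_implies, Pi.add_apply,
      Pi.smul_apply, inner_add_right, real_inner_smul_right] at *
    intro j
    have h1 := hY j
    have h2 := hY' j
    have : r = a * r + c * r := by rw [← add_mul, hac, one_mul]
    rw [this]
    nlinarith
  · have key : ∀ Y Y' : Fin (m + 1) → EuclideanSpace ℝ (Fin p),
        Finset.univ.sup' Finset.univ_nonempty (fun j : Fin (m + 1) => ⟪b, Y j⟫) -
        Finset.univ.sup' Finset.univ_nonempty (fun j : Fin (m + 1) => ⟪b, Y' j⟫) ≤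
          √(∑ j, ‖Y j - Y' j‖ ^ 2) := by
      intro Y Y'
      rw [sub_le_iff_le_add, Finset.sup'_le_iff]
      intro j _
      have h1 : ⟪b, Y' j⟫ ≤ Finset.univ.sup' Finset.univ_nonempty
          (fun j : Fin (m + 1) => ⟪b, Y' j⟫) :=
        Finset.le_sup' (fun j : Fin (m + 1) => ⟪b, Y' j⟫) (Finset.mem_univ j)
      have h2 : ⟪b, Y j⟫ - ⟪b, Y' j⟫ ≤ ‖Y j - Y' j‖ := by
        rw [← inner_sub_right]
        calc ⟪b, Y j - Y' j⟫ ≤ ‖b‖ * ‖Y j - Y' j‖ := real_inner_le_norm _ _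
          _ ≤ 1 * ‖Y j - Y' j‖ := by gcongr
          _ = _ := one_mul _
      have h3 : ‖Y j - Y' j‖ ≤ √(∑ j, ‖Y j - Y' j‖ ^ 2) := by
        refine Real.le_sqrt_of_sq_le ?_
        exact Finset.single_le_sum (f := fun j => ‖Y j - Y' j‖ ^ 2) (fun _ _ => sq_nonneg _)
          (Finset.mem_univ j)
      linarith
    intro Y Y'
    rw [abs_le]
    refine ⟨?_, key Y Y'⟩
    have := key Y' Y
    simp only [norm_sub_rev (Y' _)] at this
    linarith

theorem integrable_of_inner {μ : Measure (EuclideanSpace ℝ (Fin p))}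
    (h : ∀ b : EuclideanSpace ℝ (Fin p), ‖b‖ ≤ 1 → Integrable (fun y => ⟪b, y⟫) μ) :
    Integrable (fun y => y) μ := by
  have h1 : Integrable (fun y : EuclideanSpace ℝ (Fin p) =>
      ∑ i, ⟪EuclideanSpace.basisFun (Fin p) ℝ i, y⟫ • EuclideanSpace.basisFun (Fin p) ℝ i) μ :=
    integrable_finsetSum _ fun i _ =>
      (h _ ((EuclideanSpace.basisFun (Fin p) ℝ).orthonormal.1 i).le).smul_const _
  refine h1.congr (Filter.Eventually.of_forall fun y => ?_)
  exact (EuclideanSpace.basisFun (Fin p) ℝ).sum_repr' y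

/-- Convex concentration gives exponential moments around some value. -/
theorem LawConvexlyConcentrated.exists_expBdd {μ : Measure (EuclideanSpace ℝ (Fin p))}
    [IsProbabilityMeasure μ] {C c q : ℝ} (hq : 0 < q) (hc : 0 < c) (hC : 0 ≤ C)
    (hμ : LawConvexlyConcentrated μ fun t => C * Real.exp (-(t ^ q) / c)) (m : ℕ)
    (h : (Fin m → EuclideanSpace ℝ (Fin p)) → ℝ) (hh : QLip h) :
    ∃ Y₀, ExpBdd (Measure.pi fun _ : Fin m => μ) (fun Y => h Y - h Y₀) q (1 / (2 * c)) (1 + C) :=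
  (hμ.concentrated hh).exists_expBdd hh.continuous.measurable hq hc hC

/-- Concentration gives some pivot, which `ExpBdd.center` replaces by the mean; linearity identifies
that mean through the mean vector. The bound is uniform in `m` because of the factor `1/√m`, and
this uniformity is what fails for nondegenerate laws when `q > 2`. -/
theorem exists_expBdd_inner {C c q : ℝ} (hq : 0 < q) (hc : 0 < c) (hC : 0 ≤ C) :
    ∃ κ B : ℝ, 0 < κ ∧ ∀ {p : ℕ} (μ : Measure (EuclideanSpace ℝ (Fin p)))
      [IsProbabilityMeasure μ],
      (LawConvexlyConcentrated μ fun t => C * Real.exp (-(t ^ q) / c)) →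
      Integrable (fun y => y) μ ∧
      ∀ (m : ℕ), 0 < m → ∀ (b : EuclideanSpace ℝ (Fin p)), ‖b‖ ≤ 1 →
        ExpBdd (Measure.pi fun _ : Fin m => μ)
          (fun Y => (√m)⁻¹ * ∑ j, ⟪b, Y j - ∫ y, y ∂μ⟫) q κ B := by
  obtain ⟨κ, B, hκ, h⟩ := ExpBdd.center (q := q) (κ := 1 / (2 * c)) (1 + C) hq (by positivity)
  refine ⟨κ, B, hκ, fun {p} μ _ hμ => ?_⟩
  have hlaw : ∀ m (b : EuclideanSpace ℝ (Fin p)), ‖b‖ ≤ 1 →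
      Integrable (fun Y : Fin m → EuclideanSpace ℝ (Fin p) => (√m)⁻¹ * ∑ j, ⟪b, Y j⟫)
        (Measure.pi fun _ : Fin m => μ) ∧
      ExpBdd (Measure.pi fun _ : Fin m => μ) (fun Y => (√m)⁻¹ * ∑ j, ⟪b, Y j⟫ -
        ∫ Y : Fin m → EuclideanSpace ℝ (Fin p), (√m)⁻¹ * ∑ j, ⟪b, Y j⟫
          ∂(Measure.pi fun _ : Fin m => μ)) q κ B := by
    intro m b hb
    obtain ⟨Y₀, hY⟩ := hμ.exists_expBdd hq hc hC m _ (qLip_sum_inner hb m)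
    exact h _ _ _ (qLip_sum_inner hb m).continuous.measurable hY
  have hbi : ∀ b : EuclideanSpace ℝ (Fin p), ‖b‖ ≤ 1 → Integrable (fun y => ⟪b, y⟫) μ := by
    intro b hb
    have h1 := (hlaw 1 b hb).1
    simp only [Nat.cast_one, Real.sqrt_one, inv_one, one_mul, Fin.sum_univ_one] at h1
    have hmp := measurePreserving_eval (fun _ : Fin 1 => μ) 0
    exact (hmp.integrable_comp (by fun_prop : Continuous fun y : EuclideanSpace ℝ (Fin p) =>
      ⟪b, y⟫).aestronglyMeasurable).1 h1
  have hi := integrable_of_inner hbi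
  refine ⟨hi, fun m hm b hb => ?_⟩
  obtain ⟨-, h2⟩ := hlaw m b hb
  convert h2 using 2 with Y
  have hmp := fun j => measurePreserving_eval (fun _ : Fin m => μ) j
  have hint : ∀ j : Fin m, ∫ Y : Fin m → EuclideanSpace ℝ (Fin p), ⟪b, Y j⟫
      ∂(Measure.pi fun _ : Fin m => μ) = ⟪b, ∫ y, y ∂μ⟫ := by
    intro j
    rw [← integral_inner hi]
    exact (hmp j).integral_comp_measurable (g := fun y => ⟪b, y⟫)
      (by fun_prop : Continuous fun y : EuclideanSpace ℝ (Fin p) => ⟪b, y⟫).measurable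
  rw [integral_const_mul, integral_finsetSum]
  · simp only [hint, inner_sub_right, Finset.sum_sub_distrib]
    ring
  · intro j _
    exact ((hmp j).integrable_comp (by fun_prop : Continuous fun y : EuclideanSpace ℝ (Fin p) =>
      ⟪b, y⟫).aestronglyMeasurable).2 (hbi b hb)

theorem expBdd_of_pi_one {μ : Measure (EuclideanSpace ℝ (Fin p))} [IsProbabilityMeasure μ]
    {b m : EuclideanSpace ℝ (Fin p)} {q κ B : ℝ}
    (h : ExpBdd (Measure.pi fun _ : Fin 1 => μ)
      (fun Y => (√(1 : ℕ))⁻¹ * ∑ j, ⟪b, Y j - m⟫) q κ B) :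
    ExpBdd μ (fun y => ⟪b, y - m⟫) q κ B := by
  unfold ExpBdd at h ⊢
  simp only [Nat.cast_one, Real.sqrt_one, inv_one, one_mul, Fin.sum_univ_one] at h
  have hm : Measurable fun y : EuclideanSpace ℝ (Fin p) => ⟪b, y - m⟫ :=
    (by fun_prop : Continuous fun y : EuclideanSpace ℝ (Fin p) => ⟪b, y - m⟫).measurable
  rwa [(measurePreserving_eval (fun _ : Fin 1 => μ) 0).lintegral_comp
    (f := fun y : EuclideanSpace ℝ (Fin p) => ENNReal.ofReal (Real.exp (κ * |⟪b, y - m⟫| ^ q)))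
    (((hm.abs.pow_const q).const_mul _).exp.ennreal_ofReal)] at h

theorem exists_mul_exp_le {q c : ℝ} (C ε : ℝ) (hq : 0 < q) (hc : 0 < c) (hC : 0 < C)
    (hε : 0 < ε) : ∃ T : ℝ, 0 < T ∧ C * Real.exp (-(T ^ q) / c) ≤ ε := by
  refine ⟨(c * (|Real.log (C / ε)| + 1)) ^ (1 / q), by positivity, ?_⟩
  rw [← Real.rpow_mul (by positivity), one_div_mul_cancel hq.ne', Real.rpow_one, ← le_div_iff₀' hC]
  rw [← Real.le_log_iff_exp_le (by positivity)]
  have h1 : -(c * (|Real.log (C / ε)| + 1)) / c = -(|Real.log (C / ε)| + 1) := by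
    field_simp
  have h2 : Real.log (ε / C) = -Real.log (C / ε) := by rw [← Real.log_inv, inv_div]
  rw [h1, h2]
  have := le_abs_self (Real.log (C / ε))
  linarith

/-- Linear forms have exponential moments as soon as convex concentration holds for some
exponent. -/
theorem exists_expBdd_inner_one {C c q : ℝ} (hq : 0 < q) (hc : 0 < c) (hC : 0 < C) :
    ∃ κ B : ℝ, 0 < κ ∧ ∀ {p : ℕ} (μ : Measure (EuclideanSpace ℝ (Fin p)))
      [IsProbabilityMeasure μ],
      (LawConvexlyConcentrated μ fun t => C * Real.exp (-(t ^ q) / c)) →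
      ∀ (b : EuclideanSpace ℝ (Fin p)), ‖b‖ ≤ 1 →
        ExpBdd μ (fun y => ⟪b, y - ∫ y, y ∂μ⟫) 1 κ B := by
  obtain ⟨κ, B, hκ, h⟩ := exists_expBdd_inner hq hc hC.le
  -- `T` is the fluctuation allowed to maxima in the halving argument. `T₁` is a distance from the
  -- mean at which the tail has fallen to `1 / 2`, where halving can start.
  obtain ⟨T, hT, hTe⟩ := exists_mul_exp_le C (Real.exp (-3) / 3) hq hc hC (by positivity)
  obtain ⟨T₁, hT₁, hTe₁⟩ := exists_mul_exp_le (max B 1) (1 / 2) hq (inv_pos.2 hκ) (by positivity)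
    (by norm_num)
  have hlog : 0 < Real.log 2 := Real.log_pos (by norm_num)
  set L := Real.log 2 / T with hL
  have hL0 : 0 < L := by positivity
  refine ⟨_, _, ?_, fun {p} μ _ hμ b hb => ExpBdd.of_tail (c := 1 / L)
    (C := 2 * Real.exp (T₁ * L)) ?_ one_pos (by positivity) (by positivity) ?_⟩
  · positivity
  · exact (by fun_prop : Continuous fun y : EuclideanSpace ℝ (Fin p) =>
      ⟪b, y - ∫ y, y ∂μ⟫).measurable
  have hone : ∀ b : EuclideanSpace ℝ (Fin p), ‖b‖ ≤ 1 → ∀ t,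
      μ.real {y | t ≤ ⟪b, y - ∫ y, y ∂μ⟫} ≤ Real.exp (T₁ * L) * Real.exp (-(t * L)) := by
    intro b hb t
    have hWm : Measurable fun y : EuclideanSpace ℝ (Fin p) => ⟪b, y⟫ :=
      (by fun_prop : Continuous fun y : EuclideanSpace ℝ (Fin p) => ⟪b, y⟫).measurable
    have hmax : ∀ m : ℕ, ((Measure.pi fun _ : Fin (m + 1) => μ).prod (Measure.pi fun _ => μ))
      {w | T ≤ |Finset.univ.sup' Finset.univ_nonempty (fun j : Fin (m + 1) => ⟪b, w.1 j⟫) -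
        Finset.univ.sup' Finset.univ_nonempty (fun j : Fin (m + 1) => ⟪b, w.2 j⟫)|} ≤
          ENNReal.ofReal (Real.exp (-3) / 3) := fun m =>
      (hμ.concentrated (qLip_max_inner hb m) T hT).trans (ENNReal.ofReal_le_ofReal hTe)
    have hstart : μ.real {y | ⟪b, ∫ y, y ∂μ⟫ + T₁ ≤ ⟪b, y⟫} ≤ 1 / 2 := by
      have h1 := expBdd_of_pi_one ((h μ hμ).2 1 one_pos b hb)
      have h2 := h1.tail (by fun_prop : Continuous fun y : EuclideanSpace ℝ (Fin p) =>
        ⟪b, y - ∫ y, y ∂μ⟫).measurable hq hκ hT₁.le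
      refine ENNReal.toReal_le_of_le_ofReal (by norm_num) ((measure_mono ?_).trans
        (h2.trans (ENNReal.ofReal_le_ofReal ?_)))
      · intro y hy
        simp only [Set.mem_ofPred_eq, inner_sub_right] at hy ⊢
        exact le_trans (by linarith) (le_abs_self _)
      · refine le_trans ?_ hTe₁
        rw [neg_div, div_inv_eq_mul, mul_comm κ]
        gcongr
        exact le_max_left _ _
    have h3 := measureReal_tail_exp hT (fun s' => measureReal_tail_halving hWm hmax) hstart
      (t - T₁)
    refine (measureReal_mono ?_).trans (h3.trans (le_of_eq ?_))
    · intro y hy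
      simp only [Set.mem_ofPred_eq, inner_sub_right] at hy ⊢
      linarith
    · rw [← Real.exp_add, hL]
      congr 1
      ring
  intro t _
  rw [Real.rpow_one]
  have e1 : -t / (1 / L) = -(t * L) := by rw [one_div, div_inv_eq_mul]; ring
  have h4 := hone b hb t
  have h5 := hone (-b) (by rwa [norm_neg]) t
  have h6 : {y : EuclideanSpace ℝ (Fin p) | t ≤ |⟪b, y - ∫ y, y ∂μ⟫|} ⊆
      {y | t ≤ ⟪b, y - ∫ y, y ∂μ⟫} ∪ {y | t ≤ ⟪-b, y - ∫ y, y ∂μ⟫} := by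
    intro y hy
    simp only [inner_neg_left]
    have hy' : t ≤ |⟪b, y - ∫ y, y ∂μ⟫| := hy
    exact le_abs.1 hy'
  rw [← ofReal_measureReal]
  refine ENNReal.ofReal_le_ofReal ((measureReal_mono h6).trans
    ((measureReal_union_le _ _).trans ?_))
  rw [e1]
  linarith

/-- For `q ≥ 1` the moments of linear forms are the case `m = 1` of normalized sums; for `q < 1`
they have order one and come from maxima. Hence the exponent `max q 1`, while seminorms and sums
retain the exponent `q`. -/
theorem exists_lawReg {C c q : ℝ} (hq : 0 < q) (hc : 0 < c) (hC : 0 < C) :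
    ∃ κ B : ℝ, 0 < κ ∧ ∀ {p : ℕ} (μ : Measure (EuclideanSpace ℝ (Fin p)))
      [IsProbabilityMeasure μ],
      (LawConvexlyConcentrated μ fun t => C * Real.exp (-(t ^ q) / c)) →
      LawReg μ q (max q 1) κ B := by
  obtain ⟨κ₁, B₁, hκ₁, h₁⟩ := exists_expBdd_inner hq hc hC.le
  obtain ⟨κ₂, B₂, hκ₂, h₂⟩ := exists_expBdd_inner_one hq hc hC
  refine ⟨min (1 / (2 * c)) (min κ₁ κ₂), max (1 + C) (max B₁ B₂), by positivity,
    fun {p} μ hP hμ => ⟨hP, fun b hb => ?_, fun m hm b hb => ?_, fun m h hh => ?_⟩⟩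
  · rcases le_total q 1 with h | h
    · rw [max_eq_right h]
      exact (h₂ μ hμ b hb).mono ((min_le_right _ _).trans (min_le_right _ _))
        ((le_max_right _ _).trans (le_max_right _ _))
    · rw [max_eq_left h]
      exact (expBdd_of_pi_one ((h₁ μ hμ).2 1 one_pos b hb)).mono
        ((min_le_right _ _).trans (min_le_left _ _))
        ((le_max_left _ _).trans (le_max_right _ _))
  · exact ((h₁ μ hμ).2 m hm b hb).mono ((min_le_right _ _).trans (min_le_left _ _))
      ((le_max_left _ _).trans (le_max_right _ _))
  · obtain ⟨Y₀, hY⟩ := hμ.exists_expBdd hq hc hC.le m h hh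
    exact ⟨Y₀, hY.mono (min_le_left _ _) (le_max_left _ _)⟩

/-- For exponents larger than `2`, convex concentration of all product measures forces the law
to be a Dirac mass. -/
theorem LawConvexlyConcentrated.ae_eq_mean {μ : Measure (EuclideanSpace ℝ (Fin p))}
    [IsProbabilityMeasure μ] {C c q : ℝ} (hq : 2 < q) (hc : 0 < c) (hC : 0 < C)
    (hμ : LawConvexlyConcentrated μ fun t => C * Real.exp (-(t ^ q) / c)) :
    ∀ᵐ y ∂μ, y = ∫ y, y ∂μ := by
  obtain ⟨κ, B, hκ, h⟩ := exists_expBdd_inner (q := q) (by linarith) hc hC.le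
  have h1 : ∀ i : Fin p, ∀ᵐ y ∂μ, ⟪EuclideanSpace.basisFun (Fin p) ℝ i, y - ∫ y, y ∂μ⟫ = 0 := by
    intro i
    refine ae_eq_zero_of_expBdd_sums
      (W := fun y => ⟪EuclideanSpace.basisFun (Fin p) ℝ i, y - ∫ y, y ∂μ⟫) ?_ hq hκ
      fun m hm => (h μ hμ).2 m hm _ ((EuclideanSpace.basisFun (Fin p) ℝ).orthonormal.1 i).le
    exact Continuous.measurable (by fun_prop)
  filter_upwards [ae_all_iff.2 h1] with y hy
  rw [← sub_eq_zero, ← (EuclideanSpace.basisFun (Fin p) ℝ).sum_repr' (y - ∫ y, y ∂μ)]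
  exact Finset.sum_eq_zero fun i _ => by rw [hy i, zero_smul]

/-- Large exponents may be lowered to `2`. -/
theorem LawConvexlyConcentrated.lower {μ : Measure (EuclideanSpace ℝ (Fin p))} {C c q : ℝ}
    (hq : 2 ≤ q) (hc : 0 < c) (hC : 0 < C)
    (hμ : LawConvexlyConcentrated μ fun t => C * Real.exp (-(t ^ q) / c)) :
    LawConvexlyConcentrated μ fun t => (C * Real.exp (1 / c)) * Real.exp (-(t ^ (2 : ℝ)) / c) := by
  intro m f hf hf' t ht
  refine (hμ m f hf hf' t ht).trans (ENNReal.ofReal_le_ofReal ?_)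
  change C * Real.exp (-(t ^ q) / c) ≤ C * Real.exp (1 / c) * Real.exp (-(t ^ (2 : ℝ)) / c)
  rw [mul_assoc, ← Real.exp_add, ← add_div]
  gcongr
  rcases le_total t 1 with h | h
  · have h1 : t ^ (2 : ℝ) ≤ 1 := Real.rpow_le_one ht.le h two_pos.le
    have h2 : 0 ≤ t ^ q := by positivity
    linarith
  · have := Real.rpow_le_rpow_of_exponent_le h hq
    linarith

end Laws

/-! ### Laplace transforms of one bounded variable. -/

section MgfBounds

variable {Ω : Type*} [MeasurableSpace Ω] {P : Measure Ω} [IsProbabilityMeasure P]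

theorem exp_le_one_add_add (x : ℝ) : Real.exp x ≤ 1 + x + x ^ 2 * Real.exp |x| := by
  have h := Complex.norm_exp_sub_sum_le_norm_mul_exp (x : ℂ) 2
  have h2 : Complex.exp x - ∑ m ∈ Finset.range 2, (x : ℂ) ^ m / (m.factorial : ℂ) =
      ((Real.exp x - (1 + x) : ℝ) : ℂ) := by
    simp [Finset.sum_range_succ, Complex.ofReal_exp]
  rw [h2, Complex.norm_real, Complex.norm_real, Real.norm_eq_abs, Real.norm_eq_abs, sq_abs] at h
  have := le_abs_self (Real.exp x - (1 + x))
  linarith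

/-- Second-order expansion: the first-order term cancels against the mean. It is sharp when the
exponent is of bounded size. -/
theorem integral_exp_sub_le_exp_sq {Y : Ω → ℝ} (hY : Measurable Y) {b : ℝ}
    (hb : ∀ ω, |Y ω| ≤ b) (lam : ℝ) :
    ∫ ω, Real.exp (lam * (Y ω - ∫ ω, Y ω ∂P)) ∂P ≤
      Real.exp (lam ^ 2 * ∫ ω, Y ω ^ 2 * Real.exp (|lam| * |Y ω|) ∂P) := by
  have hYi : Integrable Y P := integrable_of_abs_le hY hb
  have hm2 : Measurable fun ω => Y ω ^ 2 * Real.exp (|lam| * |Y ω|) :=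
    (hY.pow_const 2).mul ((hY.abs.const_mul _).exp)
  have hi2 : Integrable (fun ω => Y ω ^ 2 * Real.exp (|lam| * |Y ω|)) P := by
    refine integrable_of_abs_le (B := b ^ 2 * Real.exp (|lam| * b)) hm2 fun ω => ?_
    rw [abs_of_nonneg (by positivity), ← sq_abs]
    have := hb ω
    gcongr
  have hie : Integrable (fun ω => Real.exp (lam * Y ω)) P := by
    refine integrable_of_abs_le (B := Real.exp (|lam| * b)) (hY.const_mul lam).exp fun ω => ?_
    rw [abs_of_pos (Real.exp_pos _), Real.exp_le_exp]
    calc lam * Y ω ≤ |lam * Y ω| := le_abs_self _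
      _ = |lam| * |Y ω| := abs_mul _ _
      _ ≤ _ := by have := hb ω; gcongr
  have hi1 : Integrable (fun ω => 1 + lam * Y ω) P := (integrable_const _).add (hYi.const_mul _)
  have h1 : ∫ ω, Real.exp (lam * Y ω) ∂P ≤
      1 + lam * ∫ ω, Y ω ∂P + lam ^ 2 * ∫ ω, Y ω ^ 2 * Real.exp (|lam| * |Y ω|) ∂P := by
    have h2 : ∫ ω, (1 + lam * Y ω + lam ^ 2 * (Y ω ^ 2 * Real.exp (|lam| * |Y ω|))) ∂P =
        1 + lam * ∫ ω, Y ω ∂P + lam ^ 2 * ∫ ω, Y ω ^ 2 * Real.exp (|lam| * |Y ω|) ∂P := by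
      rw [integral_add hi1 (hi2.const_mul _),
        integral_add (integrable_const _) (hYi.const_mul _), integral_const_mul,
        integral_const_mul]
      simp
    rw [← h2]
    refine integral_mono hie (hi1.add (hi2.const_mul _)) fun ω => ?_
    have := exp_le_one_add_add (lam * Y ω)
    rw [abs_mul, mul_pow] at this
    linarith
  have h3 : ∀ ω, Real.exp (lam * (Y ω - ∫ ω, Y ω ∂P)) =
      Real.exp (lam * Y ω) * Real.exp (-(lam * ∫ ω, Y ω ∂P)) := by
    intro ω; rw [← Real.exp_add]; congr 1; ring
  simp only [h3]
  rw [integral_mul_const]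
  calc _ ≤ Real.exp (lam * ∫ ω, Y ω ∂P + lam ^ 2 * ∫ ω, Y ω ^ 2 * Real.exp (|lam| * |Y ω|) ∂P) *
        Real.exp (-(lam * ∫ ω, Y ω ∂P)) := by
        gcongr
        have := Real.add_one_le_exp
          (lam * ∫ ω, Y ω ∂P + lam ^ 2 * ∫ ω, Y ω ^ 2 * Real.exp (|lam| * |Y ω|) ∂P)
        linarith
    _ = _ := by rw [← Real.exp_add]; congr 1; ring

/-- No cancellation is used: the factor from the mean is bounded by Jensen's inequality, which
produces the square. This suffices when the exponent allowed is bounded below by a constant. -/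
theorem integral_exp_sub_le_sq {Y : Ω → ℝ} (hY : Measurable Y) {b : ℝ}
    (hb : ∀ ω, |Y ω| ≤ b) (lam : ℝ) :
    ∫ ω, Real.exp (lam * (Y ω - ∫ ω, Y ω ∂P)) ∂P ≤ (∫ ω, Real.exp (|lam| * |Y ω|) ∂P) ^ 2 := by
  have hie : Integrable (fun ω => Real.exp (|lam| * |Y ω|)) P := by
    refine integrable_of_abs_le (B := Real.exp (|lam| * b)) (hY.abs.const_mul _).exp fun ω => ?_
    rw [abs_of_pos (Real.exp_pos _), Real.exp_le_exp]
    have := hb ω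
    gcongr
  have hle : ∀ ω, Real.exp (lam * Y ω) ≤ Real.exp (|lam| * |Y ω|) := fun ω => by
    rw [Real.exp_le_exp, ← abs_mul]; exact le_abs_self _
  have hie2 : Integrable (fun ω => Real.exp (lam * Y ω)) P :=
    hie.mono' ((hY.const_mul lam).exp.aestronglyMeasurable)
      (Filter.Eventually.of_forall fun ω => by
        rw [Real.norm_of_nonneg (by positivity)]; exact hle ω)
  have hYi : Integrable Y P := integrable_of_abs_le hY hb
  have hj : Real.exp (∫ ω, |lam| * |Y ω| ∂P) ≤ ∫ ω, Real.exp (|lam| * |Y ω|) ∂P :=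
    convexOn_exp.map_integral_le (s := Set.univ) (f := fun ω => |lam| * |Y ω|)
      Real.continuous_exp.continuousOn isClosed_univ
      (Filter.Eventually.of_forall fun _ => Set.mem_univ _) (hYi.abs.const_mul _) hie
  have hj2 : Real.exp (-(lam * ∫ ω, Y ω ∂P)) ≤ ∫ ω, Real.exp (|lam| * |Y ω|) ∂P := by
    refine le_trans (Real.exp_le_exp.2 ?_) hj
    rw [integral_const_mul]
    calc -(lam * ∫ ω, Y ω ∂P) ≤ |lam * ∫ ω, Y ω ∂P| := neg_le_abs _
      _ = |lam| * |∫ ω, Y ω ∂P| := abs_mul _ _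
      _ ≤ _ := by gcongr; exact abs_integral_le_integral_abs
  have h3 : ∀ ω, Real.exp (lam * (Y ω - ∫ ω, Y ω ∂P)) =
      Real.exp (lam * Y ω) * Real.exp (-(lam * ∫ ω, Y ω ∂P)) := by
    intro ω; rw [← Real.exp_add]; congr 1; ring
  simp only [h3]
  rw [integral_mul_const, sq]
  exact mul_le_mul (integral_mono hie2 hie hle) hj2 (by positivity)
    (integral_nonneg fun ω => by positivity)

/-- Weighted Young inequality with crossover `D = β T / √N`. Below it the first term is enough;
above it `T` is replaced by `D √N / β`, and `r ≤ 2` with `N ≥ 1` and `β ≤ 1` keeps the powers of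
`√N` and `β⁻¹` at most one. The small weight `β` falls on the term that is summed over columns. -/
theorem rpow_mul_div_sqrt_le {r β T N D : ℝ} (hr : 1 ≤ r) (hr2 : r ≤ 2) (hβ : 0 < β) (hβ1 : β ≤ 1)
    (hT : 0 < T) (hN : 1 ≤ N) (hD : 0 ≤ D) :
    T ^ (r - 1) / √N * D ≤ β * (T ^ r / N) + β⁻¹ * D ^ r := by
  have hN0 : 0 < N := by linarith
  have hsN : 0 < √N := Real.sqrt_pos.2 hN0
  have hTr : T ^ r = T ^ (r - 1) * T := by
    rw [← Real.rpow_add_one hT.ne']; congr 1; ring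
  rcases le_total D (β * T / √N) with h | h
  · have h1 : T ^ (r - 1) / √N * D ≤ T ^ (r - 1) / √N * (β * T / √N) := by gcongr
    have h2 : T ^ (r - 1) / √N * (β * T / √N) = β * (T ^ r / N) := by
      rw [hTr]
      nth_rewrite 3 [← Real.mul_self_sqrt hN0.le]
      field_simp
    have h3 : 0 ≤ β⁻¹ * D ^ r := by positivity
    linarith
  · have hD0 : 0 < D := lt_of_lt_of_le (by positivity) h
    have h1 : T ≤ D * √N / β := by
      rw [le_div_iff₀ hβ]; rw [div_le_iff₀ hsN] at h; linarith
    have h2 : T ^ (r - 1) ≤ (D * √N / β) ^ (r - 1) := Real.rpow_le_rpow hT.le h1 (by linarith)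
    have h3 : (D * √N / β) ^ (r - 1) = D ^ (r - 1) * √N ^ (r - 1) * β⁻¹ ^ (r - 1) := by
      rw [div_eq_mul_inv, Real.mul_rpow (by positivity) (by positivity),
        Real.mul_rpow (by positivity) (by positivity)]
    have h4 : √N ^ (r - 1) ≤ √N := by
      calc √N ^ (r - 1) ≤ √N ^ (1 : ℝ) :=
            Real.rpow_le_rpow_of_exponent_le (Real.one_le_sqrt.2 hN) (by linarith)
        _ = _ := Real.rpow_one _
    have h5 : β⁻¹ ^ (r - 1) ≤ β⁻¹ := by
      calc β⁻¹ ^ (r - 1) ≤ β⁻¹ ^ (1 : ℝ) :=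
            Real.rpow_le_rpow_of_exponent_le ((one_le_inv₀ hβ).2 hβ1) (by linarith)
        _ = _ := Real.rpow_one _
    have hDr : D ^ r = D ^ (r - 1) * D := by
      rw [← Real.rpow_add_one hD0.ne']; congr 1; ring
    have h6 : T ^ (r - 1) / √N * D ≤ β⁻¹ * D ^ r := by
      calc T ^ (r - 1) / √N * D ≤ (D ^ (r - 1) * √N * β⁻¹) / √N * D := by
            gcongr
            refine h2.trans (h3.le.trans ?_)
            gcongr
        _ = β⁻¹ * D ^ r := by rw [hDr]; field_simp
    have h7 : 0 ≤ β * (T ^ r / N) := by positivity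
    linarith

theorem sq_add_mul_le {D d x K₁ K₂ : ℝ} (hx1 : 1 ≤ x) (hK₁ : 0 < K₁) (hK₂ : 0 < K₂)
    (k1 : D ^ 2 ≤ K₁ * x ^ 2) (k2 : D ^ 4 ≤ K₂ * x ^ 2) :
    (D + D ^ 2 + d) ^ 2 * x ≤ 3 * ((K₁ + K₂ + 1) * x ^ 4 + d ^ 4) := by
  have hx3 : x ^ 3 ≤ x ^ 4 := pow_le_pow_right₀ hx1 (by norm_num)
  have f1 : (D + D ^ 2 + d) ^ 2 ≤ 3 * (D ^ 2 + D ^ 4 + d ^ 2) := by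
    nlinarith [sq_nonneg (D - D ^ 2), sq_nonneg (D - d), sq_nonneg (D ^ 2 - d)]
  have f2 : D ^ 2 * x ≤ K₁ * x ^ 4 := by
    calc D ^ 2 * x ≤ K₁ * x ^ 2 * x := by gcongr
      _ = K₁ * x ^ 3 := by ring
      _ ≤ _ := by gcongr
  have f3 : D ^ 4 * x ≤ K₂ * x ^ 4 := by
    calc D ^ 4 * x ≤ K₂ * x ^ 2 * x := by gcongr
      _ = K₂ * x ^ 3 := by ring
      _ ≤ _ := by gcongr
  have f4 : d ^ 2 * x ≤ x ^ 4 + d ^ 4 := by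
    have hx24 : x ^ 2 ≤ x ^ 4 := pow_le_pow_right₀ hx1 (by norm_num)
    nlinarith [sq_nonneg (d ^ 2 - x), sq_nonneg (d ^ 2), sq_nonneg x]
  calc (D + D ^ 2 + d) ^ 2 * x ≤ 3 * (D ^ 2 + D ^ 4 + d ^ 2) * x := by gcongr
    _ = 3 * (D ^ 2 * x + D ^ 4 * x + d ^ 2 * x) := by ring
    _ ≤ 3 * (K₁ * x ^ 4 + K₂ * x ^ 4 + (x ^ 4 + d ^ 4)) := by gcongr
    _ = _ := by ring

/-- The exponential moment estimate for one coordinate, in abstract form. -/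
theorem exists_mgf_bound {r κ B A ε : ℝ} (hr : 1 ≤ r) (hr2 : r ≤ 2) (hκ : 0 < κ) (hB : 1 ≤ B)
    (hA : 0 < A) (hε : 0 < ε) :
    ∃ c : ℝ, 0 < c ∧ ∀ {Ω : Type} [MeasurableSpace Ω] (P : Measure Ω) [IsProbabilityMeasure P]
      (Y D d : Ω → ℝ) (b n N T lam : ℝ), Measurable Y → Measurable D → (∀ ω, |Y ω| ≤ b) →
      (∀ ω, 0 ≤ D ω) → 1 ≤ N → 0 < n → 1 ≤ T → |lam| = c * (√n * T ^ (r - 1)) →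
      ExpBdd P D r κ B → Integrable (fun ω => d ω ^ 4) P → ∫ ω, d ω ^ 4 ∂P ≤ B →
      (∀ ω, Y ω ^ 2 ≤ A / (n * N) * (D ω + D ω ^ 2 + d ω) ^ 2) →
      (∀ ω, |lam| * |Y ω| ≤ c * (A * (T ^ (r - 1) / √N * D ω + D ω ^ r + 1))) →
      ∫ ω, Real.exp (lam * (Y ω - ∫ ω, Y ω ∂P)) ∂P ≤ Real.exp (ε * (c * (T ^ r / N))) := by
  have hr0 : 0 < r := by linarith
  obtain ⟨K₁, hK₁, hK₁'⟩ := exists_pow_le_exp_rpow hr0 (half_pos hκ) 2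
  obtain ⟨K₂, hK₂, hK₂'⟩ := exists_pow_le_exp_rpow hr0 (half_pos hκ) 4
  -- Threshold for the coefficient `s = c T^{r-1} / √N` of `D` in the exponent: below it, `exp
  -- (|lam| |Y|)` costs only a quarter of the available moment of `D`.
  set s₀ : ℝ := κ / (8 * A) with hs₀
  have hs₀0 : 0 < s₀ := by positivity
  set A₆ : ℝ := 3 * A * Real.exp (κ / 4) * ((K₁ + K₂ + 1) * B + B) with hA₆
  have hA₆0 : 0 < A₆ := by positivity
  set β : ℝ := min 1 (ε / (4 * A)) with hβ
  have hβ0 : 0 < β := by positivity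
  have hβ1 : β ≤ 1 := min_le_left _ _
  have hlogB : 0 ≤ Real.log B := Real.log_nonneg hB
  set A₇ : ℝ := 2 + 2 * Real.log B with hA₇
  have hA₇0 : 0 < A₇ := by positivity
  -- The first two entries serve the regime `s ≤ s₀`, the next two the exponent bound for `s > s₀`,
  -- and the last lets the constant `A₇` be absorbed there.
  set c : ℝ := min (min s₀ (ε / A₆)) (min (κ / (A * (β⁻¹ + 1))) (min (1 / A)
    (ε * s₀ ^ 2 / (2 * A₇)))) with hc
  have hc0 : 0 < c := by positivity
  have hc1 : c ≤ s₀ := (min_le_left _ _).trans (min_le_left _ _)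
  have hc2 : c * A₆ ≤ ε := by
    rw [← le_div_iff₀ hA₆0]; exact (min_le_left _ _).trans (min_le_right _ _)
  have hc3 : c * (A * (β⁻¹ + 1)) ≤ κ := by
    rw [← le_div_iff₀ (by positivity)]; exact (min_le_right _ _).trans (min_le_left _ _)
  have hc4 : c * A ≤ 1 := by
    rw [← le_div_iff₀ hA]
    exact (min_le_right _ _).trans ((min_le_right _ _).trans (min_le_left _ _))
  have hc5 : c * (2 * A₇) ≤ ε * s₀ ^ 2 := by
    rw [← le_div_iff₀ (by positivity)]
    exact (min_le_right _ _).trans ((min_le_right _ _).trans (min_le_right _ _))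
  refine ⟨c, hc0, fun {Ω} _ P _ Y D d b n N T lam hY hD hb hD0 hN hn hT hlam hDB hdi hdB h3 h4 => ?_⟩
  have hN0 : 0 < N := by linarith
  have hT0 : 0 < T := by linarith
  have hsN : 0 < √N := Real.sqrt_pos.2 hN0
  have hDi := hDB.integrable hD
  have hDe := hDB.integral_le hκ.le hD
  have hTT : (T ^ (r - 1)) ^ 2 ≤ T ^ r := by
    rw [← Real.rpow_natCast, ← Real.rpow_mul hT0.le]
    exact Real.rpow_le_rpow_of_exponent_le hT (by push_cast; linarith)
  set s := c * T ^ (r - 1) / √N with hs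
  have hs0 : 0 ≤ s := by positivity
  have hDabs : ∀ ω, |D ω| = D ω := fun ω => abs_of_nonneg (hD0 ω)
  simp only [hDabs] at hDi hDe
  -- For `s ≤ s₀` the second-order bound gives `lam² 𝔼 Y²` of order `c² T^{2(r-1)} / N`, at most `c²
  -- T^r / N` because `r ≤ 2` and `T ≥ 1`. For `s > s₀` the crude bound is enough.
  rcases le_or_gt s s₀ with hcase | hcase
  · have hU : ∀ ω, Real.exp (|lam| * |Y ω|) ≤
        Real.exp (κ / 4) * Real.exp (κ / 4 * D ω ^ r) := by
      intro ω
      rw [← Real.exp_add, Real.exp_le_exp]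
      refine (h4 ω).trans ?_
      have hDr : D ω ≤ 1 + D ω ^ r := by
        have hp : 0 ≤ D ω ^ r := Real.rpow_nonneg (hD0 ω) r
        rcases le_total (D ω) 1 with h | h
        · linarith
        · have := Real.rpow_le_rpow_of_exponent_le h hr
          rw [Real.rpow_one] at this
          linarith
      have hp : 0 ≤ D ω ^ r := Real.rpow_nonneg (hD0 ω) r
      calc c * (A * (T ^ (r - 1) / √N * D ω + D ω ^ r + 1))
          = A * (s * D ω + c * D ω ^ r + c) := by rw [hs]; ring
        _ ≤ A * (s₀ * (1 + D ω ^ r) + s₀ * D ω ^ r + s₀) := by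
            have := hD0 ω
            gcongr
        _ = κ / 4 + κ / 4 * D ω ^ r := by rw [hs₀]; field_simp; ring
    have hdi' := hDi.const_mul (K₁ + K₂ + 1)
    have hGi : Integrable (fun ω => (K₁ + K₂ + 1) * Real.exp (κ * D ω ^ r) + d ω ^ 4) P :=
      hdi'.add hdi
    have hGe : ∫ ω, ((K₁ + K₂ + 1) * Real.exp (κ * D ω ^ r) + d ω ^ 4) ∂P ≤
        (K₁ + K₂ + 1) * B + B := by
      rw [integral_add hdi' hdi, integral_const_mul]
      gcongr
    have hYU : ∀ ω, Y ω ^ 2 * Real.exp (|lam| * |Y ω|) ≤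
        3 * A * Real.exp (κ / 4) / (n * N) *
          ((K₁ + K₂ + 1) * Real.exp (κ * D ω ^ r) + d ω ^ 4) := by
      intro ω
      have hp : 0 ≤ D ω ^ r := Real.rpow_nonneg (hD0 ω) r
      set x := Real.exp (κ / 4 * D ω ^ r) with hx
      have hx1 : 1 ≤ x := Real.one_le_exp (by positivity)
      have hx2 : Real.exp (κ / 2 * D ω ^ r) = x ^ 2 := by
        rw [hx, ← Real.exp_nat_mul]; congr 1; push_cast; ring
      have hx4 : Real.exp (κ * D ω ^ r) = x ^ 4 := by
        rw [hx, ← Real.exp_nat_mul]; congr 1; push_cast; ring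
      have k1 := hK₁' (D ω) (hD0 ω)
      have k2 := hK₂' (D ω) (hD0 ω)
      rw [hx2] at k1 k2
      have e1 := sq_add_mul_le (d := d ω) hx1 hK₁ hK₂ k1 k2
      rw [hx4]
      calc Y ω ^ 2 * Real.exp (|lam| * |Y ω|)
          ≤ (A / (n * N) * (D ω + D ω ^ 2 + d ω) ^ 2) * (Real.exp (κ / 4) * x) :=
            mul_le_mul (h3 ω) (hU ω) (by positivity) (by positivity)
        _ = A / (n * N) * Real.exp (κ / 4) * ((D ω + D ω ^ 2 + d ω) ^ 2 * x) := by ring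
        _ ≤ A / (n * N) * Real.exp (κ / 4) * (3 * ((K₁ + K₂ + 1) * x ^ 4 + d ω ^ 4)) := by
            gcongr
        _ = _ := by ring
    refine (integral_exp_sub_le_exp_sq hY hb lam).trans (Real.exp_le_exp.2 ?_)
    have hI : ∫ ω, Y ω ^ 2 * Real.exp (|lam| * |Y ω|) ∂P ≤ A₆ / (n * N) := by
      have hGi' := hGi.const_mul (3 * A * Real.exp (κ / 4) / (n * N))
      refine (integral_mono_of_nonneg (Filter.Eventually.of_forall fun ω => by positivity) hGi'
        (Filter.Eventually.of_forall hYU)).trans ?_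
      rw [integral_const_mul, hA₆, div_mul_eq_mul_div]
      gcongr
    calc lam ^ 2 * ∫ ω, Y ω ^ 2 * Real.exp (|lam| * |Y ω|) ∂P ≤ lam ^ 2 * (A₆ / (n * N)) := by
          gcongr
      _ = c * A₆ * (c * ((T ^ (r - 1)) ^ 2 / N)) := by
          rw [← sq_abs, hlam, mul_pow, mul_pow, Real.sq_sqrt hn.le]; field_simp
      _ ≤ ε * (c * (T ^ r / N)) := by gcongr
  · refine (integral_exp_sub_le_sq hY hb lam).trans ?_
    have hU : ∀ ω, Real.exp (|lam| * |Y ω|) ≤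
        Real.exp (ε / 4 * (c * (T ^ r / N)) + 1) * Real.exp (κ * D ω ^ r) := by
      intro ω
      rw [← Real.exp_add, Real.exp_le_exp]
      refine (h4 ω).trans ?_
      have hp : 0 ≤ D ω ^ r := Real.rpow_nonneg (hD0 ω) r
      have h5 := rpow_mul_div_sqrt_le hr hr2 hβ0 hβ1 hT0 hN (hD0 ω)
      have hβA : A * β ≤ ε / 4 := by
        have : β ≤ ε / (4 * A) := min_le_right _ _
        rw [le_div_iff₀ (by positivity)] at this
        linarith
      calc c * (A * (T ^ (r - 1) / √N * D ω + D ω ^ r + 1))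
          ≤ c * (A * ((β * (T ^ r / N) + β⁻¹ * D ω ^ r) + D ω ^ r + 1)) := by gcongr
        _ = A * β * (c * (T ^ r / N)) + c * A + c * (A * (β⁻¹ + 1)) * D ω ^ r := by ring
        _ ≤ ε / 4 * (c * (T ^ r / N)) + 1 + κ * D ω ^ r := by gcongr
    have hI : ∫ ω, Real.exp (|lam| * |Y ω|) ∂P ≤
        Real.exp (ε / 4 * (c * (T ^ r / N)) + 1) * B := by
      refine (integral_mono_of_nonneg (Filter.Eventually.of_forall fun ω => by positivity)
        (hDi.const_mul _) (Filter.Eventually.of_forall hU)).trans ?_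
      rw [integral_const_mul]
      gcongr
    -- Here `T^r / N` is at least `s₀² / c²`, so the constants left by the crude bound fit in half
    -- of the allowed exponent.
    have hlow : A₇ ≤ ε / 2 * (c * (T ^ r / N)) := by
      have g1 : s₀ ^ 2 ≤ c * (c * (T ^ r / N)) := by
        calc s₀ ^ 2 ≤ s ^ 2 := by gcongr
          _ = c * (c * ((T ^ (r - 1)) ^ 2 / N)) := by
              rw [hs, div_pow, mul_pow, Real.sq_sqrt hN0.le]; ring
          _ ≤ _ := by gcongr
      have g2 : c * (2 * A₇) ≤ c * (ε * (c * (T ^ r / N))) := by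
        calc c * (2 * A₇) ≤ ε * s₀ ^ 2 := hc5
          _ ≤ ε * (c * (c * (T ^ r / N))) := by gcongr
          _ = _ := by ring
      have g3 := le_of_mul_le_mul_left g2 hc0
      linarith
    calc (∫ ω, Real.exp (|lam| * |Y ω|) ∂P) ^ 2
        ≤ (Real.exp (ε / 4 * (c * (T ^ r / N)) + 1) * B) ^ 2 := by
          have : 0 ≤ ∫ ω, Real.exp (|lam| * |Y ω|) ∂P := integral_nonneg fun ω => by positivity
          gcongr
      _ = Real.exp (ε / 2 * (c * (T ^ r / N)) + A₇) := by
          nth_rewrite 1 [← Real.exp_log (by linarith : 0 < B)]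
          rw [← Real.exp_add, ← Real.exp_nat_mul, hA₇]
          congr 1
          push_cast
          ring
      _ ≤ _ := by
          rw [Real.exp_le_exp]
          linarith

theorem ExpBdd.abs_add_abs {X Y : Ω → ℝ} {q κ B : ℝ} (hX : Measurable X) (hq : 0 < q)
    (hκ : 0 < κ) (h : ExpBdd P X q κ B) (h' : ExpBdd P Y q κ B) :
    ExpBdd P (fun ω => |X ω| + |Y ω|) q (κ / (2 * 2 ^ q)) (2 * B) := by
  have h2 : (0 : ℝ) < 2 ^ q := by positivity
  have hB := h.one_le hκ.le
  unfold ExpBdd at *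
  calc _ ≤ ∫⁻ ω, (ENNReal.ofReal (Real.exp (κ * |X ω| ^ q)) +
        ENNReal.ofReal (Real.exp (κ * |Y ω| ^ q))) ∂P := by
        refine lintegral_mono fun ω => ?_
        rw [← ENNReal.ofReal_add (by positivity) (by positivity)]
        refine ENNReal.ofReal_le_ofReal ?_
        have h1 := abs_add_rpow_le hq |X ω| |Y ω|
        rw [abs_abs, abs_abs] at h1
        have h3 : κ / (2 * 2 ^ q) * |(|X ω| + |Y ω|)| ^ q ≤
            (κ * |X ω| ^ q + κ * |Y ω| ^ q) / 2 := by
          calc _ ≤ κ / (2 * 2 ^ q) * (2 ^ q * (|X ω| ^ q + |Y ω| ^ q)) := by gcongr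
            _ = _ := by field_simp
        rcases le_total (κ * |X ω| ^ q) (κ * |Y ω| ^ q) with h4 | h4
        · have : Real.exp (κ / (2 * 2 ^ q) * |(|X ω| + |Y ω|)| ^ q) ≤ Real.exp (κ * |Y ω| ^ q) :=
            Real.exp_le_exp.2 (by linarith)
          have := Real.exp_pos (κ * |X ω| ^ q)
          linarith
        · have : Real.exp (κ / (2 * 2 ^ q) * |(|X ω| + |Y ω|)| ^ q) ≤ Real.exp (κ * |X ω| ^ q) :=
            Real.exp_le_exp.2 (by linarith)
          have := Real.exp_pos (κ * |Y ω| ^ q)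
          linarith
    _ = _ := lintegral_add_left (((hX.abs.pow_const q).const_mul _).exp.ennreal_ofReal) _
    _ ≤ ENNReal.ofReal B + ENNReal.ofReal B := by gcongr
    _ = _ := by rw [← ENNReal.ofReal_add (by linarith) (by linarith)]; congr 1; ring

end MgfBounds

/-! ### Dependence of a resolvent form on one column. -/

section Coordinate

open scoped RealInnerProductSpace

namespace IsRes

variable {E : Type*} [NormedAddCommGroup E] [InnerProductSpace ℝ E] {S Q : E →ₗ[ℝ] E} {z : ℝ}

theorem sqrt_inner_add_le (h : IsRes S Q z) (v w : E) :
    √⟪v + w, Q (v + w)⟫ ≤ √⟪v, Q v⟫ + √⟪w, Q w⟫ := by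
  have h1 : |⟪v, Q w⟫| ≤ √⟪v, Q v⟫ * √⟪w, Q w⟫ := by
    rw [← Real.sqrt_mul (h.inner_nonneg v)]
    exact Real.abs_le_sqrt (h.cauchy v w)
  refine Real.sqrt_le_iff.2 ⟨by positivity, ?_⟩
  have h2 : ⟪w, Q v⟫ = ⟪v, Q w⟫ := by rw [← h.Q_symm, real_inner_comm]
  rw [map_add, inner_add_left, inner_add_right, inner_add_right, h2, add_sq,
    Real.sq_sqrt (h.inner_nonneg v), Real.sq_sqrt (h.inner_nonneg w)]
  have := le_abs_self ⟪v, Q w⟫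
  linarith

theorem sqrt_inner_smul (_h : IsRes S Q z) {a : ℝ} (ha : 0 ≤ a) (v : E) :
    √⟪a • v, Q (a • v)⟫ = a * √⟪v, Q v⟫ := by
  rw [map_smul, real_inner_smul_left, real_inner_smul_right, ← mul_assoc,
    Real.sqrt_mul (mul_self_nonneg a), Real.sqrt_mul_self ha]

theorem sqrt_mul_sqrt_inner_le (h : IsRes S Q z) (v : E) : √z * √⟪v, Q v⟫ ≤ ‖v‖ := by
  rw [← Real.sqrt_mul h.pos.le]
  refine Real.sqrt_le_iff.2 ⟨norm_nonneg _, ?_⟩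
  have := h.inner_le v
  rw [le_div_iff₀ h.pos] at this
  linarith

end IsRes

/-- `√⟪y, Q y⟫` is a seminorm bounded by `‖y‖ / √z`, hence convex and Lipschitz; the quadratic form
itself is not Lipschitz. This is how convex concentration controls the denominators. -/
theorem qLip_sqrt_inner {p : ℕ} {S Q : EuclideanSpace ℝ (Fin p) →ₗ[ℝ] EuclideanSpace ℝ (Fin p)}
    {z : ℝ} (h : IsRes S Q z) :
    QLip fun Y : Fin 1 → EuclideanSpace ℝ (Fin p) => √z * √⟪Y 0, Q (Y 0)⟫ := by
  constructor
  · intro r Y hY Y' hY' a c ha hc hac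
    simp only [Set.mem_ofPred_eq, Pi.add_apply, Pi.smul_apply] at *
    have h1 := h.sqrt_inner_add_le (a • Y 0) (c • Y' 0)
    rw [h.sqrt_inner_smul ha, h.sqrt_inner_smul hc] at h1
    have hz : 0 ≤ √z := Real.sqrt_nonneg z
    have : r = a * r + c * r := by rw [← add_mul, hac, one_mul]
    rw [this]
    calc √z * √⟪a • Y 0 + c • Y' 0, Q (a • Y 0 + c • Y' 0)⟫
        ≤ √z * (a * √⟪Y 0, Q (Y 0)⟫ + c * √⟪Y' 0, Q (Y' 0)⟫) := by gcongr
      _ = a * (√z * √⟪Y 0, Q (Y 0)⟫) + c * (√z * √⟪Y' 0, Q (Y' 0)⟫) := by ring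
      _ ≤ _ := by gcongr
  · have key : ∀ y y' : EuclideanSpace ℝ (Fin p),
        √z * √⟪y, Q y⟫ - √z * √⟪y', Q y'⟫ ≤ ‖y - y'‖ := by
      intro y y'
      have h1 := h.sqrt_inner_add_le y' (y - y')
      rw [add_sub_cancel] at h1
      have h2 := h.sqrt_mul_sqrt_inner_le (y - y')
      have hz : 0 ≤ √z := Real.sqrt_nonneg z
      nlinarith
    intro Y Y'
    rw [Fin.sum_univ_one, Real.sqrt_sq (norm_nonneg _), abs_le]
    refine ⟨?_, key _ _⟩
    have := key (Y' 0) (Y 0)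
    rw [norm_sub_rev] at this
    linarith

/-- The seminorm `√⟪y, Q y⟫` of a concentrated vector. -/
theorem LawReg.exists_sqrt_inner {p : ℕ} {μ : Measure (EuclideanSpace ℝ (Fin p))} {q r κ B : ℝ}
    (hμ : LawReg μ q r κ B)
    {S Q : EuclideanSpace ℝ (Fin p) →ₗ[ℝ] EuclideanSpace ℝ (Fin p)} {z : ℝ} (h : IsRes S Q z) :
    ∃ ρ, 0 ≤ ρ ∧ ExpBdd μ (fun y => √z * (√⟪y, Q y⟫ - ρ)) q κ B := by
  have := hμ.prob
  have hQ : Continuous Q := Q.continuous_of_finiteDimensional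
  obtain ⟨Y₀, hY⟩ := hμ.conv 1 _ (qLip_sqrt_inner h)
  refine ⟨√⟪Y₀ 0, Q (Y₀ 0)⟫, Real.sqrt_nonneg _, ?_⟩
  unfold ExpBdd at *
  simp only [← mul_sub] at hY
  have hm : Measurable fun y : EuclideanSpace ℝ (Fin p) =>
      √z * (√⟪y, Q y⟫ - √⟪Y₀ 0, Q (Y₀ 0)⟫) := Continuous.measurable (by fun_prop)
  rwa [(measurePreserving_eval (fun _ : Fin 1 => μ) 0).lintegral_comp
    (f := fun y => ENNReal.ofReal (Real.exp (κ * |√z * (√⟪y, Q y⟫ -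
      √⟪Y₀ 0, Q (Y₀ 0)⟫)| ^ q)))
    (((hm.abs.pow_const q).const_mul _).exp.ennreal_ofReal)] at hY

/-- `2 x √n ≤ n + x²` bounds the slope of `x ↦ 1 / (n + x²)` by `1 / (n √n)`. -/
theorem abs_inv_add_sq_sub_le {n x y : ℝ} (hn : 0 < n) (hx : 0 ≤ x) (hy : 0 ≤ y) :
    |1 / (n + x ^ 2) - 1 / (n + y ^ 2)| ≤ |x - y| / (n * √n) := by
  have hs : 0 < √n := Real.sqrt_pos.2 hn
  have hs2 := Real.sq_sqrt hn.le
  have h1 : 1 / (n + x ^ 2) - 1 / (n + y ^ 2) =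
      (y - x) * ((x + y) / ((n + x ^ 2) * (n + y ^ 2))) := by
    field_simp; ring
  rw [h1, abs_mul, abs_sub_comm y x,
    show |x - y| / (n * √n) = |x - y| * (1 / (n * √n)) by ring]
  refine mul_le_mul_of_nonneg_left ?_ (abs_nonneg _)
  rw [abs_of_nonneg (by positivity), div_le_div_iff₀ (by positivity) (by positivity),
    one_mul]
  have h2 : 2 * (x * √n) ≤ n + x ^ 2 := by nlinarith [sq_nonneg (x - √n)]
  have h3 : 2 * (y * √n) ≤ n + y ^ 2 := by nlinarith [sq_nonneg (y - √n)]
  have h4 : n * (2 * (x * √n)) ≤ (n + y ^ 2) * (n + x ^ 2) := by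
    gcongr; nlinarith [sq_nonneg y]
  have h5 : n * (2 * (y * √n)) ≤ (n + x ^ 2) * (n + y ^ 2) := by
    gcongr; nlinarith [sq_nonneg x]
  nlinarith

/-- The numerator moves by `η`, the denominator through `x - y`. The second entry of the minimum
ignores how far the denominator moves; it is used when `x - y` has too few exponential moments. -/
theorem abs_ratio_sub_le {n a η x y : ℝ} (hn : 0 < n) (hx : 0 ≤ x) (hy : 0 ≤ y) :
    |(a + η) ^ 2 / (n + x ^ 2) - a ^ 2 / (n + y ^ 2)| ≤
      (2 * |a| * |η| + |η| ^ 2) / n + min (a ^ 2 / n * (|x - y| / √n)) (a ^ 2 / n) := by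
  have hs : 0 < √n := Real.sqrt_pos.2 hn
  have h1 : (a + η) ^ 2 / (n + x ^ 2) - a ^ 2 / (n + y ^ 2) =
      (2 * a * η + η ^ 2) / (n + x ^ 2) + a ^ 2 * (1 / (n + x ^ 2) - 1 / (n + y ^ 2)) := by
    field_simp; ring
  rw [h1]
  refine (abs_add_le _ _).trans (add_le_add ?_ (le_min ?_ ?_))
  · rw [abs_div, abs_of_pos (by positivity : 0 < n + x ^ 2)]
    have h2 : |2 * a * η + η ^ 2| ≤ 2 * |a| * |η| + |η| ^ 2 := by
      refine (abs_add_le _ _).trans (le_of_eq ?_)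
      rw [abs_mul, abs_mul, abs_two, abs_pow]
    gcongr
    nlinarith [sq_nonneg x]
  · rw [abs_mul, abs_of_nonneg (sq_nonneg a)]
    calc a ^ 2 * |1 / (n + x ^ 2) - 1 / (n + y ^ 2)| ≤ a ^ 2 * (|x - y| / (n * √n)) := by
          gcongr; exact abs_inv_add_sq_sub_le hn hx hy
      _ = _ := by field_simp
  · rw [abs_mul, abs_of_nonneg (sq_nonneg a), show a ^ 2 / n = a ^ 2 * (1 / n) by ring]
    refine mul_le_mul_of_nonneg_left ?_ (sq_nonneg a)
    have h3 : 1 / (n + x ^ 2) ≤ 1 / n := by gcongr; nlinarith [sq_nonneg x]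
    have h4 : 1 / (n + y ^ 2) ≤ 1 / n := by gcongr; nlinarith [sq_nonneg y]
    have h5 : 0 ≤ 1 / (n + x ^ 2) := by positivity
    have h6 : 0 ≤ 1 / (n + y ^ 2) := by positivity
    rw [abs_le]
    constructor <;> linarith

/-- Pointwise second moment bound for the increment. -/
theorem sq_le_of_abs_le {n N a η Y D d w C₂ z₀ : ℝ} (hn : 0 < n) (hN : 1 ≤ N) (hNn : N ≤ n)
    (hz₀ : 0 < z₀) (hC₂ : 0 ≤ C₂) (ha : a ^ 2 ≤ C₂ * (n / N)) (hD : 0 ≤ D) (hd : 0 ≤ d)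
    (hη : |η| ≤ D / z₀) (hw0 : 0 ≤ w) (hw : w ≤ d / √z₀)
    (hY : |Y| ≤ (2 * |a| * |η| + |η| ^ 2) / n + a ^ 2 / n * (w / √n)) :
    Y ^ 2 ≤ (2 * √C₂ / z₀ + 1 / z₀ ^ 2 + C₂ / √z₀) ^ 2 / (n * N) * (D + D ^ 2 + d) ^ 2 := by
  have hN0 : 0 < N := by linarith
  have hs : 0 < √n := Real.sqrt_pos.2 hn
  have hsN : 0 < √N := Real.sqrt_pos.2 hN0
  have hsz : 0 < √z₀ := Real.sqrt_pos.2 hz₀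
  have hsN1 : 1 ≤ √N := Real.one_le_sqrt.2 hN
  have hsNn : √N ≤ √n := Real.sqrt_le_sqrt hNn
  have en : n = √n ^ 2 := (Real.sq_sqrt hn.le).symm
  have eN : N = √N ^ 2 := (Real.sq_sqrt hN0.le).symm
  have ha' : |a| ≤ √C₂ * (√n / √N) := by
    have := Real.sqrt_le_sqrt ha
    rwa [Real.sqrt_sq_eq_abs, Real.sqrt_mul hC₂, Real.sqrt_div hn.le] at this
  have han : a ^ 2 / n ≤ C₂ / N := by
    rw [div_le_iff₀ hn]
    calc a ^ 2 ≤ _ := ha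
      _ = _ := by ring
  set L := 2 * √C₂ / z₀ + 1 / z₀ ^ 2 + C₂ / √z₀ with hL
  have key : |Y| ≤ L / (√n * √N) * (D + D ^ 2 + d) := by
    refine hY.trans ?_
    have t1 : 2 * |a| * |η| / n ≤ 2 * √C₂ / z₀ / (√n * √N) * D := by
      calc 2 * |a| * |η| / n ≤ 2 * (√C₂ * (√n / √N)) * (D / z₀) / n := by gcongr
        _ = _ := by rw [en, Real.sqrt_sq hs.le]; field_simp
    have t2 : |η| ^ 2 / n ≤ 1 / z₀ ^ 2 / (√n * √N) * D ^ 2 := by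
      calc |η| ^ 2 / n ≤ (D / z₀) ^ 2 / n := by gcongr
        _ = 1 / z₀ ^ 2 / (√n * √n) * D ^ 2 := by rw [en, Real.sqrt_sq hs.le]; field_simp
        _ ≤ _ := by gcongr
    have t3 : a ^ 2 / n * (w / √n) ≤ C₂ / √z₀ / (√n * √N) * d := by
      calc a ^ 2 / n * (w / √n) ≤ C₂ / N * (d / √z₀ / √n) := by gcongr
        _ = C₂ / √z₀ / (√n * (√N * √N)) * d := by
            rw [eN, Real.sqrt_sq hsN.le]; field_simp
        _ ≤ C₂ / √z₀ / (√n * √N) * d := by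
            gcongr
            nlinarith
    have hDD := sq_nonneg D
    rw [add_div]
    calc _ ≤ 2 * √C₂ / z₀ / (√n * √N) * D + 1 / z₀ ^ 2 / (√n * √N) * D ^ 2 +
          C₂ / √z₀ / (√n * √N) * d := by linarith
      _ ≤ 2 * √C₂ / z₀ / (√n * √N) * (D + D ^ 2 + d) +
          1 / z₀ ^ 2 / (√n * √N) * (D + D ^ 2 + d) +
          C₂ / √z₀ / (√n * √N) * (D + D ^ 2 + d) := by gcongr <;> linarith
      _ = _ := by rw [hL]; ring
  calc Y ^ 2 = |Y| ^ 2 := (sq_abs Y).symm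
    _ ≤ (L / (√n * √N) * (D + D ^ 2 + d)) ^ 2 := by gcongr
    _ = _ := by
      rw [mul_pow, div_pow, mul_pow, ← en, ← eN]

theorem sum_le_mul_sum {a b c d e x y : ℝ} (ha : 0 ≤ a) (hb : 0 ≤ b) (hc : 0 ≤ c) (hd : 0 ≤ d)
    (he : 0 ≤ e) (hx : 0 ≤ x) (hy : 0 ≤ y) :
    a * x + b * y + d * x + e ≤ (a + b + c + d + e) * (x + y + 1) ∧
      c * y ≤ (a + b + c + d + e) * (x + y + 1) := by
  constructor
  · calc a * x + b * y + d * x + e ≤ a * (x + y + 1) + b * (x + y + 1) + c * (x + y + 1) +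
          d * (x + y + 1) + e * (x + y + 1) := by
          have h1 : a * x ≤ a * (x + y + 1) := by gcongr; linarith
          have h2 : b * y ≤ b * (x + y + 1) := by gcongr; linarith
          have h3 : d * x ≤ d * (x + y + 1) := by gcongr; linarith
          have h4 : e * 1 ≤ e * (x + y + 1) := by gcongr; linarith
          have h5 : 0 ≤ c * (x + y + 1) := by positivity
          linarith
      _ = _ := by ring
  · gcongr <;> linarith

/-- Pointwise exponent bound for the increment. -/
theorem mul_abs_le_of_abs_le {n N a η Y D C₂ z₀ T Bt r c lam θ b₁ L₃ L₄ : ℝ} (hr : 1 ≤ r)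
    (hr2 : r ≤ 2) (hn : 0 < n) (hN : 1 ≤ N) (hc : 0 < c) (hT : 1 ≤ T) (hBt : 1 ≤ Bt)
    (hTB : T ≤ Bt * √n) (hz₀ : 0 < z₀) (hC₂ : 0 ≤ C₂) (ha : a ^ 2 ≤ C₂ * (n / N)) (hD : 0 ≤ D)
    (hη : |η| ≤ D / z₀) (hlam : |lam| = c * (√n * T ^ (r - 1))) (hb₁ : |Y| ≤ b₁)
    (hL₃ : 0 ≤ L₃) (hL₄ : 0 ≤ L₄)
    (hY : |Y| ≤ (2 * |a| * |η| + |η| ^ 2) / n + θ)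
    (hθ : |lam| * θ ≤ c * (L₃ * (T ^ (r - 1) / √N * D) + L₄)) :
    |lam| * |Y| ≤ c * ((2 * √C₂ / z₀ + Bt / z₀ ^ 2 + Bt * b₁ + L₃ + L₄) *
      (T ^ (r - 1) / √N * D + D ^ r + 1)) := by
  have hN0 : 0 < N := by linarith
  have hT0 : 0 < T := by linarith
  have hs : 0 < √n := Real.sqrt_pos.2 hn
  have hsN : 0 < √N := Real.sqrt_pos.2 hN0
  have hb0 : 0 ≤ b₁ := (abs_nonneg Y).trans hb₁
  have en : n = √n ^ 2 := (Real.sq_sqrt hn.le).symm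
  have hDr : 0 ≤ D ^ r := Real.rpow_nonneg hD r
  have hTD : 0 ≤ T ^ (r - 1) / √N * D := by positivity
  have hT1 : T ^ (r - 1) ≤ Bt * √n ^ (r - 1) := by
    calc T ^ (r - 1) ≤ (Bt * √n) ^ (r - 1) := Real.rpow_le_rpow hT0.le hTB (by linarith)
      _ = Bt ^ (r - 1) * √n ^ (r - 1) := Real.mul_rpow (by linarith) hs.le
      _ ≤ Bt ^ (1 : ℝ) * √n ^ (r - 1) := by
          gcongr
          linarith
      _ = _ := by rw [Real.rpow_one]
  have hC0 : 0 ≤ 2 * √C₂ / z₀ := by positivity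
  have hB0 : 0 ≤ Bt / z₀ ^ 2 := by positivity
  have hB1 : 0 ≤ Bt * b₁ := by positivity
  set x := T ^ (r - 1) / √N * D with hx
  -- For `D ≤ √n` the increment is expanded, and `D²` is traded for `D^r √n^{2-r}`. For larger `D`
  -- the trivial bound `|Y| ≤ b₁` suffices, because `√n T^{r-1}` is then at most `Bt D^r`.
  rcases le_total D √n with hDn | hDn
  · have ha' : |a| ≤ √C₂ * (√n / √N) := by
      have := Real.sqrt_le_sqrt ha
      rwa [Real.sqrt_sq_eq_abs, Real.sqrt_mul hC₂, Real.sqrt_div hn.le] at this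
    have t1 : |lam| * (2 * |a| * |η| / n) ≤ c * (2 * √C₂ / z₀ * x) := by
      calc |lam| * (2 * |a| * |η| / n)
          ≤ |lam| * (2 * (√C₂ * (√n / √N)) * (D / z₀) / n) := by gcongr
        _ = _ := by rw [hlam, en, Real.sqrt_sq hs.le, hx]; field_simp
    have hD2 : D ^ 2 ≤ D ^ r * √n ^ (2 - r) := by
      rcases hD.eq_or_lt with h0 | h0
      · rw [← h0]; simp; positivity
      · calc D ^ 2 = D ^ r * D ^ (2 - r) := by
              rw [← Real.rpow_add h0, ← Real.rpow_natCast]; congr 1; push_cast; ring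
          _ ≤ _ := by
              gcongr
    have hpow : √n * √n ^ (r - 1) * √n ^ (2 - r) = √n ^ 2 := by
      rw [← Real.rpow_one_add' hs.le (by linarith), ← Real.rpow_add hs, ← Real.rpow_natCast]
      congr 1; push_cast; ring
    have t2 : |lam| * (|η| ^ 2 / n) ≤ c * (Bt / z₀ ^ 2 * D ^ r) := by
      calc |lam| * (|η| ^ 2 / n) ≤ |lam| * ((D / z₀) ^ 2 / n) := by gcongr
        _ = c * (√n * T ^ (r - 1)) / (z₀ ^ 2 * n) * D ^ 2 := by rw [hlam]; field_simp
        _ ≤ c * (√n * (Bt * √n ^ (r - 1))) / (z₀ ^ 2 * n) * (D ^ r * √n ^ (2 - r)) := by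
            gcongr
        _ = c * Bt / (z₀ ^ 2 * n) * (√n * √n ^ (r - 1) * √n ^ (2 - r)) * D ^ r := by ring
        _ = _ := by rw [hpow, ← en]; field_simp
    calc |lam| * |Y| ≤ |lam| * ((2 * |a| * |η| + |η| ^ 2) / n + θ) := by gcongr
      _ = |lam| * (2 * |a| * |η| / n) + |lam| * (|η| ^ 2 / n) + |lam| * θ := by ring
      _ ≤ c * (2 * √C₂ / z₀ * x) + c * (Bt / z₀ ^ 2 * D ^ r) + c * (L₃ * x + L₄) := by
          gcongr
      _ = c * (2 * √C₂ / z₀ * x + Bt / z₀ ^ 2 * D ^ r + L₃ * x + L₄) := by ring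
      _ ≤ _ := mul_le_mul_of_nonneg_left
          (sum_le_mul_sum hC0 hB0 hB1 hL₃ hL₄ hTD hDr).1 hc.le
  · have t1 : √n * T ^ (r - 1) ≤ Bt * D ^ r := by
      calc √n * T ^ (r - 1) ≤ √n * (Bt * √n ^ (r - 1)) := by gcongr
        _ = Bt * √n ^ r := by
            have : √n ^ r = √n * √n ^ (r - 1) := by
              rw [← Real.rpow_one_add' hs.le (by linarith)]; congr 1; ring
            rw [this]; ring
        _ ≤ _ := by gcongr
    calc |lam| * |Y| ≤ c * (Bt * D ^ r) * b₁ := by rw [hlam]; gcongr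
      _ = c * (Bt * b₁ * D ^ r) := by ring
      _ ≤ _ := mul_le_mul_of_nonneg_left
          (sum_le_mul_sum hC0 hB0 hB1 hL₃ hL₄ hTD hDr).2 hc.le

set_option maxHeartbeats 2000000 in
/-- Exponential moment of the dependence of a resolvent quadratic form on one column. -/
theorem exists_coord_mgf {q κ B z₀ ν C₂ Bt ε : ℝ} (hq : 0 < q) (hq2 : q ≤ 2) (hκ : 0 < κ)
    (hz₀ : 0 < z₀) (hν : 0 < ν) (hC₂ : 0 ≤ C₂) (hBt : 1 ≤ Bt) (hε : 0 < ε) :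
    ∃ c : ℝ, 0 < c ∧ ∀ {p : ℕ} (μ : Measure (EuclideanSpace ℝ (Fin p))),
      LawReg μ q (max q 1) κ B →
      ∀ (S Q : EuclideanSpace ℝ (Fin p) →ₗ[ℝ] EuclideanSpace ℝ (Fin p)) (z : ℝ), IsRes S Q z →
      z₀ ≤ z → ∀ (v : EuclideanSpace ℝ (Fin p)) (n N T lam : ℝ), ‖v‖ = 1 → ν * √n ≤ N →
      1 ≤ N → N ≤ n → 1 ≤ T → T ≤ Bt * √n → |lam| = c * (√n * T ^ (max q 1 - 1)) →
      ⟪∫ y, y ∂μ, Q v⟫ ^ 2 ≤ C₂ * (n / N) →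
      ∫ y, Real.exp (lam * (⟪y, Q v⟫ ^ 2 / (n + ⟪y, Q y⟫) -
        ∫ y, ⟪y, Q v⟫ ^ 2 / (n + ⟪y, Q y⟫) ∂μ)) ∂μ ≤
          Real.exp (ε * (c * (T ^ max q 1 / N))) := by
  obtain ⟨K₄, hK₄, hmom⟩ := ExpBdd.moment B hq hκ 4
  set r := max q 1 with hr
  have hr1 : 1 ≤ r := le_max_right _ _
  have hr2 : r ≤ 2 := max_le hq2 (by norm_num)
  have hr0 : 0 < r := by linarith
  set B' := max (2 * B) (max K₄ 1) with hB'
  have hB'1 : 1 ≤ B' := (le_max_right _ _).trans (le_max_right _ _)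
  have h2r : (0 : ℝ) < 2 ^ r := by positivity
  set κ' := κ / (2 * 2 ^ r) with hκ'
  have hκ'0 : 0 < κ' := by positivity
  have hκ'κ : κ' ≤ κ := by
    rw [hκ', div_le_iff₀ (by positivity)]
    have : (1 : ℝ) ≤ 2 ^ r := Real.one_le_rpow (by norm_num) hr0.le
    nlinarith
  set L := 2 * √C₂ / z₀ + 1 / z₀ ^ 2 + C₂ / √z₀ with hL
  set L' := 2 * √C₂ / z₀ + Bt / z₀ ^ 2 + Bt * (1 / z₀ + C₂) + C₂ / √z₀ + C₂ / ν with hL'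
  have hsz : 0 < √z₀ := Real.sqrt_pos.2 hz₀
  have hL0 : 0 < L := by positivity
  have hL'0 : 0 < L' := by positivity
  obtain ⟨c, hc, hmain⟩ := exists_mgf_bound (A := L ^ 2 + L') hr1 hr2 hκ'0 hB'1
    (by positivity) hε
  refine ⟨c, hc, fun {p} μ hμ S Q z hQ hz v n N T lam hv hNn hN hNn' hT hTB hlam ha => ?_⟩
  have := hμ.prob
  have hz0 : 0 < z := hQ.pos
  have hn : 0 < n := by linarith
  have hs : 0 < √n := Real.sqrt_pos.2 hn
  have hszz : √z₀ ≤ √z := Real.sqrt_le_sqrt hz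
  have hQc : Continuous Q := Q.continuous_of_finiteDimensional
  obtain ⟨ρ, hρ, hρE⟩ := hμ.exists_sqrt_inner hQ
  set m := ∫ y, y ∂μ with hm
  set a := ⟪m, Q v⟫ with ha_def
  -- `X` governs the numerator, with exponential moments of order `r`, and `V` the denominator, with
  -- order `q` only. The factors `z` and `√z` normalize both to Lipschitz constant at most one.
  set X : EuclideanSpace ℝ (Fin p) → ℝ := fun y => ⟪z • Q v, y - m⟫ with hX
  set V : EuclideanSpace ℝ (Fin p) → ℝ := fun y => √z * (√⟪y, Q y⟫ - ρ) with hV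
  have hXE : ExpBdd μ X r κ B := by
    refine hμ.lin _ ?_
    rw [norm_smul, Real.norm_of_nonneg hz0.le]
    have := hQ.norm_le v
    rw [hv, le_div_iff₀ hz0] at this
    linarith
  have hXm : Measurable X := Continuous.measurable (by fun_prop)
  have hVm : Measurable V := Continuous.measurable (by fun_prop)
  have hB1 := hXE.one_le hκ.le
  obtain ⟨hV4i, hV4⟩ := hmom μ V hVm hρE
  set ψ : EuclideanSpace ℝ (Fin p) → ℝ := fun y => ⟪y, Q v⟫ ^ 2 / (n + ⟪y, Q y⟫) with hψ
  have hψm : Measurable ψ :=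
    Measurable.div (Continuous.measurable (by fun_prop)) (Continuous.measurable (by fun_prop))
  -- Subtracting a constant does not change the centred variable; this one is the value of `ψ` with
  -- the numerator at the mean and the denominator at its pivot, so `Y` is small.
  set Y : EuclideanSpace ℝ (Fin p) → ℝ := fun y => ψ y - a ^ 2 / (n + ρ ^ 2) with hY
  have hψY : ∀ y, ψ y - ∫ y, ψ y ∂μ = Y y - ∫ y, Y y ∂μ := by
    intro y
    have hψi : Integrable ψ μ := by
      refine integrable_of_abs_le (B := 1 / z) hψm fun y => ?_
      have h1 := hQ.inner_nonneg y
      have h2 := hQ.cauchy y v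
      have h3 := hQ.inner_le v
      rw [hv, one_pow] at h3
      rw [abs_of_nonneg (by positivity), div_le_iff₀ (by positivity)]
      nlinarith [mul_le_mul_of_nonneg_left h3 h1, mul_pos (one_div_pos.2 hz0) hn]
    rw [hY, integral_sub hψi (integrable_const _)]
    simp
  have hψ0 : ∀ y, 0 ≤ ψ y ∧ ψ y ≤ 1 / z₀ := by
    intro y
    have h1 := hQ.inner_nonneg y
    have h2 := hQ.cauchy y v
    have h3 := hQ.inner_le v
    rw [hv, one_pow] at h3
    have h4 : 1 / z ≤ 1 / z₀ := by gcongr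
    refine ⟨by positivity, ?_⟩
    rw [div_le_iff₀ (by positivity)]
    nlinarith [mul_le_mul_of_nonneg_left (h3.trans h4) h1, mul_pos (one_div_pos.2 hz₀) hn]
  have hab : 0 ≤ a ^ 2 / (n + ρ ^ 2) ∧ a ^ 2 / (n + ρ ^ 2) ≤ C₂ := by
    refine ⟨by positivity, ?_⟩
    rw [div_le_iff₀ (by positivity)]
    have h1 : n / N ≤ n := div_le_self hn.le hN
    nlinarith [sq_nonneg ρ, mul_le_mul_of_nonneg_left h1 hC₂, mul_nonneg hC₂ (sq_nonneg ρ)]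
  have hYb : ∀ y, |Y y| ≤ 1 / z₀ + C₂ := by
    intro y
    have h1 := hψ0 y
    have h2 := hab
    have : 0 < 1 / z₀ := by positivity
    rw [abs_le]
    constructor <;> simp only [hY] <;> linarith
  have hYm : Measurable Y := hψm.sub_const _
  have hη : ∀ y, |⟪y - m, Q v⟫| ≤ |X y| / z₀ := by
    intro y
    rw [le_div_iff₀ hz₀]
    have : |X y| = z * |⟪y - m, Q v⟫| := by
      rw [hX]
      simp only
      rw [real_inner_smul_left, abs_mul, abs_of_pos hz0, real_inner_comm]
    rw [this, mul_comm]
    gcongr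
  have hw : ∀ y, |√⟪y, Q y⟫ - ρ| ≤ |V y| / √z₀ := by
    intro y
    rw [le_div_iff₀ hsz]
    have : |V y| = √z * |√⟪y, Q y⟫ - ρ| := by
      rw [hV]
      simp only
      rw [abs_mul, abs_of_nonneg (Real.sqrt_nonneg z)]
    rw [this, mul_comm]
    gcongr
  have hYle : ∀ y, |Y y| ≤ (2 * |a| * |⟪y - m, Q v⟫| + |⟪y - m, Q v⟫| ^ 2) / n +
      min (a ^ 2 / n * (|√⟪y, Q y⟫ - ρ| / √n)) (a ^ 2 / n) := by
    intro y
    have h1 := abs_ratio_sub_le (a := a) (η := ⟪y - m, Q v⟫) hn (Real.sqrt_nonneg ⟪y, Q y⟫) hρ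
    rw [Real.sq_sqrt (hQ.inner_nonneg y)] at h1
    have h2 : a + ⟪y - m, Q v⟫ = ⟪y, Q v⟫ := by rw [inner_sub_left, ha_def]; ring
    rwa [h2] at h1
  have hX0 : ∀ y, 0 ≤ |X y| := fun y => abs_nonneg _
  have hV0 : ∀ y, 0 ≤ |V y| := fun y => abs_nonneg _
  have hLsum : 0 ≤ T ^ (r - 1) / √N := by positivity
  change ∫ y, Real.exp (lam * (ψ y - ∫ y, ψ y ∂μ)) ∂μ ≤ _
  simp only [hψY]
  have han : a ^ 2 / n ≤ C₂ / N := by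
    rw [div_le_iff₀ hn]
    calc a ^ 2 ≤ _ := ha
      _ = _ := by ring
  have hfin : ∀ D : EuclideanSpace ℝ (Fin p) → ℝ, Measurable D → (∀ y, |X y| ≤ D y) →
      ExpBdd μ D r κ' B' →
      (∀ y, |lam| * min (a ^ 2 / n * (|√⟪y, Q y⟫ - ρ| / √n)) (a ^ 2 / n) ≤
        c * (C₂ / √z₀ * (T ^ (r - 1) / √N * D y) + C₂ / ν)) →
      ∫ y, Real.exp (lam * (Y y - ∫ y, Y y ∂μ)) ∂μ ≤ Real.exp (ε * (c * (T ^ r / N))) := by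
    intro D hDm hXD hDE hθ
    have hD0 : ∀ y, 0 ≤ D y := fun y => (abs_nonneg _).trans (hXD y)
    have hηD : ∀ y, |⟪y - m, Q v⟫| ≤ D y / z₀ := fun y =>
      (hη y).trans (by have := hXD y; gcongr)
    refine hmain μ Y D (fun y => |V y|) (1 / z₀ + C₂) n N T lam hYm hDm hYb hD0 hN hn hT
      hlam hDE hV4i (hV4.trans ((le_max_left _ _).trans (le_max_right _ _))) (fun y => ?_)
      fun y => ?_
    · have h1 := sq_le_of_abs_le (Y := Y y) (d := |V y|) hn hN hNn' hz₀ hC₂ ha (hD0 y) (hV0 y)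
        (hηD y) (abs_nonneg _) (hw y)
        ((hYle y).trans (add_le_add_right (min_le_left _ _) _))
      refine h1.trans ?_
      have hNp : 0 < N := by linarith
      gcongr
      linarith
    · have h1 := mul_abs_le_of_abs_le (Y := Y y) hr1 hr2 hn hN hc hT hBt hTB hz₀ hC₂ ha (hD0 y)
        (hηD y) hlam (hYb y) (by positivity : 0 ≤ C₂ / √z₀) (by positivity : 0 ≤ C₂ / ν)
        (hYle y) (hθ y)
      refine h1.trans ?_
      have h2 : 0 ≤ T ^ (r - 1) / √N * D y + D y ^ r + 1 := by
        have := hD0 y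
        positivity
      refine mul_le_mul_of_nonneg_left (mul_le_mul_of_nonneg_right ?_ h2) hc.le
      exact le_add_of_nonneg_left (sq_nonneg L)
  have hNp : 0 < N := by linarith
  -- For `q ≥ 1` both `X` and `V` have moments of order `r = q` and `D` is their sum. For `q < 1`
  -- only `X` has moments of order `r = 1`: the motion of the denominator is then bounded by `a² / n
  -- ≤ C₂ / N`, and `√n / N ≤ 1 / ν` keeps it bounded after multiplication by `lam`. `V` survives
  -- only in the variance, through its fourth moment.
  rcases le_total 1 q with h1q | h1q
  · have hrq : r = q := max_eq_left h1q
    rw [← hrq] at hρE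
    refine hfin (fun y => |X y| + |V y|) (hXm.abs.add hVm.abs)
      (fun y => le_add_of_nonneg_right (hV0 y))
      ((hXE.abs_add_abs hXm hr0 hκ hρE).mono le_rfl (le_max_left _ _)) fun y => ?_
    have hsN : 0 < √N := Real.sqrt_pos.2 hNp
    have hsNN : √N ≤ N := by
      rw [Real.sqrt_le_left (by linarith)]; nlinarith
    calc |lam| * min (a ^ 2 / n * (|√⟪y, Q y⟫ - ρ| / √n)) (a ^ 2 / n)
        ≤ |lam| * (a ^ 2 / n * (|√⟪y, Q y⟫ - ρ| / √n)) := by gcongr; exact min_le_left _ _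
      _ ≤ |lam| * (C₂ / N * ((|V y| / √z₀) / √n)) := by
          have := hw y
          gcongr
      _ = c * (C₂ / √z₀ * (T ^ (r - 1) / N * |V y|)) := by rw [hlam]; field_simp
      _ ≤ c * (C₂ / √z₀ * (T ^ (r - 1) / √N * (|X y| + |V y|))) := by
          have := hX0 y
          gcongr
          linarith
      _ ≤ _ := by
          refine mul_le_mul_of_nonneg_left (le_add_of_nonneg_right (by positivity)) hc.le
  · have hrq : r = 1 := max_eq_right h1q
    refine hfin (fun y => |X y|) hXm.abs (fun y => le_rfl) ?_ fun y => ?_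
    · have : ExpBdd μ (fun y => |X y|) r κ B := by
        unfold ExpBdd at hXE ⊢
        simpa only [abs_abs] using hXE
      exact this.mono hκ'κ ((by linarith : B ≤ 2 * B).trans (le_max_left _ _))
    · calc |lam| * min (a ^ 2 / n * (|√⟪y, Q y⟫ - ρ| / √n)) (a ^ 2 / n)
          ≤ |lam| * (C₂ / N) := by gcongr; exact (min_le_right _ _).trans han
        _ = c * (C₂ * √n / N) := by rw [hlam, hrq]; simp; ring
        _ ≤ c * (C₂ / ν) := by
            refine mul_le_mul_of_nonneg_left ?_ hc.le
            rw [div_le_div_iff₀ hNp hν]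
            calc C₂ * √n * ν = C₂ * (ν * √n) := by ring
              _ ≤ C₂ * N := by gcongr
        _ ≤ _ := by
            have := hX0 y
            refine mul_le_mul_of_nonneg_left (le_add_of_nonneg_left (by positivity)) hc.le

end Coordinate

/-! ### Norms of centred sums of independent columns. -/

section NormSum

open scoped RealInnerProductSpace

variable {p : ℕ}

theorem qLip_norm_sum (a : EuclideanSpace ℝ (Fin p)) (m : ℕ) :
    QLip fun Y : Fin m → EuclideanSpace ℝ (Fin p) => (√m)⁻¹ * ‖∑ j, (Y j - a)‖ := by
  constructor
  · intro r Y hY Y' hY' s t hs ht hst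
    simp only [Set.mem_ofPred_eq, Pi.add_apply, Pi.smul_apply] at *
    have h1 : ∑ j, (s • Y j + t • Y' j - a) = s • ∑ j, (Y j - a) + t • ∑ j, (Y' j - a) := by
      rw [Finset.smul_sum, Finset.smul_sum, ← Finset.sum_add_distrib]
      refine Finset.sum_congr rfl fun j _ => ?_
      have : a = s • a + t • a := by rw [← add_smul, hst, one_smul]
      nth_rewrite 1 [this]
      rw [smul_sub, smul_sub]
      abel
    rw [h1]
    have h2 := norm_add_le (s • ∑ j, (Y j - a)) (t • ∑ j, (Y' j - a))
    rw [norm_smul, norm_smul, Real.norm_of_nonneg hs, Real.norm_of_nonneg ht] at h2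
    have h3 : (0 : ℝ) ≤ (√m)⁻¹ := by positivity
    calc (√m)⁻¹ * ‖s • ∑ j, (Y j - a) + t • ∑ j, (Y' j - a)‖
        ≤ (√m)⁻¹ * (s * ‖∑ j, (Y j - a)‖ + t * ‖∑ j, (Y' j - a)‖) := by gcongr
      _ = s * ((√m)⁻¹ * ‖∑ j, (Y j - a)‖) + t * ((√m)⁻¹ * ‖∑ j, (Y' j - a)‖) := by ring
      _ ≤ s * r + t * r := by gcongr
      _ = r := by rw [← add_mul, hst, one_mul]
  · intro Y Y'
    rw [← mul_sub, abs_mul, abs_of_nonneg (by positivity)]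
    have h1 : |‖∑ j, (Y j - a)‖ - ‖∑ j, (Y' j - a)‖| ≤ √m * √(∑ j, ‖Y j - Y' j‖ ^ 2) := by
      refine (abs_norm_sub_norm_le _ _).trans ?_
      rw [← Finset.sum_sub_distrib]
      simp only [sub_sub_sub_cancel_right]
      exact (norm_sum_le _ _).trans (sum_norm_le_sqrt_mul_sqrt _)
    calc (√m)⁻¹ * |‖∑ j, (Y j - a)‖ - ‖∑ j, (Y' j - a)‖|
        ≤ (√m)⁻¹ * (√m * √(∑ j, ‖Y j - Y' j‖ ^ 2)) := by gcongr
      _ = ((√m)⁻¹ * √m) * √(∑ j, ‖Y j - Y' j‖ ^ 2) := by ring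
      _ ≤ 1 * √(∑ j, ‖Y j - Y' j‖ ^ 2) := by
          gcongr
          exact inv_mul_le_one
      _ = _ := one_mul _

/-- Norms of normalized centered sums concentrate around a value of order `√n`. -/
theorem exists_norm_sum {q κ : ℝ} (B Γ : ℝ) (hq : 0 < q) (hκ : 0 < κ) :
    ∃ G : ℝ, 0 < G ∧ ∀ {p : ℕ} (μ : Measure (EuclideanSpace ℝ (Fin p))) (r n : ℝ),
      LawReg μ q r κ B → 1 ≤ n → p ≤ Γ * n → ∀ m : ℕ, 0 < m →
      ∃ ρ, 0 ≤ ρ ∧ ρ ≤ G * √n ∧ ExpBdd (Measure.pi fun _ : Fin m => μ)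
        (fun Y => (√m)⁻¹ * ‖∑ j, (Y j - ∫ y, y ∂μ)‖ - ρ) q κ B := by
  obtain ⟨K, hK, hmom⟩ := ExpBdd.moment B hq hκ 2
  refine ⟨√(2 * (|Γ| * K) + 2 * K), by positivity, fun {p} μ r n hμ hn hpn m hm => ?_⟩
  have := hμ.prob
  set a := ∫ y, y ∂μ with ha
  obtain ⟨Y₀, hY⟩ := hμ.conv m _ (qLip_norm_sum a m)
  set h : (Fin m → EuclideanSpace ℝ (Fin p)) → ℝ := fun Y => (√m)⁻¹ * ‖∑ j, (Y j - a)‖ with hh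
  have hhm : Measurable h := (qLip_norm_sum a m).continuous.measurable
  have h0 : ∀ Y, 0 ≤ h Y := fun Y => by positivity
  refine ⟨h Y₀, h0 _, ?_, hY⟩
  obtain ⟨hi1, hb1⟩ := hmom _ _ (hhm.sub_const (h Y₀)) hY
  have hcoord : ∀ i : Fin p, Integrable (fun Y : Fin m → EuclideanSpace ℝ (Fin p) =>
      |(√m)⁻¹ * ∑ j, ⟪EuclideanSpace.basisFun (Fin p) ℝ i, Y j - a⟫| ^ 2)
      (Measure.pi fun _ : Fin m => μ) ∧ ∫ Y : Fin m → EuclideanSpace ℝ (Fin p),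
      |(√m)⁻¹ * ∑ j, ⟪EuclideanSpace.basisFun (Fin p) ℝ i, Y j - a⟫| ^ 2
        ∂(Measure.pi fun _ : Fin m => μ) ≤ K := by
    intro i
    refine hmom _ (fun Y : Fin m → EuclideanSpace ℝ (Fin p) =>
      (√m)⁻¹ * ∑ j, ⟪EuclideanSpace.basisFun (Fin p) ℝ i, Y j - a⟫)
      (Continuous.measurable (by fun_prop))
      (hμ.sum m hm _ ((EuclideanSpace.basisFun (Fin p) ℝ).orthonormal.1 i).le)
  have hsq : ∀ Y, h Y ^ 2 =
      ∑ i, |(√m)⁻¹ * ∑ j, ⟪EuclideanSpace.basisFun (Fin p) ℝ i, Y j - a⟫| ^ 2 := by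
    intro Y
    rw [hh]
    simp only
    rw [mul_pow, ← (EuclideanSpace.basisFun (Fin p) ℝ).sum_sq_norm_inner_right, Finset.mul_sum]
    refine Finset.sum_congr rfl fun i _ => ?_
    rw [sq_abs, mul_pow, inner_sum, Real.norm_eq_abs, sq_abs]
  have hhi : Integrable (fun Y => h Y ^ 2) (Measure.pi fun _ : Fin m => μ) := by
    simp only [hsq]
    exact integrable_finsetSum _ fun i _ => (hcoord i).1
  have hhb : ∫ Y, h Y ^ 2 ∂(Measure.pi fun _ : Fin m => μ) ≤ p * K := by
    simp only [hsq]
    rw [integral_finsetSum _ fun i _ => (hcoord i).1]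
    calc _ ≤ ∑ i : Fin p, K := Finset.sum_le_sum fun i _ => (hcoord i).2
      _ = _ := by simp
  -- The pivot is compared with `h` in mean square. Summing over an orthonormal basis gives `𝔼 h² ≤
  -- p K`, which is of order `n`.
  have hsum : h Y₀ ^ 2 ≤ 2 * (p * K) + 2 * K := by
    calc h Y₀ ^ 2 = ∫ _, h Y₀ ^ 2 ∂(Measure.pi fun _ : Fin m => μ) := by simp
      _ ≤ ∫ Y, (2 * h Y ^ 2 + 2 * |h Y - h Y₀| ^ 2) ∂(Measure.pi fun _ : Fin m => μ) := by
          refine integral_mono (integrable_const _) ((hhi.const_mul 2).add (hi1.const_mul 2))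
            fun Y => ?_
          simp only [sq_abs]
          nlinarith [sq_nonneg (2 * h Y - h Y₀)]
      _ = 2 * ∫ Y, h Y ^ 2 ∂(Measure.pi fun _ : Fin m => μ) +
          2 * ∫ Y, |h Y - h Y₀| ^ 2 ∂(Measure.pi fun _ : Fin m => μ) := by
          rw [integral_add (hhi.const_mul 2) (hi1.const_mul 2), integral_const_mul,
            integral_const_mul]
      _ ≤ _ := by gcongr
  rw [← Real.sqrt_mul (by positivity)]
  refine Real.le_sqrt_of_sq_le (hsum.trans ?_)
  have h1 : (p : ℝ) ≤ |Γ| * n := hpn.trans (by gcongr; exact le_abs_self Γ)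
  calc 2 * (p * K) + 2 * K ≤ 2 * (|Γ| * n * K) + 2 * K * n := by
        refine add_le_add (by gcongr) ?_
        exact le_mul_of_one_le_right (by positivity) hn
    _ = _ := by ring

/-- The same for the sum of the members of a set of columns with a common law. -/
theorem expBdd_norm_sum_of_subset {n : ℕ} {ν : Fin n → Measure (EuclideanSpace ℝ (Fin p))}
    [∀ i, IsProbabilityMeasure (ν i)] {μ : Measure (EuclideanSpace ℝ (Fin p))} {J : Finset (Fin n)}
    (hJ : ∀ j ∈ J, ν j = μ) {a : EuclideanSpace ℝ (Fin p)} {ρ q κ B : ℝ}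
    (h : ExpBdd (Measure.pi fun _ : Fin J.card => μ)
        (fun Y => (√J.card)⁻¹ * ‖∑ j, (Y j - a)‖ - ρ) q κ B) :
    ExpBdd (Measure.pi ν) (fun x => (√J.card)⁻¹ * ‖∑ j ∈ J, (x j - a)‖ - ρ) q κ B := by
  set f : Fin J.card ≃ J := J.equivFin.symm with hf
  have hmp := measurePreserving_comp_injective ν (f := fun i => (f i : Fin n))
    (Subtype.val_injective.comp f.injective)
  have hν : (fun i => ν (f i)) = fun _ => μ := funext fun i => hJ _ (f i).2
  rw [show (Measure.pi fun j => ν (f j)) = Measure.pi fun _ : Fin J.card => μ by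
    congr] at hmp
  unfold ExpBdd at *
  rw [← hmp.lintegral_comp] at h
  · convert h using 8 with x
    simp only
    rw [← Finset.sum_coe_sort, ← f.sum_comp]
  · refine Measurable.ennreal_ofReal (Measurable.exp (Measurable.const_mul
      (Measurable.pow_const (Measurable.abs ?_) _) _))
    exact Continuous.measurable (by fun_prop)

end NormSum

/-! ### Jensen, Chernoff, and partial averages over half of the coordinates. -/

section Averages

/-- Jensen's inequality for exponential moments of absolutely subconvex combinations. -/
theorem integral_exp_sum_le {Ω ι : Type*} [MeasurableSpace Ω] {P : Measure Ω}
    [IsProbabilityMeasure P] [Fintype ι] {a : ι → ℝ} {X : ι → Ω → ℝ} {lam E b : ℝ}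
    (ha : ∑ k, |a k| ≤ 1) (hX : ∀ k, Measurable (X k)) (hb : ∀ k ω, |X k ω| ≤ b) (hE : 1 ≤ E)
    (h : ∀ k s, |s| = |lam| → ∫ ω, Real.exp (s * X k ω) ∂P ≤ E) :
    ∫ ω, Real.exp (lam * ∑ k, a k * X k ω) ∂P ≤ E := by
  -- The signs of the weights are moved into the parameter, leaving a convex combination.
  set s : ι → ℝ := fun k => if 0 ≤ a k then lam else -lam with hs
  have hsa : ∀ k, |s k| = |lam| := by
    intro k
    simp only [hs]
    split_ifs <;> simp
  have hsum : ∀ ω, lam * ∑ k, a k * X k ω = ∑ k, |a k| * (s k * X k ω) := by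
    intro ω
    rw [Finset.mul_sum]
    refine Finset.sum_congr rfl fun k _ => ?_
    simp only [hs]
    split_ifs with h1
    · rw [abs_of_nonneg h1]; ring
    · rw [abs_of_neg (not_le.1 h1)]; ring
  have hpt : ∀ ω, Real.exp (lam * ∑ k, a k * X k ω) ≤
      (1 - ∑ k, |a k|) + ∑ k, |a k| * Real.exp (s k * X k ω) := by
    intro ω
    -- The extra index carries the missing mass `1 - ∑ |a k|`, placed at the point `0`.
    have hconv := convexOn_exp.map_sum_le (t := (Finset.univ : Finset (Option ι)))
      (w := fun o => o.elim (1 - ∑ k, |a k|) fun k => |a k|)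
      (p := fun o => o.elim 0 fun k => s k * X k ω) ?_ ?_ (fun _ _ => Set.mem_univ _)
    · simpa [Fintype.sum_option, hsum] using hconv
    · rintro (_ | k) _
      · simpa using ha
      · exact abs_nonneg _
    · simp [Fintype.sum_option]
  have hint : ∀ k, Integrable (fun ω => Real.exp (s k * X k ω)) P := by
    intro k
    refine integrable_of_abs_le (B := Real.exp (|lam| * b)) ((hX k).const_mul _).exp fun ω => ?_
    rw [abs_of_pos (Real.exp_pos _), Real.exp_le_exp]
    calc s k * X k ω ≤ |s k * X k ω| := le_abs_self _
      _ = |lam| * |X k ω| := by rw [abs_mul, hsa]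
      _ ≤ _ := by gcongr; exact hb k ω
  have hint2 : Integrable (fun ω => ∑ k, |a k| * Real.exp (s k * X k ω)) P :=
    integrable_finsetSum _ fun k _ => (hint k).const_mul _
  calc _ ≤ ∫ ω, ((1 - ∑ k, |a k|) + ∑ k, |a k| * Real.exp (s k * X k ω)) ∂P :=
        integral_mono_of_nonneg (Filter.Eventually.of_forall fun _ => (Real.exp_pos _).le)
          ((integrable_const _).add hint2) (Filter.Eventually.of_forall hpt)
    _ = (1 - ∑ k, |a k|) + ∑ k, |a k| * ∫ ω, Real.exp (s k * X k ω) ∂P := by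
        rw [integral_add (integrable_const _) hint2,
          integral_finsetSum _ fun k _ => (hint k).const_mul _]
        simp [integral_const_mul]
    _ ≤ (1 - ∑ k, |a k|) * E + ∑ k, |a k| * E := by
        gcongr with k
        · nlinarith
        · exact h k _ (hsa k)
    _ = E := by rw [← Finset.sum_mul]; ring

/-- Two-sided Chernoff bound. -/
theorem measure_abs_ge_le_of_mgf {Ω : Type*} [MeasurableSpace Ω] {P : Measure Ω}
    [IsProbabilityMeasure P] {X : Ω → ℝ} (hX : Measurable X) {b lam t β : ℝ}
    (hb : ∀ ω, |X ω| ≤ b) (hlam : 0 ≤ lam)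
    (h : ∀ s, |s| = lam → ∫ ω, Real.exp (s * X ω) ∂P ≤ Real.exp β) :
    P {ω | t ≤ |X ω|} ≤ ENNReal.ofReal (2 * Real.exp (β - lam * t)) := by
  have hint : ∀ s, Integrable (fun ω => Real.exp (s * X ω)) P := by
    intro s
    refine integrable_of_abs_le (B := Real.exp (|s| * b)) (hX.const_mul _).exp fun ω => ?_
    rw [abs_of_pos (Real.exp_pos _), Real.exp_le_exp]
    calc s * X ω ≤ |s * X ω| := le_abs_self _
      _ = |s| * |X ω| := by rw [abs_mul]
      _ ≤ _ := by gcongr; exact hb ω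
  have h1 : P.real {ω | t ≤ X ω} ≤ Real.exp (β - lam * t) := by
    have := measure_ge_le_exp_mul_mgf (μ := P) t hlam (hint lam)
    refine this.trans ?_
    rw [sub_eq_add_neg, Real.exp_add, mul_comm, neg_mul]
    gcongr
    exact h _ (abs_of_nonneg hlam)
  have h2 : P.real {ω | X ω ≤ -t} ≤ Real.exp (β - lam * t) := by
    have := measure_le_le_exp_mul_mgf (μ := P) (t := -lam) (-t) (by linarith) (hint (-lam))
    refine this.trans ?_
    rw [sub_eq_add_neg, Real.exp_add, mul_comm, neg_neg, mul_neg]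
    gcongr
    exact h _ (by rw [abs_neg, abs_of_nonneg hlam])
  have h3 : {ω | t ≤ |X ω|} ⊆ {ω | t ≤ X ω} ∪ {ω | X ω ≤ -t} := by
    intro ω hω
    simp only [Set.mem_ofPred_eq, Set.mem_union, le_abs'] at hω ⊢
    exact hω.symm
  have h4 := (measureReal_mono h3 (μ := P)).trans (measureReal_union_le _ _)
  rw [← ofReal_measureReal]
  exact ENNReal.ofReal_le_ofReal (by linarith)

variable {ι α : Type*} [Fintype ι] [DecidableEq ι] [MeasurableSpace α] (μ : ι → Measure α)

theorem avg_piecewise (S : Finset ι) (f : (ι → α) → ℝ) (x x' : ι → α) :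
    avg μ S f (S.piecewise x' x) = avg μ S f x := by
  unfold avg
  congr 1
  ext y
  congr 1
  ext j
  by_cases hj : j ∈ S <;> simp [hj]

theorem avg_compl_piecewise (S : Finset ι) (f : (ι → α) → ℝ) (x x' : ι → α) :
    avg μ Sᶜ f (S.piecewise x' x) = avg μ Sᶜ f x' := by
  unfold avg
  congr 1
  ext y
  congr 1
  ext j
  by_cases hj : j ∈ S <;> simp [hj]

variable [∀ i, IsProbabilityMeasure (μ i)]

/-- Fubini: resampling the coordinates in `S` preserves the law and, with the others frozen, leaves
the average unchanged. Frozen parts outside `A` obey the conditional bound; `A` is discarded at the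
cost of its probability. -/
theorem measure_sub_avg_le {f : (ι → α) → ℝ} (hf : Measurable f) (S : Finset ι) {t : ℝ}
    {A : Set (ι → α)} (hA : MeasurableSet A) {h b : ENNReal} (hb : Measure.pi μ A ≤ b)
    (hh : ∀ x ∉ A, Measure.pi μ {x' | t ≤ |f (S.piecewise x' x) - avg μ S f x|} ≤ h) :
    Measure.pi μ {x | t ≤ |f x - avg μ S f x|} ≤ b + h := by
  have hm : Measurable fun x => |f x - avg μ S f x| := (hf.sub (measurable_avg μ hf S)).abs
  have hms : MeasurableSet {x | t ≤ |f x - avg μ S f x|} := measurableSet_le measurable_const hm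
  have hmp := measurePreserving_piecewise μ S
  rw [← hmp.measure_preimage hms.nullMeasurableSet,
    Measure.prod_apply (hmp.measurable hms)]
  calc _ ≤ ∫⁻ x, (A.indicator 1 x + h) ∂(Measure.pi μ) := by
        refine lintegral_mono fun x => ?_
        by_cases hx : x ∈ A
        · simp only [Set.indicator_of_mem hx, Pi.one_apply]
          exact prob_le_one.trans le_self_add
        · simp only [Set.indicator_of_notMem hx, zero_add]
          refine le_trans (le_of_eq ?_) (hh x hx)
          congr 1
          ext x'
          simp only [Set.mem_preimage, Set.mem_ofPred_eq, avg_piecewise]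
    _ = Measure.pi μ A + h := by
        rw [lintegral_add_right _ measurable_const, lintegral_indicator_one hA]
        simp
    _ ≤ _ := by gcongr

/-- The mixed sample equal to `x'` on `S` and to `x` elsewhere has the same `S`-average as `x` and
the same `Sᶜ`-average as `x'`. Hence `f x` and `f x'` are joined by four deviations from averages,
each involving a point of the product law. -/
theorem measure_prod_sub_le_avg {f : (ι → α) → ℝ} (hf : Measurable f) (S : Finset ι) (t : ℝ) :
    ((Measure.pi μ).prod (Measure.pi μ)) {w | t ≤ |f w.1 - f w.2|} ≤
      2 * Measure.pi μ {x | t / 4 ≤ |f x - avg μ S f x|} +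
      2 * Measure.pi μ {x | t / 4 ≤ |f x - avg μ Sᶜ f x|} := by
  have hms : ∀ T : Finset ι, MeasurableSet {x | t / 4 ≤ |f x - avg μ T f x|} := fun T =>
    measurableSet_le measurable_const (hf.sub (measurable_avg μ hf T)).abs
  set A : Finset ι → Set (ι → α) := fun T => {x | t / 4 ≤ |f x - avg μ T f x|} with hA
  have hmp := measurePreserving_piecewise μ S
  have h1 : {w : (ι → α) × (ι → α) | t ≤ |f w.1 - f w.2|} ⊆
      (Prod.fst ⁻¹' A S ∪ (fun w => S.piecewise w.2 w.1) ⁻¹' A S) ∪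
      ((fun w => S.piecewise w.2 w.1) ⁻¹' A Sᶜ ∪ Prod.snd ⁻¹' A Sᶜ) := by
    rintro ⟨x, x'⟩ hw
    by_contra hcon
    simp only [Set.mem_union, Set.mem_preimage, hA, Set.mem_ofPred_eq, not_or, not_le,
      avg_piecewise, avg_compl_piecewise] at hcon hw
    obtain ⟨⟨h1, h2⟩, h3, h4⟩ := hcon
    rw [abs_lt] at h1 h2 h3 h4
    rcases le_abs'.1 hw with h | h <;> linarith [h1.1, h1.2, h2.1, h2.2, h3.1, h3.2, h4.1, h4.2]
  have e1 := (measurePreserving_fst (μ := Measure.pi μ) (ν := Measure.pi μ)).measure_preimage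
    (hms S).nullMeasurableSet
  have e2 := (measurePreserving_snd (μ := Measure.pi μ) (ν := Measure.pi μ)).measure_preimage
    (hms Sᶜ).nullMeasurableSet
  have e3 := hmp.measure_preimage (hms S).nullMeasurableSet
  have e4 := hmp.measure_preimage (hms Sᶜ).nullMeasurableSet
  refine (measure_mono h1).trans ((measure_union_le _ _).trans ?_)
  rw [two_mul, two_mul]
  refine add_le_add ((measure_union_le _ _).trans ?_) ((measure_union_le _ _).trans ?_)
  · exact (add_le_add e1.le e3.le)
  · exact (add_le_add e4.le e2.le)

end Averages

/-! ### Concentration of linear forms of the resolvent for `q ≤ 2`. -/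

section ResolventConcentration

open scoped RealInnerProductSpace

variable {p n k : ℕ}

/-- Take the integer half of every class; from size two on, either part holds at least a third of
the class. Each half must retain enough columns of every class to locate its mean while the other
half is averaged. -/
theorem exists_split (κ : Fin n → Fin k) (h2 : ∀ i, 2 ≤ classSize κ (κ i)) :
    ∃ S : Finset (Fin n), ∀ l,
      classSize κ l ≤ 3 * (S.filter fun i => κ i = l).card ∧
      classSize κ l ≤ 3 * (Sᶜ.filter fun i => κ i = l).card := by
  have h : ∀ l, ∃ T ⊆ Finset.univ.filter fun i => κ i = l, T.card = classSize κ l / 2 := fun l =>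
    Finset.exists_subset_card_eq (Nat.div_le_self _ _)
  choose T hT hTc using h
  refine ⟨Finset.univ.filter fun i => i ∈ T (κ i), fun l => ?_⟩
  have h0 : classSize κ l = 0 ∨ 2 ≤ classSize κ l := by
    rcases Nat.eq_zero_or_pos (classSize κ l) with h | h
    · exact Or.inl h
    · obtain ⟨i, hi⟩ := Finset.card_pos.1 h
      rw [← (Finset.mem_filter.1 hi).2]
      exact Or.inr (h2 i)
  have h1 : (Finset.univ.filter fun i => i ∈ T (κ i)).filter (fun i => κ i = l) = T l := by
    ext i
    simp only [Finset.mem_filter, Finset.mem_univ, true_and]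
    constructor
    · rintro ⟨h, rfl⟩; exact h
    · intro h
      have := (Finset.mem_filter.1 (hT l h)).2
      subst this
      exact ⟨h, rfl⟩
  have h3 : ((Finset.univ.filter fun i => i ∈ T (κ i)).filter fun i => κ i = l).card +
      ((Finset.univ.filter fun i => i ∈ T (κ i))ᶜ.filter fun i => κ i = l).card =
      classSize κ l := by
    rw [← Finset.card_union_of_disjoint, ← Finset.filter_union, Finset.union_compl]
    · rfl
    · exact (disjoint_compl_right).mono (Finset.filter_subset _ _) (Finset.filter_subset _ _)
  rw [h1] at h3 ⊢
  have := hTc l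
  omega

theorem classSize_le (κ : Fin n → Fin k) (l : Fin k) : classSize κ l ≤ n :=
  (Finset.card_le_univ _).trans (by simp)

/-- Each nonempty class contributes exactly one. Hence the costs of the individual columns add up to
a bound independent of `n`. -/
theorem sum_inv_classSize_le (κ : Fin n → Fin k) (S : Finset (Fin n)) :
    ∑ i ∈ S, (1 : ℝ) / classSize κ (κ i) ≤ k := by
  calc ∑ i ∈ S, (1 : ℝ) / classSize κ (κ i) ≤ ∑ i, (1 : ℝ) / classSize κ (κ i) :=
        Finset.sum_le_univ_sum_of_nonneg fun i => by positivity
    _ = ∑ l, ∑ i ∈ Finset.univ.filter (fun i => κ i = l), (1 : ℝ) / classSize κ (κ i) :=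
        (Finset.sum_fiberwise _ _ _).symm
    _ ≤ ∑ _l : Fin k, 1 := by
        refine Finset.sum_le_sum fun l _ => ?_
        calc ∑ i ∈ Finset.univ.filter (fun i => κ i = l), (1 : ℝ) / classSize κ (κ i)
            = ∑ i ∈ Finset.univ.filter (fun i => κ i = l), (1 : ℝ) / classSize κ l :=
              Finset.sum_congr rfl fun i hi => by rw [(Finset.mem_filter.1 hi).2]
          _ = classSize κ l * (1 / classSize κ l) := by
              rw [Finset.sum_const, nsmul_eq_mul]; rfl
          _ ≤ 1 := by
              rw [mul_one_div]
              exact div_self_le_one _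
    _ = k := by simp

/-- A vector close to an average of columns is small for the resolvent. -/
theorem mean_inner_res_le {z z₀ G : ℝ} (hz₀ : 0 < z₀) (hz : z₀ ≤ z)
    (x : Fin n → EuclideanSpace ℝ (Fin p)) (a : EuclideanSpace ℝ (Fin p)) {J : Finset (Fin n)}
    (hJ : J.Nonempty) (hG : ‖∑ j ∈ J, (x j - a)‖ ^ 2 ≤ G * n * J.card) :
    ⟪a, op (res z x) a⟫ ≤ (2 + 2 * G / z₀) * (n / J.card) := by
  have hz0 : 0 < z := by linarith
  have hR := isRes_res hz0 x
  have hn : (0 : ℝ) < n := by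
    obtain ⟨j, -⟩ := hJ
    exact_mod_cast j.pos
  have hc : (0 : ℝ) < J.card := by exact_mod_cast hJ.card_pos
  have hcancel : ∀ c : ℝ, 0 < c → c⁻¹ ^ 2 * (G * n * c) = G * (n / c) := fun c hc => by
    field_simp
  set w := (J.card : ℝ)⁻¹ • ∑ j ∈ J, x j with hw
  set d := (J.card : ℝ)⁻¹ • ∑ j ∈ J, (x j - a) with hd
  have ha : a = w + (-1 : ℝ) • d := by
    rw [hw, hd, Finset.sum_sub_distrib, smul_sub, Finset.sum_const, ← Nat.cast_smul_eq_nsmul ℝ,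
      smul_smul, inv_mul_cancel₀ hc.ne', one_smul, neg_one_smul]
    abel
  have h1 := hR.inner_mean_le hn (fun v => op_sampleCov x v) J hJ
  have h2 : ⟪d, op (res z x) d⟫ ≤ G / z₀ * (n / J.card) := by
    have h3 := hR.inner_le d
    have h4 : ‖d‖ ^ 2 ≤ G * (n / J.card) := by
      rw [hd, norm_smul, mul_pow, norm_inv, Real.norm_of_nonneg hc.le]
      calc (J.card : ℝ)⁻¹ ^ 2 * ‖∑ j ∈ J, (x j - a)‖ ^ 2
          ≤ (J.card : ℝ)⁻¹ ^ 2 * (G * n * J.card) :=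
            mul_le_mul_of_nonneg_left hG (sq_nonneg _)
        _ = _ := hcancel _ hc
    calc ⟪d, op (res z x) d⟫ ≤ ‖d‖ ^ 2 / z := h3
      _ ≤ ‖d‖ ^ 2 / z₀ := by gcongr
      _ ≤ G * (n / J.card) / z₀ := by gcongr
      _ = _ := by ring
  have h5 := hR.inner_add_le w ((-1 : ℝ) • d)
  rw [← ha] at h5
  have h6 : ⟪(-1 : ℝ) • d, op (res z x) ((-1 : ℝ) • d)⟫ = ⟪d, op (res z x) d⟫ := by
    rw [map_smul, real_inner_smul_left, real_inner_smul_right]; ring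
  rw [h6] at h5
  calc _ ≤ _ := h5
    _ ≤ 2 * (n / J.card) + 2 * (G / z₀ * (n / J.card)) := by gcongr
    _ = _ := by ring

theorem inner_res_update {z : ℝ} (hz : 0 < z) (x : Fin n → EuclideanSpace ℝ (Fin p)) (i : Fin n)
    (e v : EuclideanSpace ℝ (Fin p)) :
    ⟪v, op (res z (Function.update x i e)) v⟫ = ⟪v, op (res z (Function.update x i 0)) v⟫ -
      ⟪e, op (res z (Function.update x i 0)) v⟫ ^ 2 /
        (n + ⟪e, op (res z (Function.update x i 0)) e⟫) :=
  (isRes_res hz _).rank_one_inner (isRes_res hz _) (by exact_mod_cast i.pos) e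
    (op_sampleCov_update x i e) v

theorem continuous_quadratic {ι : Type*} [Fintype ι] {z : ℝ} (hz : 0 < z) (a : ι → ℝ)
    (v : ι → EuclideanSpace ℝ (Fin p)) :
    Continuous fun x : Fin n → EuclideanSpace ℝ (Fin p) =>
      ∑ j, a j * ⟪v j, op (res z x) (v j)⟫ :=
  continuous_finsetSum _ fun _ _ => continuous_const.mul
    (continuous_inner_res hz continuous_id continuous_const continuous_const)

theorem abs_quadratic_le {ι : Type*} [Fintype ι] {z z₀ : ℝ} (hz₀ : 0 < z₀) (hz : z₀ ≤ z)
    {a : ι → ℝ} {v : ι → EuclideanSpace ℝ (Fin p)} (ha : ∑ j, |a j| ≤ 1) (hv : ∀ j, ‖v j‖ = 1)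
    (x : Fin n → EuclideanSpace ℝ (Fin p)) :
    |∑ j, a j * ⟪v j, op (res z x) (v j)⟫| ≤ 1 / z₀ := by
  have hR := isRes_res (hz₀.trans_le hz) x
  calc _ ≤ ∑ j, |a j * ⟪v j, op (res z x) (v j)⟫| := Finset.abs_sum_le_sum_abs _ _
    _ ≤ ∑ j, |a j| * (1 / z₀) := by
        refine Finset.sum_le_sum fun j _ => ?_
        rw [abs_mul, abs_of_nonneg (hR.inner_nonneg _)]
        have h1 := hR.inner_le (v j)
        rw [hv, one_pow] at h1
        have h2 : 1 / z ≤ 1 / z₀ := by gcongr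
        gcongr
        exact h1.trans h2
    _ = (∑ j, |a j|) * (1 / z₀) := by rw [Finset.sum_mul]
    _ ≤ 1 * (1 / z₀) := by gcongr
    _ = _ := one_mul _

/-- Tail of a quadratic functional of the resolvent around its partial average. -/
theorem exists_avg_tail {q κ₀ B z₀ ν : ℝ} (K : ℕ) (Γ : ℝ) (hq : 0 < q) (hq2 : q ≤ 2)
    (hκ : 0 < κ₀) (hz₀ : 0 < z₀) (hν : 0 < ν) :
    ∃ C c : ℝ, 0 < C ∧ 0 < c ∧ ∀ {n p k : ℕ} (z : ℝ) (κ : Fin n → Fin k)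
      (μ : Fin k → Measure (EuclideanSpace ℝ (Fin p))) [∀ l, IsProbabilityMeasure (μ l)]
      (S : Finset (Fin n)),
      1 ≤ n → p ≤ Γ * n → k ≤ K → z₀ ≤ z → (∀ l, LawReg (μ l) q (max q 1) κ₀ B) →
      (∀ i, ν * √n ≤ classSize κ (κ i)) →
      (∀ l, classSize κ l ≤ 3 * (Sᶜ.filter fun i => κ i = l).card) →
      ∀ (a : Fin p → ℝ) (v : Fin p → EuclideanSpace ℝ (Fin p)), ∑ j, |a j| ≤ 1 →
      (∀ j, ‖v j‖ = 1) → ∀ T, 1 ≤ T →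
      Measure.pi (fun i => μ (κ i)) {x | T / √n ≤ |∑ j, a j * ⟪v j, op (res z x) (v j)⟫ -
        avg (fun i => μ (κ i)) S (fun x => ∑ j, a j * ⟪v j, op (res z x) (v j)⟫) x|} ≤
      ENNReal.ofReal (C * Real.exp (-(T ^ q) / c)) := by
  obtain ⟨G₀, hG₀, hnorm⟩ := exists_norm_sum B Γ hq hκ
  set G := (G₀ + 1) ^ 2 with hG
  -- Bound for `⟪m, Q₀ v⟫²` in units of `n / n_l`: `3` from the splitting, the bracket from
  -- `mean_inner_res_le`, and `1 / z₀` from `⟪v, Q₀ v⟫`.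
  set C₂ := 3 * (2 + 2 * G / z₀) / z₀ with hC₂
  set Bt := 1 + 2 / z₀ with hBt
  have hC₂0 : 0 ≤ C₂ := by positivity
  have hBt1 : 1 ≤ Bt := by
    have : 0 < 2 / z₀ := by positivity
    linarith
  -- The column costs sum to at most `ε (K + 1) c T^r`, half of the Chernoff gain `lam · T / √n = c
  -- T^r`. Using `K + 1` avoids dividing by zero.
  set ε : ℝ := 1 / (2 * (K + 1)) with hε
  obtain ⟨c, hc, hcoord⟩ := exists_coord_mgf (B := B) hq hq2 hκ hz₀ hν hC₂0 hBt1
    (by positivity : 0 < ε)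
  refine ⟨K * |B| + 2, max (Bt ^ q / κ₀) (2 / c), by positivity, by positivity, ?_⟩
  intro n p k z κ μ _ S hn hpn hkK hz hμ hν' hS a v ha hv T hT
  set r := max q 1 with hr
  have hr1 : 1 ≤ r := le_max_right _ _
  have hz0 : 0 < z := by linarith
  have hn1 : (1 : ℝ) ≤ n := by exact_mod_cast hn
  have hn0 : (0 : ℝ) < n := by linarith
  have hs : 0 < √(n : ℝ) := Real.sqrt_pos.2 hn0
  have hT0 : 0 < T := by linarith
  set f : (Fin n → EuclideanSpace ℝ (Fin p)) → ℝ :=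
    fun x => ∑ j, a j * ⟪v j, op (res z x) (v j)⟫ with hf
  set π := fun i => μ (κ i) with hπ
  have hfm : Measurable f := (continuous_quadratic hz0 a v).measurable
  have hfb : ∀ x, |f x| ≤ 1 / z₀ := abs_quadratic_le hz₀ hz ha hv
  have hfavg : ∀ x x', |f x - avg π S f x'| ≤ 2 / z₀ := by
    intro x x'
    have h1 := hfb x
    have h2 := avg_bound π hfb S x'
    calc _ ≤ |f x| + |avg π S f x'| := abs_sub _ _
      _ ≤ 1 / z₀ + 1 / z₀ := add_le_add h1 h2
      _ = _ := by ring
  -- A form bounded by `1 / z₀` cannot deviate by more than `2 / z₀`, so only `T ≤ Bt √n` needs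
  -- work.
  rcases lt_or_ge (Bt * √n) T with hTB | hTB
  · have : {x | T / √n ≤ |f x - avg π S f x|} = ∅ := by
      refine Set.eq_empty_of_forall_notMem fun x hx => ?_
      have h1 : T / √n ≤ 2 / z₀ := le_trans hx (hfavg x x)
      rw [div_le_iff₀ hs] at h1
      nlinarith
    rw [this, measure_empty]
    exact zero_le
  set J : Fin k → Finset (Fin n) := fun l => Sᶜ.filter fun i => κ i = l with hJ
  set hh : Fin k → (Fin n → EuclideanSpace ℝ (Fin p)) → ℝ := fun l x =>
    (√(J l).card)⁻¹ * ‖∑ j ∈ J l, (x j - ∫ y, y ∂(μ l))‖ with hhh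
  have hhm : ∀ l, Measurable (hh l) := fun l => Continuous.measurable (by fun_prop)
  -- The bad event: in some class, the frozen columns are atypically far from their mean. It
  -- involves columns outside `S` only.
  set A : Set (Fin n → EuclideanSpace ℝ (Fin p)) :=
    ⋃ l, {x | (G₀ + 1) * √n ≤ hh l x} with hA
  have hAm : MeasurableSet A :=
    MeasurableSet.iUnion fun l => measurableSet_le measurable_const (hhm l)
  have hA1 : ∀ l, Measure.pi π {x | (G₀ + 1) * √n ≤ hh l x} ≤
      ENNReal.ofReal (|B| * Real.exp (-(κ₀ * √n ^ q))) := by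
    intro l
    rcases (J l).eq_empty_or_nonempty with h0 | h0
    · have : {x | (G₀ + 1) * √n ≤ hh l x} = ∅ := by
        refine Set.eq_empty_of_forall_notMem fun x hx => ?_
        have h1 : (G₀ + 1) * √n ≤ hh l x := hx
        have h2 : hh l x = 0 := by simp [hhh, h0]
        rw [h2] at h1
        have : 0 < (G₀ + 1) * √n := by positivity
        linarith
      rw [this, measure_empty]
      exact zero_le
    · obtain ⟨ρ, hρ0, hρ, hE⟩ := hnorm (μ l) r n (hμ l) hn1 hpn (J l).card h0.card_pos
      have hE' := expBdd_norm_sum_of_subset (ν := π) (fun j hj => by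
        rw [hπ]; simp only; rw [(Finset.mem_filter.1 hj).2]) hE
      have h1 := hE'.tail ((hhm l).sub_const ρ) hq hκ hs.le
      refine (measure_mono fun x hx => ?_).trans (h1.trans ?_)
      · have h2 : (G₀ + 1) * √n ≤ hh l x := hx
        change √n ≤ |hh l x - ρ|
        exact le_trans (by linarith) (le_abs_self _)
      · gcongr
        exact le_abs_self B
  have hA2 : Measure.pi π A ≤ ENNReal.ofReal (K * (|B| * Real.exp (-(κ₀ * √n ^ q)))) := by
    calc Measure.pi π A ≤ ∑ l, Measure.pi π {x | (G₀ + 1) * √n ≤ hh l x} :=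
          measure_iUnion_fintype_le _ _
      _ ≤ ∑ _l : Fin k, ENNReal.ofReal (|B| * Real.exp (-(κ₀ * √n ^ q))) :=
          Finset.sum_le_sum fun l _ => hA1 l
      _ = ENNReal.ofReal (k * (|B| * Real.exp (-(κ₀ * √n ^ q)))) := by
          rw [Finset.sum_const, Finset.card_univ, Fintype.card_fin, nsmul_eq_mul,
            ENNReal.ofReal_mul (Nat.cast_nonneg k), ENNReal.ofReal_natCast]
      _ ≤ _ := by gcongr
  have hmgf : ∀ x ∉ A, ∀ s, |s| = c * (√n * T ^ (r - 1)) →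
      ∫ x', Real.exp (s * (f (S.piecewise x' x) - avg π S f x)) ∂(Measure.pi π) ≤
        Real.exp (c * T ^ r / 2) := by
    intro x hx s hs'
    have hgood : ∀ l, (J l).Nonempty → ‖∑ j ∈ J l, (x j - ∫ y, y ∂(μ l))‖ ^ 2 ≤
        G * n * (J l).card := by
      intro l hl
      have hcard : (0 : ℝ) < (J l).card := by exact_mod_cast hl.card_pos
      have h1 : hh l x ≤ (G₀ + 1) * √n := by
        by_contra hcon
        exact hx (Set.mem_iUnion.2 ⟨l, (not_le.1 hcon).le⟩)
      have h2 : ‖∑ j ∈ J l, (x j - ∫ y, y ∂(μ l))‖ ≤ (G₀ + 1) * √n * √(J l).card := by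
        rw [hhh] at h1
        simp only at h1
        rwa [inv_mul_le_iff₀ (Real.sqrt_pos.2 hcard), mul_comm] at h1
      calc ‖∑ j ∈ J l, (x j - ∫ y, y ∂(μ l))‖ ^ 2 ≤ ((G₀ + 1) * √n * √(J l).card) ^ 2 := by
            gcongr
        _ = _ := by rw [mul_pow, mul_pow, Real.sq_sqrt hn0.le, Real.sq_sqrt hcard.le]
    refine (mgf_avg_le π hfm hfb s (fun i => ε * (c * (T ^ r / classSize κ (κ i)))) S x
      fun y hy i hi => ?_).trans (Real.exp_le_exp.2 ?_)
    · have hN : (1 : ℝ) ≤ classSize κ (κ i) := by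
        have : 0 < classSize κ (κ i) := Finset.card_pos.2 ⟨i, by simp⟩
        exact_mod_cast this
      have hNn : (classSize κ (κ i) : ℝ) ≤ n := by exact_mod_cast classSize_le κ (κ i)
      have hJc : (classSize κ (κ i) : ℝ) ≤ 3 * (J (κ i)).card := by exact_mod_cast hS (κ i)
      have hJ0 : (0 : ℝ) < (J (κ i)).card := by linarith
      have hJn : (J (κ i)).Nonempty := Finset.card_pos.1 (by exact_mod_cast hJ0)
      -- Since `i ∈ S`, deleting column `i` does not touch the frozen columns, and `y` agrees with
      -- `x` there; the good event still applies to `x₀`.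
      set x₀ := Function.update y i 0 with hx₀
      have hR := isRes_res hz0 x₀
      have hm := mean_inner_res_le (G := G) hz₀ hz x₀ (∫ y, y ∂(μ (κ i))) hJn (by
        refine le_trans (le_of_eq ?_) (hgood _ hJn)
        congr 2
        refine Finset.sum_congr rfl fun j hj => ?_
        have hjS : j ∉ S := Finset.mem_compl.1 (Finset.mem_filter.1 hj).1
        have hji : j ≠ i := fun h => hjS (h ▸ hi)
        rw [hx₀, Function.update_of_ne hji, hy j hjS])
      have hmean : ∀ j, ⟪∫ y, y ∂(μ (κ i)), op (res z x₀) (v j)⟫ ^ 2 ≤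
          C₂ * (n / classSize κ (κ i)) := by
        intro j
        have h1 := hR.inner_le (v j)
        rw [hv, one_pow] at h1
        have h2 : 1 / z ≤ 1 / z₀ := by gcongr
        have h3 : (n : ℝ) / (J (κ i)).card ≤ 3 * (n / classSize κ (κ i)) := by
          rw [div_le_iff₀ hJ0, mul_assoc, div_mul_eq_mul_div, ← mul_div_assoc,
            le_div_iff₀ (by linarith)]
          nlinarith
        calc _ ≤ ⟪∫ y, y ∂(μ (κ i)), op (res z x₀) (∫ y, y ∂(μ (κ i)))⟫ *
              ⟪v j, op (res z x₀) (v j)⟫ := hR.cauchy _ _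
          _ ≤ ((2 + 2 * G / z₀) * (n / (J (κ i)).card)) * (1 / z₀) :=
              mul_le_mul hm (h1.trans h2) (hR.inner_nonneg _) (by positivity)
          _ ≤ ((2 + 2 * G / z₀) * (3 * (n / classSize κ (κ i)))) * (1 / z₀) := by gcongr
          _ = _ := by rw [hC₂]; ring
      set ψ : Fin p → EuclideanSpace ℝ (Fin p) → ℝ := fun j e =>
        ⟪e, op (res z x₀) (v j)⟫ ^ 2 / (n + ⟪e, op (res z x₀) e⟫) with hψ
      have hopc : Continuous (op (res z x₀)) := LinearMap.continuous_of_finiteDimensional _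
      have hψm : ∀ j, Measurable (ψ j) := fun j =>
        Measurable.div (Continuous.measurable (by fun_prop))
          (Continuous.measurable (by fun_prop))
      have hupd : ∀ j e, ⟪v j, op (res z (Function.update y i e)) (v j)⟫ =
          ⟪v j, op (res z x₀) (v j)⟫ - ψ j e := fun j e => inner_res_update hz0 y i e (v j)
      have hψb : ∀ j e, |ψ j e| ≤ 1 / z₀ := by
        intro j e
        have h0 : 0 ≤ ψ j e := by
          have := hR.inner_nonneg e
          simp only [hψ]
          positivity
        have h1 := hupd j e
        have h2 := (isRes_res hz0 (Function.update y i e)).inner_nonneg (v j)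
        have h3 := hR.inner_le (v j)
        rw [hv, one_pow] at h3
        have h4 : 1 / z ≤ 1 / z₀ := by gcongr
        rw [abs_of_nonneg h0]
        linarith
      have hψi : ∀ j, Integrable (ψ j) (π i) := fun j => integrable_of_abs_le (hψm j) (hψb j)
      have hfe : ∀ e, f (Function.update y i e) - ∫ e', f (Function.update y i e') ∂(π i) =
          ∑ j, a j * (-(ψ j e - ∫ e', ψ j e' ∂(π i))) := by
        intro e
        simp only [hf, hupd]
        have hI : ∫ e', ∑ j, a j * (⟪v j, op (res z x₀) (v j)⟫ - ψ j e') ∂(π i) =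
            ∑ j, a j * (⟪v j, op (res z x₀) (v j)⟫ - ∫ e', ψ j e' ∂(π i)) := by
          rw [integral_finsetSum _ fun j _ => Integrable.const_mul
            (f := fun e' => ⟪v j, op (res z x₀) (v j)⟫ - ψ j e')
            ((integrable_const _).sub (hψi j)) _]
          refine Finset.sum_congr rfl fun j _ => ?_
          rw [integral_const_mul, integral_sub (integrable_const _) (hψi j)]
          simp
        rw [hI, ← Finset.sum_sub_distrib]
        exact Finset.sum_congr rfl fun j _ => by ring
      simp only [hfe]
      refine integral_exp_sum_le (b := 1 / z₀ + 1 / z₀) ha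
        (fun j => ((hψm j).sub_const _).neg) (fun j e => ?_) (Real.one_le_exp (by positivity))
        fun j s' hs'' => ?_
      · rw [abs_neg]
        refine (abs_sub _ _).trans (add_le_add (hψb j e) ?_)
        have := norm_integral_le_of_norm_le_const (μ := π i) (f := ψ j) (C := 1 / z₀)
          (Filter.Eventually.of_forall fun x' => hψb j x')
        simpa using this
      · have := hcoord (μ (κ i)) (hμ _) _ _ z hR hz (v j) n (classSize κ (κ i)) T (-s') (hv j)
          (hν' i) hN hNn hT hTB (by rw [abs_neg, hs'', hs']) (hmean j)
        simpa only [mul_neg, neg_mul] using this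
    · have h1 := sum_inv_classSize_le κ S
      have h2 : ∑ i ∈ S, ε * (c * (T ^ r / classSize κ (κ i))) =
          ε * c * T ^ r * ∑ i ∈ S, (1 : ℝ) / classSize κ (κ i) := by
        rw [Finset.mul_sum]
        exact Finset.sum_congr rfl fun i _ => by ring
      rw [h2]
      have h3 : (k : ℝ) ≤ K + 1 := by
        have : (k : ℝ) ≤ K := by exact_mod_cast hkK
        linarith
      calc ε * c * T ^ r * ∑ i ∈ S, (1 : ℝ) / classSize κ (κ i) ≤ ε * c * T ^ r * (K + 1) := by
            gcongr
            exact h1.trans h3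
        _ = _ := by rw [hε]; field_simp
  have hlam : 0 ≤ c * (√n * T ^ (r - 1)) := by positivity
  have htail : ∀ x ∉ A, Measure.pi π {x' | T / √n ≤ |f (S.piecewise x' x) - avg π S f x|} ≤
      ENNReal.ofReal (2 * Real.exp (-(c * T ^ r / 2))) := by
    intro x hx
    have hm : Measurable fun x' => f (S.piecewise x' x) - avg π S f x :=
      (hfm.comp ((measurable_piecewise S).comp (measurable_const.prodMk measurable_id))).sub_const _
    refine (measure_abs_ge_le_of_mgf hm (fun x' => hfavg _ x) hlam (hmgf x hx)).trans
      (le_of_eq ?_)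
    congr 3
    have h1 : T ^ r = T ^ (r - 1) * T := by
      rw [← Real.rpow_add_one hT0.ne']; congr 1; ring
    rw [h1]
    field_simp
    ring
  refine (measure_sub_avg_le π hfm S hAm hA2 htail).trans ?_
  rw [← ENNReal.ofReal_add (by positivity) (by positivity)]
  refine ENNReal.ofReal_le_ofReal ?_
  -- The bad event has probability `e^{-κ₀ √n^q}` up to a factor; in the range `T ≤ Bt √n` this is
  -- dominated by the target tail.
  have e1 : Real.exp (-(κ₀ * √n ^ q)) ≤ Real.exp (-(T ^ q) / max (Bt ^ q / κ₀) (2 / c)) := by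
    rw [Real.exp_le_exp, neg_div, neg_le_neg_iff]
    calc T ^ q / max (Bt ^ q / κ₀) (2 / c) ≤ T ^ q / (Bt ^ q / κ₀) := by
          gcongr; exact le_max_left _ _
      _ ≤ (Bt * √n) ^ q / (Bt ^ q / κ₀) := by gcongr
      _ = _ := by rw [Real.mul_rpow (by linarith) hs.le]; field_simp
  have e2 : Real.exp (-(c * T ^ r / 2)) ≤ Real.exp (-(T ^ q) / max (Bt ^ q / κ₀) (2 / c)) := by
    rw [Real.exp_le_exp, neg_div, neg_le_neg_iff]
    calc T ^ q / max (Bt ^ q / κ₀) (2 / c) ≤ T ^ q / (2 / c) := by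
          gcongr; exact le_max_right _ _
      _ ≤ T ^ r / (2 / c) := by gcongr; exact le_max_left _ _
      _ = _ := by field_simp
  calc _ ≤ K * (|B| * Real.exp (-(T ^ q) / max (Bt ^ q / κ₀) (2 / c))) +
        2 * Real.exp (-(T ^ q) / max (Bt ^ q / κ₀) (2 / c)) := by gcongr
    _ = _ := by ring

open scoped Matrix.Norms.L2Operator in
theorem exists_quadratic_res {z : ℝ} (hz : 0 < z) {u : Matrix (Fin p) (Fin p) ℝ →ₗ[ℝ] ℝ}
    (hu : ∀ M, |u M| ≤ ‖M‖) : ∃ (a : Fin p → ℝ) (v : Fin p → EuclideanSpace ℝ (Fin p)),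
      (∀ k, ‖v k‖ = 1) ∧ ∑ k, |a k| ≤ 1 ∧ ∀ x : Fin n → EuclideanSpace ℝ (Fin p),
        u (res z x) = ∑ k, a k * ⟪v k, op (res z x) (v k)⟫ := by
  obtain ⟨a, v, hv, ha, h⟩ := exists_quadratic_decomposition u hu
  refine ⟨a, v, hv, ha, fun x => h _ (isSymm_of_inner fun w w' => ?_)⟩
  exact (isRes_res hz x).Q_symm w w'

open scoped Matrix.Norms.L2Operator in
/-- Exponential moments of bounded linear forms of the resolvent. -/
theorem exists_expBdd_res {q κ₀ z₀ ν : ℝ} (B : ℝ) (K : ℕ) (Γ : ℝ) (hq : 0 < q) (hq2 : q ≤ 2)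
    (hκ : 0 < κ₀) (hz₀ : 0 < z₀) (hν : 0 < ν) :
    ∃ κ' B' : ℝ, 0 < κ' ∧ ∀ {n p k : ℕ} (z : ℝ) (κ : Fin n → Fin k)
      (μ : Fin k → Measure (EuclideanSpace ℝ (Fin p))) [∀ l, IsProbabilityMeasure (μ l)],
      1 ≤ n → p ≤ Γ * n → k ≤ K → z₀ ≤ z → (∀ l, LawReg (μ l) q (max q 1) κ₀ B) →
      (∀ i, ν * √n ≤ classSize κ (κ i)) → (∀ i, 2 ≤ classSize κ (κ i)) →
      ∀ u : Matrix (Fin p) (Fin p) ℝ →ₗ[ℝ] ℝ, (∀ M, |u M| ≤ ‖M‖) →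
      ExpBdd (Measure.pi fun i => μ (κ i)) (fun x => √n * (u (res z x) -
        ∫ x, u (res z x) ∂(Measure.pi fun i => μ (κ i)))) q κ' B' := by
  obtain ⟨C, c, hC, hc, htail⟩ := exists_avg_tail (B := B) K Γ hq hq2 hκ hz₀ hν
  set C' := 4 * C + Real.exp (1 / c) with hC'
  set c' := 4 ^ q * c with hc'
  obtain ⟨κ', B', hκ', hcenter⟩ := ExpBdd.center (q := q) (κ := 1 / (2 * c')) (1 + C') hq
    (by positivity)
  refine ⟨κ', B', hκ', fun {n p k} z κ μ _ hn hpn hk hz hμ hν' h2 u hu => ?_⟩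
  have hz0 : 0 < z := by linarith
  have hs : 0 < √(n : ℝ) := Real.sqrt_pos.2 (by exact_mod_cast hn)
  obtain ⟨a, v, hv, ha, hav⟩ := exists_quadratic_res (n := n) hz0 hu
  obtain ⟨S, hS⟩ := exists_split κ h2
  simp only [hav]
  set f : (Fin n → EuclideanSpace ℝ (Fin p)) → ℝ :=
    fun x => ∑ j, a j * ⟪v j, op (res z x) (v j)⟫ with hf
  set π := fun i => μ (κ i) with hπ
  have hfm : Measurable f := (continuous_quadratic hz0 a v).measurable
  have hconc : Concentrated (Measure.pi π) (fun x => √n * f x)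
      fun t => C' * Real.exp (-(t ^ q) / c') := by
    intro t ht
    -- The tail estimate starts at level one. Below it, the summand `exp (1 / c)` of `C'` makes the
    -- claimed bound at least one.
    rcases lt_or_ge (t / 4) 1 with h1 | h1
    · refine prob_le_one.trans ?_
      rw [ENNReal.one_le_ofReal]
      have h3 : (t / 4) ^ q ≤ 1 := Real.rpow_le_one (by positivity) h1.le hq.le
      rw [Real.div_rpow ht.le (by norm_num)] at h3
      calc (1 : ℝ) = Real.exp (1 / c) * Real.exp (-(1 / c)) := by rw [← Real.exp_add]; simp
        _ ≤ C' * Real.exp (-(t ^ q) / c') := by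
            gcongr
            · rw [hC']; linarith
            · rw [hc', neg_div, neg_le_neg_iff, ← div_div]
              gcongr
    · have hset : {w : (Fin n → EuclideanSpace ℝ (Fin p)) × (Fin n → EuclideanSpace ℝ (Fin p)) |
          t ≤ |√n * f w.1 - √n * f w.2|} = {w | t / √n ≤ |f w.1 - f w.2|} := by
        ext w
        simp only [Set.mem_ofPred_eq]
        rw [← mul_sub, abs_mul, abs_of_pos hs, div_le_iff₀ hs, mul_comm]
      rw [hset]
      refine (measure_prod_sub_le_avg π hfm S _).trans ?_
      have e1 := htail z κ μ S hn hpn hk hz hμ hν' (fun l => (hS l).2) a v ha hv (t / 4) h1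
      have e2 := htail z κ μ Sᶜ hn hpn hk hz hμ hν'
        (fun l => by rw [compl_compl]; exact (hS l).1) a v ha hv (t / 4) h1
      rw [div_right_comm] at e1 e2
      refine (add_le_add (mul_le_mul' le_rfl e1) (mul_le_mul' le_rfl e2)).trans ?_
      calc 2 * ENNReal.ofReal (C * Real.exp (-((t / 4) ^ q) / c)) +
            2 * ENNReal.ofReal (C * Real.exp (-((t / 4) ^ q) / c))
          = ENNReal.ofReal (4 * C * Real.exp (-((t / 4) ^ q) / c)) := by
            rw [← add_mul, mul_assoc, ENNReal.ofReal_mul (by norm_num : (0 : ℝ) ≤ 4)]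
            norm_num
        _ ≤ _ := by
            refine ENNReal.ofReal_le_ofReal ?_
            have e3 : -((t / 4) ^ q) / c = -(t ^ q) / c' := by
              rw [Real.div_rpow ht.le (by norm_num), hc']
              field_simp
            rw [e3]
            refine mul_le_mul_of_nonneg_right ?_ (Real.exp_pos _).le
            rw [hC']
            have := Real.exp_pos (1 / c)
            linarith
  obtain ⟨ω', hω⟩ := hconc.exists_expBdd (hfm.const_mul _) hq (by positivity) (by positivity)
  have := (hcenter (Measure.pi π) _ _ (hfm.const_mul _) hω).2
  simpa only [integral_const_mul, ← mul_sub] using this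

end ResolventConcentration

/-! ### Moment bounds for one column, uniform in the dimension. -/

section Moments

open scoped RealInnerProductSpace

variable {p : ℕ}

theorem sq_integral_le {Ω : Type*} [MeasurableSpace Ω] {P : Measure Ω} [IsProbabilityMeasure P]
    {f : Ω → ℝ} (hf : Integrable f P) (hf2 : Integrable (fun ω => f ω ^ 2) P) :
    (∫ ω, f ω ∂P) ^ 2 ≤ ∫ ω, f ω ^ 2 ∂P := by
  set e := ∫ ω, f ω ∂P with he
  have h1 : 0 ≤ ∫ ω, (f ω ^ 2 - 2 * e * f ω + e ^ 2) ∂P :=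
    integral_nonneg fun ω => by
      change 0 ≤ f ω ^ 2 - 2 * e * f ω + e ^ 2
      nlinarith [sq_nonneg (f ω - e)]
  have hI : Integrable (fun ω => f ω ^ 2 - 2 * e * f ω) P := hf2.sub (hf.const_mul _)
  rw [integral_add hI (integrable_const _),
    integral_sub hf2 (hf.const_mul _), integral_const_mul] at h1
  simp only [integral_const, probReal_univ, one_smul, ← he] at h1
  linarith

theorem four_integral_le {Ω : Type*} [MeasurableSpace Ω] {P : Measure Ω} [IsProbabilityMeasure P]
    {f : Ω → ℝ} (hf : Integrable f P) (hf2 : Integrable (fun ω => f ω ^ 2) P)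
    (hf4 : Integrable (fun ω => f ω ^ 4) P) :
    (∫ ω, f ω ∂P) ^ 4 ≤ ∫ ω, f ω ^ 4 ∂P := by
  have h1 := sq_integral_le hf hf2
  have h2 := sq_integral_le hf2 (by simpa only [← pow_mul] using hf4)
  simp only [← pow_mul] at h2
  calc (∫ ω, f ω ∂P) ^ 4 = ((∫ ω, f ω ∂P) ^ 2) ^ 2 := by ring
    _ ≤ (∫ ω, f ω ^ 2 ∂P) ^ 2 := by gcongr
    _ ≤ _ := h2

theorem add_pow_four_le (a b : ℝ) : (a + b) ^ 4 ≤ 8 * (a ^ 4 + b ^ 4) := by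
  have h1 : (a + b) ^ 2 ≤ 2 * (a ^ 2 + b ^ 2) := by nlinarith [sq_nonneg (a - b)]
  calc (a + b) ^ 4 = ((a + b) ^ 2) ^ 2 := by ring
    _ ≤ (2 * (a ^ 2 + b ^ 2)) ^ 2 := by gcongr
    _ ≤ _ := by nlinarith [sq_nonneg (a ^ 2 - b ^ 2)]

theorem integral_sub_mean_pow_four_le {Ω : Type*} [MeasurableSpace Ω] {P : Measure Ω}
    [IsProbabilityMeasure P] {f : Ω → ℝ} (c : ℝ) (hf : Integrable f P)
    (hf2 : Integrable (fun ω => (f ω - c) ^ 2) P)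
    (hf4 : Integrable (fun ω => (f ω - c) ^ 4) P) :
    ∫ ω, (f ω - ∫ ω, f ω ∂P) ^ 4 ∂P ≤ 16 * ∫ ω, (f ω - c) ^ 4 ∂P := by
  have h1 := four_integral_le (hf.sub (integrable_const c)) hf2 hf4
  simp only [Pi.sub_apply] at h1
  rw [integral_sub hf (integrable_const c)] at h1
  simp only [integral_const, probReal_univ, one_smul] at h1
  set e := ∫ ω, f ω ∂P with he
  calc ∫ ω, (f ω - e) ^ 4 ∂P ≤ ∫ ω, (8 * (f ω - c) ^ 4 + 8 * (e - c) ^ 4) ∂P := by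
        refine integral_mono_of_nonneg (Filter.Eventually.of_forall fun ω => by positivity)
          ((hf4.const_mul 8).add (integrable_const _)) (Filter.Eventually.of_forall fun ω => ?_)
        have := add_pow_four_le (f ω - c) (c - e)
        simp only [sub_add_sub_cancel] at this
        have h2 : (c - e) ^ 4 = (e - c) ^ 4 := by ring
        rw [h2] at this
        change (f ω - e) ^ 4 ≤ 8 * (f ω - c) ^ 4 + 8 * (e - c) ^ 4
        linarith
    _ = 8 * ∫ ω, (f ω - c) ^ 4 ∂P + 8 * (e - c) ^ 4 := by
        rw [integral_add (hf4.const_mul 8) (integrable_const _), integral_const_mul]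
        simp
    _ ≤ _ := by linarith

/-- Moment bounds used for the bias of the resolvent. -/
structure LawMom (μ : Measure (EuclideanSpace ℝ (Fin p))) (z₀ n C : ℝ) : Prop where
  prob : IsProbabilityMeasure μ
  int_pow : ∀ j : ℕ, Integrable (fun y => ‖y‖ ^ j) μ
  sq : ∀ a : EuclideanSpace ℝ (Fin p), ∫ y, ⟪a, y - ∫ y, y ∂μ⟫ ^ 2 ∂μ ≤ C * ‖a‖ ^ 2
  four : ∀ a : EuclideanSpace ℝ (Fin p), ∫ y, ⟪a, y - ∫ y, y ∂μ⟫ ^ 4 ∂μ ≤ C * ‖a‖ ^ 4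
  tr : ∫ y, ‖y‖ ^ 2 ∂μ ≤ C * n
  quad : ∀ (S Q : EuclideanSpace ℝ (Fin p) →ₗ[ℝ] EuclideanSpace ℝ (Fin p)) (z : ℝ), IsRes S Q z →
    z₀ ≤ z → ∫ y, (⟪y, Q y⟫ / n - ∫ y, ⟪y, Q y⟫ / n ∂μ) ^ 4 ∂μ ≤ C / n ^ 2

theorem integrable_of_polynomial {μ : Measure (EuclideanSpace ℝ (Fin p))}
    (hint : ∀ j : ℕ, Integrable (fun y => ‖y‖ ^ j) μ) {f : EuclideanSpace ℝ (Fin p) → ℝ}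
    (hf : Measurable f) {c : ℝ} {j : ℕ} (h : ∀ y, |f y| ≤ c * (1 + ‖y‖) ^ j) :
    Integrable f μ := by
  refine Integrable.mono' (g := fun y => c * (1 + ‖y‖) ^ j) ?_ hf.aestronglyMeasurable
    (Filter.Eventually.of_forall h)
  refine Integrable.const_mul ?_ _
  simp only [add_pow]
  exact integrable_finsetSum _ fun i _ => (((hint _).const_mul _).mul_const _)

theorem integral_norm_sq_le {μ : Measure (EuclideanSpace ℝ (Fin p))} [IsProbabilityMeasure μ]
    (hint : ∀ j : ℕ, Integrable (fun y => ‖y‖ ^ j) μ) {C : ℝ}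
    (hC : ∀ a : EuclideanSpace ℝ (Fin p), ∫ y, ⟪a, y - ∫ y, y ∂μ⟫ ^ 2 ∂μ ≤ C * ‖a‖ ^ 2) :
    ∫ y, ‖y‖ ^ 2 ∂μ ≤ 2 * (p * C) + 2 * ‖∫ y, y ∂μ‖ ^ 2 := by
  set m := ∫ y, y ∂μ with hm
  have hi : ∀ a : EuclideanSpace ℝ (Fin p), Integrable (fun y => ⟪a, y - m⟫ ^ 2) μ := by
    intro a
    refine integrable_of_polynomial hint (Continuous.measurable (by fun_prop))
      (c := (‖a‖ * (1 + ‖m‖)) ^ 2) (j := 2) fun y => ?_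
    rw [abs_pow, ← mul_pow]
    refine pow_le_pow_left₀ (abs_nonneg _) ?_ 2
    calc |⟪a, y - m⟫| ≤ ‖a‖ * ‖y - m‖ := abs_real_inner_le_norm _ _
      _ ≤ ‖a‖ * (‖y‖ + ‖m‖) := by gcongr; exact norm_sub_le _ _
      _ ≤ ‖a‖ * ((1 + ‖m‖) * (1 + ‖y‖)) := by
          gcongr
          nlinarith [norm_nonneg y, norm_nonneg m]
      _ = _ := by ring
  have hpt : ∀ y : EuclideanSpace ℝ (Fin p), ‖y‖ ^ 2 ≤
      2 * ∑ i, ⟪EuclideanSpace.basisFun (Fin p) ℝ i, y - m⟫ ^ 2 + 2 * ‖m‖ ^ 2 := by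
    intro y
    have h1 : ∑ i, ⟪EuclideanSpace.basisFun (Fin p) ℝ i, y - m⟫ ^ 2 = ‖y - m‖ ^ 2 := by
      rw [← (EuclideanSpace.basisFun (Fin p) ℝ).sum_sq_norm_inner_right]
      exact Finset.sum_congr rfl fun i _ => by rw [Real.norm_eq_abs, sq_abs]
    rw [h1]
    have h2 : ‖y‖ ≤ ‖y - m‖ + ‖m‖ := by
      have := norm_add_le (y - m) m
      rwa [sub_add_cancel] at this
    nlinarith [norm_nonneg y, sq_nonneg (‖y - m‖ - ‖m‖)]
  have hs : Integrable (fun y => ∑ i, ⟪EuclideanSpace.basisFun (Fin p) ℝ i, y - m⟫ ^ 2) μ :=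
    integrable_finsetSum _ fun i _ => hi _
  calc ∫ y, ‖y‖ ^ 2 ∂μ ≤ ∫ y, (2 * ∑ i, ⟪EuclideanSpace.basisFun (Fin p) ℝ i, y - m⟫ ^ 2 +
        2 * ‖m‖ ^ 2) ∂μ :=
        integral_mono (hint 2) ((hs.const_mul 2).add (integrable_const _)) hpt
    _ = 2 * ∑ i, ∫ y, ⟪EuclideanSpace.basisFun (Fin p) ℝ i, y - m⟫ ^ 2 ∂μ + 2 * ‖m‖ ^ 2 := by
        rw [integral_add (hs.const_mul 2) (integrable_const _), integral_const_mul,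
          integral_finsetSum _ fun i _ => hi _]
        simp
    _ ≤ 2 * ∑ _i : Fin p, C + 2 * ‖m‖ ^ 2 := by
        gcongr with i
        have := hC (EuclideanSpace.basisFun (Fin p) ℝ i)
        rwa [(EuclideanSpace.basisFun (Fin p) ℝ).orthonormal.1 i, one_pow, mul_one] at this
    _ = _ := by simp

theorem integral_inner_pow_le {μ : Measure (EuclideanSpace ℝ (Fin p))} {m : EuclideanSpace ℝ (Fin p)}
    {K : ℝ} {j : ℕ} (hj : j ≠ 0) (hK : ∀ b : EuclideanSpace ℝ (Fin p), ‖b‖ ≤ 1 →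
      ∫ y, |⟪b, y - m⟫| ^ j ∂μ ≤ K) (a : EuclideanSpace ℝ (Fin p)) :
    ∫ y, |⟪a, y - m⟫| ^ j ∂μ ≤ K * ‖a‖ ^ j := by
  rcases eq_or_ne a 0 with rfl | ha
  · simp [hj]
  · have ha' : 0 < ‖a‖ := norm_pos_iff.2 ha
    have h1 := hK (‖a‖⁻¹ • a) (by rw [norm_smul, norm_inv, norm_norm, inv_mul_cancel₀ ha'.ne'])
    have h2 : ∀ y, |⟪a, y - m⟫| ^ j = ‖a‖ ^ j * |⟪‖a‖⁻¹ • a, y - m⟫| ^ j := by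
      intro y
      rw [real_inner_smul_left, abs_mul, abs_of_pos (inv_pos.2 ha'), ← mul_pow,
        mul_inv_cancel_left₀ ha'.ne']
    simp only [h2]
    rw [integral_const_mul, mul_comm]
    gcongr

/-- The last field carries the idea. With `δ = √⟪y, Q y⟫ - ρ`, one has `⟪y, Q y⟫ - ρ² = 2 ρ δ + δ²`;
`δ` has bounded moments and `ρ² = O(n)`, so the fourth central moment is `O(n²)` before division by
`n⁴`. The bound on the mean vector enters only in `𝔼 ‖y‖² = O(n)`, from which `ρ² = O(n)` follows.
-/
theorem exists_lawMom {q κ z₀ : ℝ} (B Γ M : ℝ) (hq : 0 < q) (hκ : 0 < κ) (hz₀ : 0 < z₀) :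
    ∃ C : ℝ, 0 < C ∧ ∀ {p : ℕ} (μ : Measure (EuclideanSpace ℝ (Fin p))) (r n : ℝ),
      LawReg μ q r κ B → 1 ≤ n → p ≤ Γ * n → ‖∫ y, y ∂μ‖ ≤ M * √p → LawMom μ z₀ n C := by
  obtain ⟨K₂, hK₂, h₂⟩ := ExpBdd.moment B hq hκ 2
  obtain ⟨K₄, hK₄, h₄⟩ := ExpBdd.moment B hq hκ 4
  obtain ⟨K₈, hK₈, h₈⟩ := ExpBdd.moment B hq hκ 8
  set c₁ := 2 * (|Γ| * K₂) + 2 * (M ^ 2 * |Γ|) with hc₁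
  have hc₁0 : 0 ≤ c₁ := by positivity
  set c₂ := 2 * (c₁ / z₀) + 2 * (K₂ / z₀) with hc₂
  set c₃ := 16 * (128 * c₂ ^ 2 * (K₄ / z₀ ^ 2) + 8 * (K₈ / z₀ ^ 4)) with hc₃
  refine ⟨K₂ + K₄ + c₁ + c₃, by positivity, fun {p} μ r n hμ hn hpn hM => ?_⟩
  have := hμ.prob
  have hn0 : 0 < n := by linarith
  set m := ∫ y, y ∂μ with hm
  have hpn' : (p : ℝ) ≤ |Γ| * n := hpn.trans (by gcongr; exact le_abs_self Γ)
  have hint : ∀ j : ℕ, Integrable (fun y => ‖y‖ ^ j) μ := by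
    intro j
    obtain ⟨K, hK, h⟩ := ExpBdd.moment B hq hκ j
    have hm1 : Measurable fun Y : Fin 1 → EuclideanSpace ℝ (Fin p) =>
        (√(1 : ℕ))⁻¹ * ‖∑ j, (Y j - 0)‖ := Continuous.measurable (by fun_prop)
    obtain ⟨Y₀, hY⟩ := hμ.conv 1 _ (qLip_norm_sum 0 1)
    set c := (√(1 : ℕ))⁻¹ * ‖∑ j, (Y₀ j - 0)‖ with hc
    have h1 := (h _ _ (hm1.sub_const c) hY).1
    simp only [Nat.cast_one, Real.sqrt_one, inv_one, one_mul, Fin.sum_univ_one, sub_zero] at h1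
    have hmp := measurePreserving_eval (fun _ : Fin 1 => μ) 0
    have h2 : Integrable (fun y => |‖y‖ - c| ^ j) μ :=
      (hmp.integrable_comp (Continuous.aestronglyMeasurable (by fun_prop))).1 h1
    have h3 : Integrable (fun y => 2 ^ j * (|‖y‖ - c| ^ j + |c| ^ j)) μ :=
      (h2.add (integrable_const _)).const_mul _
    refine h3.mono' (Continuous.aestronglyMeasurable (by fun_prop))
      (Filter.Eventually.of_forall fun y => ?_)
    rw [Real.norm_of_nonneg (by positivity)]
    have h4 : ‖y‖ ≤ 2 * max |‖y‖ - c| |c| := by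
      have h5 := le_max_left |‖y‖ - c| |c|
      have h6 := le_max_right |‖y‖ - c| |c|
      have h7 := le_abs_self (‖y‖ - c)
      have h8 := le_abs_self c
      linarith
    calc ‖y‖ ^ j ≤ (2 * max |‖y‖ - c| |c|) ^ j := by gcongr
      _ = 2 ^ j * max |‖y‖ - c| |c| ^ j := by rw [mul_pow]
      _ ≤ _ := by
          gcongr
          rcases max_choice |‖y‖ - c| |c| with h | h <;> rw [h]
          · exact le_add_of_nonneg_right (by positivity)
          · exact le_add_of_nonneg_left (by positivity)
  have hlin : ∀ b : EuclideanSpace ℝ (Fin p), ‖b‖ ≤ 1 → ExpBdd μ (fun y => ⟪b, y - m⟫) q κ B :=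
    fun b hb => expBdd_of_pi_one (hμ.sum 1 one_pos b hb)
  have hsq : ∀ a : EuclideanSpace ℝ (Fin p), ∫ y, ⟪a, y - m⟫ ^ 2 ∂μ ≤ K₂ * ‖a‖ ^ 2 := by
    intro a
    have := integral_inner_pow_le two_ne_zero (fun b hb => (h₂ μ _
      (Continuous.measurable (by fun_prop)) (hlin b hb)).2) a
    simpa only [sq_abs] using this
  have htr : ∫ y, ‖y‖ ^ 2 ∂μ ≤ c₁ * n := by
    have h1 := integral_norm_sq_le hint hsq
    have h2 : ‖m‖ ^ 2 ≤ M ^ 2 * p := by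
      calc ‖m‖ ^ 2 ≤ (M * √p) ^ 2 := by gcongr
        _ = _ := by rw [mul_pow, Real.sq_sqrt (Nat.cast_nonneg p)]
    calc _ ≤ _ := h1
      _ ≤ 2 * ((|Γ| * n) * K₂) + 2 * (M ^ 2 * (|Γ| * n)) := by
          gcongr
          exact h2.trans (by gcongr)
      _ = _ := by ring
  refine ⟨hμ.prob, hint, fun a => (hsq a).trans ?_, fun a => ?_, htr.trans ?_,
    fun S Q z hQ hz => ?_⟩
  · gcongr
    have : 0 ≤ c₃ := by positivity
    linarith
  · have := integral_inner_pow_le four_ne_zero (fun b hb => (h₄ μ _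
      (Continuous.measurable (by fun_prop)) (hlin b hb)).2) a
    have e : ∀ y, |⟪a, y - m⟫| ^ 4 = ⟪a, y - m⟫ ^ 4 := fun y => (even_two_mul 2).pow_abs _
    simp only [e] at this
    refine this.trans ?_
    gcongr
    have : 0 ≤ c₃ := by positivity
    linarith
  · gcongr
    have : 0 ≤ c₃ := by positivity
    linarith
  · obtain ⟨ρ, hρ, hE⟩ := hμ.exists_sqrt_inner hQ
    have hQc : Continuous Q := Q.continuous_of_finiteDimensional
    have hVm : Measurable fun y => √z * (√⟪y, Q y⟫ - ρ) := Continuous.measurable (by fun_prop)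
    obtain ⟨i2, b2⟩ := h₂ μ _ hVm hE
    obtain ⟨i4, b4⟩ := h₄ μ _ hVm hE
    obtain ⟨i8, b8⟩ := h₈ μ _ hVm hE
    set V : EuclideanSpace ℝ (Fin p) → ℝ := fun y => √z * (√⟪y, Q y⟫ - ρ) with hV
    have hz0 : 0 < z := hQ.pos
    have hVδ : ∀ y, |V y| ^ 2 = z * (√⟪y, Q y⟫ - ρ) ^ 2 := fun y => by
      rw [sq_abs, hV]; simp only; rw [mul_pow, Real.sq_sqrt hz0.le]
    have hδ : ∀ y, (√⟪y, Q y⟫ - ρ) ^ 2 ≤ |V y| ^ 2 / z₀ := fun y => by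
      rw [hVδ, le_div_iff₀ hz₀, mul_comm]
      gcongr
    have hYs : ∀ y, ⟪y, Q y⟫ = √⟪y, Q y⟫ ^ 2 := fun y => (Real.sq_sqrt (hQ.inner_nonneg y)).symm
    have hYz : ∀ y, ⟪y, Q y⟫ ≤ ‖y‖ ^ 2 / z₀ := fun y =>
      (hQ.inner_le y).trans (by gcongr)
    have hYi : Integrable (fun y => ⟪y, Q y⟫) μ := by
      refine ((hint 2).div_const z₀).mono' (Continuous.aestronglyMeasurable (by fun_prop))
        (Filter.Eventually.of_forall fun y => ?_)
      rw [Real.norm_of_nonneg (hQ.inner_nonneg y)]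
      exact hYz y
    have hρ2 : ρ ^ 2 ≤ c₂ * n := by
      calc ρ ^ 2 = ∫ _, ρ ^ 2 ∂μ := by simp
        _ ≤ ∫ y, (2 * (‖y‖ ^ 2 / z₀) + 2 * (|V y| ^ 2 / z₀)) ∂μ := by
            refine integral_mono (integrable_const _)
              ((((hint 2).div_const z₀).const_mul 2).add ((i2.div_const z₀).const_mul 2))
              fun y => ?_
            have h1 := hδ y
            have h2 := hYz y
            rw [hYs y] at h2
            change ρ ^ 2 ≤ 2 * (‖y‖ ^ 2 / z₀) + 2 * (|V y| ^ 2 / z₀)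
            nlinarith [sq_nonneg (2 * √⟪y, Q y⟫ - ρ)]
        _ = 2 * ((∫ y, ‖y‖ ^ 2 ∂μ) / z₀) + 2 * ((∫ y, |V y| ^ 2 ∂μ) / z₀) := by
            rw [integral_add (((hint 2).div_const z₀).const_mul 2)
              ((i2.div_const z₀).const_mul 2), integral_const_mul, integral_const_mul,
              integral_div, integral_div]
        _ ≤ 2 * (c₁ * n / z₀) + 2 * (K₂ * n / z₀) := by
            gcongr
            exact b2.trans (le_mul_of_one_le_right hK₂.le hn)
        _ = _ := by rw [hc₂]; ring
    have hpt : ∀ y, (⟪y, Q y⟫ - ρ ^ 2) ^ 4 ≤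
        128 * ρ ^ 4 * (|V y| ^ 4 / z₀ ^ 2) + 8 * (|V y| ^ 8 / z₀ ^ 4) := by
      intro y
      set δ := √⟪y, Q y⟫ - ρ with hδd
      have h1 : ⟪y, Q y⟫ - ρ ^ 2 = 2 * ρ * δ + δ ^ 2 := by
        rw [hYs y, hδd]; ring
      have h2 := hδ y
      rw [← hδd] at h2
      have h3 : δ ^ 4 ≤ |V y| ^ 4 / z₀ ^ 2 := by
        calc δ ^ 4 = (δ ^ 2) ^ 2 := by ring
          _ ≤ (|V y| ^ 2 / z₀) ^ 2 := by gcongr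
          _ = _ := by rw [div_pow]; ring
      have h4 : δ ^ 8 ≤ |V y| ^ 8 / z₀ ^ 4 := by
        calc δ ^ 8 = (δ ^ 2) ^ 4 := by ring
          _ ≤ (|V y| ^ 2 / z₀) ^ 4 := by gcongr
          _ = _ := by rw [div_pow]; ring
      rw [h1]
      calc (2 * ρ * δ + δ ^ 2) ^ 4 ≤ 8 * ((2 * ρ * δ) ^ 4 + (δ ^ 2) ^ 4) := add_pow_four_le _ _
        _ = 128 * ρ ^ 4 * δ ^ 4 + 8 * δ ^ 8 := by ring
        _ ≤ _ := by gcongr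
    have hdom := ((i4.div_const (z₀ ^ 2)).const_mul (128 * ρ ^ 4)).add
      ((i8.div_const (z₀ ^ 4)).const_mul 8)
    have hY4i : Integrable (fun y => (⟪y, Q y⟫ - ρ ^ 2) ^ 4) μ := by
      refine hdom.mono' (Continuous.aestronglyMeasurable (by fun_prop))
        (Filter.Eventually.of_forall fun y => ?_)
      rw [Real.norm_of_nonneg (by positivity)]
      exact hpt y
    have hY2i : Integrable (fun y => (⟪y, Q y⟫ - ρ ^ 2) ^ 2) μ := by
      refine (hY4i.add (integrable_const 1)).mono' (Continuous.aestronglyMeasurable (by fun_prop))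
        (Filter.Eventually.of_forall fun y => ?_)
      rw [Real.norm_of_nonneg (by positivity)]
      change (⟪y, Q y⟫ - ρ ^ 2) ^ 2 ≤ (⟪y, Q y⟫ - ρ ^ 2) ^ 4 + 1
      nlinarith [sq_nonneg ((⟪y, Q y⟫ - ρ ^ 2) ^ 2 - 1)]
    have h4 := integral_sub_mean_pow_four_le (ρ ^ 2) hYi hY2i hY4i
    have h5 : ∫ y, (⟪y, Q y⟫ - ρ ^ 2) ^ 4 ∂μ ≤ c₃ / 16 * n ^ 2 := by
      calc _ ≤ ∫ y, (128 * ρ ^ 4 * (|V y| ^ 4 / z₀ ^ 2) + 8 * (|V y| ^ 8 / z₀ ^ 4)) ∂μ :=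
            integral_mono hY4i hdom hpt
        _ = 128 * (ρ ^ 2) ^ 2 * ((∫ y, |V y| ^ 4 ∂μ) / z₀ ^ 2) +
            8 * ((∫ y, |V y| ^ 8 ∂μ) / z₀ ^ 4) := by
            rw [integral_add ((i4.div_const (z₀ ^ 2)).const_mul (128 * ρ ^ 4))
              ((i8.div_const (z₀ ^ 4)).const_mul 8), integral_const_mul, integral_const_mul,
              integral_div, integral_div]
            ring
        _ ≤ 128 * (c₂ * n) ^ 2 * (K₄ / z₀ ^ 2) + 8 * (K₈ * n ^ 2 / z₀ ^ 4) := by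
            gcongr
            exact b8.trans (le_mul_of_one_le_right hK₈.le (one_le_pow₀ hn))
        _ = _ := by rw [hc₃]; ring
    have h6 : ∀ y, (⟪y, Q y⟫ / n - ∫ y, ⟪y, Q y⟫ / n ∂μ) ^ 4 =
        (⟪y, Q y⟫ - ∫ y, ⟪y, Q y⟫ ∂μ) ^ 4 / n ^ 4 := by
      intro y
      rw [integral_div, ← sub_div, div_pow]
    simp only [h6]
    rw [integral_div, div_le_div_iff₀ (by positivity) (by positivity)]
    calc _ ≤ 16 * (c₃ / 16 * n ^ 2) * n ^ 2 := by
          gcongr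
          exact h4.trans (by gcongr)
      _ = c₃ * n ^ 4 := by ring
      _ ≤ _ := by gcongr; linarith

end Moments

/-! ### Covariances conjugated by resolvents, and the mixed covariance. -/

section Covariance

open scoped RealInnerProductSpace

variable {p : ℕ}

theorem inner_sq_le_of_nonneg {E : Type*} [NormedAddCommGroup E] [InnerProductSpace ℝ E]
    {S : E →ₗ[ℝ] E} (hs : ∀ v w, ⟪S v, w⟫ = ⟪v, S w⟫) (hnn : ∀ v, 0 ≤ ⟪v, S v⟫) (v w : E) :
    ⟪v, S w⟫ ^ 2 ≤ ⟪v, S v⟫ * ⟪w, S w⟫ := by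
  have h1 : ∀ t : ℝ, 0 ≤ ⟪w, S w⟫ * (t * t) + 2 * ⟪v, S w⟫ * t + ⟪v, S v⟫ := by
    intro t
    have := hnn (v + t • w)
    rw [map_add, map_smul, inner_add_left, inner_add_right, inner_add_right, real_inner_smul_left,
      real_inner_smul_left, real_inner_smul_right, real_inner_smul_right] at this
    have h2 : ⟪w, S v⟫ = ⟪v, S w⟫ := by rw [← hs, real_inner_comm]
    rw [h2] at this
    linarith
  have := discrim_le_zero h1
  rw [discrim] at this
  linarith

namespace LawMom

variable {μ : Measure (EuclideanSpace ℝ (Fin p))} {z₀ n C : ℝ}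

theorem integrable_coord (h : LawMom μ z₀ n C) (i j : Fin p) :
    Integrable (fun y : EuclideanSpace ℝ (Fin p) => y i * y j) μ := by
  have := h.prob
  refine integrable_of_polynomial h.int_pow (Continuous.measurable (by fun_prop)) (c := 1) (j := 2)
    fun y => ?_
  have h1 := PiLp.norm_apply_le y i
  have h2 := PiLp.norm_apply_le y j
  rw [Real.norm_eq_abs] at h1 h2
  rw [abs_mul, one_mul, pow_two]
  have := norm_nonneg y
  gcongr <;> linarith

theorem integrable_mean (h : LawMom μ z₀ n C) : Integrable (fun y => y) μ := by
  refine ((h.int_pow 1).mono' continuous_id.aestronglyMeasurable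
    (Filter.Eventually.of_forall fun y => ?_))
  simp

theorem integrable_inner_pow (h : LawMom μ z₀ n C) (a m : EuclideanSpace ℝ (Fin p)) (j : ℕ) :
    Integrable (fun y => ⟪a, y - m⟫ ^ j) μ := by
  have := h.prob
  refine integrable_of_polynomial h.int_pow (Continuous.measurable (by fun_prop))
    (c := (‖a‖ * (1 + ‖m‖)) ^ j) (j := j) fun y => ?_
  rw [abs_pow, ← mul_pow]
  refine pow_le_pow_left₀ (abs_nonneg _) ?_ j
  calc |⟪a, y - m⟫| ≤ ‖a‖ * ‖y - m‖ := abs_real_inner_le_norm _ _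
    _ ≤ ‖a‖ * (‖y‖ + ‖m‖) := by gcongr; exact norm_sub_le _ _
    _ ≤ ‖a‖ * ((1 + ‖m‖) * (1 + ‖y‖)) := by
        gcongr
        nlinarith [norm_nonneg y, norm_nonneg m]
    _ = _ := by ring

theorem inner_cov_self (h : LawMom μ z₀ n C) (a : EuclideanSpace ℝ (Fin p)) :
    ⟪a, op (popCov μ) a⟫ = ∫ y, ⟪y, a⟫ ^ 2 ∂μ := by
  rw [inner_popCov h.integrable_coord]
  simp only [pow_two]

theorem cov_nonneg (h : LawMom μ z₀ n C) (a : EuclideanSpace ℝ (Fin p)) :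
    0 ≤ ⟪a, op (popCov μ) a⟫ := by
  rw [h.inner_cov_self]
  exact integral_nonneg fun y => sq_nonneg _

theorem cov_cauchy (h : LawMom μ z₀ n C) (a b : EuclideanSpace ℝ (Fin p)) :
    ⟪a, op (popCov μ) b⟫ ^ 2 ≤ ⟪a, op (popCov μ) a⟫ * ⟪b, op (popCov μ) b⟫ :=
  inner_sq_le_of_nonneg (inner_op_popCov_symm μ) h.cov_nonneg a b

theorem integrable_inner_sq (h : LawMom μ z₀ n C) (a : EuclideanSpace ℝ (Fin p)) :
    Integrable (fun y => ⟪y, a⟫ ^ 2) μ := by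
  have := h.integrable_inner_pow a 0 2
  simpa only [sub_zero, real_inner_comm] using this

theorem integral_inner_eq (h : LawMom μ z₀ n C) (a : EuclideanSpace ℝ (Fin p)) :
    ∫ y, ⟪y, a⟫ ∂μ = ⟪∫ y, y ∂μ, a⟫ := by
  rw [real_inner_comm, ← integral_inner h.integrable_mean]
  simp only [real_inner_comm]

theorem mean_sq_le (h : LawMom μ z₀ n C) (a : EuclideanSpace ℝ (Fin p)) :
    ⟪∫ y, y ∂μ, a⟫ ^ 2 ≤ ⟪a, op (popCov μ) a⟫ := by
  have := h.prob
  rw [h.inner_cov_self, ← h.integral_inner_eq]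
  refine sq_integral_le ?_ (h.integrable_inner_sq a)
  have := h.integrable_inner_pow a 0 1
  simpa only [sub_zero, pow_one, real_inner_comm] using this

/-- `Σ = m mᵀ` plus the centred covariance, which is at most `C`. Large eigenvalues of `Σ` can thus
come only from the mean. -/
theorem cov_le (h : LawMom μ z₀ n C) (a : EuclideanSpace ℝ (Fin p)) :
    ⟪a, op (popCov μ) a⟫ ≤ ⟪∫ y, y ∂μ, a⟫ ^ 2 + C * ‖a‖ ^ 2 := by
  have := h.prob
  set m := ∫ y, y ∂μ with hm
  have h1 : ∀ y, ⟪y, a⟫ ^ 2 = ⟪a, y - m⟫ ^ 2 + (2 * ⟪m, a⟫ * ⟪y, a⟫ - ⟪m, a⟫ ^ 2) := by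
    intro y
    rw [inner_sub_right, real_inner_comm a y, real_inner_comm a m]
    ring
  have hi : Integrable (fun y => ⟪y, a⟫) μ := by
    have := h.integrable_inner_pow a 0 1
    simpa only [sub_zero, pow_one, real_inner_comm] using this
  rw [h.inner_cov_self, integral_congr_ae (Filter.Eventually.of_forall h1)]
  have hi2 : Integrable (fun y => 2 * ⟪m, a⟫ * ⟪y, a⟫ - ⟪m, a⟫ ^ 2) μ :=
    (hi.const_mul _).sub (integrable_const _)
  rw [integral_add (h.integrable_inner_pow a m 2) hi2,
    integral_sub (hi.const_mul _) (integrable_const _), integral_const_mul, h.integral_inner_eq, integral_const, probReal_univ, one_smul, ← hm]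
  have h2 : ∫ y, ⟪a, y - m⟫ ^ 2 ∂μ ≤ C * ‖a‖ ^ 2 := h.sq a
  linarith

/-- Conjugation of the covariance by a resolvent. -/
theorem cov_resolvent_le (h : LawMom μ z₀ n C) (hC : 0 ≤ C) (hz₀ : 0 < z₀) {z : ℝ} (hz : z₀ ≤ z)
    {S Q : EuclideanSpace ℝ (Fin p) →ₗ[ℝ] EuclideanSpace ℝ (Fin p)} (hQ : IsRes S Q z)
    (a : EuclideanSpace ℝ (Fin p)) :
    ⟪Q a, op (popCov μ) (Q a)⟫ ≤ (⟪∫ y, y ∂μ, Q (∫ y, y ∂μ)⟫ + C / z₀) * ⟪a, Q a⟫ := by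
  have h1 := h.cov_le (Q a)
  have h2 := hQ.cauchy (∫ y, y ∂μ) a
  have h3 : ‖Q a‖ ^ 2 ≤ ⟪a, Q a⟫ / z₀ := by
    rw [le_div_iff₀ hz₀, mul_comm]
    refine le_trans ?_ (hQ.mul_norm_sq_le a)
    gcongr
  calc _ ≤ _ := h1
    _ ≤ ⟪∫ y, y ∂μ, Q (∫ y, y ∂μ)⟫ * ⟪a, Q a⟫ + C * (⟪a, Q a⟫ / z₀) := by gcongr
    _ = _ := by ring

/-- Self-bounding: with `g = Q Σ w`, the previous bound at `Σ w` gives `⟪g, Σ g⟫ ≤ M ⟪w, Σ g⟫`, and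
Cauchy–Schwarz for `Σ` brings `⟪g, Σ g⟫` back on the right. The spectral norm of `Σ`, which may be
of order `n`, never appears. -/
theorem cov_resolvent_cov_le (h : LawMom μ z₀ n C) (hC : 0 ≤ C) (hz₀ : 0 < z₀) {z : ℝ}
    (hz : z₀ ≤ z) {S Q : EuclideanSpace ℝ (Fin p) →ₗ[ℝ] EuclideanSpace ℝ (Fin p)}
    (hQ : IsRes S Q z) (w : EuclideanSpace ℝ (Fin p)) :
    ⟪Q (op (popCov μ) w), op (popCov μ) (Q (op (popCov μ) w))⟫ ≤
      (⟪∫ y, y ∂μ, Q (∫ y, y ∂μ)⟫ + C / z₀) ^ 2 * ⟪w, op (popCov μ) w⟫ := by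
  set g := Q (op (popCov μ) w) with hg
  have h1 := h.cov_resolvent_le hC hz₀ hz hQ (op (popCov μ) w)
  rw [← hg, inner_op_popCov_symm] at h1
  have h2 := h.cov_cauchy w g
  have h3 := h.cov_nonneg g
  set M := ⟪∫ y, y ∂μ, Q (∫ y, y ∂μ)⟫ + C / z₀ with hM
  rcases h3.eq_or_lt with h0 | h0
  · rw [← h0]
    exact mul_nonneg (sq_nonneg _) (h.cov_nonneg w)
  · have h4 : ⟪g, op (popCov μ) g⟫ ^ 2 ≤ M ^ 2 * (⟪w, op (popCov μ) w⟫ * ⟪g, op (popCov μ) g⟫) := by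
      calc ⟪g, op (popCov μ) g⟫ ^ 2 ≤ (M * ⟪w, op (popCov μ) g⟫) ^ 2 := by gcongr
        _ = M ^ 2 * ⟪w, op (popCov μ) g⟫ ^ 2 := by ring
        _ ≤ _ := by gcongr
    nlinarith

theorem integrable_quad (h : LawMom μ z₀ n C)
    (Q : EuclideanSpace ℝ (Fin p) →ₗ[ℝ] EuclideanSpace ℝ (Fin p)) :
    Integrable (fun y => ⟪y, Q y⟫) μ := by
  have hQc : Continuous Q := Q.continuous_of_finiteDimensional
  refine integrable_of_polynomial h.int_pow (Continuous.measurable (by fun_prop))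
    (c := ‖LinearMap.toContinuousLinearMap Q‖) (j := 2) fun y => ?_
  have h2 : ‖Q y‖ ≤ ‖LinearMap.toContinuousLinearMap Q‖ * ‖y‖ :=
    (LinearMap.toContinuousLinearMap Q).le_opNorm y
  calc |⟪y, Q y⟫| ≤ ‖y‖ * ‖Q y‖ := abs_real_inner_le_norm _ _
    _ ≤ ‖y‖ * (‖LinearMap.toContinuousLinearMap Q‖ * ‖y‖) := by gcongr
    _ = ‖LinearMap.toContinuousLinearMap Q‖ * ‖y‖ ^ 2 := by ring
    _ ≤ _ := by gcongr; linarith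

theorem trace_nonneg (h : LawMom μ z₀ n C) {M : Matrix (Fin p) (Fin p) ℝ}
    (hM : ∀ v, 0 ≤ ⟪v, op M v⟫) : 0 ≤ (popCov μ * M).trace := by
  rw [trace_popCov_mul h.integrable_coord]
  exact integral_nonneg fun y => hM y

theorem trace_res_le (h : LawMom μ z₀ n C) {z : ℝ} (hz₀ : 0 < z₀) (hz : z₀ ≤ z)
    {S : EuclideanSpace ℝ (Fin p) →ₗ[ℝ] EuclideanSpace ℝ (Fin p)} {M : Matrix (Fin p) (Fin p) ℝ}
    (hM : IsRes S (op M) z) : (popCov μ * M).trace ≤ C * n / z₀ := by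
  rw [trace_popCov_mul h.integrable_coord]
  calc ∫ y, ⟪y, op M y⟫ ∂μ ≤ ∫ y, ‖y‖ ^ 2 / z₀ ∂μ := by
        refine integral_mono (h.integrable_quad _) ((h.int_pow 2).div_const _) fun y => ?_
        exact (hM.inner_le y).trans (by gcongr)
    _ = (∫ y, ‖y‖ ^ 2 ∂μ) / z₀ := integral_div _ _
    _ ≤ _ := by have := h.tr; gcongr

open scoped Matrix.Norms.L2Operator in
theorem abs_trace_le (h : LawMom μ z₀ n C) (M : Matrix (Fin p) (Fin p) ℝ) :
    |(popCov μ * M).trace| ≤ C * n * ‖M‖ := by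
  rw [trace_popCov_mul h.integrable_coord]
  calc |∫ y, ⟪y, op M y⟫ ∂μ| ≤ ∫ y, |⟪y, op M y⟫| ∂μ := abs_integral_le_integral_abs
    _ ≤ ∫ y, ‖M‖ * ‖y‖ ^ 2 ∂μ := by
        refine integral_mono (h.integrable_quad _).abs ((h.int_pow 2).const_mul _) fun y => ?_
        change |⟪y, op M y⟫| ≤ ‖M‖ * ‖y‖ ^ 2
        calc |⟪y, op M y⟫| ≤ ‖y‖ * ‖op M y‖ := abs_real_inner_le_norm _ _
          _ ≤ ‖y‖ * (‖M‖ * ‖y‖) := by gcongr; exact norm_op_le M y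
          _ = _ := by ring
    _ = ‖M‖ * ∫ y, ‖y‖ ^ 2 ∂μ := integral_const_mul _ _
    _ ≤ ‖M‖ * (C * n) := by have := h.tr; gcongr
    _ = _ := by ring

/-- Effect of a rank one update on the trace against the covariance. -/
theorem trace_rank_one (h : LawMom μ z₀ n C) (hC : 0 ≤ C) (hz₀ : 0 < z₀) {z : ℝ} (hz : z₀ ≤ z)
    {S S' : EuclideanSpace ℝ (Fin p) →ₗ[ℝ] EuclideanSpace ℝ (Fin p)}
    {M M' : Matrix (Fin p) (Fin p) ℝ} (hM : IsRes S (op M) z) (hM' : IsRes S' (op M') z)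
    {N : ℝ} (hN : 0 < N) (x : EuclideanSpace ℝ (Fin p))
    (hS : ∀ v, S' v = S v + (N⁻¹ * ⟪x, v⟫) • x) :
    |(popCov μ * M').trace - (popCov μ * M).trace| ≤
      ⟪∫ y, y ∂μ, op M (∫ y, y ∂μ)⟫ + C / z₀ := by
  rw [trace_popCov_mul h.integrable_coord, trace_popCov_mul h.integrable_coord]
  have h0 := hM.inner_nonneg x
  have h1 : ∫ y, ⟪y, op M' y⟫ ∂μ - ∫ y, ⟪y, op M y⟫ ∂μ =
      -(⟪op M x, op (popCov μ) (op M x)⟫ / (N + ⟪x, op M x⟫)) := by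
    rw [← integral_sub (h.integrable_quad _) (h.integrable_quad _), h.inner_cov_self,
      ← integral_div, ← integral_neg]
    refine integral_congr_ae (Filter.Eventually.of_forall fun y => ?_)
    simp only
    rw [hM.rank_one_inner hM' hN x hS y, real_inner_comm (op M x) y, hM.Q_symm]
    ring
  have h2 := h.cov_resolvent_le hC hz₀ hz hM x
  have h3 := hM.inner_nonneg (∫ y, y ∂μ)
  rw [h1, abs_neg, abs_of_nonneg (div_nonneg (h.cov_nonneg _) (by positivity)),
    div_le_iff₀ (by positivity)]
  refine h2.trans ?_
  gcongr
  linarith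

end LawMom

variable {n k : ℕ}

theorem inner_op_mixedCov (κ : Fin n → Fin k) (μ : Fin k → Measure (EuclideanSpace ℝ (Fin p)))
    (δ : Fin k → ℝ) (v w : EuclideanSpace ℝ (Fin p)) :
    ⟪v, op (mixedCov κ μ δ) w⟫ =
      ∑ l, ((classSize κ l : ℝ) / n / (1 + δ l)) * ⟪v, op (popCov (μ l)) w⟫ := by
  rw [mixedCov, op_sum, inner_sum]
  exact Finset.sum_congr rfl fun l _ => by rw [op_smul, real_inner_smul_right]

theorem isRes_mixedCov {z z₀ N C : ℝ} (hz : 0 < z) {κ : Fin n → Fin k}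
    {μ : Fin k → Measure (EuclideanSpace ℝ (Fin p))} (hμ : ∀ l, LawMom (μ l) z₀ N C)
    {δ : Fin k → ℝ} (hδ : ∀ l, 0 ≤ δ l) :
    IsRes (op (mixedCov κ μ δ)) (op (resolvent (mixedCov κ μ δ) z)) z := by
  refine isRes_resolvent hz (fun v w => ?_) fun v => ?_
  · rw [real_inner_comm, inner_op_mixedCov, inner_op_mixedCov]
    refine Finset.sum_congr rfl fun l _ => ?_
    rw [← inner_op_popCov_symm, real_inner_comm]
  · rw [real_inner_comm, inner_op_mixedCov]
    refine Finset.sum_nonneg fun l _ => mul_nonneg ?_ ((hμ l).cov_nonneg v)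
    have := hδ l
    positivity

/-- The mixed covariance contains `Σ_l` with weight `(n_l / n) / (1 + δ_l)`, its other terms are
nonnegative, and its conjugation by its own resolvent is at most that resolvent. -/
theorem inner_cov_mixed_le {z z₀ N C : ℝ} (hz : 0 < z) {κ : Fin n → Fin k}
    {μ : Fin k → Measure (EuclideanSpace ℝ (Fin p))} (hμ : ∀ l, LawMom (μ l) z₀ N C)
    {δ : Fin k → ℝ} (hδ : ∀ l, 0 ≤ δ l) {l : Fin k} (hl : 0 < classSize κ l)
    (v : EuclideanSpace ℝ (Fin p)) :
    ⟪op (resolvent (mixedCov κ μ δ) z) v,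
      op (popCov (μ l)) (op (resolvent (mixedCov κ μ δ) z) v)⟫ ≤
      (1 + δ l) * (n / classSize κ l) * (‖v‖ ^ 2 / z) := by
  have hR := isRes_mixedCov hz hμ hδ (κ := κ)
  set w := op (resolvent (mixedCov κ μ δ) z) v with hw
  have h1 := hR.inner_eq v
  have h2 := hR.inner_le v
  rw [← hw, real_inner_comm w (op (mixedCov κ μ δ) w), inner_op_mixedCov] at h1
  rw [← hw] at h2
  have h3 : ((classSize κ l : ℝ) / n / (1 + δ l)) * ⟪w, op (popCov (μ l)) w⟫ ≤
      ∑ l, ((classSize κ l : ℝ) / n / (1 + δ l)) * ⟪w, op (popCov (μ l)) w⟫ :=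
    Finset.single_le_sum (f := fun l => ((classSize κ l : ℝ) / n / (1 + δ l)) *
      ⟪w, op (popCov (μ l)) w⟫) (fun j _ => by
        have := hδ j
        have := (hμ j).cov_nonneg w
        positivity) (Finset.mem_univ l)
  have h4 : 0 ≤ z * ‖w‖ ^ 2 := by positivity
  have hc : (0 : ℝ) < classSize κ l := by exact_mod_cast hl
  have hn : (0 : ℝ) < n := hc.trans_le (by exact_mod_cast classSize_le κ l)
  have hd := hδ l
  calc ⟪w, op (popCov (μ l)) w⟫ = (1 + δ l) * (n / classSize κ l) *
        (((classSize κ l : ℝ) / n / (1 + δ l)) * ⟪w, op (popCov (μ l)) w⟫) := by field_simp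
    _ ≤ _ := by gcongr; linarith

end Covariance

/-! ### Integrability of functionals growing polynomially in one column; conditioning on the other
columns. -/

section PolynomialGrowth

open scoped RealInnerProductSpace

variable {ι F : Type*} [NormedAddCommGroup F]

/-- Functions of a family of vectors which grow at most polynomially in the `i`-th vector. -/
def PolyBdd (i : ι) (f : (ι → F) → ℝ) : Prop :=
  ∃ (c : ℝ) (j : ℕ), 0 ≤ c ∧ ∀ X, |f X| ≤ c * (1 + ‖X i‖) ^ j

namespace PolyBdd

variable {i : ι} {f g : (ι → F) → ℝ}

theorem of_bound {c : ℝ} (h : ∀ X, |f X| ≤ c) : PolyBdd i f := by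
  refine ⟨|c|, 0, abs_nonneg _, fun X => ?_⟩
  rw [pow_zero, mul_one]
  exact (h X).trans (le_abs_self c)

theorem const (c : ℝ) : PolyBdd i fun _ : ι → F => c := of_bound fun _ => le_rfl

theorem add (hf : PolyBdd i f) (hg : PolyBdd i g) : PolyBdd i fun X => f X + g X := by
  obtain ⟨c, j, hc, h⟩ := hf
  obtain ⟨c', j', hc', h'⟩ := hg
  refine ⟨c + c', j + j', by positivity, fun X => (abs_add_le _ _).trans ?_⟩
  have h1 : (1 : ℝ) ≤ 1 + ‖X i‖ := by linarith [norm_nonneg (X i)]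
  rw [add_mul]
  refine add_le_add ((h X).trans ?_) ((h' X).trans ?_)
  · gcongr
    exact Nat.le_add_right _ _
  · gcongr
    exact Nat.le_add_left _ _

theorem mul (hf : PolyBdd i f) (hg : PolyBdd i g) : PolyBdd i fun X => f X * g X := by
  obtain ⟨c, j, hc, h⟩ := hf
  obtain ⟨c', j', hc', h'⟩ := hg
  refine ⟨c * c', j + j', by positivity, fun X => ?_⟩
  rw [abs_mul]
  calc |f X| * |g X| ≤ (c * (1 + ‖X i‖) ^ j) * (c' * (1 + ‖X i‖) ^ j') :=
        mul_le_mul (h X) (h' X) (abs_nonneg _) (by positivity)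
    _ = _ := by rw [pow_add]; ring

theorem const_mul (hf : PolyBdd i f) (c : ℝ) : PolyBdd i fun X => c * f X := (const c).mul hf

theorem sub (hf : PolyBdd i f) (hg : PolyBdd i g) : PolyBdd i fun X => f X - g X := by
  have := hf.add (hg.const_mul (-1))
  simpa only [neg_one_mul, ← sub_eq_add_neg] using this

theorem pow (hf : PolyBdd i f) (j : ℕ) : PolyBdd i fun X => f X ^ j := by
  induction j with
  | zero => simpa using const (i := i) (F := F) 1
  | succ j ih => simpa only [pow_succ] using ih.mul hf

theorem inner_left [InnerProductSpace ℝ F] {v : (ι → F) → F} {c : ℝ} (h : ∀ X, ‖v X‖ ≤ c) :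
    PolyBdd i fun X => ⟪X i, v X⟫ := by
  refine ⟨|c|, 1, abs_nonneg _, fun X => ?_⟩
  calc |⟪X i, v X⟫| ≤ ‖X i‖ * ‖v X‖ := abs_real_inner_le_norm _ _
    _ ≤ (1 + ‖X i‖) * |c| := by
        gcongr
        · linarith
        · exact (h X).trans (le_abs_self c)
    _ = _ := by ring

variable [Fintype ι] [MeasurableSpace F] {ν : ι → Measure F}
  [∀ i, IsProbabilityMeasure (ν i)]

theorem integrable (hf : PolyBdd i f) (hm : Measurable f)
    (hν : ∀ j : ℕ, Integrable (fun y => ‖y‖ ^ j) (ν i)) : Integrable f (Measure.pi ν) := by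
  obtain ⟨c, j, hc, h⟩ := hf
  have h1 : Integrable (fun y => c * (1 + ‖y‖) ^ j) (ν i) := by
    refine Integrable.const_mul ?_ _
    simp only [add_pow]
    exact integrable_finsetSum _ fun i _ => (((hν _).const_mul _).mul_const _)
  exact ((measurePreserving_eval ν i).integrable_comp_of_integrable h1).mono'
    hm.aestronglyMeasurable (Filter.Eventually.of_forall h)

end PolyBdd

variable [Fintype ι] [DecidableEq ι] {α : Type*} [MeasurableSpace α] (ν : ι → Measure α)
  [∀ i, IsProbabilityMeasure (ν i)]

theorem integral_eq_integral_update (i : ι) {f : (ι → α) → ℝ} (hf : Measurable f)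
    (hi : Integrable f (Measure.pi ν)) :
    ∫ X, f X ∂(Measure.pi ν) = ∫ X, ∫ e, f (Function.update X i e) ∂(ν i) ∂(Measure.pi ν) := by
  have hmp := measurePreserving_update ν i
  rw [← hmp.integral_comp_measurable hf, integral_prod]
  exact hmp.integrable_comp_of_integrable hi

theorem integral_le_of_update (i : ι) {f g : (ι → α) → ℝ} (hf : Measurable f)
    (hi : Integrable f (Measure.pi ν)) (hg : Integrable g (Measure.pi ν))
    (h : ∀ X, ∫ e, f (Function.update X i e) ∂(ν i) ≤ g X) :
    ∫ X, f X ∂(Measure.pi ν) ≤ ∫ X, g X ∂(Measure.pi ν) := by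
  rw [integral_eq_integral_update ν i hf hi]
  have hmp := measurePreserving_update ν i
  refine integral_mono ?_ hg h
  exact (hmp.integrable_comp_of_integrable hi).integral_prod_left

end PolynomialGrowth

/-! ### Fourth moments of the leave-one-out forms. -/

section Bias

open scoped RealInnerProductSpace

variable {n p k : ℕ}

theorem continuous_trace_res (A : Matrix (Fin p) (Fin p) ℝ) {z : ℝ} (hz : 0 < z) :
    Continuous fun X : Fin n → EuclideanSpace ℝ (Fin p) => (A * res z X).trace := by
  simp only [trace_mul_eq_sum]
  exact continuous_finsetSum _ fun i _ => continuous_finsetSum _ fun j _ =>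
    continuous_const.mul (continuous_res_apply hz j i)

theorem continuous_update_zero (i : Fin n) :
    Continuous fun X : Fin n → EuclideanSpace ℝ (Fin p) => Function.update X i 0 :=
  continuous_id.update i continuous_const

section Column

variable {κ : Fin n → Fin k} {μ : Fin k → Measure (EuclideanSpace ℝ (Fin p))}
  [∀ l, IsProbabilityMeasure (μ l)] {z z₀ C C₁ ν : ℝ}

/-- The quadratic form of the resolvent without the `i`-th column at the mean of that column. -/
noncomputable def meanForm (μ : Measure (EuclideanSpace ℝ (Fin p))) (z : ℝ) (i : Fin n)
    (X : Fin n → EuclideanSpace ℝ (Fin p)) : ℝ :=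
  ⟪∫ y, y ∂μ, op (res z (Function.update X i 0)) (∫ y, y ∂μ)⟫

theorem meanForm_nonneg (μ : Measure (EuclideanSpace ℝ (Fin p))) (hz : 0 < z) (i : Fin n)
    (X : Fin n → EuclideanSpace ℝ (Fin p)) : 0 ≤ meanForm μ z i X :=
  (isRes_res hz _).inner_nonneg _

theorem continuous_meanForm (μ : Measure (EuclideanSpace ℝ (Fin p))) (hz : 0 < z) (i : Fin n) :
    Continuous (meanForm μ z i) :=
  continuous_inner_res hz (continuous_update_zero i) continuous_const continuous_const

theorem integrable_meanForm_pow (hμ : ∀ l, LawMom (μ l) z₀ n C) (hz : 0 < z) (i : Fin n) (c : ℝ)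
    (j : ℕ) : Integrable (fun X => (meanForm (μ (κ i)) z i X + c) ^ j)
      (Measure.pi fun i => μ (κ i)) := by
  refine PolyBdd.integrable (i := i) (((PolyBdd.of_bound
    (c := ‖∫ y, y ∂(μ (κ i))‖ ^ 2 / z) fun X => ?_).add (PolyBdd.const c)).pow j) ?_
    (hμ _).int_pow
  · rw [abs_of_nonneg (meanForm_nonneg _ hz i X)]
    exact (isRes_res hz _).inner_le _
  · exact (((continuous_meanForm _ hz i).add continuous_const).pow j).measurable

theorem integral_meanForm_pow_four_le (hμ : ∀ l, LawMom (μ l) z₀ n C) (hz : 0 < z)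
    (i : Fin n) {c N : ℝ} (hN : 0 < N) (hNn : N ≤ n)
    (hM : ∫ X, meanForm (μ (κ i)) z i X ^ 4 ∂(Measure.pi fun i => μ (κ i)) ≤ C₁ * (n / N) ^ 4) :
    ∫ X, (meanForm (μ (κ i)) z i X + c) ^ 4 ∂(Measure.pi fun i => μ (κ i)) ≤
      8 * (C₁ + c ^ 4) * (n / N) ^ 4 := by
  have h1 : 1 ≤ (n / N : ℝ) := by rwa [one_le_div hN]
  have hi := integrable_meanForm_pow (κ := κ) hμ hz i 0 4
  simp only [add_zero] at hi
  calc _ ≤ ∫ X, (8 * (meanForm (μ (κ i)) z i X ^ 4 + c ^ 4)) ∂(Measure.pi fun i => μ (κ i)) :=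
        integral_mono (integrable_meanForm_pow (κ := κ) hμ hz i c 4)
          ((hi.add (integrable_const _)).const_mul 8) fun X => add_pow_four_le _ _
    _ = 8 * (∫ X, meanForm (μ (κ i)) z i X ^ 4 ∂(Measure.pi fun i => μ (κ i)) + c ^ 4) := by
        rw [integral_const_mul, integral_add hi (integrable_const _)]
        simp
    _ ≤ 8 * (C₁ * (n / N) ^ 4 + c ^ 4 * (n / N) ^ 4) := by
        gcongr
        refine le_mul_of_one_le_right (by positivity) (one_le_pow₀ h1)
    _ = _ := by ring

theorem integral_meanForm_sq_le (hμ : ∀ l, LawMom (μ l) z₀ n C) (hz : 0 < z)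
    (i : Fin n) {c N : ℝ} (hN : 0 < N) (hNn : N ≤ n)
    (hM : ∫ X, meanForm (μ (κ i)) z i X ^ 4 ∂(Measure.pi fun i => μ (κ i)) ≤ C₁ * (n / N) ^ 4) :
    ∫ X, (meanForm (μ (κ i)) z i X + c) ^ 2 ∂(Measure.pi fun i => μ (κ i)) ≤
      (1 / 2 + 4 * (C₁ + c ^ 4)) * (n / N) ^ 2 := by
  have hn : (0 : ℝ) < n := hN.trans_le hNn
  have h4 := integral_meanForm_pow_four_le (c := c) hμ hz i hN hNn hM
  have hi := integrable_meanForm_pow (κ := κ) hμ hz i c 4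
  set b : ℝ := (n / N) ^ 2 with hb
  have hb0 : 0 < b := by positivity
  calc _ ≤ ∫ X, (b / 2 + (meanForm (μ (κ i)) z i X + c) ^ 4 / (2 * b))
        ∂(Measure.pi fun i => μ (κ i)) := by
        refine integral_mono (integrable_meanForm_pow (κ := κ) hμ hz i c 2)
          ((integrable_const _).add (hi.div_const _)) fun X => ?_
        change (meanForm (μ (κ i)) z i X + c) ^ 2 ≤
          b / 2 + (meanForm (μ (κ i)) z i X + c) ^ 4 / (2 * b)
        set a := meanForm (μ (κ i)) z i X + c with ha
        have : b / 2 + a ^ 4 / (2 * b) - a ^ 2 = (a ^ 2 - b) ^ 2 / (2 * b) := by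
          field_simp
          ring
        have h0 : 0 ≤ (a ^ 2 - b) ^ 2 / (2 * b) := by positivity
        linarith
    _ = b / 2 + (∫ X, (meanForm (μ (κ i)) z i X + c) ^ 4 ∂(Measure.pi fun i => μ (κ i))) /
        (2 * b) := by
        rw [integral_add (integrable_const _) (hi.div_const _), integral_const, probReal_univ,
          one_smul, integral_div]
    _ ≤ b / 2 + 8 * (C₁ + c ^ 4) * (n / N) ^ 4 / (2 * b) := by gcongr
    _ = _ := by
        have : (n / N : ℝ) ^ 4 = b * b := by rw [hb]; ring
        rw [this]
        field_simp
        ring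

/-- The normalized quadratic form of the `i`-th column in the resolvent without it. -/
noncomputable def selfForm (z : ℝ) (i : Fin n) (X : Fin n → EuclideanSpace ℝ (Fin p)) : ℝ :=
  ⟪X i, op (res z (Function.update X i 0)) (X i)⟫ / n

theorem continuous_selfForm (hz : 0 < z) (i : Fin n) :
    Continuous (selfForm (p := p) z i) :=
  (continuous_inner_res hz (continuous_update_zero i) (continuous_apply i)
    (continuous_apply i)).div_const _

theorem selfForm_nonneg (hz : 0 < z) (i : Fin n) (X : Fin n → EuclideanSpace ℝ (Fin p)) :
    0 ≤ selfForm z i X :=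
  div_nonneg ((isRes_res hz _).inner_nonneg _) (Nat.cast_nonneg n)

theorem polyBdd_selfForm (hz : 0 < z) (i : Fin n) : PolyBdd i (selfForm (p := p) z i) := by
  refine ⟨1 / z, 2, by positivity, fun X => ?_⟩
  rw [abs_of_nonneg (selfForm_nonneg hz i X)]
  have hn : (1 : ℝ) ≤ n := by exact_mod_cast i.pos
  have h1 := (isRes_res hz (Function.update X i 0)).inner_le (X i)
  calc selfForm z i X ≤ ⟪X i, op (res z (Function.update X i 0)) (X i)⟫ :=
        div_le_self ((isRes_res hz _).inner_nonneg _) hn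
    _ ≤ ‖X i‖ ^ 2 / z := h1
    _ ≤ (1 + ‖X i‖) ^ 2 / z := by gcongr; linarith
    _ = _ := by ring

/-- Three approximations: the form is close to its conditional mean, the leave-one-out trace `T'`
(field `quad`); `T'` is close to the full trace `T` by the rank-one update; `T` is close to `D` by
hypothesis. The second costs order `1 / N` in fourth mean, and `N ≥ ν √n` turns its fourth power
into `1 / n²`. -/
theorem integral_selfForm_pow_four_le (hμ : ∀ l, LawMom (μ l) z₀ n C) (hC : 0 ≤ C) (hz₀ : 0 < z₀)
    (hz : z₀ ≤ z) (hν : 0 < ν) (i : Fin n) {D N : ℝ} (hN : 0 < N) (hNn : N ≤ n)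
    (hνN : ν * √n ≤ N)
    (hM : ∫ X, meanForm (μ (κ i)) z i X ^ 4 ∂(Measure.pi fun i => μ (κ i)) ≤ C₁ * (n / N) ^ 4)
    (hC₁ : 0 ≤ C₁)
    (hT : ∫ X, ((n : ℝ)⁻¹ * (popCov (μ (κ i)) * res z X).trace - D) ^ 4
      ∂(Measure.pi fun i => μ (κ i)) ≤ C₁ / n ^ 2) :
    ∫ X, (selfForm z i X - D) ^ 4 ∂(Measure.pi fun i => μ (κ i)) ≤
      (8 * C₁ + 512 * (C₁ + (C / z₀) ^ 4) / ν ^ 4 + 64 * C) / n ^ 2 := by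
  have hz0 : 0 < z := by linarith
  have hn : (0 : ℝ) < n := hN.trans_le hNn
  set π := Measure.pi fun i => μ (κ i) with hπ
  set T : (Fin n → EuclideanSpace ℝ (Fin p)) → ℝ :=
    fun X => (n : ℝ)⁻¹ * (popCov (μ (κ i)) * res z X).trace with hTd
  have hTc : Continuous T := continuous_const.mul (continuous_trace_res _ hz0)
  have hTb : ∀ X, |T X| ≤ C / z₀ := by
    intro X
    have h1 := (hμ (κ i)).trace_res_le hz₀ hz (isRes_res hz0 X)
    have h2 := (hμ (κ i)).trace_nonneg (isRes_res hz0 X).inner_nonneg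
    rw [abs_of_nonneg (by positivity)]
    calc T X ≤ (n : ℝ)⁻¹ * (C * n / z₀) := by simp only [hTd]; gcongr
      _ = _ := by field_simp
  set T' : (Fin n → EuclideanSpace ℝ (Fin p)) → ℝ := fun X => T (Function.update X i 0) with hT'
  have hT'c : Continuous T' := hTc.comp (continuous_update_zero i)
  set m' : (Fin n → EuclideanSpace ℝ (Fin p)) → ℝ :=
    fun X => meanForm (μ (κ i)) z i X + C / z₀ with hm'
  have hTT : ∀ X, |T X - T' X| ≤ m' X / n := by
    intro X
    have h1 := (hμ (κ i)).trace_rank_one hC hz₀ hz (isRes_res hz0 (Function.update X i 0))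
      (isRes_res hz0 X) hn (X i) (fun v => by
        have := op_sampleCov_update X i (X i) v
        rwa [Function.update_eq_self] at this)
    simp only [hT', hTd]
    rw [← mul_sub, abs_mul, abs_of_pos (inv_pos.2 hn), inv_mul_eq_div]
    gcongr
    exact h1
  have ha : Integrable (fun X => (T X - D) ^ 4) π :=
    PolyBdd.integrable (i := i) (((PolyBdd.of_bound hTb).sub (PolyBdd.const D)).pow 4)
      ((hTc.sub continuous_const).pow 4).measurable (hμ _).int_pow
  have hb : Integrable (fun X => m' X ^ 4) π := integrable_meanForm_pow (κ := κ) hμ hz0 i _ 4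
  have hcm : Continuous fun X => (selfForm z i X - T' X) ^ 4 :=
    ((continuous_selfForm hz0 i).sub hT'c).pow 4
  have hc : Integrable (fun X => (selfForm z i X - T' X) ^ 4) π :=
    PolyBdd.integrable (i := i) (((polyBdd_selfForm hz0 i).sub
      (PolyBdd.of_bound fun X => hTb _)).pow 4) hcm.measurable (hμ _).int_pow
  have hd : Integrable (fun X => (selfForm z i X - D) ^ 4) π :=
    PolyBdd.integrable (i := i) (((polyBdd_selfForm hz0 i).sub (PolyBdd.const D)).pow 4)
      (((continuous_selfForm hz0 i).sub continuous_const).pow 4).measurable (hμ _).int_pow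
  have hcond : ∫ X, (selfForm z i X - T' X) ^ 4 ∂π ≤ C / n ^ 2 := by
    calc _ ≤ ∫ _, C / (n : ℝ) ^ 2 ∂π := by
          refine integral_le_of_update (fun i => μ (κ i)) i hcm.measurable hc
            (integrable_const _) fun X => ?_
          have h1 := (hμ (κ i)).quad _ _ z (isRes_res hz0 (Function.update X i 0)) hz
          refine le_trans (le_of_eq ?_) h1
          refine integral_congr_ae (Filter.Eventually.of_forall fun e => ?_)
          simp only [selfForm, hT', hTd, Function.update_idem, Function.update_self]
          rw [trace_popCov_mul (hμ (κ i)).integrable_coord, integral_div, inv_mul_eq_div]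
      _ = _ := by simp
  have hpt : ∀ X, (selfForm z i X - D) ^ 4 ≤
      64 * (selfForm z i X - T' X) ^ 4 + (64 / n ^ 4 * m' X ^ 4 + 8 * (T X - D) ^ 4) := by
    intro X
    have h1 := add_pow_four_le ((selfForm z i X - T' X) + (T' X - T X)) (T X - D)
    have h2 := add_pow_four_le (selfForm z i X - T' X) (T' X - T X)
    have h3 : (T' X - T X) ^ 4 ≤ m' X ^ 4 / n ^ 4 := by
      rw [← div_pow]
      calc (T' X - T X) ^ 4 = |T X - T' X| ^ 4 := by
            rw [abs_sub_comm, (by decide : Even 4).pow_abs]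
        _ ≤ _ := by gcongr; exact hTT X
    have h4 : (selfForm z i X - T' X) + (T' X - T X) + (T X - D) = selfForm z i X - D := by ring
    rw [h4] at h1
    have h5 : 64 / (n : ℝ) ^ 4 * m' X ^ 4 = 64 * (m' X ^ 4 / n ^ 4) := by ring
    rw [h5]
    linarith
  have hm4 := integral_meanForm_pow_four_le (c := C / z₀) hμ hz0 i hN hNn hM
  have hdom : Integrable (fun X => 64 / n ^ 4 * m' X ^ 4 + 8 * (T X - D) ^ 4) π :=
    (hb.const_mul _).add (ha.const_mul 8)
  have hN4 : ν ^ 4 * n ^ 2 ≤ N ^ 4 := by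
    calc ν ^ 4 * (n : ℝ) ^ 2 = (ν * √n) ^ 4 := by
          rw [mul_pow, show √(n : ℝ) ^ 4 = (√n ^ 2) ^ 2 by ring, Real.sq_sqrt hn.le]
      _ ≤ _ := by gcongr
  calc _ ≤ ∫ X, (64 * (selfForm z i X - T' X) ^ 4 +
        (64 / n ^ 4 * m' X ^ 4 + 8 * (T X - D) ^ 4)) ∂π :=
        integral_mono hd ((hc.const_mul 64).add hdom) hpt
    _ = 64 * ∫ X, (selfForm z i X - T' X) ^ 4 ∂π + (64 / n ^ 4 * ∫ X, m' X ^ 4 ∂π +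
        8 * ∫ X, (T X - D) ^ 4 ∂π) := by
        rw [integral_add (hc.const_mul 64) hdom, integral_add (hb.const_mul _) (ha.const_mul 8),
          integral_const_mul, integral_const_mul, integral_const_mul]
    _ ≤ 64 * (C / n ^ 2) + (64 / n ^ 4 * (8 * (C₁ + (C / z₀) ^ 4) * (n / N) ^ 4) +
        8 * (C₁ / n ^ 2)) := by gcongr
    _ = 64 * (C / n ^ 2) + (512 * (C₁ + (C / z₀) ^ 4) / N ^ 4 + 8 * (C₁ / n ^ 2)) := by
        field_simp
        ring
    _ ≤ 64 * (C / n ^ 2) + (512 * (C₁ + (C / z₀) ^ 4) / (ν ^ 4 * n ^ 2) + 8 * (C₁ / n ^ 2)) := by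
        gcongr
    _ = _ := by field_simp; ring

end Column

end Bias

/-! ### Leave-one-out expansion of the expected resolvent. -/

section BiasBound

open scoped RealInnerProductSpace

variable {n p k : ℕ} {κ : Fin n → Fin k} {μ : Fin k → Measure (EuclideanSpace ℝ (Fin p))}
  {z z₀ C C₁ C₂ ν : ℝ}

/-- Error made by replacing the `i`-th column by its law. -/
noncomputable def columnError (μ : Measure (EuclideanSpace ℝ (Fin p))) (z D : ℝ) (i : Fin n)
    (w : EuclideanSpace ℝ (Fin p)) (X : Fin n → EuclideanSpace ℝ (Fin p)) : ℝ :=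
  2 * (⟪X i, w⟫ ^ 2 * (selfForm z i X - D) ^ 2) +
    2 * (⟪X i, op (res z (Function.update X i 0)) (op (popCov μ) w)⟫ ^ 2 / n ^ 2)

theorem continuous_inner_res_update (hz : 0 < z) (i : Fin n) (a : EuclideanSpace ℝ (Fin p)) :
    Continuous fun X : Fin n → EuclideanSpace ℝ (Fin p) =>
      ⟪X i, op (res z (Function.update X i 0)) a⟫ :=
  continuous_inner_res hz (continuous_update_zero i) (continuous_apply i) continuous_const

theorem polyBdd_inner_res {x : (Fin n → EuclideanSpace ℝ (Fin p)) → Fin n →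
    EuclideanSpace ℝ (Fin p)} (hz : 0 < z) (i : Fin n) (a : EuclideanSpace ℝ (Fin p)) :
    PolyBdd i fun X => ⟪X i, op (res z (x X)) a⟫ :=
  PolyBdd.inner_left fun _ => (isRes_res hz _).norm_le a

theorem continuous_columnError (μ : Measure (EuclideanSpace ℝ (Fin p))) (hz : 0 < z) (D : ℝ)
    (i : Fin n) (w : EuclideanSpace ℝ (Fin p)) : Continuous (columnError μ z D i w) := by
  have h1 := continuous_selfForm (p := p) hz i
  have h2 := continuous_inner_res_update hz i (op (popCov μ) w)
  unfold columnError
  fun_prop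

theorem polyBdd_columnError (μ : Measure (EuclideanSpace ℝ (Fin p))) (hz : 0 < z) (D : ℝ)
    (i : Fin n) (w : EuclideanSpace ℝ (Fin p)) : PolyBdd i (columnError μ z D i w) := by
  refine PolyBdd.add (PolyBdd.const_mul (PolyBdd.mul (PolyBdd.pow (PolyBdd.inner_left
    (c := ‖w‖) fun _ => le_rfl) 2) (((polyBdd_selfForm hz i).sub (PolyBdd.const D)).pow 2)) 2) ?_
  simp only [div_eq_mul_inv]
  exact (((polyBdd_inner_res hz i _).pow 2).mul (PolyBdd.const _)).const_mul 2

variable [∀ l, IsProbabilityMeasure (μ l)]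

/-- In the first term, `⟪X_i, w⟫²` is at most of order `n / N` from the mean, plus a fluctuation
with bounded fourth moment; the inequality between arithmetic and geometric means leaves only fourth
powers of `selfForm - D`, which are `O(1/n²)`. The second term uses `cov_resolvent_cov_le`
conditionally on the other columns, and `n ≤ N² / ν²`. -/
theorem integral_columnError_le (hμ : ∀ l, LawMom (μ l) z₀ n C) (hC : 0 ≤ C) (hz₀ : 0 < z₀)
    (hz : z₀ ≤ z) (hν : 0 < ν) (i : Fin n) {D N c : ℝ} (hN : 0 < N) (hNn : N ≤ n)
    (hνN : ν * √n ≤ N) (hC₁ : 0 ≤ C₁) (hC₂ : 0 ≤ C₂)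
    (hM : ∫ X, meanForm (μ (κ i)) z i X ^ 4 ∂(Measure.pi fun i => μ (κ i)) ≤ C₁ * (n / N) ^ 4)
    (hτ : ∫ X, (selfForm z i X - D) ^ 4 ∂(Measure.pi fun i => μ (κ i)) ≤ C₂ / n ^ 2)
    (hc : 0 ≤ c) {w : EuclideanSpace ℝ (Fin p)} (hw : ‖w‖ ≤ 1 / z₀)
    (hcov : ⟪w, op (popCov (μ (κ i))) w⟫ ≤ c * (n / N)) :
    ∫ X, columnError (μ (κ i)) z D i w X ∂(Measure.pi fun i => μ (κ i)) ≤
      (2 * (c + c * C₂ + C / z₀ ^ 4 + C₂) +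
        2 * (c * (1 / 2 + 4 * (C₁ + (C / z₀) ^ 4)) / ν ^ 2)) / N := by
  have hz0 : 0 < z := by linarith
  have hn : (0 : ℝ) < n := hN.trans_le hNn
  set π := Measure.pi fun i => μ (κ i) with hπ
  set m := ∫ y, y ∂(μ (κ i)) with hm
  set f₁ : (Fin n → EuclideanSpace ℝ (Fin p)) → ℝ :=
    fun X => ⟪X i, w⟫ ^ 2 * (selfForm z i X - D) ^ 2 with hf₁
  set f₂ : (Fin n → EuclideanSpace ℝ (Fin p)) → ℝ :=
    fun X => ⟪X i, op (res z (Function.update X i 0)) (op (popCov (μ (κ i))) w)⟫ ^ 2 with hf₂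
  have hs := continuous_selfForm (p := p) hz0 i
  have hf₁i : Integrable f₁ π := PolyBdd.integrable (i := i)
    (PolyBdd.mul (PolyBdd.pow (PolyBdd.inner_left (c := ‖w‖) fun _ => le_rfl) 2)
      (((polyBdd_selfForm hz0 i).sub (PolyBdd.const D)).pow 2))
    (Continuous.measurable (by fun_prop)) (hμ _).int_pow
  have hf₂c : Continuous f₂ := (continuous_inner_res_update hz0 i _).pow 2
  have hf₂i : Integrable f₂ π := PolyBdd.integrable (i := i)
    ((polyBdd_inner_res hz0 i _).pow 2) hf₂c.measurable (hμ _).int_pow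
  have hd4 : Integrable (fun X => (selfForm z i X - D) ^ 4) π :=
    PolyBdd.integrable (i := i) (((polyBdd_selfForm hz0 i).sub (PolyBdd.const D)).pow 4)
      (Continuous.measurable (by fun_prop)) (hμ _).int_pow
  have hw4 : Integrable (fun X : Fin n → EuclideanSpace ℝ (Fin p) => ⟪w, X i - m⟫ ^ 4) π :=
    (measurePreserving_eval (fun i => μ (κ i)) i).integrable_comp_of_integrable
      ((hμ (κ i)).integrable_inner_pow w m 4)
  have hw4b : ∫ X : Fin n → EuclideanSpace ℝ (Fin p), ⟪w, X i - m⟫ ^ 4 ∂π ≤ C / z₀ ^ 4 := by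
    have h1 := (measurePreserving_eval (fun i => μ (κ i)) i).integral_comp_measurable
      (g := fun y => ⟪w, y - m⟫ ^ 4) (Continuous.measurable (by fun_prop))
    refine (le_of_eq h1).trans (((hμ (κ i)).four w).trans ?_)
    calc C * ‖w‖ ^ 4 ≤ C * (1 / z₀) ^ 4 := by gcongr
      _ = _ := by rw [one_div, inv_pow, div_eq_mul_inv]
  have hmw : ⟪m, w⟫ ^ 2 ≤ c * (n / N) := ((hμ (κ i)).mean_sq_le w).trans hcov
  have hpt : ∀ X, f₁ X ≤ c / N + (c * (n / N) * n + n) * (selfForm z i X - D) ^ 4 +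
      1 / n * ⟪w, X i - m⟫ ^ 4 := by
    intro X
    set Z := selfForm z i X - D with hZ
    set b := ⟪w, X i - m⟫ with hb
    have h1 : ⟪X i, w⟫ = ⟪m, w⟫ + b := by
      rw [hb, inner_sub_right, real_inner_comm w (X i), real_inner_comm w m]; ring
    have h2 : f₁ X ≤ 2 * (⟪m, w⟫ ^ 2 * Z ^ 2) + 2 * (b ^ 2 * Z ^ 2) := by
      have : (⟪m, w⟫ + b) ^ 2 ≤ 2 * ⟪m, w⟫ ^ 2 + 2 * b ^ 2 := by
        nlinarith [sq_nonneg (⟪m, w⟫ - b)]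
      calc f₁ X = (⟪m, w⟫ + b) ^ 2 * Z ^ 2 := by rw [← h1]
        _ ≤ (2 * ⟪m, w⟫ ^ 2 + 2 * b ^ 2) * Z ^ 2 := by gcongr
        _ = _ := by ring
    have h3 : 2 * Z ^ 2 ≤ 1 / n + n * Z ^ 4 := by
      have : 1 / (n : ℝ) + n * Z ^ 4 - 2 * Z ^ 2 = (n * Z ^ 2 - 1) ^ 2 / n := by
        field_simp
        ring
      have h0 : 0 ≤ (n * Z ^ 2 - 1) ^ 2 / (n : ℝ) := by positivity
      linarith
    have h4 : 2 * (b ^ 2 * Z ^ 2) ≤ 1 / n * b ^ 4 + n * Z ^ 4 := by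
      have : 1 / (n : ℝ) * b ^ 4 + n * Z ^ 4 - 2 * (b ^ 2 * Z ^ 2) =
          (n * Z ^ 2 - b ^ 2) ^ 2 / n := by
        field_simp
        ring
      have h0 : 0 ≤ (n * Z ^ 2 - b ^ 2) ^ 2 / (n : ℝ) := by positivity
      linarith
    have h5 : 2 * (⟪m, w⟫ ^ 2 * Z ^ 2) ≤ c * (n / N) * (1 / n + n * Z ^ 4) := by
      calc 2 * (⟪m, w⟫ ^ 2 * Z ^ 2) = ⟪m, w⟫ ^ 2 * (2 * Z ^ 2) := by ring
        _ ≤ c * (n / N) * (1 / n + n * Z ^ 4) :=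
          mul_le_mul hmw h3 (by positivity) (by positivity)
    have h6 : c * (n / N) * (1 / n + n * Z ^ 4) = c / N + c * (n / N) * n * Z ^ 4 := by
      field_simp
    rw [h6] at h5
    linarith
  have hI₁ : ∫ X, f₁ X ∂π ≤ (c + c * C₂ + C / z₀ ^ 4 + C₂) / N := by
    have hA : Integrable (fun X => c / N + (c * (n / N) * n + n) * (selfForm z i X - D) ^ 4) π :=
      (integrable_const _).add (hd4.const_mul _)
    calc ∫ X, f₁ X ∂π ≤ ∫ X, (c / N + (c * (n / N) * n + n) * (selfForm z i X - D) ^ 4 +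
          1 / n * ⟪w, X i - m⟫ ^ 4) ∂π := integral_mono hf₁i (hA.add (hw4.const_mul _)) hpt
      _ = c / N + (c * (n / N) * n + n) * ∫ X, (selfForm z i X - D) ^ 4 ∂π +
          1 / n * ∫ X : Fin n → EuclideanSpace ℝ (Fin p), ⟪w, X i - m⟫ ^ 4 ∂π := by
          rw [integral_add hA (hw4.const_mul _), integral_add (integrable_const _)
            (hd4.const_mul _), integral_const, probReal_univ, one_smul, integral_const_mul,
            integral_const_mul]
      _ ≤ c / N + (c * (n / N) * n + n) * (C₂ / n ^ 2) + 1 / n * (C / z₀ ^ 4) := by gcongr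
      _ = c / N + c * C₂ / N + C₂ / n + C / z₀ ^ 4 / n := by field_simp; ring
      _ ≤ c / N + c * C₂ / N + C₂ / N + C / z₀ ^ 4 / N := by gcongr
      _ = _ := by ring
  have hI₂ : ∫ X, f₂ X ∂π ≤ c * (n / N) * ((1 / 2 + 4 * (C₁ + (C / z₀) ^ 4)) * (n / N) ^ 2) := by
    have hi := integrable_meanForm_pow (κ := κ) hμ hz0 i (C / z₀) 2
    calc ∫ X, f₂ X ∂π ≤ ∫ X, c * (n / N) * (meanForm (μ (κ i)) z i X + C / z₀) ^ 2 ∂π := by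
          refine integral_le_of_update (fun i => μ (κ i)) i hf₂c.measurable hf₂i
            (hi.const_mul _) fun X => ?_
          simp only [hf₂, Function.update_self, Function.update_idem]
          rw [← (hμ (κ i)).inner_cov_self]
          refine ((hμ (κ i)).cov_resolvent_cov_le hC hz₀ hz (isRes_res hz0 _) w).trans ?_
          rw [mul_comm]
          exact mul_le_mul_of_nonneg_right hcov (sq_nonneg _)
      _ = c * (n / N) * ∫ X, (meanForm (μ (κ i)) z i X + C / z₀) ^ 2 ∂π := integral_const_mul _ _
      _ ≤ _ := by
          gcongr
          exact integral_meanForm_sq_le hμ hz0 i hN hNn hM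
  have hN2 : (n : ℝ) ≤ N ^ 2 / ν ^ 2 := by
    rw [le_div_iff₀ (by positivity)]
    calc (n : ℝ) * ν ^ 2 = (ν * √n) ^ 2 := by rw [mul_pow, Real.sq_sqrt hn.le]; ring
      _ ≤ _ := by gcongr
  calc ∫ X, columnError (μ (κ i)) z D i w X ∂π = 2 * ∫ X, f₁ X ∂π + 2 * ((∫ X, f₂ X ∂π) / n ^ 2) := by
        unfold columnError
        rw [integral_add (hf₁i.const_mul 2) ((hf₂i.div_const _).const_mul 2), integral_const_mul,
          integral_const_mul, integral_div]
    _ ≤ 2 * ((c + c * C₂ + C / z₀ ^ 4 + C₂) / N) +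
        2 * (c * (n / N) * ((1 / 2 + 4 * (C₁ + (C / z₀) ^ 4)) * (n / N) ^ 2) / n ^ 2) := by
        gcongr
    _ = 2 * ((c + c * C₂ + C / z₀ ^ 4 + C₂) / N) +
        2 * (c * (1 / 2 + 4 * (C₁ + (C / z₀) ^ 4)) * n / N ^ 3) := by
        field_simp
    _ ≤ 2 * ((c + c * C₂ + C / z₀ ^ 4 + C₂) / N) +
        2 * (c * (1 / 2 + 4 * (C₁ + (C / z₀) ^ 4)) * (N ^ 2 / ν ^ 2) / N ^ 3) := by
        gcongr
    _ = _ := by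
        field_simp

/-- Contribution of one column to the bias of the resolvent. -/
theorem abs_integral_column_le (hμ : ∀ l, LawMom (μ l) z₀ n C) (hz : 0 < z) (i : Fin n) {D : ℝ}
    (hD : 0 ≤ D) (v w : EuclideanSpace ℝ (Fin p)) :
    |∫ X, (⟪op (res z X) v, op (popCov (μ (κ i))) w⟫ / (1 + D) -
        ⟪X i, op (res z X) v⟫ * ⟪X i, w⟫) ∂(Measure.pi fun i => μ (κ i))| ≤
      ∫ X, (1 / (2 * √n) * ⟪X i, op (res z X) v⟫ ^ 2 +
        √n / 2 * columnError (μ (κ i)) z D i w X) ∂(Measure.pi fun i => μ (κ i)) := by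
  have hn : (0 : ℝ) < n := by exact_mod_cast i.pos
  have hsn : 0 < √(n : ℝ) := Real.sqrt_pos.2 hn
  set π := Measure.pi fun i => μ (κ i) with hπ
  set Sw := op (popCov (μ (κ i))) w with hSw
  set A : (Fin n → EuclideanSpace ℝ (Fin p)) → EuclideanSpace ℝ (Fin p) →ₗ[ℝ]
    EuclideanSpace ℝ (Fin p) := fun X => op (res z (Function.update X i 0)) with hA
  have hRA : ∀ X, IsRes (op (sampleCov (columns (Function.update X i 0)))) (A X) z :=
    fun X => isRes_res hz _
  have hup : ∀ (X : Fin n → EuclideanSpace ℝ (Fin p)) v, op (sampleCov (columns X)) v =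
      op (sampleCov (columns (Function.update X i 0))) v + ((n : ℝ)⁻¹ * ⟪X i, v⟫) • X i := by
    intro X v
    have := op_sampleCov_update X i (X i) v
    rwa [Function.update_eq_self] at this
  -- The main term, with the resolvent replaced by its leave-one-out version `A`. Given the other
  -- columns it has mean zero, by the definition of the covariance; `e` collects the rank-one error
  -- and the replacement of `selfForm` by `D`.
  set f₀ : (Fin n → EuclideanSpace ℝ (Fin p)) → ℝ :=
    fun X => ⟪A X v, Sw⟫ - ⟪X i, A X v⟫ * ⟪X i, w⟫ with hf₀
  set e : (Fin n → EuclideanSpace ℝ (Fin p)) → ℝ := fun X =>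
    -(1 / n * ⟪X i, op (res z X) v⟫ * ⟪X i, A X Sw⟫) -
      ⟪X i, op (res z X) v⟫ * ⟪X i, w⟫ * (D - selfForm z i X) with he
  have hdec : ∀ X, ⟪op (res z X) v, Sw⟫ / (1 + D) - ⟪X i, op (res z X) v⟫ * ⟪X i, w⟫ =
      1 / (1 + D) * f₀ X + 1 / (1 + D) * e X := by
    intro X
    have h1 := (hRA X).rank_one_apply (isRes_res hz X) hn (X i) (hup X) v
    have h2 := (hRA X).rank_one_sub (isRes_res hz X) hn (X i) (hup X) v
    have h3 := selfForm_nonneg hz i X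
    have h4 : ⟪X i, op (res z X) v⟫ * (1 + selfForm z i X) = ⟪X i, A X v⟫ := by
      have h5 : 1 + selfForm z i X ≠ 0 := by positivity
      change ⟪X i, op (res z X) v⟫ = ⟪X i, A X v⟫ / (1 + selfForm z i X) at h1
      rw [h1, div_mul_cancel₀ _ h5]
    have h6 : ⟪op (res z X) v, Sw⟫ = ⟪A X v, Sw⟫ -
        1 / n * ⟪X i, op (res z X) v⟫ * ⟪X i, A X Sw⟫ := by
      have h7 : op (res z X) v = A X v - ((n : ℝ)⁻¹ * ⟪X i, op (res z X) v⟫) • A X (X i) := by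
        rw [← h2]; abel
      conv_lhs => rw [h7]
      rw [inner_sub_left, real_inner_smul_left, (hRA X).Q_symm (X i), one_div]
    have hD1 : 1 + D ≠ 0 := by positivity
    rw [h6, hf₀, he]
    simp only
    rw [← h4]
    field_simp
    ring
  have hf₀c : Continuous f₀ := by
    have h1 : Continuous fun X => ⟪A X v, Sw⟫ := by
      simp only [(hRA _).Q_symm]
      exact continuous_inner_res hz (continuous_update_zero i) continuous_const continuous_const
    have h2 : Continuous fun X => ⟪X i, A X v⟫ := continuous_inner_res_update hz i v
    have h3 : Continuous fun X : Fin n → EuclideanSpace ℝ (Fin p) => ⟪X i, w⟫ := by fun_prop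
    exact h1.sub (h2.mul h3)
  have hw : PolyBdd i fun X : Fin n → EuclideanSpace ℝ (Fin p) => ⟪X i, w⟫ :=
    PolyBdd.inner_left (c := ‖w‖) fun _ => le_rfl
  have hf₀i : Integrable f₀ π := by
    refine PolyBdd.integrable (i := i) (PolyBdd.sub (PolyBdd.of_bound
      (c := ‖v‖ / z * ‖Sw‖) fun X => ?_) ((polyBdd_inner_res hz i v).mul hw)) hf₀c.measurable
      (hμ _).int_pow
    refine (abs_real_inner_le_norm _ _).trans ?_
    gcongr
    exact (hRA X).norm_le v
  have hRc : Continuous fun X : Fin n → EuclideanSpace ℝ (Fin p) => ⟪X i, op (res z X) v⟫ :=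
    continuous_inner_res hz continuous_id (continuous_apply i) continuous_const
  have hRp : PolyBdd i fun X : Fin n → EuclideanSpace ℝ (Fin p) => ⟪X i, op (res z X) v⟫ :=
    polyBdd_inner_res hz i v
  have hec : Continuous e := by
    have h1 : Continuous fun X => ⟪X i, A X Sw⟫ := continuous_inner_res_update hz i Sw
    have h2 := continuous_selfForm (p := p) hz i
    fun_prop
  have hei : Integrable e π := by
    have h1 : PolyBdd i fun X => ⟪X i, A X Sw⟫ := polyBdd_inner_res hz i Sw
    have h2 : PolyBdd i e := by
      have := (((hRp.const_mul (1 / n)).mul h1).const_mul (-1)).sub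
        ((hRp.mul hw).mul ((PolyBdd.const D).sub (polyBdd_selfForm hz i)))
      simpa only [neg_one_mul] using this
    exact h2.integrable hec.measurable (hμ _).int_pow
  have hf₀0 : ∫ X, f₀ X ∂π = 0 := by
    rw [hπ, integral_eq_integral_update (fun i => μ (κ i)) i hf₀c.measurable hf₀i]
    refine integral_eq_zero_of_ae (Filter.Eventually.of_forall fun X => ?_)
    simp only [hf₀, hA, Function.update_self, Function.update_idem, Pi.zero_apply]
    have h1 := inner_popCov (hμ (κ i)).integrable_coord (A X v) w
    have h2 : Integrable (fun y => ⟪y, A X v⟫ * ⟪y, w⟫) (μ (κ i)) := by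
      have h3 := ((hμ (κ i)).integrable_inner_sq (A X v)).add ((hμ (κ i)).integrable_inner_sq w)
      refine h3.mono' (Continuous.aestronglyMeasurable (by fun_prop))
        (Filter.Eventually.of_forall fun y => ?_)
      rw [Real.norm_eq_abs, abs_mul]
      change _ ≤ ⟪y, A X v⟫ ^ 2 + ⟪y, w⟫ ^ 2
      nlinarith [sq_nonneg (|⟪y, A X v⟫| - |⟪y, w⟫|), sq_abs ⟪y, A X v⟫, sq_abs ⟪y, w⟫,
        sq_nonneg ⟪y, A X v⟫, sq_nonneg ⟪y, w⟫]
    have h4 := integral_sub (integrable_const (μ := μ (κ i)) ⟪A X v, Sw⟫) h2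
    refine h4.trans ?_
    rw [← h1]
    simp [hSw]
  have hgi : Integrable (fun X => 1 / (2 * √n) * ⟪X i, op (res z X) v⟫ ^ 2 +
      √n / 2 * columnError (μ (κ i)) z D i w X) π :=
    PolyBdd.integrable (i := i) (((hRp.pow 2).const_mul _).add
      ((polyBdd_columnError _ hz D i w).const_mul _))
      ((continuous_const.mul (hRc.pow 2)).add
        (continuous_const.mul (continuous_columnError _ hz D i w))).measurable (hμ _).int_pow
  have hpt : ∀ X, |e X| ≤ 1 / (2 * √n) * ⟪X i, op (res z X) v⟫ ^ 2 +
      √n / 2 * columnError (μ (κ i)) z D i w X := by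
    intro X
    set a := ⟪X i, op (res z X) v⟫ with ha
    set b₁ := ⟪X i, w⟫ * (D - selfForm z i X) with hb₁
    set b₂ := ⟪X i, A X Sw⟫ / n with hb₂
    have h1 : e X = -(a * (b₁ + b₂)) := by
      rw [he, hb₁, hb₂]
      ring
    have h2 : columnError (μ (κ i)) z D i w X = 2 * b₁ ^ 2 + 2 * b₂ ^ 2 := by
      rw [hb₁, hb₂, mul_pow, div_pow, columnError]
      ring
    -- The weight `√n` balances the sums: after the factor `1 / n`, the squares `a²` sum to `O(1)`,
    -- while the column errors contribute `O(1/n)`.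
    have h3 : |a * (b₁ + b₂)| ≤ 1 / (2 * √n) * a ^ 2 + √n / 2 * (b₁ + b₂) ^ 2 := by
      rw [abs_mul]
      have : 1 / (2 * √n) * a ^ 2 + √n / 2 * (b₁ + b₂) ^ 2 - |a| * |b₁ + b₂| =
          (|a| - √n * |b₁ + b₂|) ^ 2 / (2 * √n) := by
        rw [← sq_abs a, ← sq_abs (b₁ + b₂)]
        field_simp
        ring
      have h0 : 0 ≤ (|a| - √n * |b₁ + b₂|) ^ 2 / (2 * √n) := by positivity
      linarith
    rw [h1, abs_neg, h2]
    refine h3.trans ?_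
    gcongr
    nlinarith [sq_nonneg (b₁ - b₂)]
  simp only [hdec]
  rw [integral_add (hf₀i.const_mul _) (hei.const_mul _), integral_const_mul, integral_const_mul,
    hf₀0, mul_zero, zero_add, abs_mul, abs_of_nonneg (by positivity)]
  have h1 : 1 / (1 + D) ≤ 1 := by
    rw [div_le_one (by positivity)]; linarith
  calc 1 / (1 + D) * |∫ X, e X ∂π| ≤ 1 * |∫ X, e X ∂π| := by gcongr
    _ ≤ ∫ X, |e X| ∂π := by rw [one_mul]; exact abs_integral_le_integral_abs
    _ ≤ _ := integral_mono hei.abs hgi hpt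

theorem sum_mixed (κ : Fin n → Fin k) (f : Fin k → ℝ) :
    ∑ l, ((classSize κ l : ℝ) / n) * f l = (n : ℝ)⁻¹ * ∑ i, f (κ i) := by
  rw [← Finset.sum_fiberwise Finset.univ κ, Finset.mul_sum]
  refine Finset.sum_congr rfl fun l _ => ?_
  rw [Finset.sum_congr rfl fun i hi => by rw [(Finset.mem_filter.1 hi).2], Finset.sum_const,
    nsmul_eq_mul, classSize]
  ring

/-- Bias of the quadratic forms of the resolvent. -/
theorem abs_integral_sub_le (hn : 1 ≤ n) (hμ : ∀ l, LawMom (μ l) z₀ n C) (hC : 0 ≤ C)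
    (hz₀ : 0 < z₀) (hz : z₀ ≤ z) (hν : 0 < ν) (hC₁ : 0 ≤ C₁)
    (hκ : ∀ i, ν * √n ≤ classSize κ (κ i)) {δ : Fin k → ℝ} (hδ : ∀ l, 0 ≤ δ l)
    (hδC : ∀ l, δ l ≤ C / z₀)
    (hM : ∀ i, ∫ X, meanForm (μ (κ i)) z i X ^ 4 ∂(Measure.pi fun i => μ (κ i)) ≤
      C₁ * (n / classSize κ (κ i)) ^ 4)
    (hT : ∀ l, ∫ X, ((n : ℝ)⁻¹ * (popCov (μ l) * res z X).trace - δ l) ^ 4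
      ∂(Measure.pi fun i => μ (κ i)) ≤ C₁ / n ^ 2) (hC₂ : C₂ = 8 * C₁ +
      512 * (C₁ + (C / z₀) ^ 4) / ν ^ 4 + 64 * C) {c C₅ : ℝ} (hc : c = (1 + C / z₀) / z₀)
    (hC₅ : C₅ = 2 * (c + c * C₂ + C / z₀ ^ 4 + C₂) +
        2 * (c * (1 / 2 + 4 * (C₁ + (C / z₀) ^ 4)) / ν ^ 2))
    {v : EuclideanSpace ℝ (Fin p)} (hv : ‖v‖ = 1) :
    |∫ X, ⟪v, op (res z X) v⟫ ∂(Measure.pi fun i => μ (κ i)) -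
      ⟪v, op (resolvent (mixedCov κ μ δ) z) v⟫| ≤ (1 / z₀ + C₅ * k) / (2 * √n) := by
  have hz0 : 0 < z := by linarith
  have hn0 : (0 : ℝ) < n := by exact_mod_cast hn
  have hsn : 0 < √(n : ℝ) := Real.sqrt_pos.2 hn0
  have hR := isRes_mixedCov hz0 hμ hδ (κ := κ)
  set w := op (resolvent (mixedCov κ μ δ) z) v with hw
  set π := Measure.pi fun i => μ (κ i) with hπ
  have hC₂0 : 0 ≤ C₂ := by rw [hC₂]; positivity
  have hc0 : 0 ≤ c := by rw [hc]; positivity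
  have hC₅0 : 0 ≤ C₅ := by rw [hC₅]; positivity
  set t : Fin n → (Fin n → EuclideanSpace ℝ (Fin p)) → ℝ := fun i X =>
    ⟪op (res z X) v, op (popCov (μ (κ i))) w⟫ / (1 + δ (κ i)) -
        ⟪X i, op (res z X) v⟫ * ⟪X i, w⟫ with ht
  -- The resolvent identity `Q - Q̃ = Q (Σ_δ - X Xᵀ / n) Q̃`, with both matrices written as sums
  -- over columns.
  have hdec : ∀ X, ⟪v, op (res z X) v⟫ - ⟪v, w⟫ = (n : ℝ)⁻¹ * ∑ i, t i X := by
    intro X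
    set a := op (res z X) v with ha
    have h1 : ⟪a, v⟫ = ⟪a, op (mixedCov κ μ δ) w⟫ + z * ⟪a, w⟫ := by
      conv_lhs => rw [← hR.eq v]
      rw [inner_add_right, real_inner_smul_right]
    have h2 : ⟪w, v⟫ = ⟪w, op (sampleCov (columns X)) a⟫ + z * ⟪a, w⟫ := by
      conv_lhs => rw [← (isRes_res hz0 X).eq v]
      rw [inner_add_right, real_inner_smul_right, real_inner_comm a w]
    have h3 : ⟪w, op (sampleCov (columns X)) a⟫ = (n : ℝ)⁻¹ * ∑ i, ⟪X i, a⟫ * ⟪X i, w⟫ := by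
      rw [real_inner_comm, inner_op_sampleCov]
    have h4 : ⟪a, op (mixedCov κ μ δ) w⟫ =
        (n : ℝ)⁻¹ * ∑ i, ⟪a, op (popCov (μ (κ i))) w⟫ / (1 + δ (κ i)) := by
      rw [inner_op_mixedCov, ← sum_mixed κ fun l => ⟪a, op (popCov (μ l)) w⟫ / (1 + δ l)]
      exact Finset.sum_congr rfl fun l _ => by ring
    rw [real_inner_comm a v, real_inner_comm w v, h1, h2, h3, h4, ht]
    simp only
    rw [Finset.sum_sub_distrib]
    ring
  have hRi : ∀ i, Integrable (fun X : Fin n → EuclideanSpace ℝ (Fin p) =>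
      ⟪X i, op (res z X) v⟫ ^ 2) π := fun i =>
    PolyBdd.integrable (i := i) ((polyBdd_inner_res hz0 i v).pow 2)
      ((continuous_inner_res hz0 continuous_id (continuous_apply i)
        continuous_const).pow 2).measurable (hμ _).int_pow
  have hEi : ∀ i, Integrable (columnError (μ (κ i)) z (δ (κ i)) i w) π := fun i =>
    (polyBdd_columnError _ hz0 _ i w).integrable (continuous_columnError _ hz0 _ i w).measurable
      (hμ _).int_pow
  have hti : ∀ i, Integrable (t i) π := by
    intro i
    have hc1 : Continuous fun X : Fin n → EuclideanSpace ℝ (Fin p) =>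
        ⟪op (res z X) v, op (popCov (μ (κ i))) w⟫ := by
      simp only [(isRes_res hz0 _).Q_symm]
      exact continuous_inner_res hz0 continuous_id continuous_const continuous_const
    have hc2 : Continuous fun X : Fin n → EuclideanSpace ℝ (Fin p) => ⟪X i, op (res z X) v⟫ :=
      continuous_inner_res hz0 continuous_id (continuous_apply i) continuous_const
    refine PolyBdd.integrable (i := i) (PolyBdd.sub (PolyBdd.of_bound
      (c := ‖v‖ / z * ‖op (popCov (μ (κ i))) w‖ / (1 + δ (κ i))) fun X => ?_)
      ((polyBdd_inner_res hz0 i v).mul (PolyBdd.inner_left (c := ‖w‖) fun _ => le_rfl))) ?_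
      (hμ _).int_pow
    · have := hδ (κ i)
      rw [abs_div, abs_of_pos (by positivity : 0 < 1 + δ (κ i))]
      gcongr
      refine (abs_real_inner_le_norm _ _).trans ?_
      gcongr
      exact (isRes_res hz0 X).norm_le v
    · exact Continuous.measurable ((hc1.div_const _).sub (hc2.mul (by fun_prop)))
  have hvR : Integrable (fun X : Fin n → EuclideanSpace ℝ (Fin p) => ⟪v, op (res z X) v⟫) π := by
    refine integrable_of_abs_le (B := ‖v‖ ^ 2 / z) (continuous_inner_res hz0 continuous_id
      continuous_const continuous_const).measurable fun X => ?_
    rw [abs_of_nonneg ((isRes_res hz0 X).inner_nonneg v)]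
    exact (isRes_res hz0 X).inner_le v
  have hE : ∀ i, ∫ X, columnError (μ (κ i)) z (δ (κ i)) i w X ∂π ≤ C₅ / classSize κ (κ i) := by
    intro i
    have hN : 0 < classSize κ (κ i) := Finset.card_pos.2 ⟨i, by simp⟩
    have hN' : (0 : ℝ) < classSize κ (κ i) := by exact_mod_cast hN
    have hNn : (classSize κ (κ i) : ℝ) ≤ n := by exact_mod_cast classSize_le κ (κ i)
    rw [hC₅]
    refine integral_columnError_le hμ hC hz₀ hz hν i hN' hNn (hκ i) hC₁ hC₂0 (hM i) ?_ hc0 ?_ ?_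
    · rw [hC₂]
      exact integral_selfForm_pow_four_le hμ hC hz₀ hz hν i hN' hNn (hκ i) (hM i) hC₁ (hT (κ i))
    · have := hR.norm_le v
      rw [hv] at this
      exact this.trans (by gcongr)
    · refine (inner_cov_mixed_le hz0 hμ hδ hN v).trans ?_
      rw [hv, one_pow, hc]
      have h1 := hδC (κ i)
      have h2 := hδ (κ i)
      calc (1 + δ (κ i)) * (n / classSize κ (κ i)) * (1 / z) ≤
            (1 + C / z₀) * (n / classSize κ (κ i)) * (1 / z₀) := by gcongr
        _ = _ := by ring
  have hsq : ∫ X, ((n : ℝ)⁻¹ * ∑ i, ⟪X i, op (res z X) v⟫ ^ 2) ∂π ≤ 1 / z₀ := by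
    have h1 : ∀ X : Fin n → EuclideanSpace ℝ (Fin p),
        (n : ℝ)⁻¹ * ∑ i, ⟪X i, op (res z X) v⟫ ^ 2 ≤ 1 / z₀ := by
      intro X
      have h2 := (isRes_res hz0 X).sum_sq_le (op_sampleCov X) v
      have h3 := (isRes_res hz0 X).inner_le v
      rw [hv, one_pow] at h3
      exact h2.trans (h3.trans (by gcongr))
    calc _ ≤ ∫ _, 1 / z₀ ∂π := integral_mono
          ((integrable_finsetSum _ fun i _ => hRi i).const_mul _) (integrable_const _) h1
      _ = _ := by simp
  have h0 : ∫ X, ⟪v, op (res z X) v⟫ ∂π - ⟪v, w⟫ = (n : ℝ)⁻¹ * ∑ i, ∫ X, t i X ∂π := by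
    rw [← integral_finsetSum _ fun i _ => hti i, ← integral_const_mul]
    simp only [← hdec]
    rw [integral_sub hvR (integrable_const _)]
    simp
  have hsum : ∑ i, C₅ / (classSize κ (κ i) : ℝ) ≤ C₅ * k := by
    have h1 := sum_inv_classSize_le κ Finset.univ
    calc ∑ i, C₅ / (classSize κ (κ i) : ℝ) = C₅ * ∑ i, (1 : ℝ) / classSize κ (κ i) := by
          rw [Finset.mul_sum]; exact Finset.sum_congr rfl fun i _ => by ring
      _ ≤ _ := by gcongr
  rw [h0, abs_mul, abs_of_pos (inv_pos.2 hn0)]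
  calc (n : ℝ)⁻¹ * |∑ i, ∫ X, t i X ∂π| ≤ (n : ℝ)⁻¹ * ∑ i, |∫ X, t i X ∂π| := by
        gcongr; exact Finset.abs_sum_le_sum_abs _ _
    _ ≤ (n : ℝ)⁻¹ * ∑ i, (1 / (2 * √n) * ∫ X, ⟪X i, op (res z X) v⟫ ^ 2 ∂π +
          √n / 2 * (C₅ / classSize κ (κ i))) := by
        gcongr with i
        refine (abs_integral_column_le hμ hz0 i (hδ (κ i)) v w).trans ?_
        rw [integral_add ((hRi i).const_mul _) ((hEi i).const_mul _), integral_const_mul,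
          integral_const_mul]
        gcongr
        exact hE i
    _ = 1 / (2 * √n) * ∫ X, ((n : ℝ)⁻¹ * ∑ i, ⟪X i, op (res z X) v⟫ ^ 2) ∂π +
          √n / 2 * (n : ℝ)⁻¹ * ∑ i, C₅ / (classSize κ (κ i) : ℝ) := by
        rw [integral_const_mul, integral_finsetSum _ fun i _ => hRi i, Finset.sum_add_distrib,
          ← Finset.mul_sum, ← Finset.mul_sum]
        ring
    _ ≤ 1 / (2 * √n) * (1 / z₀) + √n / 2 * (n : ℝ)⁻¹ * (C₅ * k) := by gcongr
    _ = _ := by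
        have : (n : ℝ)⁻¹ = 1 / (√n * √n) := by rw [Real.mul_self_sqrt hn0.le, one_div]
        rw [this]
        field_simp

end BiasBound

/-! ### Bias of bounded linear forms, centred at the expected traces. -/

section DeterministicEquivalent

open scoped RealInnerProductSpace

/-- The other columns of the same class, at least half of it since its size is at least two, locate
the mean. `mean_inner_res_le` is applied pointwise with a random constant, whose moments come from
the concentration of the norm of the centred sum. -/
theorem exists_meanForm_moment {q κ₀ z₀ : ℝ} (B Γ : ℝ) (hq : 0 < q) (hκ : 0 < κ₀) (hz₀ : 0 < z₀) :
    ∃ C₁ : ℝ, 0 ≤ C₁ ∧ ∀ {n p k : ℕ} (z r : ℝ) (κ : Fin n → Fin k)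
      (μ : Fin k → Measure (EuclideanSpace ℝ (Fin p))) [∀ l, IsProbabilityMeasure (μ l)],
      1 ≤ n → p ≤ Γ * n → z₀ ≤ z → (∀ l, LawReg (μ l) q r κ₀ B) → ∀ i, 2 ≤ classSize κ (κ i) →
      ∫ X, meanForm (μ (κ i)) z i X ^ 4 ∂(Measure.pi fun i => μ (κ i)) ≤
        C₁ * (n / classSize κ (κ i)) ^ 4 := by
  obtain ⟨G, hG, hnorm⟩ := exists_norm_sum B Γ hq hκ
  obtain ⟨K, hK, hmom⟩ := ExpBdd.moment B hq hκ 8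
  set c := 2 + 4 * G ^ 2 / z₀ with hc
  refine ⟨128 * (c ^ 4 + (4 / z₀) ^ 4 * K), by positivity,
    fun {n p k} z r κ μ _ hn hpn hz hμ i h2 => ?_⟩
  have hz0 : 0 < z := by linarith
  have hn1 : (1 : ℝ) ≤ n := by exact_mod_cast hn
  have hn0 : (0 : ℝ) < n := by linarith
  set π := Measure.pi fun i => μ (κ i) with hπ
  obtain ⟨N, hN⟩ : ∃ N : ℝ, N = (classSize κ (κ i) : ℕ) := ⟨_, rfl⟩
  rw [← hN]
  set J := (Finset.univ.filter fun j => κ j = κ i).erase i with hJ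
  have hJc : J.card + 1 = classSize κ (κ i) :=
    Finset.card_erase_add_one (by simp)
  have hJ2 : N ≤ 2 * J.card := by
    rw [hN]
    have : classSize κ (κ i) ≤ 2 * J.card := by omega
    exact_mod_cast this
  have hN0 : 0 < N := by
    rw [hN]
    have : 0 < classSize κ (κ i) := by omega
    exact_mod_cast this
  have hJ0 : (0 : ℝ) < J.card := by linarith
  have hJn : J.Nonempty := Finset.card_pos.1 (by exact_mod_cast hJ0)
  obtain ⟨ρ, hρ0, hρ, hE⟩ := hnorm (μ (κ i)) r n (hμ _) hn1 hpn J.card hJn.card_pos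
  have hE' := expBdd_norm_sum_of_subset (ν := fun i => μ (κ i)) (fun j hj => by
    rw [(Finset.mem_filter.1 (Finset.mem_of_mem_erase hj)).2]) hE
  set m := ∫ y, y ∂(μ (κ i)) with hm
  set V : (Fin n → EuclideanSpace ℝ (Fin p)) → ℝ := fun X =>
    (√J.card)⁻¹ * ‖∑ j ∈ J, (X j - m)‖ - ρ with hV
  obtain ⟨hVi, hVb⟩ := hmom π V (Continuous.measurable (by fun_prop)) hE'
  have hpt : ∀ X, meanForm (μ (κ i)) z i X ≤ (c + 4 / z₀ * V X ^ 2) * (2 * (n / N)) := by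
    intro X
    set h := (√J.card)⁻¹ * ‖∑ j ∈ J, (X j - m)‖ with hh
    have h1 := mean_inner_res_le (G := h ^ 2 / n) hz₀ hz (Function.update X i 0) m hJn (by
      refine le_of_eq ?_
      have e1 : ∑ j ∈ J, (Function.update X i 0 j - m) = ∑ j ∈ J, (X j - m) :=
        Finset.sum_congr rfl fun j hj => by
          rw [Function.update_of_ne (Finset.ne_of_mem_erase hj)]
      rw [e1, hh, mul_pow, inv_pow, Real.sq_sqrt hJ0.le]
      field_simp)
    have h2 : h ^ 2 / n ≤ 2 * G ^ 2 + 2 * V X ^ 2 := by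
      rw [div_le_iff₀ hn0]
      have e2 : h = ρ + V X := by rw [hV]; simp only; rw [hh]; ring
      have e3 : ρ ^ 2 ≤ G ^ 2 * n := by
        calc ρ ^ 2 ≤ (G * √n) ^ 2 := by gcongr
          _ = _ := by rw [mul_pow, Real.sq_sqrt hn0.le]
      have e4 : V X ^ 2 ≤ V X ^ 2 * n := le_mul_of_one_le_right (sq_nonneg _) hn1
      rw [e2]
      nlinarith [sq_nonneg (ρ - V X)]
    have h3 : (n : ℝ) / J.card ≤ 2 * (n / N) := by
      rw [← mul_div_assoc, div_le_div_iff₀ hJ0 hN0]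
      nlinarith
    calc meanForm (μ (κ i)) z i X ≤ (2 + 2 * (h ^ 2 / n) / z₀) * (n / J.card) := h1
      _ ≤ (2 + 2 * (2 * G ^ 2 + 2 * V X ^ 2) / z₀) * (2 * (n / N)) := by gcongr
      _ = _ := by rw [hc]; ring
  have hpt4 : ∀ X, meanForm (μ (κ i)) z i X ^ 4 ≤
      128 * (n / N) ^ 4 * (c ^ 4 + (4 / z₀) ^ 4 * |V X| ^ 8) := by
    intro X
    have h0 := meanForm_nonneg (μ (κ i)) hz0 i X
    calc meanForm (μ (κ i)) z i X ^ 4 ≤ ((c + 4 / z₀ * V X ^ 2) * (2 * (n / N))) ^ 4 := by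
          gcongr; exact hpt X
      _ = 16 * (n / N) ^ 4 * (c + 4 / z₀ * V X ^ 2) ^ 4 := by ring
      _ ≤ 16 * (n / N) ^ 4 * (8 * (c ^ 4 + (4 / z₀ * V X ^ 2) ^ 4)) := by
          gcongr; exact add_pow_four_le _ _
      _ = _ := by rw [(by decide : Even 8).pow_abs]; ring
  calc _ ≤ ∫ X, 128 * (n / N) ^ 4 * (c ^ 4 + (4 / z₀) ^ 4 * |V X| ^ 8) ∂π :=
        integral_mono_of_nonneg (Filter.Eventually.of_forall fun X => by positivity)
          (((integrable_const _).add (hVi.const_mul _)).const_mul _)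
          (Filter.Eventually.of_forall hpt4)
    _ = 128 * (n / N) ^ 4 * (c ^ 4 + (4 / z₀) ^ 4 * ∫ X, |V X| ^ 8 ∂π) := by
        rw [integral_const_mul, integral_add (integrable_const _) (hVi.const_mul _),
          integral_const_mul, integral_const, probReal_univ, one_smul]
    _ ≤ 128 * (n / N) ^ 4 * (c ^ 4 + (4 / z₀) ^ 4 * K) := by gcongr
    _ = _ := by ring

theorem LawMom.mono {p : ℕ} {μ : Measure (EuclideanSpace ℝ (Fin p))} {z₀ n C C' : ℝ}
    (h : LawMom μ z₀ n C) (hn : 0 ≤ n) (hC : C ≤ C') : LawMom μ z₀ n C' where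
  prob := h.prob
  int_pow := h.int_pow
  sq a := (h.sq a).trans (by gcongr)
  four a := (h.four a).trans (by gcongr)
  tr := h.tr.trans (by gcongr)
  quad S Q z hQ hz := (h.quad S Q z hQ hz).trans (by gcongr)

/-- The expected normalized trace of the resolvent against the covariance of a class. -/
noncomputable def traceMean {n p k : ℕ} (κ : Fin n → Fin k)
    (μ : Fin k → Measure (EuclideanSpace ℝ (Fin p))) (z : ℝ) (l : Fin k) : ℝ :=
  ∫ X, (n : ℝ)⁻¹ * (popCov (μ l) * res z X).trace ∂(Measure.pi fun i => μ (κ i))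

/-- The normalized trace against a covariance, as a linear form. -/
noncomputable def traceForm {p : ℕ} (μ : Measure (EuclideanSpace ℝ (Fin p))) (c : ℝ) :
    Matrix (Fin p) (Fin p) ℝ →ₗ[ℝ] ℝ :=
  c • (Matrix.traceLinearMap (Fin p) ℝ ℝ ∘ₗ LinearMap.mulLeft ℝ (popCov μ))

theorem traceForm_apply {p : ℕ} (μ : Measure (EuclideanSpace ℝ (Fin p))) (c : ℝ)
    (M : Matrix (Fin p) (Fin p) ℝ) : traceForm μ c M = c * (popCov μ * M).trace := by
  simp [traceForm]

open scoped Matrix.Norms.L2Operator in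
theorem LawMom.abs_traceForm_le {p : ℕ} {μ : Measure (EuclideanSpace ℝ (Fin p))} {z₀ n C : ℝ}
    (h : LawMom μ z₀ n C) (hC : 0 < C) (hn : 0 < n) (M : Matrix (Fin p) (Fin p) ℝ) :
    |traceForm μ (1 / (C * n)) M| ≤ ‖M‖ := by
  rw [traceForm_apply, abs_mul, abs_of_pos (by positivity), one_div, inv_mul_le_iff₀ (by positivity)]
  exact h.abs_trace_le M

open scoped Matrix.Norms.L2Operator in
theorem abs_sub_le_of_quadratic {p : ℕ} {M M' : Matrix (Fin p) (Fin p) ℝ} (hM : M.IsSymm)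
    (hM' : M'.IsSymm) {ε : ℝ} (hε : 0 ≤ ε)
    (h : ∀ v : EuclideanSpace ℝ (Fin p), ‖v‖ = 1 → |⟪v, op M v⟫ - ⟪v, op M' v⟫| ≤ ε)
    {u : Matrix (Fin p) (Fin p) ℝ →ₗ[ℝ] ℝ} (hu : ∀ M, |u M| ≤ ‖M‖) : |u M - u M'| ≤ ε := by
  obtain ⟨a, v, hv, ha, hav⟩ := exists_quadratic_decomposition u hu
  rw [hav M hM, hav M' hM', ← Finset.sum_sub_distrib]
  calc |∑ k, (a k * ⟪v k, op M (v k)⟫ - a k * ⟪v k, op M' (v k)⟫)|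
      ≤ ∑ k, |a k * ⟪v k, op M (v k)⟫ - a k * ⟪v k, op M' (v k)⟫| :=
        Finset.abs_sum_le_sum_abs _ _
    _ ≤ ∑ k, |a k| * ε := by
        refine Finset.sum_le_sum fun k _ => ?_
        rw [← mul_sub, abs_mul]
        gcongr
        exact h _ (hv k)
    _ = (∑ k, |a k|) * ε := by rw [Finset.sum_mul]
    _ ≤ 1 * ε := by gcongr
    _ = ε := one_mul ε

set_option maxHeartbeats 1000000 in
open scoped Matrix.Norms.L2Operator in
/-- Bias of bounded linear forms of the resolvent. -/
theorem exists_bias {q κ₀ z₀ ν : ℝ} (B Γ M : ℝ) (K : ℕ) (hq : 0 < q) (hq2 : q ≤ 2) (hκ : 0 < κ₀)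
    (hz₀ : 0 < z₀) (hν : 0 < ν) :
    ∃ C : ℝ, 0 < C ∧ ∀ {n p k : ℕ} (z : ℝ) (κ : Fin n → Fin k)
      (μ : Fin k → Measure (EuclideanSpace ℝ (Fin p))) [∀ l, IsProbabilityMeasure (μ l)],
      1 ≤ n → p ≤ Γ * n → k ≤ K → z₀ ≤ z → (∀ l, LawReg (μ l) q (max q 1) κ₀ B) →
      (∀ l, ‖∫ y, y ∂(μ l)‖ ≤ M * √p) →
      (∀ i, ν * √n ≤ classSize κ (κ i)) → (∀ i, 2 ≤ classSize κ (κ i)) →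
      (∀ l, LawMom (μ l) z₀ n C) ∧ (∀ l, 0 ≤ traceMean κ μ z l) ∧
      (∀ l, |traceMean κ μ z l - (n : ℝ)⁻¹ *
        (popCov (μ l) * resolvent (mixedCov κ μ (traceMean κ μ z)) z).trace| ≤ C / √n) ∧
      ∀ u : Matrix (Fin p) (Fin p) ℝ →ₗ[ℝ] ℝ, (∀ M, |u M| ≤ ‖M‖) →
        |∫ X, u (res z X) ∂(Measure.pi fun i => μ (κ i)) -
          u (resolvent (mixedCov κ μ (traceMean κ μ z)) z)| ≤ C / √n := by
  obtain ⟨C, hC, hlm⟩ := exists_lawMom B Γ M hq hκ hz₀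
  obtain ⟨C₁, hC₁, hmean⟩ := exists_meanForm_moment B Γ hq hκ hz₀
  obtain ⟨κ', B', hκ', hconc⟩ := exists_expBdd_res B K Γ hq hq2 hκ hz₀ hν
  obtain ⟨K₄, hK₄, hmom⟩ := ExpBdd.moment B' hq hκ' 4
  -- One constant for both fourth-moment hypotheses of `abs_integral_sub_le`: `C₁` for the mean
  -- forms, `C⁴ K₄` for the traces.
  obtain ⟨C₁', hC₁'⟩ : ∃ x, x = C₁ + C ^ 4 * K₄ := ⟨_, rfl⟩
  obtain ⟨C₂, hC₂⟩ : ∃ x, x = 8 * C₁' + 512 * (C₁' + (C / z₀) ^ 4) / ν ^ 4 + 64 * C := ⟨_, rfl⟩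
  obtain ⟨c, hc⟩ : ∃ x, x = (1 + C / z₀) / z₀ := ⟨_, rfl⟩
  obtain ⟨C₅, hC₅⟩ : ∃ x, x = 2 * (c + c * C₂ + C / z₀ ^ 4 + C₂) +
    2 * (c * (1 / 2 + 4 * (C₁' + (C / z₀) ^ 4)) / ν ^ 2) := ⟨_, rfl⟩
  obtain ⟨C₆, hC₆⟩ : ∃ x, x = (1 / z₀ + C₅ * K) / 2 := ⟨_, rfl⟩
  have hC₁0 : 0 ≤ C₁' := by rw [hC₁']; positivity
  have hC₂0 : 0 ≤ C₂ := by rw [hC₂]; positivity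
  have hc0 : 0 ≤ c := by rw [hc]; positivity
  have hC₅0 : 0 ≤ C₅ := by rw [hC₅]; positivity
  have hC₆0 : 0 ≤ C₆ := by rw [hC₆]; positivity
  refine ⟨C + C₆ + C * C₆, by positivity,
    fun {n p k} z κ μ _ hn hpn hk hz hμ hM hκν h2 => ?_⟩
  have hz0 : 0 < z := by linarith
  have hn1 : (1 : ℝ) ≤ n := by exact_mod_cast hn
  have hn0 : (0 : ℝ) < n := by linarith
  have hs : 0 < √(n : ℝ) := Real.sqrt_pos.2 hn0
  have hm : ∀ l, LawMom (μ l) z₀ n C := fun l => hlm (μ l) _ n (hμ l) hn1 hpn (hM l)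
  set π := Measure.pi fun i => μ (κ i) with hπ
  set D := traceMean κ μ z with hD
  have hTn : ∀ l X, 0 ≤ (n : ℝ)⁻¹ * (popCov (μ l) * res z (X : Fin n → _)).trace := fun l X =>
    mul_nonneg (by positivity) ((hm l).trace_nonneg (isRes_res hz0 X).inner_nonneg)
  have hTC : ∀ l X, (n : ℝ)⁻¹ * (popCov (μ l) * res z (X : Fin n → _)).trace ≤ C / z₀ := by
    intro l X
    have h1 := (hm l).trace_res_le hz₀ hz (isRes_res hz0 X)
    calc _ ≤ (n : ℝ)⁻¹ * (C * n / z₀) := by gcongr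
      _ = _ := by field_simp
  have hTm : ∀ l, Measurable fun X : Fin n → EuclideanSpace ℝ (Fin p) =>
      (n : ℝ)⁻¹ * (popCov (μ l) * res z X).trace := fun l =>
    (continuous_const.mul (continuous_trace_res _ hz0)).measurable
  have hTi : ∀ l, Integrable (fun X : Fin n → EuclideanSpace ℝ (Fin p) =>
      (n : ℝ)⁻¹ * (popCov (μ l) * res z X).trace) π := fun l =>
    integrable_of_abs_le (hTm l) fun X => by
      rw [abs_of_nonneg (hTn l X)]; exact hTC l X
  have hD0 : ∀ l, 0 ≤ D l := fun l => integral_nonneg (hTn l)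
  have hDC : ∀ l, D l ≤ C / z₀ := fun l => by
    calc D l ≤ ∫ _, C / z₀ ∂π := integral_mono (hTi l) (integrable_const _) (hTC l)
      _ = _ := by simp
  have hT : ∀ l, ∫ X, ((n : ℝ)⁻¹ * (popCov (μ l) * res z X).trace - D l) ^ 4 ∂π ≤ C₁' / n ^ 2 := by
    intro l
    -- A trace against `Σ_l` has norm at most `C n` as a linear form, so after normalization the
    -- concentration already proved bounds its fourth central moment.
    have h1 := hconc z κ μ hn hpn hk hz hμ hκν h2 (traceForm (μ l) (1 / (C * n)))
      ((hm l).abs_traceForm_le hC hn0)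
    have hu : ∀ X : Fin n → EuclideanSpace ℝ (Fin p), traceForm (μ l) (1 / (C * n)) (res z X) =
        C⁻¹ * ((n : ℝ)⁻¹ * (popCov (μ l) * res z X).trace) := by
      intro X
      rw [traceForm_apply]
      field_simp
    have e : (fun X : Fin n → EuclideanSpace ℝ (Fin p) =>
        √n * (traceForm (μ l) (1 / (C * n)) (res z X) -
          ∫ X, traceForm (μ l) (1 / (C * n)) (res z X) ∂π)) =
        fun X => √n * (C⁻¹ * ((n : ℝ)⁻¹ * (popCov (μ l) * res z X).trace - D l)) := by
      funext X
      simp_rw [hu]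
      rw [integral_const_mul, mul_sub C⁻¹, hD]
      unfold traceMean
      rfl
    obtain ⟨h3, h4⟩ := hmom π _ ((((hTm l).sub_const (D l)).const_mul _).const_mul _) (e ▸ h1)
    have h5 : ∀ X : Fin n → EuclideanSpace ℝ (Fin p),
        |√n * (C⁻¹ * ((n : ℝ)⁻¹ * (popCov (μ l) * res z X).trace - D l))| ^ 4 =
        (n ^ 2 / C ^ 4) * ((n : ℝ)⁻¹ * (popCov (μ l) * res z X).trace - D l) ^ 4 := by
      intro X
      rw [(by decide : Even 4).pow_abs, mul_pow, mul_pow,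
        show √(n : ℝ) ^ 4 = (√n ^ 2) ^ 2 by ring, Real.sq_sqrt hn0.le, inv_pow]
      ring
    simp only [h5] at h4
    rw [integral_const_mul] at h4
    rw [le_div_iff₀ (by positivity)]
    have h6 : C ^ 4 * (n ^ 2 / C ^ 4 * ∫ X, ((n : ℝ)⁻¹ * (popCov (μ l) * res z X).trace - D l) ^ 4
        ∂π) = (∫ X, ((n : ℝ)⁻¹ * (popCov (μ l) * res z X).trace - D l) ^ 4 ∂π) * n ^ 2 := by
      field_simp
    rw [← h6, hC₁']
    have h7 := mul_le_mul_of_nonneg_left h4 (by positivity : 0 ≤ C ^ 4)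
    linarith
  have hMm : ∀ i, ∫ X, meanForm (μ (κ i)) z i X ^ 4 ∂π ≤ C₁' * (n / classSize κ (κ i)) ^ 4 := by
    intro i
    refine (hmean z _ κ μ hn hpn hz hμ i (h2 i)).trans ?_
    gcongr
    rw [hC₁']
    have : 0 ≤ C ^ 4 * K₄ := by positivity
    linarith
  have hquad : ∀ v : EuclideanSpace ℝ (Fin p), ‖v‖ = 1 → |∫ X, ⟪v, op (res z X) v⟫ ∂π -
      ⟪v, op (resolvent (mixedCov κ μ D) z) v⟫| ≤ C₆ / √n := by
    intro v hv
    refine (abs_integral_sub_le hn hm hC.le hz₀ hz hν hC₁0 hκν hD0 hDC hMm hT hC₂ hc hC₅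
      hv).trans ?_
    have hkK : (k : ℝ) ≤ K := by exact_mod_cast hk
    rw [hC₆, div_div]
    gcongr
  have hsymm : (resolvent (mixedCov κ μ D) z).IsSymm :=
    isSymm_of_inner (isRes_mixedCov hz0 hm hD0 (κ := κ)).Q_symm
  have hmain : ∀ u : Matrix (Fin p) (Fin p) ℝ →ₗ[ℝ] ℝ, (∀ M, |u M| ≤ ‖M‖) →
        |∫ X, u (res z X) ∂π - u (resolvent (mixedCov κ μ D) z)| ≤ C₆ / √n := by
    intro u hu
    obtain ⟨a, v, hv, ha, hav⟩ := exists_quadratic_decomposition u hu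
    have hi : ∀ j, Integrable (fun X : Fin n → EuclideanSpace ℝ (Fin p) =>
        ⟪v j, op (res z X) (v j)⟫) π := fun j => by
      refine integrable_of_abs_le (B := ‖v j‖ ^ 2 / z) (continuous_inner_res hz0 continuous_id
        continuous_const continuous_const).measurable fun X => ?_
      rw [abs_of_nonneg ((isRes_res hz0 X).inner_nonneg _)]
      exact (isRes_res hz0 X).inner_le _
    have h1 : ∀ X : Fin n → EuclideanSpace ℝ (Fin p), u (res z X) =
        ∑ j, a j * ⟪v j, op (res z X) (v j)⟫ := fun X =>
      hav _ (isSymm_of_inner (isRes_res hz0 X).Q_symm)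
    simp only [h1]
    rw [hav _ hsymm, integral_finsetSum _ fun j _ => (hi j).const_mul _, ← Finset.sum_sub_distrib]
    calc _ ≤ ∑ j, |∫ X, a j * ⟪v j, op (res z X) (v j)⟫ ∂π -
          a j * ⟪v j, op (resolvent (mixedCov κ μ D) z) (v j)⟫| := Finset.abs_sum_le_sum_abs _ _
      _ ≤ ∑ j, |a j| * (C₆ / √n) := by
          refine Finset.sum_le_sum fun j _ => ?_
          rw [integral_const_mul, ← mul_sub, abs_mul]
          gcongr
          exact hquad _ (hv j)
      _ = (∑ j, |a j|) * (C₆ / √n) := by rw [Finset.sum_mul]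
      _ ≤ 1 * (C₆ / √n) := by gcongr
      _ = _ := one_mul _
  refine ⟨fun l => ?_, hD0, fun l => ?_, fun u hu => (hmain u hu).trans ?_⟩
  · refine (hm l).mono hn0.le ?_
    have : 0 ≤ C * C₆ := by positivity
    linarith
  · have h1 := hmain _ ((hm l).abs_traceForm_le hC hn0)
    have h3 : ∀ A : Matrix (Fin p) (Fin p) ℝ, traceForm (μ l) (1 / (C * n)) A =
        C⁻¹ * ((n : ℝ)⁻¹ * (popCov (μ l) * A).trace) := by
      intro A
      rw [traceForm_apply]
      field_simp
    simp only [h3] at h1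
    rw [integral_const_mul, ← mul_sub, abs_mul, abs_of_pos (inv_pos.2 hC),
      inv_mul_le_iff₀ hC] at h1
    refine h1.trans ?_
    rw [← mul_div_assoc]
    gcongr
    linarith
  · gcongr
    have : 0 ≤ C * C₆ := by positivity
    linarith

end DeterministicEquivalent

/-! ### Existence, uniqueness and stability for the fixed-point system. -/

section FixedPoint

open scoped RealInnerProductSpace

/-- The map whose fixed points are sought. -/
noncomputable def traceMap {n p k : ℕ} (κ : Fin n → Fin k)
    (μ : Fin k → Measure (EuclideanSpace ℝ (Fin p))) (z : ℝ) (δ : Fin k → ℝ) (l : Fin k) : ℝ :=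
  (n : ℝ)⁻¹ * (popCov (μ l) * resolvent (mixedCov κ μ δ) z).trace

variable {n p k : ℕ} {κ : Fin n → Fin k} {μ : Fin k → Measure (EuclideanSpace ℝ (Fin p))}
  {z z₀ C : ℝ} {δ D : Fin k → ℝ}

theorem inner_resolvent_mixedCov_le (hz : 0 < z) (hμ : ∀ l, LawMom (μ l) z₀ n C)
    (hδ : ∀ l, 0 ≤ δ l) (hD : ∀ l, 0 ≤ D l) {α : ℝ} (hα : 1 ≤ α)
    (h : ∀ l, 1 + D l ≤ α * (1 + δ l)) (v : EuclideanSpace ℝ (Fin p)) :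
    ⟪v, op (resolvent (mixedCov κ μ D) z) v⟫ ≤ α * ⟪v, op (resolvent (mixedCov κ μ δ) z) v⟫ := by
  refine (isRes_mixedCov hz hμ hδ).inner_le_mul (isRes_mixedCov hz hμ hD) hα (fun w => ?_) v
  rw [real_inner_comm, inner_op_mixedCov, real_inner_comm, inner_op_mixedCov, Finset.mul_sum]
  refine Finset.sum_le_sum fun l _ => ?_
  rw [← mul_assoc]
  refine mul_le_mul_of_nonneg_right ?_ ((hμ l).cov_nonneg w)
  have h1 := hδ l
  have h2 := hD l
  rw [← mul_div_assoc, div_le_div_iff₀ (by positivity) (by positivity)]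
  calc _ ≤ (classSize κ l : ℝ) / n * (α * (1 + δ l)) := by gcongr; exact h l
    _ = _ := by ring

theorem traceMap_nonneg (hz : 0 < z) (hμ : ∀ l, LawMom (μ l) z₀ n C) (hδ : ∀ l, 0 ≤ δ l)
    (l : Fin k) : 0 ≤ traceMap κ μ z δ l :=
  mul_nonneg (by positivity) ((hμ l).trace_nonneg (isRes_mixedCov hz hμ hδ).inner_nonneg)

theorem traceMap_le (hn : 0 < n) (hz₀ : 0 < z₀) (hz : z₀ ≤ z) (hμ : ∀ l, LawMom (μ l) z₀ n C)
    (hδ : ∀ l, 0 ≤ δ l) (l : Fin k) : traceMap κ μ z δ l ≤ C / z₀ := by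
  have hn0 : (0 : ℝ) < n := by exact_mod_cast hn
  calc _ ≤ (n : ℝ)⁻¹ * (C * n / z₀) := by
        refine mul_le_mul_of_nonneg_left ?_ (by positivity)
        exact (hμ l).trace_res_le hz₀ hz (isRes_mixedCov (hz₀.trans_le hz) hμ hδ)
    _ = _ := by field_simp

theorem traceMap_le_mul (hz : 0 < z) (hμ : ∀ l, LawMom (μ l) z₀ n C)
    (hδ : ∀ l, 0 ≤ δ l) (hD : ∀ l, 0 ≤ D l) {α : ℝ} (hα : 1 ≤ α)
    (h : ∀ l, 1 + D l ≤ α * (1 + δ l)) (l : Fin k) :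
    traceMap κ μ z D l ≤ α * traceMap κ μ z δ l := by
  unfold traceMap
  rw [trace_popCov_mul (hμ l).integrable_coord, trace_popCov_mul (hμ l).integrable_coord,
    mul_left_comm, ← integral_const_mul α]
  refine mul_le_mul_of_nonneg_left ?_ (by positivity)
  exact integral_mono ((hμ l).integrable_quad _) (((hμ l).integrable_quad _).const_mul _)
    fun y => inner_resolvent_mixedCov_le hz hμ hδ hD hα h y

/-- Let `α` be the largest ratio `(1 + a_l) / (1 + b_l)`, attained at `m`. If `α ≥ 1`, then `α (1 +
b_m) = 1 + a_m ≤ 1 + α (b_m + ε)`, so `α (1 - ε) ≤ 1`, and `ε ≤ 1/2` gives `α ≤ 1 + 2 ε`. The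
contraction comes from the summand `1`, which is not multiplied by `α`. -/
theorem one_add_le_of_contraction {a b : Fin k → ℝ} (hb : ∀ l, 0 ≤ b l) {ε : ℝ}
    (hε : 0 ≤ ε) (hε' : ε ≤ 1 / 2)
    (h : ∀ α : ℝ, 1 ≤ α → (∀ l, 1 + a l ≤ α * (1 + b l)) → ∀ l, a l ≤ α * (b l + ε)) (l : Fin k) :
    1 + a l ≤ (1 + 2 * ε) * (1 + b l) := by
  obtain ⟨m, -, hm⟩ := Finset.exists_max_image Finset.univ (fun l => (1 + a l) / (1 + b l))
    ⟨l, Finset.mem_univ l⟩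
  have hb' : ∀ l, 0 < 1 + b l := fun l => by linarith [hb l]
  obtain ⟨α, hα⟩ : ∃ α, α = (1 + a m) / (1 + b m) := ⟨_, rfl⟩
  have h1 : ∀ l, 1 + a l ≤ α * (1 + b l) := fun l => by
    rw [← div_le_iff₀ (hb' l), hα]
    exact hm l (Finset.mem_univ l)
  have h2 : α ≤ 1 + 2 * ε := by
    by_contra! h3
    have h4 := h α (by linarith) h1 m
    have h5 : α * (1 + b m) = 1 + a m := by rw [hα, div_mul_cancel₀ _ (hb' m).ne']
    nlinarith
  exact (h1 l).trans (mul_le_mul_of_nonneg_right h2 (hb' l).le)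

/-- The case `α = 1` of `traceMap_le_mul` says that the map is order preserving, and it sends the
complete lattice `[0, C / z₀]^k` to itself: the Knaster–Tarski theorem applies. -/
theorem exists_isFixedPoint (hn : 0 < n) (hz₀ : 0 < z₀) (hz : z₀ ≤ z) (hC : 0 ≤ C)
    (hμ : ∀ l, LawMom (μ l) z₀ n C) : ∃ δ, IsFixedPoint κ μ z δ := by
  have hz0 := hz₀.trans_le hz
  have hB : 0 ≤ C / z₀ := by positivity
  have : Fact (0 ≤ C / z₀) := ⟨hB⟩
  let f : (Fin k → Set.Icc 0 (C / z₀)) →o (Fin k → Set.Icc 0 (C / z₀)) :=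
    { toFun := fun δ l => ⟨traceMap κ μ z (fun l => (δ l : ℝ)) l,
        traceMap_nonneg hz0 hμ (fun l => (δ l).2.1) l,
        traceMap_le hn hz₀ hz hμ (fun l => (δ l).2.1) l⟩
      monotone' := fun D δ h l => by
        have h1 := traceMap_le_mul (κ := κ) hz0 hμ (fun l => (δ l).2.1) (fun l => (D l).2.1) le_rfl
          (fun l => by
            have : (D l : ℝ) ≤ δ l := h l
            linarith) l
        rw [one_mul] at h1
        exact h1 }
  refine ⟨fun l => f.lfp l, fun l => (f.lfp l).2.1, fun l => ?_⟩
  exact (congrArg (fun δ : Fin k → Set.Icc 0 (C / z₀) => (δ l : ℝ)) f.map_lfp).symm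

/-- An exact and an approximate solution are compared in both directions by
`one_add_le_of_contraction`; distances are multiplicative in `1 + δ`. With `ε = 0` this is
uniqueness. -/
theorem IsFixedPoint.stability (hz : 0 < z) (hμ : ∀ l, LawMom (μ l) z₀ n C)
    (h : IsFixedPoint κ μ z δ) (hD : ∀ l, 0 ≤ D l) {ε : ℝ} (hε : 0 ≤ ε) (hε' : ε ≤ 1 / 2)
    (hDε : ∀ l, |D l - traceMap κ μ z D l| ≤ ε) (l : Fin k) :
    1 + D l ≤ (1 + 2 * ε) * (1 + δ l) ∧ 1 + δ l ≤ (1 + 2 * ε) * (1 + D l) := by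
  constructor
  · refine one_add_le_of_contraction h.1 hε hε' (fun α hα hle l => ?_) l
    have h1 := traceMap_le_mul (κ := κ) hz hμ h.1 hD hα hle l
    have h2 : δ l = traceMap κ μ z δ l := h.2 l
    have h3 := (abs_le.1 (hDε l)).2
    rw [← h2] at h1
    nlinarith
  · refine one_add_le_of_contraction hD hε hε' (fun α hα hle l => ?_) l
    have h1 := traceMap_le_mul (κ := κ) hz hμ hD h.1 hα hle l
    have h2 : δ l = traceMap κ μ z δ l := h.2 l
    have h3 := (abs_le.1 (hDε l)).1
    rw [h2]
    refine h1.trans ?_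
    gcongr
    linarith

theorem existsUnique_isFixedPoint (hn : 0 < n) (hz₀ : 0 < z₀) (hz : z₀ ≤ z) (hC : 0 ≤ C)
    (hμ : ∀ l, LawMom (μ l) z₀ n C) : ∃! δ, IsFixedPoint κ μ z δ := by
  obtain ⟨δ, hδ⟩ := exists_isFixedPoint (κ := κ) hn hz₀ hz hC hμ
  refine ⟨δ, hδ, fun D hD => funext fun l => ?_⟩
  have h1 := hδ.stability (hz₀.trans_le hz) hμ hD.1 le_rfl (by norm_num) (fun l => by
    have h2 : D l = traceMap κ μ z D l := hD.2 l
    rw [← h2]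
    simp) l
  linarith [h1.1, h1.2]

-- Stability makes either quadratic form at most `1 + 2 ε` times the other, and both are at most `1
-- / z₀` on unit vectors.
open scoped Matrix.Norms.L2Operator in
theorem IsFixedPoint.abs_sub_le (hz₀ : 0 < z₀) (hz : z₀ ≤ z) (hμ : ∀ l, LawMom (μ l) z₀ n C)
    (h : IsFixedPoint κ μ z δ) (hD : ∀ l, 0 ≤ D l) {ε : ℝ} (hε : 0 ≤ ε) (hε' : ε ≤ 1 / 2)
    (hDε : ∀ l, |D l - traceMap κ μ z D l| ≤ ε) {u : Matrix (Fin p) (Fin p) ℝ →ₗ[ℝ] ℝ}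
    (hu : ∀ M, |u M| ≤ ‖M‖) :
    |u (resolvent (mixedCov κ μ D) z) - u (resolvent (mixedCov κ μ δ) z)| ≤ 2 * ε / z₀ := by
  have hz0 := hz₀.trans_le hz
  have hst := h.stability hz0 hμ hD hε hε' hDε
  have hRD := isRes_mixedCov hz0 hμ hD (κ := κ)
  have hRδ := isRes_mixedCov hz0 hμ h.1 (κ := κ)
  refine abs_sub_le_of_quadratic (isSymm_of_inner hRD.Q_symm) (isSymm_of_inner hRδ.Q_symm)
    (by positivity) (fun v hv => ?_) hu
  have h1 := inner_resolvent_mixedCov_le (κ := κ) hz0 hμ h.1 hD (by linarith) (fun l => (hst l).1) v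
  have h2 := inner_resolvent_mixedCov_le (κ := κ) hz0 hμ hD h.1 (by linarith) (fun l => (hst l).2) v
  have h3 : ∀ {S Q : EuclideanSpace ℝ (Fin p) →ₗ[ℝ] EuclideanSpace ℝ (Fin p)}, IsRes S Q z →
      2 * ε * ⟪v, Q v⟫ ≤ 2 * ε / z₀ := by
    intro S Q hQ
    have h4 : ⟪v, Q v⟫ ≤ 1 / z₀ := by
      refine (hQ.inner_le v).trans ?_
      rw [hv, one_pow]
      gcongr
    calc _ ≤ 2 * ε * (1 / z₀) := by gcongr
      _ = _ := by ring
  have h5 := h3 hRD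
  have h6 := h3 hRδ
  rw [abs_le]
  constructor <;> nlinarith

end FixedPoint

/-! ### Assembly: fluctuation, bias and fixed point. -/

section Conclusion

open scoped Matrix.Norms.L2Operator

theorem exists_mean_estimate {q κ₀ z₀ ν : ℝ} (B Γ M : ℝ) (K : ℕ) (hq : 0 < q) (hq2 : q ≤ 2)
    (hκ : 0 < κ₀) (hz₀ : 0 < z₀) (hν : 0 < ν) :
    ∃ (N : ℕ) (C : ℝ), 1 ≤ N ∧ 0 < C ∧ ∀ {n p k : ℕ} (z : ℝ) (κ : Fin n → Fin k)
      (μ : Fin k → Measure (EuclideanSpace ℝ (Fin p))) [∀ l, IsProbabilityMeasure (μ l)],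
      N ≤ n → p ≤ Γ * n → k ≤ K → z₀ ≤ z → (∀ l, LawReg (μ l) q (max q 1) κ₀ B) →
      (∀ l, ‖∫ y, y ∂(μ l)‖ ≤ M * √p) → (∀ i, ν * √n ≤ classSize κ (κ i)) →
      (∀ i, 2 ≤ classSize κ (κ i)) ∧ (∃! δ, IsFixedPoint κ μ z δ) ∧
      ∀ δ, IsFixedPoint κ μ z δ → ∀ u : Matrix (Fin p) (Fin p) ℝ →ₗ[ℝ] ℝ, (∀ M, |u M| ≤ ‖M‖) →
        |√n * (∫ X, u (res z X) ∂(Measure.pi fun i => μ (κ i)) -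
          u (resolvent (mixedCov κ μ δ) z))| ≤ C := by
  obtain ⟨C, hC, hbias⟩ := exists_bias B Γ M K hq hq2 hκ hz₀ hν
  -- The first entry ensures at least two columns in every occurring class; the second makes the
  -- fixed-point error `C / √n` at most `1 / 2`.
  obtain ⟨N, hN⟩ := exists_nat_ge (max ((2 / ν) ^ 2) ((2 * C) ^ 2))
  refine ⟨N + 1, C + 2 * C / z₀, by omega, by positivity,
    fun {n p k} z κ μ _ hn hpn hk hz hμ hM hκν => ?_⟩
  have hn1 : 1 ≤ n := by omega
  have hn0 : (0 : ℝ) < n := by exact_mod_cast hn1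
  have hs : 0 < √(n : ℝ) := Real.sqrt_pos.2 hn0
  have hNn : (N : ℝ) ≤ n := by exact_mod_cast (by omega : N ≤ n)
  have hs1 : 2 / ν ≤ √n := Real.le_sqrt_of_sq_le ((le_max_left _ _).trans (hN.trans hNn))
  have hs2 : 2 * C ≤ √n := Real.le_sqrt_of_sq_le ((le_max_right _ _).trans (hN.trans hNn))
  have h2 : ∀ i, 2 ≤ classSize κ (κ i) := fun i => by
    have h3 : (2 : ℝ) ≤ classSize κ (κ i) := by
      refine le_trans ?_ (hκν i)
      rwa [div_le_iff₀' hν] at hs1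
    exact_mod_cast h3
  obtain ⟨hm, hD, hDε, hu⟩ := hbias z κ μ hn1 hpn hk hz hμ hM hκν h2
  refine ⟨h2, existsUnique_isFixedPoint hn1 hz₀ hz hC.le hm, fun δ hδ u hu' => ?_⟩
  have hε : C / √n ≤ 1 / 2 := by rw [div_le_iff₀ hs]; linarith
  have h3 := hδ.abs_sub_le hz₀ hz hm hD (by positivity) hε hDε hu'
  have h4 := (abs_sub_le _ _ _).trans (add_le_add (hu u hu') h3)
  rw [abs_mul, abs_of_pos hs]
  calc _ ≤ √n * (C / √n + 2 * (C / √n) / z₀) := by gcongr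
    _ = _ := by field_simp

theorem measurable_linear_res {n p : ℕ} {z : ℝ} (hz : 0 < z)
    (u : Matrix (Fin p) (Fin p) ℝ →ₗ[ℝ] ℝ) :
    Measurable fun X : Fin n → EuclideanSpace ℝ (Fin p) => u (res z X) := by
  simp only [linear_eq_sum u (res z _)]
  exact Finset.measurable_sum _ fun i _ => Finset.measurable_sum _ fun j _ =>
    (continuous_res_apply hz i j).measurable.mul_const _

/-- Multiplied by `√n`, the bias is a bounded shift. `ExpBdd.add_const` moves the exponential moment
from the mean to the deterministic equivalent, and Markov's inequality returns to tails. -/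
theorem exists_concentration_of_le_two {C₀ c₀ q z₀ ν : ℝ} (Γ M : ℝ) (K : ℕ) (hC₀ : 0 < C₀)
    (hc₀ : 0 < c₀) (hq : 0 < q) (hq2 : q ≤ 2) (hz₀ : 0 < z₀) (hν : 0 < ν) :
    ∃ (N : ℕ) (C c : ℝ), 1 ≤ N ∧ Real.exp 1 ≤ C ∧ 0 < c ∧
      ∀ {n p k : ℕ} (z : ℝ) (κ : Fin n → Fin k) (μ : Fin k → Measure (EuclideanSpace ℝ (Fin p)))
        [∀ l, IsProbabilityMeasure (μ l)], N ≤ n → p ≤ Γ * n → k ≤ K → z₀ ≤ z →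
        (∀ l, LawConvexlyConcentrated (μ l) fun t => C₀ * Real.exp (-(t ^ q) / c₀)) →
        (∀ l, ‖∫ y, y ∂(μ l)‖ ≤ M * √p) → (∀ i, ν * √n ≤ classSize κ (κ i)) →
        (∃! δ, IsFixedPoint κ μ z δ) ∧ ∀ δ, IsFixedPoint κ μ z δ →
        ∀ u : Matrix (Fin p) (Fin p) ℝ →ₗ[ℝ] ℝ, (∀ M, |u M| ≤ ‖M‖) →
          ConcentratedAround (Measure.pi fun i => μ (κ i)) (fun X => u (res z X))
            (u (resolvent (mixedCov κ μ δ) z)) fun t => C * Real.exp (-((√n * t) ^ q) / c) := by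
  obtain ⟨κ₀, B, hκ₀, hreg⟩ := exists_lawReg hq hc₀ hC₀
  obtain ⟨N, A, hN, hA, hmean⟩ := exists_mean_estimate B Γ M K hq hq2 hκ₀ hz₀ hν
  obtain ⟨κ', B', hκ', hconc⟩ := exists_expBdd_res B K Γ hq hq2 hκ₀ hz₀ hν
  have h2q : (0 : ℝ) < 2 ^ q := by positivity
  refine ⟨N, max (Real.exp 1) (Real.exp (κ' * A ^ q) * B'), (κ' / 2 ^ q)⁻¹, hN, le_max_left _ _,
    by positivity, fun {n p k} z κ μ _ hn hpn hk hz hμ hM hκν => ?_⟩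
  have hn1 : 1 ≤ n := hN.trans hn
  have hs : 0 < √(n : ℝ) := Real.sqrt_pos.2 (by exact_mod_cast hn1)
  have hμ' := fun l => hreg (μ l) (hμ l)
  obtain ⟨h2, hfix, hest⟩ := hmean z κ μ hn hpn hk hz hμ' hM hκν
  refine ⟨hfix, fun δ hδ u hu t ht => ?_⟩
  have hZ := (hconc z κ μ hn1 hpn hk hz hμ' hκν h2 u hu).add_const hq hκ' (hest δ hδ u hu)
  simp only [← mul_add, sub_add_sub_cancel] at hZ
  have h3 := hZ.tail (((measurable_linear_res (hz₀.trans_le hz) u).sub_const _).const_mul _)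
    hq (by positivity) (mul_pos hs ht).le
  have h4 : ∀ X : Fin n → EuclideanSpace ℝ (Fin p),
      √n * t ≤ |√n * (u (res z X) - u (resolvent (mixedCov κ μ δ) z))| ↔
      t ≤ |u (res z X) - u (resolvent (mixedCov κ μ δ) z)| := fun X => by
    rw [abs_mul, abs_of_pos hs, mul_le_mul_iff_right₀ hs]
  simp only [h4] at h3
  refine h3.trans (ENNReal.ofReal_le_ofReal ?_)
  beta_reduce
  rw [div_inv_eq_mul, neg_mul, mul_comm (κ' / 2 ^ q)]
  gcongr
  exact le_max_right _ _

/-- The columns are almost surely equal to their means, so the resolvent is almost surely constant.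
The hypothesis is lowered to exponent `2` only to estimate the bias. -/
theorem exists_concentration_of_two_lt {C₀ c₀ q z₀ ν : ℝ} (Γ M : ℝ) (K : ℕ) (hC₀ : 0 < C₀)
    (hc₀ : 0 < c₀) (hq : 2 < q) (hz₀ : 0 < z₀) (hν : 0 < ν) :
    ∃ (N : ℕ) (C c : ℝ), 1 ≤ N ∧ Real.exp 1 ≤ C ∧ 0 < c ∧
      ∀ {n p k : ℕ} (z : ℝ) (κ : Fin n → Fin k) (μ : Fin k → Measure (EuclideanSpace ℝ (Fin p)))
        [∀ l, IsProbabilityMeasure (μ l)], N ≤ n → p ≤ Γ * n → k ≤ K → z₀ ≤ z →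
        (∀ l, LawConvexlyConcentrated (μ l) fun t => C₀ * Real.exp (-(t ^ q) / c₀)) →
        (∀ l, ‖∫ y, y ∂(μ l)‖ ≤ M * √p) → (∀ i, ν * √n ≤ classSize κ (κ i)) →
        (∃! δ, IsFixedPoint κ μ z δ) ∧ ∀ δ, IsFixedPoint κ μ z δ →
        ∀ u : Matrix (Fin p) (Fin p) ℝ →ₗ[ℝ] ℝ, (∀ M, |u M| ≤ ‖M‖) →
          ConcentratedAround (Measure.pi fun i => μ (κ i)) (fun X => u (res z X))
            (u (resolvent (mixedCov κ μ δ) z)) fun t => C * Real.exp (-((√n * t) ^ q) / c) := by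
  obtain ⟨κ₀, B, hκ₀, hreg⟩ := exists_lawReg (C := C₀ * Real.exp (1 / c₀)) two_pos hc₀
    (by positivity)
  obtain ⟨N, A, hN, hA, hmean⟩ := exists_mean_estimate B Γ M K two_pos le_rfl hκ₀ hz₀ hν
  refine ⟨N, max (Real.exp 1) (Real.exp (A ^ q)), 1, hN, le_max_left _ _,
    one_pos, fun {n p k} z κ μ _ hn hpn hk hz hμ hM hκν => ?_⟩
  have hn1 : 1 ≤ n := hN.trans hn
  have hs : 0 < √(n : ℝ) := Real.sqrt_pos.2 (by exact_mod_cast hn1)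
  obtain ⟨h2, hfix, hest⟩ := hmean z κ μ hn hpn hk hz
    (fun l => hreg (μ l) ((hμ l).lower hq.le hc₀ hC₀)) hM hκν
  refine ⟨hfix, fun δ hδ u hu t ht => ?_⟩
  set π := Measure.pi fun i => μ (κ i) with hπ
  have hae : ∀ᵐ X ∂π, X = fun i => ∫ y, y ∂(μ (κ i)) := by
    have h3 : ∀ᵐ X ∂π, ∀ i, X i = ∫ y, y ∂(μ (κ i)) := ae_all_iff.2 fun i =>
      (measurePreserving_eval (fun i => μ (κ i)) i).quasiMeasurePreserving.ae
        ((hμ (κ i)).ae_eq_mean hq hc₀ hC₀)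
    filter_upwards [h3] with X hX using funext hX
  have hconst : ∀ᵐ X ∂π, u (res z X) = ∫ X, u (res z X) ∂π := by
    set b := u (res z fun i => ∫ y, y ∂(μ (κ i))) with hb
    have h3 : ∀ᵐ X ∂π, u (res z X) = b := by
      filter_upwards [hae] with X hX
      rw [hX]
    have h4 : ∫ X, u (res z X) ∂π = b := by
      rw [integral_congr_ae h3]
      simp
    rwa [h4]
  have h5 := hest δ hδ u hu
  rw [abs_mul, abs_of_pos hs] at h5
  -- Below `A` the claimed bound is at least one by the choice of the constant; above it the
  -- deviation set is null, since the constant value lies within `A / √n` of its equivalent.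
  by_cases htA : √n * t ≤ A
  · refine prob_le_one.trans ?_
    rw [← ENNReal.ofReal_one]
    refine ENNReal.ofReal_le_ofReal ?_
    calc (1 : ℝ) = Real.exp (A ^ q) * Real.exp (-(A ^ q) / 1) := by
          rw [← Real.exp_add]; simp
      _ ≤ max (Real.exp 1) (Real.exp (A ^ q)) * Real.exp (-((√n * t) ^ q) / 1) := by
          gcongr
          exact le_max_right _ _
  · refine le_of_eq_of_le (measure_eq_zero_iff_ae_notMem.2 ?_) zero_le
    filter_upwards [hconst] with X hX
    rw [not_le] at htA
    refine not_le.2 ?_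
    rw [hX]
    exact lt_of_mul_lt_mul_left (h5.trans_lt htA) hs.le

theorem exists_concentration {C₀ c₀ q z₀ ν : ℝ} (Γ M : ℝ) (K : ℕ) (hC₀ : 0 < C₀)
    (hc₀ : 0 < c₀) (hq : 0 < q) (hz₀ : 0 < z₀) (hν : 0 < ν) :
    ∃ (N : ℕ) (C c : ℝ), 1 ≤ N ∧ Real.exp 1 ≤ C ∧ 0 < c ∧
      ∀ {n p k : ℕ} (z : ℝ) (κ : Fin n → Fin k) (μ : Fin k → Measure (EuclideanSpace ℝ (Fin p)))
        [∀ l, IsProbabilityMeasure (μ l)], N ≤ n → p ≤ Γ * n → k ≤ K → z₀ ≤ z →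
        (∀ l, LawConvexlyConcentrated (μ l) fun t => C₀ * Real.exp (-(t ^ q) / c₀)) →
        (∀ l, ‖∫ y, y ∂(μ l)‖ ≤ M * √p) → (∀ i, ν * √n ≤ classSize κ (κ i)) →
        (∃! δ, IsFixedPoint κ μ z δ) ∧ ∀ δ, IsFixedPoint κ μ z δ →
        ∀ u : Matrix (Fin p) (Fin p) ℝ →ₗ[ℝ] ℝ, (∀ M, |u M| ≤ ‖M‖) →
          ConcentratedAround (Measure.pi fun i => μ (κ i)) (fun X => u (res z X))
            (u (resolvent (mixedCov κ μ δ) z)) fun t => C * Real.exp (-((√n * t) ^ q) / c) := by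
  rcases le_or_gt q 2 with hq2 | hq2
  · exact exists_concentration_of_le_two Γ M K hC₀ hc₀ hq hq2 hz₀ hν
  · exact exists_concentration_of_two_lt Γ M K hC₀ hc₀ hq2 hz₀ hν

theorem linearlyConcentratedSpectral_of_pi {n p : ℕ} {z : ℝ} (hz : 0 < z)
    {ν : Fin n → Measure (EuclideanSpace ℝ (Fin p))} {Ω : Type*} [MeasurableSpace Ω]
    {P : Measure Ω} [IsProbabilityMeasure P] {x : Fin n → Ω → EuclideanSpace ℝ (Fin p)}
    (hx : ∀ i, Measurable (x i)) (hind : iIndepFun x P) (hlaw : ∀ i, P.map (x i) = ν i)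
    {R : Matrix (Fin p) (Fin p) ℝ} {α : ℝ → ℝ}
    (h : ∀ u : Matrix (Fin p) (Fin p) ℝ →ₗ[ℝ] ℝ, (∀ M, |u M| ≤ ‖M‖) →
      ConcentratedAround (Measure.pi ν) (fun X => u (res z X)) (u R) α) :
    LinearlyConcentratedSpectral P
      (fun ω => resolvent (sampleCov (columns fun i => x i ω)) z) R α := by
  intro u hu t ht
  have h1 : P.map (fun ω i => x i ω) = Measure.pi ν := by
    rw [(iIndepFun_iff_map_fun_eq_pi_map fun i => (hx i).aemeasurable).1 hind]
    simp only [hlaw]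
  have h2 := h u hu t ht
  rw [← h1, Measure.map_apply (measurable_pi_lambda _ hx)
    (measurableSet_le measurable_const ((measurable_linear_res hz u).sub_const _).abs)] at h2
  exact h2

end Conclusion
end SampleCov

theorem mainTheorem1
    (C₀ c₀ q : ℝ) (hC₀ : Real.exp 1 ≤ C₀) (hc₀ : 0 < c₀) (hq : 0 < q)
    (K : ℕ) (M Γ z₀ ν : ℝ) (hz₀ : 0 < z₀) (hν : 0 < ν) :
    ∃ (N : ℕ) (C c : ℝ), Real.exp 1 ≤ C ∧ 0 < c ∧
      ∀ (n p k : ℕ) (z : ℝ), N ≤ n → (p : ℝ) / n ≤ Γ → k ≤ K → z₀ ≤ z →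
      ∀ (κ : Fin n → Fin k) (μ : Fin k → Measure (EuclideanSpace ℝ (Fin p))),
        (∀ l, IsProbabilityMeasure (μ l)) →
        (∀ l, SampleCov.LawConvexlyConcentrated (μ l)
          (fun t => C₀ * Real.exp (-(t ^ q) / c₀))) →
        ((∀ l, ∫ y, ‖y‖ ∂(μ l) ≤ M * √(p : ℝ)) ∨
          (2 ≤ q ∧ ∀ l, ‖∫ y, y ∂(μ l)‖ ≤ M * √(p : ℝ))) →
        (∀ i, ν * √(n : ℝ) ≤ (SampleCov.classSize κ (κ i) : ℝ)) →
        ∀ (Ω : Type*) [MeasurableSpace Ω] (P : Measure Ω) [IsProbabilityMeasure P]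
          (x : Fin n → Ω → EuclideanSpace ℝ (Fin p)),
          (∀ i, Measurable (x i)) → iIndepFun x P → (∀ i, P.map (x i) = μ (κ i)) →
          (∃! δ : Fin k → ℝ, SampleCov.IsFixedPoint κ μ z δ) ∧
          ∀ δ : Fin k → ℝ, SampleCov.IsFixedPoint κ μ z δ →
            SampleCov.LinearlyConcentratedSpectral P
              (fun ω => SampleCov.resolvent
                (SampleCov.sampleCov (SampleCov.columns fun i => x i ω)) z)
              (SampleCov.resolvent (SampleCov.mixedCov κ μ δ) z)
              (fun t => C * Real.exp (-((√(n : ℝ) * t) ^ q) / c)) := by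
  have hC₀' : 0 < C₀ := (Real.exp_pos 1).trans_le hC₀
  obtain ⟨N, C, c, hN, hC, hc, h⟩ :=
    SampleCov.exists_concentration Γ M K hC₀' hc₀ hq hz₀ hν
  refine ⟨N, C, c, hC, hc, fun n p k z hn hpn hk hz κ μ hprob hμ hM hκν Ω _ P _ x hx hind hlaw => ?_⟩
  have hn0 : (0 : ℝ) < n := by exact_mod_cast hN.trans hn
  -- Both alternatives provide a bound on the norm of the mean vector, the first by the triangle
  -- inequality for integrals.
  have hmean : ∀ l, ‖∫ y, y ∂(μ l)‖ ≤ M * √(p : ℝ) := fun l => by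
    rcases hM with h1 | h1
    · exact (norm_integral_le_integral_norm _).trans (h1 l)
    · exact h1.2 l
  obtain ⟨hfix, hconc⟩ := h z κ μ hn ((div_le_iff₀ hn0).1 hpn) hk hz hμ hmean hκν
  exact ⟨hfix, fun δ hδ => SampleCov.linearlyConcentratedSpectral_of_pi (hz₀.trans_le hz) hx hind
    hlaw (hconc δ hδ)⟩
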